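/- **Search structures.** Fix a set $V$ of values. A *dictionary* stores a partial map from keys in $\mathbb N$ to $V$ (initially empty) and has the operations $\mathrm{insert}(k,v)$ (if $k$ is absent, store $v$ under $k$ and return true, otherwise return false), $\mathrm{delete}(k)$ (if $k$ is present, remove it and return true, otherwise return false) and $\mathrm{find}(k)$ (return the node $(k,v)$ if $k$ is present, otherwise false). A *search structure* implements it sequentially by a directed graph whose nodes are a root and key-value pairs; each node is one shared element, whose content is the finite set of its labelled outgoing edges; initially there are no edges. An operation first reads the root and then repeatedly reads (visits) the node given by a traverse function of the operation, its coin tosses and the visited part of the graph, always a successor of the last visited node, until this function ends the traversal. The key counts as present iff a node with this key was visited. A successful $\mathrm{insert}(k,v)$ then writes the outgoing edges of the new node $(k,v)$ and of some nodes that thereby become predecessors of it, as given by an insert function of the visited part. A successful $\mathrm{delete}(k)$ rewrites each visited predecessor $p$ of the removed node $b$; the new outgoing edges of $p$ are given by a delete function of $p$, $b$ and their outgoing edges, and every added edge leads to a successor of $b$. All other operations write nothing. It is required that in each state reached by a sequence of operations the graph of nodes reachable from the root is acyclic, and that operations run sequentially terminate and respond as the dictionary does, the reachable nodes being the stored pairs.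 *Non-triviality:* there are a reachable state without key $k$ and an insertion $\mathrm{insert}(k,v)$ leading from it to a state $G'$ in which exactly one node $a$ has an edge to a node with key $k$, and every path from the root to $a$ has length at least $2$. **Executions and schedules.** There are $n\ge 3$ processes. In a concurrent implementation every operation follows the sequential code (its coin tosses are fixed when it is invoked), but reads and writes of elements, and synchronization between them, are carried out by atomic primitives on base objects; a read or write may return $\bot$, which aborts its operation. A *history* is the sequence of invocations and responses of operations, reads and writes in a finite execution, without the reads and writes that return $\bot$. A history is *LS-linearizable* (LSL) if the events of each operation (without $\bot$) are also the events of an operation in some history of the sequential implementation, and the history of invocations and responses of the non-aborted operations is linearizable with respect to the dictionary. An implementation is LSL if all its histories are. A *schedule* is a history restricted to the operations that returned a non-$\bot$ response, with the responses of reads and of operations left unspecified; a history with this restriction exports the schedule. An implementation *accepts* a schedule if one of its histories exports it. A schedule is LSL if some well-formed LSL history exports it; an implementation is *concurrency-optimal* if it accepts all LSL schedules. **The class $\mathcal{SM}$ (serializable optimistic).** Call an operation *complete* if it has returned a non-$\bot$ response; incomplete operations that have finished all their reads and writes may be completed by adding their response. An execution is *strictly serializable* if, after completing some operations in this way, its complete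 operations have the same events per process as some sequential execution that respects the real-time order and is legal (every read returns the latest written value). It is *safe-strict serializable* if, moreover, for each operation $\pi$ (even aborted or incomplete), in the prefix up to its last event, $\pi$ has the same events as in a legal sequential execution that consists of complete operations of that prefix, with their events there, followed by $\pi$. $\mathcal{SM}$ is the class of LSL implementations all of whose executions are safe-strict serializable. **The class $\mathcal P$ (pessimistic, lock-based).** A lock-based implementation inserts exclusive or shared $\mathrm{lock}$ and $\mathrm{unlock}$ primitives on elements (a lock request blocks while another process holds a conflicting lock) into the operations; reads and writes act in place on the elements, decisions depend only on the local state of the process, and no operation aborts. It is *deadlock-free* if, in each infinite execution in which no process stops taking steps in the middle of an operation and locks are starvation-free (a process waits forever for a lock only if another process holds a lock on the same element forever), whenever operations are pending some operation returns later. $\mathcal P$ is the class of deadlock-free LSL lock-based implementations. **Theorem.** For every search structure and every $n\ge3$, $\mathcal P$ and $\mathcal{SM}$ are incomparable in the schedules they accept: some schedule is accepted by an implementation in $\mathcal{SM}$ and by no implementation in $\mathcal P$, and some schedule is accepted by an implementation in $\mathcal P$ and by no implementation in $\mathcal{SM}$. Consequently, for each of the two classes there is an LSL schedule that no implementation in the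 class accepts; in particular, no implementation in $\mathcal P$ and no implementation in $\mathcal{SM}$ is concurrency-optimal. -/

import Mathlib

namespace SearchConc

/-! ## Sequential types and the dictionary type -/

/-- A sequential type `(Φ, Γ, Q, q₀, δ)`. -/
structure SeqType where
  Φ : Type
  Γ : Type
  Q : Type
  q₀ : Q
  δ : Q → Φ → Q → Γ → Prop

/-- A sequence of operations with their responses is consistent with the sequential
specification when run from state `q`. -/
inductive SeqType.Consistent (τ : SeqType) : τ.Q → List (τ.Φ × τ.Γ) → Prop
  | nil (q : τ.Q) : SeqType.Consistent τ q []
  | cons {q q' : τ.Q} {o : τ.Φ} {r : τ.Γ} {l : List (τ.Φ × τ.Γ)} :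
      τ.δ q o q' r → SeqType.Consistent τ q' l → SeqType.Consistent τ q ((o, r) :: l)

/-- Nodes of a search structure: the root, and key-value pairs. Every node is one shared
element of the sequential implementation. -/
inductive Node (V : Type) where
  | root : Node V
  | pair (key : ℕ) (val : V) : Node V

/-- The key of a node (the root has none). -/
def Node.key? {V : Type} : Node V → Option ℕ
  | .root => none
  | .pair k _ => some k

/-- Operations of a dictionary. -/
inductive DictOp (V : Type) where
  | insert (k : ℕ) (v : V) : DictOp V
  | delete (k : ℕ) : DictOp V
  | find (k : ℕ) : DictOp V

/-- Responses of a dictionary: a truth value, or (for `find`) a pointer to a node. -/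
inductive DictResp (V : Type) where
  | bool (b : Bool) : DictResp V
  | ptr (x : Node V) : DictResp V

/-- Sequential specification of a dictionary; a state maps keys to values. -/
def dictSpec (V : Type) (q : ℕ → Option V) : DictOp V → (ℕ → Option V) → DictResp V → Prop
  | .insert k v, q', r =>
      (q k = none ∧ q' = Function.update q k (some v) ∧ r = .bool true) ∨
      (q k ≠ none ∧ q' = q ∧ r = .bool false)
  | .delete k, q', r =>
      (q k ≠ none ∧ q' = Function.update q k none ∧ r = .bool true) ∨
      (q k = none ∧ q' = q ∧ r = .bool false)
  | .find k, q', r =>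
      q' = q ∧ ((∃ v, q k = some v ∧ r = .ptr (.pair k v)) ∨ (q k = none ∧ r = .bool false))

/-- The dictionary type, initially empty. -/
def dictType (V : Type) : SeqType where
  Φ := DictOp V
  Γ := DictResp V
  Q := ℕ → Option V
  q₀ := fun _ => none
  δ := dictSpec V

/-! ## Search structures and their sequential implementations -/

/-- The content of an element: the finite set of labelled outgoing edges of the node. -/
abbrev Edges (V Λ : Type) := Finset (Λ × Node V)

/-- `Leads e y`: some edge in `e` leads to the node `y`. -/
def Leads {V Λ : Type} (e : Edges V Λ) (y : Node V) : Prop := ∃ l, (l, y) ∈ e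

/-- Contents of all elements. -/
abbrev Mem (V Λ : Type) := Node V → Edges V Λ

/-- The part of the graph visited by an operation: the visited nodes in the order of the
visits, with the outgoing edges found there. The last entry is the last visited node. -/
abbrev View (V Λ : Type) := List (Node V × Edges V Λ)

/-- An invocation of a dictionary operation, with the outcome of its coin tosses (traversals
and links may be randomized; `Ω` is a one-point type for a deterministic structure). -/
structure Call (V Ω : Type) where
  op : DictOp V
  coin : Ω

/-- A completed read or write of an element. -/
inductive Access (V Λ : Type) where
  | read (x : Node V) (e : Edges V Λ) : Access V Λ
  | write (x : Node V) (e : Edges V Λ) : Access V Λ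

/-- A requested read or write of an element. -/
inductive Req (V Λ : Type) where
  | read (x : Node V) : Req V Λ
  | write (x : Node V) (e : Edges V Λ) : Req V Λ

/-- The next command of a sequential read-write algorithm. -/
inductive Cmd (V Λ : Type) where
  | req (a : Req V Λ) : Cmd V Λ
  | ret (r : DictResp V) : Cmd V Λ

/-- The visited part of the graph after some accesses. -/
def viewOf {V Λ : Type} (h : List (Access V Λ)) : View V Λ :=
  h.filterMap fun a => match a with
    | .read x e => some (x, e)
    | .write _ _ => none

/-- The number of writes among some accesses. -/
def numWrites {V Λ : Type} (h : List (Access V Λ)) : ℕ :=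
  (h.filter fun a => match a with
    | .read _ _ => false
    | .write _ _ => true).length

/-- The functions that define a search structure.
* `trav` is the traverse function: from the visited part of the graph it computes the next
  node to visit, or `none` when the traversal is over.
* `link` is the insert function: from the visited part of the graph it computes the outgoing
  edges of the new node, and the new outgoing edges of the nodes that get linked to it.
* `unlink b eb p ep` is the delete function: when the node `b`, with outgoing edges `eb`, is
  removed, a predecessor `p` of `b` with outgoing edges `ep` gets these outgoing edges. -/
structure SearchData (V Λ Ω : Type) where
  trav : DictOp V → Ω → View V Λ → Option (Node V)
  link : ℕ → V → Ω → View V Λ → Edges V Λ × List (Node V × Edges V Λ)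
  unlink : Node V → Edges V Λ → Node V → Edges V Λ → Edges V Λ

namespace SearchData

variable {V Λ Ω : Type} (D : SearchData V Λ Ω)

open Classical in
/-- The writes of the update phase, in order, and the response, determined by the part of the
graph visited in the traverse phase. The key `k` counts as present iff a node with key `k`
was visited. -/
noncomputable def update (c : Call V Ω) (w : View V Λ) :
    List (Node V × Edges V Λ) × DictResp V :=
  match c.op, w.find? (fun y => y.1.key? = some (match c.op with
    | .insert k _ => k
    | .delete k => k
    | .find k => k)) with
  | .find _, none => ([], .bool false)
  | .find _, some y => ([], .ptr y.1)
  | .insert k v, none =>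
      ((.pair k v, (D.link k v c.coin w).1) :: (D.link k v c.coin w).2, .bool true)
  | .insert _ _, some _ => ([], .bool false)
  | .delete _, none => ([], .bool false)
  | .delete _, some b =>
      (w.filterMap fun p =>
        if Leads p.2 b.1 then some (p.1, D.unlink b.1 b.2 p.1 p.2) else none, .bool true)

/-- The sequential implementation: the next command of an operation, given its accesses so
far. An operation first reads the root, then visits nodes as directed by the traverse
function, then performs the writes of its update phase, then returns. -/
noncomputable def next (c : Call V Ω) (h : List (Access V Λ)) : Cmd V Λ :=
  if viewOf h = [] then .req (.read .root)
  else match D.trav c.op c.coin (viewOf h) with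
    | some y => .req (.read y)
    | none => match (D.update c (viewOf h)).1[numWrites h]? with
      | some u => .req (.write u.1 u.2)
      | none => .ret (D.update c (viewOf h)).2

open Classical in
/-- `SeqRun c m h m'`: run alone from memory `m`, the operation `c` can perform the accesses
`h`, with resulting memory `m'`. -/
inductive SeqRun (c : Call V Ω) (m : Mem V Λ) : List (Access V Λ) → Mem V Λ → Prop
  | nil : SeqRun c m [] m
  | read {h : List (Access V Λ)} {m' : Mem V Λ} {x : Node V} :
      SeqRun c m h m' → D.next c h = .req (.read x) →
      SeqRun c m (h ++ [.read x (m' x)]) m'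
  | write {h : List (Access V Λ)} {m' : Mem V Λ} {x : Node V} {e : Edges V Λ} :
      SeqRun c m h m' → D.next c h = .req (.write x e) →
      SeqRun c m (h ++ [.write x e]) (Function.update m' x e)

/-- Run alone from `m`, the operation `c` performs the accesses `h` and returns `r`, leaving
memory `m'`. -/
def Completes (c : Call V Ω) (m : Mem V Λ) (h : List (Access V Λ)) (m' : Mem V Λ)
    (r : DictResp V) : Prop :=
  D.SeqRun c m h m' ∧ D.next c h = .ret r

/-- Memories reached by sequences of operations. Initially there is only the root. -/
inductive Reach : Mem V Λ → Prop
  | init : Reach (fun _ => ∅)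
  | step {m m' : Mem V Λ} {c : Call V Ω} {h : List (Access V Λ)} {r : DictResp V} :
      Reach m → D.Completes c m h m' r → Reach m'

end SearchData

/-- The edge relation stored in a memory. -/
def Edge {V Λ : Type} (m : Mem V Λ) (x y : Node V) : Prop := Leads (m x) y

/-- Nodes of the graph stored in a memory: those reachable from the root. -/
def InGraph {V Λ : Type} (m : Mem V Λ) (x : Node V) : Prop :=
  Relation.ReflTransGen (Edge m) .root x

/-- The graph stored in `m` encodes the dictionary state `q`. -/
def Represents {V Λ : Type} (m : Mem V Λ) (q : ℕ → Option V) : Prop :=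
  ∀ k v, InGraph m (.pair k v) ↔ q k = some v

/-- A search structure: a sequential implementation of a dictionary by a rooted acyclic graph,
given by a traverse function, an insert function and a delete function. -/
structure SearchStructure (V Λ Ω : Type) extends SearchData V Λ Ω where
  /-- A traversal proceeds from the last visited node to one of its successors. -/
  proper_trav : ∀ (o : DictOp V) (ω : Ω) (w : View V Λ) (x : Node V) (e : Edges V Λ) (y : Node V),
    trav o ω (w ++ [(x, e)]) = some y → Leads e y
  /-- Insertion changes outgoing edges only of the new node and of its predecessors. -/
  proper_link : ∀ (k : ℕ) (v : V) (ω : Ω) (w : View V Λ) (p : Node V) (e : Edges V Λ),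
    (p, e) ∈ (link k v ω w).2 → Leads e (.pair k v)
  /-- The edges added by a deletion are shortcuts, to successors of the removed node. -/
  proper_unlink : ∀ (b : Node V) (eb : Edges V Λ) (p : Node V) (ep : Edges V Λ) (l : Λ) (y : Node V),
    (l, y) ∈ unlink b eb p ep → (l, y) ∈ ep ∨ Leads eb y
  /-- Every reachable graph is acyclic. -/
  acyclic : ∀ m, toSearchData.Reach m → ∀ x, InGraph m x → ¬ Relation.TransGen (Edge m) x x
  /-- Executed sequentially, operations return, with responses and effects as specified. -/
  correct : ∀ m, toSearchData.Reach m → ∀ q, Represents m q → ∀ c : Call V Ω,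
    ∃ h m' r q', toSearchData.Completes c m h m' r ∧ dictSpec V q c.op q' r ∧ Represents m' q'
  /-- Non-triviality: in some reachable state `m` without key `k`, inserting `(k, v)` leads to a
  state `m'` in which a single node `a` has an edge to a node with key `k`, and every path
  from the root to `a` has length at least two. -/
  nontrivial : ∃ (k : ℕ) (v : V) (ω : Ω) (m : Mem V Λ) (h : List (Access V Λ)) (m' : Mem V Λ)
      (r : DictResp V) (a : Node V),
    toSearchData.Reach m ∧ (∀ u, ¬ InGraph m (.pair k u)) ∧
    toSearchData.Completes ⟨.insert k v, ω⟩ m h m' r ∧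
    InGraph m' a ∧ (∀ x u, InGraph m' x → (Edge m' x (.pair k u) ↔ x = a ∧ u = v)) ∧
    a ≠ .root ∧ ¬ Edge m' .root a

/-! ## Events, histories and schedules -/

/-- The `j`-th operation invoked by process `p` has the identifier `(p, j)`. -/
abbrev OpId (n : ℕ) := Fin n × ℕ

/-- Kinds of events: invocations and responses of operations, reads and writes. `abort` is the
response `⊥` of a read or write and of the operation it belongs to. -/
inductive EvKind (V Λ Ω : Type) where
  | inv (c : Call V Ω) : EvKind V Λ Ω
  | invRead (x : Node V) : EvKind V Λ Ω
  | resRead (x : Node V) (e : Edges V Λ) : EvKind V Λ Ω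
  | invWrite (x : Node V) (e : Edges V Λ) : EvKind V Λ Ω
  | resWrite (x : Node V) (e : Edges V Λ) : EvKind V Λ Ω
  | res (r : DictResp V) : EvKind V Λ Ω
  | abort : EvKind V Λ Ω

/-- An event of the operation `op`. -/
structure Event (V Λ Ω : Type) (n : ℕ) where
  op : OpId n
  kind : EvKind V Λ Ω

section Histories

variable {V Λ Ω : Type} {n : ℕ}

/-- Invocation of an operation. -/
def EvKind.IsInv : EvKind V Λ Ω → Prop
  | .inv _ => True
  | _ => False

/-- Invocation of a read or write. -/
def EvKind.IsAccInv : EvKind V Λ Ω → Prop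
  | .invRead _ => True
  | .invWrite _ _ => True
  | _ => False

/-- The last event of an operation: a response or an abort. -/
def EvKind.IsEnd : EvKind V Λ Ω → Prop
  | .res _ => True
  | .abort => True
  | _ => False

/-- The operation `π` has an event in `H`. -/
def Occurs (H : List (Event V Λ Ω n)) (π : OpId n) : Prop := ∃ e ∈ H, e.op = π

/-- The operation `π` has returned a (non-`⊥`) response in `H`. -/
def Returned (H : List (Event V Λ Ω n)) (π : OpId n) : Prop := ∃ r, ⟨π, .res r⟩ ∈ H

/-- The operation `π` has returned or aborted in `H`. -/
def Ended (H : List (Event V Λ Ω n)) (π : OpId n) : Prop := ∃ e ∈ H, e.op = π ∧ e.kind.IsEnd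

/-- `π` precedes `π'` in `H`: it ends before `π'` is invoked. -/
def Precedes (H : List (Event V Λ Ω n)) (π π' : OpId n) : Prop :=
  ∃ l₁ l₂, H = l₁ ++ l₂ ∧ Ended l₁ π ∧ ∃ e ∈ l₂, e.op = π' ∧ e.kind.IsInv

/-- Well-formedness: an operation starts with its invocation and takes no steps after its end,
and a process invokes an operation only when its previous one has ended. -/
structure WellFormed (H : List (Event V Λ Ω n)) : Prop where
  starts : ∀ π, Occurs H π → ∃ c, ⟨π, .inv c⟩ ∈ H
  inv_first : ∀ l₁ e l₂, H = l₁ ++ e :: l₂ → e.kind.IsInv → ¬ Occurs l₁ e.op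
  end_last : ∀ l₁ e l₂, H = l₁ ++ e :: l₂ → e.kind.IsEnd → ¬ Occurs l₂ e.op
  one_at_a_time : ∀ π π', Occurs H π → Occurs H π' → π.1 = π'.1 → π ≠ π' →
    Precedes H π π' ∨ Precedes H π' π

open Classical in
/-- The history exported by an execution: reads and writes that return `⊥` are left out. -/
noncomputable def history : List (Event V Λ Ω n) → List (Event V Λ Ω n)
  | [] => []
  | e :: l =>
      if e.kind.IsAccInv ∧ l.find? (fun e' => e'.op = e.op) = some ⟨e.op, .abort⟩ then history l
      else e :: history l

open Classical in
/-- The local history of `π` (without the response `⊥`). -/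
noncomputable def localHist (H : List (Event V Λ Ω n)) (π : OpId n) : List (Event V Λ Ω n) :=
  H.filter fun e => e.op = π ∧ e.kind ≠ .abort

/-- The events of process `p`. -/
def procHist (H : List (Event V Λ Ω n)) (p : Fin n) : List (Event V Λ Ω n) :=
  H.filter fun e => e.op.1 = p

open Classical in
/-- The events of the operations that returned a (non-`⊥`) response. -/
noncomputable def completeHist (H : List (Event V Λ Ω n)) : List (Event V Λ Ω n) :=
  H.filter fun e => Returned H e.op

/-- An event with the responses of reads and of operations left unspecified. -/
inductive Shape (V Λ Ω : Type) where
  | inv (c : Call V Ω) : Shape V Λ Ω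
  | invRead (x : Node V) : Shape V Λ Ω
  | resRead (x : Node V) : Shape V Λ Ω
  | invWrite (x : Node V) (e : Edges V Λ) : Shape V Λ Ω
  | resWrite (x : Node V) (e : Edges V Λ) : Shape V Λ Ω
  | res : Shape V Λ Ω
  | abort : Shape V Λ Ω

/-- Forget responses of reads and of operations. -/
def EvKind.shape : EvKind V Λ Ω → Shape V Λ Ω
  | .inv c => .inv c
  | .invRead x => .invRead x
  | .resRead x _ => .resRead x
  | .invWrite x e => .invWrite x e
  | .resWrite x e => .resWrite x e
  | .res _ => .res
  | .abort => .abort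

/-- A schedule: the order of the events of the processes, without responses of reads and of
operations. -/
abbrev Schedule (V Λ Ω : Type) (n : ℕ) := List (Fin n × Shape V Λ Ω)

/-- The schedule exported by a history. -/
noncomputable def scheduleOf (H : List (Event V Λ Ω n)) : Schedule V Λ Ω n :=
  (completeHist H).map fun e => (e.op.1, e.kind.shape)

/-! ## LS-linearizability -/

/-- The events of an access. -/
def accessEvents (π : OpId n) : Access V Λ → List (Event V Λ Ω n)
  | .read x e => [⟨π, .invRead x⟩, ⟨π, .resRead x e⟩]
  | .write x e => [⟨π, .invWrite x e⟩, ⟨π, .resWrite x e⟩]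

/-- Histories of sequences of complete operations of the sequential implementation, with the
resulting memory. -/
inductive SeqHistory (D : SearchData V Λ Ω) : List (Event V Λ Ω n) → Mem V Λ → Prop
  | nil : SeqHistory D [] (fun _ => ∅)
  | op {S : List (Event V Λ Ω n)} {m m' : Mem V Λ} {π : OpId n} {c : Call V Ω}
      {h : List (Access V Λ)} {r : DictResp V} :
      SeqHistory D S m → ¬ Occurs S π → D.Completes c m h m' r →
      SeqHistory D (S ++ ⟨π, .inv c⟩ :: h.flatMap (accessEvents π) ++ [⟨π, .res r⟩]) m'

/-- The set of (complete or incomplete) histories of the sequential implementation. -/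
def IsSeqHist (D : SearchData V Λ Ω) (S : List (Event V Λ Ω n)) : Prop :=
  ∃ S' m, SeqHistory D S' m ∧ S <+: S'

/-- Every operation has the same local history as in some sequential history. -/
def LocallySerializable (D : SearchData V Λ Ω) (H : List (Event V Λ Ω n)) : Prop :=
  ∀ π, Occurs H π → ∃ S : List (Event V Λ Ω n), IsSeqHist D S ∧ localHist H π = localHist S π

/-- Linearizability with respect to the dictionary type. The list `L` is the sequential history:
it contains all operations that returned, with their responses, and some incomplete (not
aborted) operations, completed with a response; it respects the precedence order. -/
def Linearizable (H : List (Event V Λ Ω n)) : Prop :=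
  ∃ L : List (OpId n × DictOp V × DictResp V),
    (L.map fun a => a.1).Nodup ∧
    (∀ a ∈ L, (∃ ω, ⟨a.1, .inv ⟨a.2.1, ω⟩⟩ ∈ H) ∧ ⟨a.1, .abort⟩ ∉ H) ∧
    (∀ π r, ⟨π, .res r⟩ ∈ H → ∃ o, (π, o, r) ∈ L) ∧
    L.Pairwise (fun a b => ¬ Precedes H b.1 a.1) ∧
    (dictType V).Consistent (dictType V).q₀ (L.map fun a => a.2)

/-- LS-linearizability of a history. -/
def LSL (D : SearchData V Λ Ω) (H : List (Event V Λ Ω n)) : Prop :=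
  LocallySerializable D H ∧ Linearizable H

/-- LS-linearizable schedules: those exported by an LS-linearizable history. -/
def LSLSchedules (D : SearchData V Λ Ω) (n : ℕ) : Set (Schedule V Λ Ω n) :=
  {σ | ∃ H : List (Event V Λ Ω n), WellFormed H ∧ LSL D H ∧ scheduleOf H = σ}

/-! ## Safe-strict serializability -/

/-- No two operations are concurrent. -/
def Sequential (H : List (Event V Λ Ω n)) : Prop :=
  ∀ π π', Occurs H π → Occurs H π' → π ≠ π' → Precedes H π π' ∨ Precedes H π' π

open Classical in
/-- Every read returns the latest written value, with initial values given by `m`. -/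
def LegalFrom : Mem V Λ → List (Event V Λ Ω n) → Prop
  | _, [] => True
  | m, e :: l => match e.kind with
    | .resRead x ex => ex = m x ∧ LegalFrom m l
    | .resWrite x ex => LegalFrom (Function.update m x ex) l
    | _ => LegalFrom m l

/-- Legality, from the initial memory. -/
def Legal (H : List (Event V Λ Ω n)) : Prop := LegalFrom (fun _ => ∅) H

/-- `H'` is obtained from `H` by adding the responses of some operations that have completed all
their reads and writes, so that only the response was missing. -/
def Completion (D : SearchData V Λ Ω) (H H' : List (Event V Λ Ω n)) : Prop :=
  ∃ t : List (Event V Λ Ω n), H' = H ++ t ∧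
    ∀ e ∈ t, (∃ r, e.kind = .res r) ∧ Occurs H e.op ∧ ¬ Ended H e.op ∧
      ∃ S : List (Event V Λ Ω n), IsSeqHist D S ∧ localHist H' e.op = localHist S e.op

/-- Strict serializability of an execution. -/
def StrictlySerializable (D : SearchData V Λ Ω) (α : List (Event V Λ Ω n)) : Prop :=
  ∃ H' α' : List (Event V Λ Ω n), Completion D (history α) H' ∧
    Sequential α' ∧ Legal α' ∧ (∀ p, procHist α' p = procHist (completeHist H') p) ∧
    ∀ π π', Precedes (completeHist H') π π' → Precedes α' π π'

/-- Strict serializability, and every operation `π` (even incomplete or aborted) observes, up to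
its last event, a legal sequential execution of complete operations followed by `π`. -/
def SafeStrictlySerializable (D : SearchData V Λ Ω) (α : List (Event V Λ Ω n)) : Prop :=
  StrictlySerializable D α ∧
  ∀ β e γ, α = β ++ e :: γ → ¬ Occurs γ e.op →
    ∃ H' α' : List (Event V Λ Ω n), Completion D (history (β ++ [e])) H' ∧
      Sequential α' ∧ Legal α' ∧
      (∀ π, Occurs α' π → π ≠ e.op → Returned H' π ∧ Precedes α' π e.op ∧
        localHist α' π = localHist H' π) ∧
      localHist α' e.op = localHist (history (β ++ [e])) e.op

end Histories

/-! ## Concurrent implementations -/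

/-- What a process does between reads and writes of an operation: apply a primitive to the base
objects, or proceed with the sequential implementation. A primitive acts atomically on the
joint state `Sh` of the base objects; a primitive that is not enabled (`none`) blocks. -/
inductive ReadyAct (Sh Loc : Type) where
  | prim (f : Sh → Option (Sh × Loc)) : ReadyAct Sh Loc
  | proceed : ReadyAct Sh Loc

/-- What a process does inside a read or write: apply a primitive, respond (the value is ignored
for a write), or abort. -/
inductive ServeAct (V Λ Sh Loc : Type) where
  | prim (f : Sh → Option (Sh × Loc)) : ServeAct V Λ Sh Loc
  | reply (e : Edges V Λ) : ServeAct V Λ Sh Loc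
  | abort : ServeAct V Λ Sh Loc

/-- The status of a process: idle, between two accesses of an operation, or inside an access. -/
inductive Phase (V Λ Ω : Type) where
  | idle : Phase V Λ Ω
  | ready (c : Call V Ω) (h : List (Access V Λ)) : Phase V Λ Ω
  | pending (c : Call V Ω) (h : List (Access V Λ)) (a : Req V Λ) : Phase V Λ Ω

/-- A concurrent implementation for `n` processes. Every operation follows the sequential
implementation; the implementation supplies algorithms, over base objects with joint state
`Sh`, for reads and writes, and synchronization between them. `obs` is the effect of the own
events on the local state of a process. -/
structure Impl (V Λ Ω : Type) (n : ℕ) where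
  Sh : Type
  Loc : Type
  sh₀ : Sh
  loc₀ : Fin n → Loc
  ready : Fin n → Loc → Call V Ω → List (Access V Λ) → ReadyAct Sh Loc
  serve : Fin n → Loc → Call V Ω → List (Access V Λ) → Req V Λ → ServeAct V Λ Sh Loc
  obs : Fin n → Loc → EvKind V Λ Ω → Loc

/-- Configurations: base objects, local states, statuses, and the number of operations that each
process has finished. -/
structure Config (V Λ Ω Sh Loc : Type) (n : ℕ) where
  sh : Sh
  loc : Fin n → Loc
  phase : Fin n → Phase V Λ Ω
  cnt : Fin n → ℕ

namespace Impl

variable {V Λ Ω : Type} {n : ℕ} (D : SearchData V Λ Ω) (I : Impl V Λ Ω n)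

/-- Configurations of an implementation. -/
abbrev Conf := Config V Λ Ω I.Sh I.Loc n

/-- The initial configuration. -/
def start : I.Conf := ⟨I.sh₀, I.loc₀, fun _ => .idle, fun _ => 0⟩

variable {I}

/-- Process `p` applies a primitive. -/
def afterPrim (C : I.Conf) (p : Fin n) (s : I.Sh) (l : I.Loc) : I.Conf :=
  { C with sh := s, loc := Function.update C.loc p l }

/-- Process `p` has an event inside its operation and gets the status `φ`. -/
def afterEvent (C : I.Conf) (p : Fin n) (k : EvKind V Λ Ω) (φ : Phase V Λ Ω) : I.Conf :=
  { C with
    loc := Function.update C.loc p (I.obs p (C.loc p) k)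
    phase := Function.update C.phase p φ }

/-- Process `p` ends its operation. -/
def afterEnd (C : I.Conf) (p : Fin n) (k : EvKind V Λ Ω) : I.Conf :=
  { C with
    loc := Function.update C.loc p (I.obs p (C.loc p) k)
    phase := Function.update C.phase p .idle
    cnt := Function.update C.cnt p (C.cnt p + 1) }

/-- The invocation event of an access. -/
def reqKind : Req V Λ → EvKind V Λ Ω
  | .read x => .invRead x
  | .write x e => .invWrite x e

/-- The response event of an access. -/
def replyKind (e : Edges V Λ) : Req V Λ → EvKind V Λ Ω
  | .read x => .resRead x e
  | .write x e' => .resWrite x e'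

/-- The access completed by a response. -/
def replyAccess (e : Edges V Λ) : Req V Λ → Access V Λ
  | .read x => .read x e
  | .write x e' => .write x e'

/-- Steps of process `p`, with the event that the step exhibits, if any. -/
inductive Step : I.Conf → Fin n → Option (Event V Λ Ω n) → I.Conf → Prop
  | invoke {C : I.Conf} {p : Fin n} (c : Call V Ω) :
      C.phase p = .idle →
      Step C p (some ⟨(p, C.cnt p), .inv c⟩) (afterEvent C p (.inv c) (.ready c []))
  | readyPrim {C : I.Conf} {p : Fin n} {c : Call V Ω} {h : List (Access V Λ)}
      {f : I.Sh → Option (I.Sh × I.Loc)} {s : I.Sh} {l : I.Loc} :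
      C.phase p = .ready c h → I.ready p (C.loc p) c h = .prim f → f C.sh = some (s, l) →
      Step C p none (afterPrim C p s l)
  | request {C : I.Conf} {p : Fin n} {c : Call V Ω} {h : List (Access V Λ)} {a : Req V Λ} :
      C.phase p = .ready c h → I.ready p (C.loc p) c h = .proceed → D.next c h = .req a →
      Step C p (some ⟨(p, C.cnt p), reqKind a⟩) (afterEvent C p (reqKind a) (.pending c h a))
  | respond {C : I.Conf} {p : Fin n} {c : Call V Ω} {h : List (Access V Λ)} {r : DictResp V} :
      C.phase p = .ready c h → I.ready p (C.loc p) c h = .proceed → D.next c h = .ret r →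
      Step C p (some ⟨(p, C.cnt p), .res r⟩) (afterEnd C p (.res r))
  | servePrim {C : I.Conf} {p : Fin n} {c : Call V Ω} {h : List (Access V Λ)} {a : Req V Λ}
      {f : I.Sh → Option (I.Sh × I.Loc)} {s : I.Sh} {l : I.Loc} :
      C.phase p = .pending c h a → I.serve p (C.loc p) c h a = .prim f →
      f C.sh = some (s, l) →
      Step C p none (afterPrim C p s l)
  | reply {C : I.Conf} {p : Fin n} {c : Call V Ω} {h : List (Access V Λ)} {a : Req V Λ}
      {e : Edges V Λ} :
      C.phase p = .pending c h a → I.serve p (C.loc p) c h a = .reply e →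
      Step C p (some ⟨(p, C.cnt p), replyKind e a⟩)
        (afterEvent C p (replyKind e a) (.ready c (h ++ [replyAccess e a])))
  | abort {C : I.Conf} {p : Fin n} {c : Call V Ω} {h : List (Access V Λ)} {a : Req V Λ} :
      C.phase p = .pending c h a → I.serve p (C.loc p) c h a = .abort →
      Step C p (some ⟨(p, C.cnt p), .abort⟩) (afterEnd C p .abort)

variable (I)

/-- Finite executions: the events, and the configuration reached. -/
inductive Exec : List (Event V Λ Ω n) → I.Conf → Prop
  | nil : Exec [] I.start
  | step {α : List (Event V Λ Ω n)} {C C' : I.Conf} {p : Fin n} {e : Option (Event V Λ Ω n)} :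
      Exec α C → Step D C p e C' → Exec (α ++ e.toList) C'

/-- The histories exported by an implementation. -/
def Exports (H : List (Event V Λ Ω n)) : Prop := ∃ α C, I.Exec D α C ∧ H = history α

/-- An implementation is LS-linearizable if all its histories are. -/
def IsLSL : Prop := ∀ H, I.Exports D H → LSL D H

/-- The implementation accepts the schedule. -/
def Accepts (σ : Schedule V Λ Ω n) : Prop := ∃ H, I.Exports D H ∧ scheduleOf H = σ

/-- An implementation is concurrency-optimal if it accepts all LS-linearizable schedules. -/
def ConcurrencyOptimal : Prop := ∀ σ ∈ LSLSchedules D n, I.Accepts D σ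

/-- Pessimistic implementations never abort an operation. -/
def Pessimistic : Prop := ∀ α C, I.Exec D α C → ∀ e ∈ α, e.kind ≠ .abort

end Impl

/-! ## Lock-based implementations -/

/-- Lock primitives. -/
inductive LockPrim where
  | lock : LockPrim
  | lockShared : LockPrim
  | unlock : LockPrim
  | unlockShared : LockPrim

/-- The locks on the elements: for each element the process that holds the exclusive lock, if
any, and the processes that hold a shared lock. -/
structure Locks (V : Type) (n : ℕ) where
  excl : Node V → Option (Fin n)
  shared : Node V → Set (Fin n)

section LockBased

variable {V Λ Ω : Type} {n : ℕ}

/-- Process `p` holds a lock on `x`. -/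
def Locks.Holds (t : Locks V n) (p : Fin n) (x : Node V) : Prop :=
  t.excl x = some p ∨ p ∈ t.shared x

open Classical in
/-- Effect of a lock primitive; a lock is granted only if no other process holds a conflicting
one, and the request blocks until then. -/
noncomputable def Locks.apply (t : Locks V n) (p : Fin n) (x : Node V) :
    LockPrim → Option (Locks V n)
  | .lock => if ∀ q, q ≠ p → ¬ t.Holds q x then
      some { t with excl := Function.update t.excl x (some p) } else none
  | .lockShared => if ∀ q, q ≠ p → t.excl x ≠ some q then
      some { t with shared := Function.update t.shared x (insert p (t.shared x)) } else none
  | .unlock => some (if t.excl x = some p then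
      { t with excl := Function.update t.excl x none } else t)
  | .unlockShared =>
      some { t with shared := Function.update t.shared x (t.shared x \ {p}) }

/-- A step of a lock-based program: apply a lock primitive (and continue with local state `l`),
or proceed with the sequential code. -/
inductive LockAct (V Loc : Type) where
  | sync (k : LockPrim) (x : Node V) (l : Loc) : LockAct V Loc
  | proceed : LockAct V Loc

/-- A lock-based program: lock primitives inserted into the sequential code, anywhere between the
invocation and the response of an operation. Decisions depend on the local state of the
process, its operation, and what the operation has read. Inside a read or write, `ready`
and `serve` decide on lock primitives; the last argument of `serve` tells whether the element
has already been accessed. -/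
structure LockProgram (V Λ Ω : Type) (n : ℕ) where
  Loc : Type
  loc₀ : Fin n → Loc
  ready : Fin n → Loc → Call V Ω → List (Access V Λ) → LockAct V Loc
  serve : Fin n → Loc → Call V Ω → List (Access V Λ) → Req V Λ → Option (Edges V Λ) →
    LockAct V Loc
  obs : Fin n → Loc → EvKind V Λ Ω → Loc

namespace LockProgram

variable (L : LockProgram V Λ Ω n)

/-- A lock primitive of process `p` as a primitive on memory and locks. -/
noncomputable def lockPrim (p : Fin n) (k : LockPrim) (x : Node V) (l : L.Loc)
    (b : Option (Edges V Λ)) (s : Mem V Λ × Locks V n) :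
    Option ((Mem V Λ × Locks V n) × (L.Loc × Option (Edges V Λ))) :=
  (s.2.apply p x k).map fun t => ((s.1, t), (l, b))

open Classical in
/-- The access to the shared element, in place: the value read or written is kept in the second
component of the local state until the response. -/
noncomputable def accessPrim (l : L.Loc) (a : Req V Λ) (s : Mem V Λ × Locks V n) :
    Option ((Mem V Λ × Locks V n) × (L.Loc × Option (Edges V Λ))) :=
  match a with
  | .read x => some (s, (l, some (s.1 x)))
  | .write x e => some ((Function.update s.1 x e, s.2), (l, some e))

/-- The concurrent implementation defined by a lock-based program. The base objects are the
elements themselves and their locks. -/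
noncomputable def toImpl : Impl V Λ Ω n where
  Sh := Mem V Λ × Locks V n
  Loc := L.Loc × Option (Edges V Λ)
  sh₀ := (fun _ => ∅, ⟨fun _ => none, fun _ => ∅⟩)
  loc₀ := fun p => (L.loc₀ p, none)
  ready := fun p l c h => match L.ready p l.1 c h with
    | .sync k x l' => .prim (L.lockPrim p k x l' none)
    | .proceed => .proceed
  serve := fun p l c h a => match L.serve p l.1 c h a l.2 with
    | .sync k x l' => .prim (L.lockPrim p k x l' l.2)
    | .proceed => match l.2 with
      | none => .prim (L.accessPrim l.1 a)
      | some e => .reply e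
  obs := fun p l k => (L.obs p l.1 k, none)

/-- In configuration `C`, the next step of process `p` is to acquire a lock on `x`. -/
def Requests (C : L.toImpl.Conf) (p : Fin n) (x : Node V) : Prop :=
  ∃ k : LockPrim, (k = .lock ∨ k = .lockShared) ∧ ∃ l' : L.Loc,
    (∃ c h, C.phase p = .ready c h ∧ L.ready p (C.loc p).1 c h = .sync k x l') ∨
    (∃ c h a, C.phase p = .pending c h a ∧
      L.serve p (C.loc p).1 c h a (C.loc p).2 = .sync k x l')

/-- An infinite execution: at each time one process takes a step, or nothing happens. -/
def IsRun (D : SearchData V Λ Ω) (C : ℕ → L.toImpl.Conf)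
    (act : ℕ → Option (Fin n × Option (Event V Λ Ω n))) : Prop :=
  C 0 = L.toImpl.start ∧ ∀ t, match act t with
    | none => C (t + 1) = C t
    | some (p, e) => Impl.Step D (C t) p e (C (t + 1))

/-- Process `p` takes a step at time `t`. -/
def Acts (act : ℕ → Option (Fin n × Option (Event V Λ Ω n))) (p : Fin n) (t : ℕ) : Prop :=
  ∃ e, act t = some (p, e)

/-- No process stops taking steps in the middle of an operation (unless it is blocked). -/
def FairRun (D : SearchData V Λ Ω) (C : ℕ → L.toImpl.Conf)
    (act : ℕ → Option (Fin n × Option (Event V Λ Ω n))) : Prop :=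
  ∀ p t₀, (∀ t ≥ t₀, (C t).phase p ≠ .idle) →
    ∃ t ≥ t₀, Acts act p t ∨ ¬ ∃ e C', Impl.Step D (C t) p e C'

/-- Locks are starvation-free: a process waits forever for a lock on `x` only if another process
holds a lock on `x` forever. -/
def StarvationFreeLocks (C : ℕ → L.toImpl.Conf)
    (act : ℕ → Option (Fin n × Option (Event V Λ Ω n))) : Prop :=
  ∀ p x t₀, (∀ t ≥ t₀, L.Requests (C t) p x ∧ ¬ Acts act p t) →
    ∃ q, q ≠ p ∧ ∃ t₁, ∀ t ≥ t₁, (C t).sh.2.Holds q x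

/-- Deadlock-freedom: if no process stops in the middle of an operation (and locks are
starvation-free), then whenever operations are pending some operation returns later. -/
def DeadlockFree (D : SearchData V Λ Ω) : Prop :=
  ∀ C act, L.IsRun D C act → L.FairRun D C act → L.StarvationFreeLocks C act →
    ∀ t, (∃ p, (C t).phase p ≠ .idle) →
      ∃ t' ≥ t, ∃ p π r, act t' = some (p, some ⟨π, .res r⟩)

end LockProgram

end LockBased

/-! ## The two classes of implementations -/

section Classes

variable {V Λ Ω : Type} (D : SearchData V Λ Ω) (n : ℕ)

/-- Serializable optimistic implementations: all executions are safe-strictly serializable, and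
the implementation is LS-linearizable. Operations may abort. -/
def classSM : Set (Impl V Λ Ω n) :=
  {I | I.IsLSL D ∧ ∀ α C, I.Exec D α C → SafeStrictlySerializable D α}

/-- Pessimistic implementations: lock-based, never aborting, deadlock-free, LS-linearizable. -/
def classP : Set (Impl V Λ Ω n) :=
  {I | I.IsLSL D ∧ I.Pessimistic D ∧
    ∃ L : LockProgram V Λ Ω n, L.toImpl = I ∧ L.DeadlockFree D}

variable {n}

/-- The schedules accepted by implementations of a class. -/
def acceptedBy (𝒞 : Set (Impl V Λ Ω n)) : Set (Schedule V Λ Ω n) :=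
  {σ | ∃ I ∈ 𝒞, I.Accepts D σ}

end Classes

end SearchConc

open SearchConc

/-!
For each direction of the incomparability there is a schedule that one implementation accepts and
that every implementation of the other class rejects. Both schedules are LS-linearizable because
they are accepted by LS-linearizable implementations, so they also show that neither class contains
a concurrency-optimal implementation.

**The stale read.** A process invokes a search for a key, another process inserts this key into the
empty structure, and only then the search reads the root and, having visited nothing else, returns.
The snapshot implementation reads from a copy of the memory taken when the operation starts,
validates the copy at the last write, and commits all writes at once. Its operations are serialized
at their snapshots or at their commits (`SnapInv.step`), and even an aborted operation has read from
a state between two commits, so it belongs to the serializable class (`snapshotImpl_mem_classSM`);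
it accepts the schedule (`snapshot_runs_stale`). In a lock-based implementation reads and writes act
in place, and as they do not overlap in this schedule, every read returns the latest written value
(`inPlace_exec`). The search then reads the edges of the root after the insertion, and the
sequential code prescribes visiting the inserted node (`lock_rejects`).

**The detour.** By non-triviality, in some reachable state a key `k` is stored in a node with a
unique predecessor `a`, and all paths from the root to `a` have length at least two. A search for
`k` hence visits, after the root, a node `(kx, vx)` other than `a`. Let the search pause after these
two reads while another process deletes first `kx` and then `k`, and let it then go on, missing `k`
(`exists_detour`). In a serialization the search runs from the memory before, between or after the
deletions (`serialization_point`). From the first two it would visit `k`, and from the last one it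
would not visit `(kx, vx)` (`Detour.not_completes`), so no strictly serializable implementation
accepts this schedule (`serializable_rejects`). It is LS-linearizable nevertheless: the search alone
looks as if `k`, but not `kx`, had been deleted before it, and it can be linearized last.

The lock-based implementation that accepts it, `Detour.bypass`, protects the whole structure by a
lock on the root. There are two exceptions, tailored to the detour, and a second lock, on
`(kx, vx)`, keeps everything else out while they apply. A search for `k` that has visited the root and
`(kx, vx)`, neither of which leads to `k`, is *gapped*: it gives up the lock on the root and keeps
the second one. A deletion of `kx`, or one of `k` that writes to at most one element, is *light*: it
needs the lock on the root only, so it can run while a gapped search pauses. Light deletions leave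
the part of the graph that the gapped search may still visit as the search expects it: the deletion
of `kx` rewrites only predecessors of `(kx, vx)`, which by acyclicity lie above, and a single write
of the deletion of `k` takes effect atomically. If this write concerns the gapped search, the search
continues as if `k` had been deleted first, and it is linearized after that deletion (`Gap`,
`GapInv.delete_kx`, `GapInv.delete_k`). This gives LS-linearizability (`BypassInv.access`,
`Detour.bypass_isLSL`). Since the locks are acquired in a fixed order and operations visit only
finitely many stored pairs, the implementation is deadlock-free (`Detour.bypass_deadlockFree`).

**Quiescence.** A schedule does not show operations that have not returned, so an implementation
that accepts it might have performed further, unscheduled events, whose writes could change what the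
scheduled operations read. Both schedules therefore end with a round of searches by all processes:
an operation of a process that is incomplete at the end starts after the last scheduled operation of
this process, hence it has no events in the part of the execution that matters (`filter_prefix`).
-/

open SearchConc
namespace SearchConc

open Classical

/-! ### Solo runs of the sequential code -/

section SequentialRuns

variable {V Λ Ω : Type} {D : SearchData V Λ Ω} {c : Call V Ω}

/-- The memory after the accesses `l`, performed from memory `m`. -/
noncomputable def accMem (m : Mem V Λ) : List (Access V Λ) → Mem V Λ
  | [] => m
  | .read _ _ :: l => accMem m l
  | .write x e :: l => accMem (Function.update m x e) l

/-- The operation `c`, having performed the accesses `h`, can go on with the accesses `l` when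
it runs alone from memory `m`. -/
def Runs (D : SearchData V Λ Ω) (c : Call V Ω) :
    Mem V Λ → List (Access V Λ) → List (Access V Λ) → Prop
  | _, _, [] => True
  | m, h, .read x e :: l => D.next c h = .req (.read x) ∧ e = m x ∧ Runs D c m (h ++ [.read x e]) l
  | m, h, .write x e :: l => D.next c h = .req (.write x e) ∧
      Runs D c (Function.update m x e) (h ++ [.write x e]) l

theorem accMem_append (m : Mem V Λ) (l l' : List (Access V Λ)) :
    accMem m (l ++ l') = accMem (accMem m l) l' := by
  induction l generalizing m with
  | nil => rfl
  | cons a l ih => cases a <;> simp [accMem, ih]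

theorem runs_append {m : Mem V Λ} {h l l' : List (Access V Λ)} :
    Runs D c m h (l ++ l') ↔ Runs D c m h l ∧ Runs D c (accMem m l) (h ++ l) l' := by
  induction l generalizing m h with
  | nil => simp [Runs, accMem]
  | cons a l ih => cases a <;> simp [accMem, Runs, ih, and_assoc]

theorem seqRun_iff {m m' : Mem V Λ} {h : List (Access V Λ)} :
    D.SeqRun c m h m' ↔ Runs D c m [] h ∧ m' = accMem m h := by
  constructor
  · intro hr
    induction hr with
    | nil => simp [Runs, accMem]
    | read _ hn ih =>
      obtain ⟨h1, rfl⟩ := ih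
      simp [runs_append, Runs, accMem_append, accMem, h1, hn]
    | write _ hn ih =>
      obtain ⟨h1, rfl⟩ := ih
      simp [runs_append, Runs, accMem_append, accMem, h1, hn]
  · rintro ⟨h1, rfl⟩
    induction h using List.reverseRecOn with
    | nil => exact .nil
    | append_singleton h a ih =>
      rw [runs_append] at h1
      cases a with
      | read x e =>
        obtain ⟨h1, h2, rfl, -⟩ := h1
        simpa [accMem_append, accMem] using SearchData.SeqRun.read (ih h1) h2
      | write x e =>
        obtain ⟨h1, h2, -⟩ := h1
        simpa [accMem_append, accMem] using SearchData.SeqRun.write (ih h1) h2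

theorem runs_prefix {m : Mem V Λ} {h l l' : List (Access V Λ)} (hl : l <+: l')
    (hr : Runs D c m h l') : Runs D c m h l := by
  obtain ⟨t, rfl⟩ := hl
  exact (runs_append.1 hr).1

/-- Runs are deterministic. -/
theorem runs_linear {m : Mem V Λ} {h l l' : List (Access V Λ)} (h1 : Runs D c m h l)
    (h2 : Runs D c m h l') : l <+: l' ∨ l' <+: l := by
  induction l generalizing m h l' with
  | nil => simp
  | cons a l ih =>
    cases l' with
    | nil => simp
    | cons b l' =>
      cases a <;> cases b <;> simp only [Runs] at h1 h2
      · obtain ⟨n1, rfl, r1⟩ := h1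
        obtain ⟨n2, rfl, r2⟩ := h2
        rw [n1] at n2
        simp only [Cmd.req.injEq, Req.read.injEq] at n2
        subst n2
        simpa [List.cons_prefix_cons] using ih r1 r2
      · rw [h1.1] at h2; simp at h2
      · rw [h1.1] at h2; simp at h2
      · obtain ⟨n1, r1⟩ := h1
        obtain ⟨n2, r2⟩ := h2
        rw [n1] at n2
        simp only [Cmd.req.injEq, Req.write.injEq] at n2
        obtain ⟨rfl, rfl⟩ := n2
        simpa [List.cons_prefix_cons] using ih r1 r2

theorem runs_le_of_ret {m : Mem V Λ} {h l l' : List (Access V Λ)} {r : DictResp V}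
    (h1 : Runs D c m h l) (h2 : Runs D c m h l') (hr : D.next c (h ++ l') = .ret r) :
    l <+: l' := by
  rcases runs_linear h1 h2 with hp | ⟨t, rfl⟩
  · exact hp
  · rw [runs_append] at h1
    cases t with
    | nil => simp
    | cons a t => cases a <;> · have := h1.2.1; rw [hr] at this; simp at this

theorem completes_det {m m₁ m₂ : Mem V Λ} {h₁ h₂ : List (Access V Λ)} {r₁ r₂ : DictResp V}
    (h1 : D.Completes c m h₁ m₁ r₁) (h2 : D.Completes c m h₂ m₂ r₂) :
    h₁ = h₂ ∧ m₁ = m₂ ∧ r₁ = r₂ := by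
  obtain ⟨s1, n1⟩ := h1
  obtain ⟨s2, n2⟩ := h2
  obtain ⟨t1, rfl⟩ := seqRun_iff.1 s1
  obtain ⟨t2, rfl⟩ := seqRun_iff.1 s2
  obtain rfl : h₁ = h₂ := (runs_le_of_ret t1 t2 n2).eq_of_length_le
    (runs_le_of_ret t2 t1 n1).length_le
  rw [n1] at n2
  simpa using n2

theorem completes_extends {m m₁ m₂ : Mem V Λ} {h₁ h₂ : List (Access V Λ)} {r : DictResp V}
    (h1 : D.SeqRun c m h₁ m₁) (h2 : D.Completes c m h₂ m₂ r) : h₁ <+: h₂ := by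
  obtain ⟨s1, rfl⟩ := seqRun_iff.1 h1
  obtain ⟨s2, rfl⟩ := seqRun_iff.1 h2.1
  exact runs_le_of_ret s1 s2 h2.2

@[simp] theorem viewOf_append (h h' : List (Access V Λ)) :
    viewOf (h ++ h') = viewOf h ++ viewOf h' := by simp [viewOf]

@[simp] theorem viewOf_nil : viewOf ([] : List (Access V Λ)) = [] := rfl

@[simp] theorem viewOf_cons_read (x : Node V) (e : Edges V Λ) (h : List (Access V Λ)) :
    viewOf (.read x e :: h) = (x, e) :: viewOf h := by simp [viewOf]

@[simp] theorem viewOf_cons_write (x : Node V) (e : Edges V Λ) (h : List (Access V Λ)) :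
    viewOf (.write x e :: h) = viewOf h := by simp [viewOf]

@[simp] theorem numWrites_append (h h' : List (Access V Λ)) :
    numWrites (h ++ h') = numWrites h + numWrites h' := by simp [numWrites]

@[simp] theorem numWrites_nil : numWrites ([] : List (Access V Λ)) = 0 := rfl

@[simp] theorem numWrites_cons_read (x : Node V) (e : Edges V Λ) (h : List (Access V Λ)) :
    numWrites (.read x e :: h) = numWrites h := by simp [numWrites]

@[simp] theorem numWrites_cons_write (x : Node V) (e : Edges V Λ) (h : List (Access V Λ)) :
    numWrites (.write x e :: h) = numWrites h + 1 := by simp [numWrites]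

/-- The memory after a list of writes. -/
noncomputable def writeMem (m : Mem V Λ) (u : List (Node V × Edges V Λ)) : Mem V Λ :=
  accMem m (u.map fun a => .write a.1 a.2)

theorem writeMem_of_not_mem {m : Mem V Λ} {u : List (Node V × Edges V Λ)} {y : Node V}
    (hy : ∀ a ∈ u, a.1 ≠ y) : writeMem m u y = m y := by
  unfold writeMem
  induction u generalizing m with
  | nil => rfl
  | cons a u ih =>
    simp only [List.map_cons, accMem]
    rw [ih (fun b hb => hy b (by simp [hb]))]
    exact Function.update_of_ne (hy a (by simp)).symm _ _

theorem writeMem_of_const {m : Mem V Λ} {u : List (Node V × Edges V Λ)} {y : Node V}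
    {e : Edges V Λ} (hy : ∀ a ∈ u, a.1 = y → a.2 = e) (h : ∃ a ∈ u, a.1 = y) :
    writeMem m u y = e := by
  induction u using List.reverseRecOn with
  | nil => simp at h
  | append_singleton u a ih =>
    have e1 : writeMem m (u ++ [a]) = Function.update (writeMem m u) a.1 a.2 := by
      simp [writeMem, accMem_append, accMem]
    rw [e1]
    by_cases ha : a.1 = y
    · subst ha; simp [hy a (by simp) rfl]
    · rw [Function.update_of_ne (Ne.symm ha)]
      apply ih (fun b hb => hy b (by simp [hb]))
      obtain ⟨b, hb, rfl⟩ := h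
      simp only [List.mem_append, List.mem_singleton] at hb
      rcases hb with hb | rfl
      · exact ⟨b, hb, rfl⟩
      · exact absurd rfl ha

theorem accMem_map_read (m : Mem V Λ) (w : View V Λ) :
    accMem m (w.map fun a => .read a.1 a.2) = m := by
  induction w with
  | nil => rfl
  | cons a w ih => simpa [accMem] using ih

theorem next_read_iff {h : List (Access V Λ)} {x : Node V} :
    D.next c h = .req (.read x) ↔
      (viewOf h = [] ∧ x = .root) ∨ (viewOf h ≠ [] ∧ D.trav c.op c.coin (viewOf h) = some x) := by
  unfold SearchData.next
  by_cases hv : viewOf h = []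
  · simp [hv, eq_comm]
  · rw [if_neg hv]
    cases ht : D.trav c.op c.coin (viewOf h) with
    | some y => simp [hv]
    | none =>
      simp only [hv, ne_eq, not_false_eq_true, false_and, reduceCtorEq, and_false, or_false]
      split <;> simp

theorem next_write_iff {h : List (Access V Λ)} {x : Node V} {e : Edges V Λ} :
    D.next c h = .req (.write x e) ↔ viewOf h ≠ [] ∧ D.trav c.op c.coin (viewOf h) = none ∧
      (D.update c (viewOf h)).1[numWrites h]? = some (x, e) := by
  unfold SearchData.next
  by_cases hv : viewOf h = []
  · simp [hv]
  · rw [if_neg hv]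
    cases ht : D.trav c.op c.coin (viewOf h) with
    | some y => simp
    | none =>
      simp only [hv, ne_eq, not_false_eq_true, true_and]
      split
      · rename_i u hu; simp [hu, Prod.ext_iff]
      · rename_i hu; simp [hu]

theorem next_ret_iff {h : List (Access V Λ)} {r : DictResp V} :
    D.next c h = .ret r ↔ viewOf h ≠ [] ∧ D.trav c.op c.coin (viewOf h) = none ∧
      (D.update c (viewOf h)).1.length ≤ numWrites h ∧ r = (D.update c (viewOf h)).2 := by
  unfold SearchData.next
  by_cases hv : viewOf h = []
  · simp [hv]
  · rw [if_neg hv]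
    cases ht : D.trav c.op c.coin (viewOf h) with
    | some y => simp
    | none =>
      simp only [hv, ne_eq, not_false_eq_true, true_and]
      split
      · rename_i u hu
        have := (List.getElem?_eq_some_iff.1 hu).1
        simp; omega
      · rename_i hu
        have := List.getElem?_eq_none_iff.1 hu
        simp [this, eq_comm]

/-- An operation reads first and then performs a part of the writes of its update phase. -/
theorem seqRun_shape {m m' : Mem V Λ} {h : List (Access V Λ)} (hr : D.SeqRun c m h m') :
    h = (viewOf h).map (fun a => .read a.1 a.2) ++
        ((D.update c (viewOf h)).1.take (numWrites h)).map (fun a => .write a.1 a.2) ∧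
      m' = writeMem m ((D.update c (viewOf h)).1.take (numWrites h)) ∧
      numWrites h ≤ (D.update c (viewOf h)).1.length ∧
      (numWrites h ≠ 0 → viewOf h ≠ [] ∧ D.trav c.op c.coin (viewOf h) = none) ∧
      ∀ a ∈ viewOf h, a.2 = m a.1 := by
  have key : h = (viewOf h).map (fun a => .read a.1 a.2) ++
        ((D.update c (viewOf h)).1.take (numWrites h)).map (fun a => .write a.1 a.2) ∧
      numWrites h ≤ (D.update c (viewOf h)).1.length ∧
      (numWrites h ≠ 0 → viewOf h ≠ [] ∧ D.trav c.op c.coin (viewOf h) = none) ∧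
      (numWrites h = 0 → m' = m) ∧ ∀ a ∈ viewOf h, a.2 = m a.1 := by
    induction hr with
    | nil => simp
    | @read h m' x _ hn ih =>
      obtain ⟨i1, i2, i3, i4, i5⟩ := ih
      have h0 : numWrites h = 0 := by
        by_contra hc
        obtain ⟨v, t⟩ := i3 hc
        rw [next_read_iff] at hn
        rcases hn with hn | hn
        · exact v hn.1
        · rw [t] at hn; simp at hn
      have hm := i4 h0
      subst hm
      simp only [viewOf_append, viewOf_cons_read, viewOf_nil, numWrites_append,
        numWrites_cons_read, numWrites_nil, h0]
      refine ⟨?_, by simp, by simp, fun _ => trivial, ?_⟩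
      · rw [h0] at i1; simpa using i1
      · intro a ha
        simp only [List.mem_append, List.mem_singleton] at ha
        rcases ha with ha | rfl
        · exact i5 a ha
        · rfl
    | @write h m' x e _ hn ih =>
      obtain ⟨i1, i2, i3, i4, i5⟩ := ih
      rw [next_write_iff] at hn
      obtain ⟨n1, n2, n3⟩ := hn
      obtain ⟨n3, n4⟩ := List.getElem?_eq_some_iff.1 n3
      simp only [viewOf_append, viewOf_cons_write, viewOf_nil, numWrites_append,
        numWrites_cons_write, numWrites_nil, List.append_nil, zero_add]
      refine ⟨?_, by omega, fun _ => ⟨n1, n2⟩, by omega, i5⟩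
      rw [List.take_add_one]
      conv_lhs => rw [i1]
      simp [n3, n4]
  refine ⟨key.1, ?_, key.2.1, key.2.2.1, key.2.2.2.2⟩
  obtain ⟨-, rfl⟩ := seqRun_iff.1 hr
  conv_lhs => rw [key.1]
  rw [accMem_append, accMem_map_read]
  rfl

/-- A complete operation reads first and then performs all writes of its update phase. -/
theorem completes_shape {m m' : Mem V Λ} {h : List (Access V Λ)} {r : DictResp V}
    (hr : D.Completes c m h m' r) :
    m' = writeMem m (D.update c (viewOf h)).1 ∧ r = (D.update c (viewOf h)).2 ∧
      viewOf h ≠ [] ∧ D.trav c.op c.coin (viewOf h) = none ∧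
      (∀ a ∈ viewOf h, a.2 = m a.1) := by
  obtain ⟨h1, h2, h3, h4, h5⟩ := seqRun_shape hr.1
  obtain ⟨n1, n2, n3, n4⟩ := next_ret_iff.1 hr.2
  rw [List.take_of_length_le n3] at h2
  exact ⟨h2, n4, n1, n2, h5⟩

end SequentialRuns

/-! ### Runs of a search structure -/

section Structures

variable {V Λ Ω : Type} {D : SearchStructure V Λ Ω} {c : Call V Ω}

theorem view_root {m m' : Mem V Λ} {h : List (Access V Λ)}
    (hr : D.SeqRun c m h m') (hv : viewOf h ≠ []) : ∃ w, viewOf h = (.root, m .root) :: w := by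
  induction hr with
  | nil => simp at hv
  | @read h m' x hr hn ih =>
    rw [next_read_iff] at hn
    rcases hn with ⟨hn, rfl⟩ | ⟨hn, -⟩
    · refine ⟨[], ?_⟩
      have h5 :=
        (seqRun_shape (SearchData.SeqRun.read hr (next_read_iff.2 (.inl ⟨hn, rfl⟩)))).2.2.2.2
      simp only [viewOf_append, viewOf_cons_read, viewOf_nil, hn, List.nil_append,
        List.mem_singleton, forall_eq] at h5 ⊢
      rw [h5]
    · obtain ⟨w, hw⟩ := ih hn
      exact ⟨w ++ [(x, m' x)], by simp [hw]⟩
  | write hr hn ih => simpa using ih (by simpa using hv)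

/-- The visited nodes form a path along the edges of the initial memory. -/
theorem view_chain {m m' : Mem V Λ} {h : List (Access V Λ)}
    (hr : D.SeqRun c m h m') : (viewOf h).IsChain (fun a b => Edge m a.1 b.1) := by
  induction hr with
  | nil => simp
  | @read h m' x hr hn ih =>
    simp only [viewOf_append, viewOf_cons_read, viewOf_nil]
    rw [List.isChain_append]
    refine ⟨ih, by simp, ?_⟩
    intro a ha b hb
    simp only [List.head?_cons, Option.mem_def, Option.some.injEq] at hb
    subst hb
    rw [Option.mem_def, List.getLast?_eq_some_iff] at ha
    obtain ⟨w, hw⟩ := ha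
    rw [next_read_iff] at hn
    rcases hn with ⟨hn, rfl⟩ | ⟨-, hn⟩
    · rw [hn] at hw; simp at hw
    · rw [hw] at hn
      have := D.proper_trav _ _ _ _ _ _ hn
      have h5 := (seqRun_shape hr).2.2.2.2 a (by simp [hw])
      rw [h5] at this
      exact this
  | write hr hn ih => simpa using ih

theorem view_pairwise {m m' : Mem V Λ} {h : List (Access V Λ)}
    (hr : D.SeqRun c m h m') :
    (viewOf h).Pairwise (fun a b => Relation.TransGen (Edge m) a.1 b.1) := by
  have : Trans (fun a b : Node V × Edges V Λ => Relation.TransGen (Edge m) a.1 b.1)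
      (fun a b : Node V × Edges V Λ => Relation.TransGen (Edge m) a.1 b.1)
      (fun a b : Node V × Edges V Λ => Relation.TransGen (Edge m) a.1 b.1) :=
    ⟨fun h1 h2 => Relation.TransGen.trans h1 h2⟩
  exact List.IsChain.pairwise ((view_chain hr).imp fun a b h => Relation.TransGen.single h)

theorem view_inGraph {m m' : Mem V Λ} {h : List (Access V Λ)}
    (hr : D.SeqRun c m h m') : ∀ a ∈ viewOf h, InGraph m a.1 := by
  intro a ha
  have hv : viewOf h ≠ [] := by rintro e; simp [e] at ha
  obtain ⟨w, hw⟩ := view_root hr hv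
  have hp := view_pairwise hr
  rw [hw] at hp ha
  rw [List.pairwise_cons] at hp
  rcases List.mem_cons.1 ha with rfl | ha
  · exact .refl
  · exact (hp.1 a ha).to_reflTransGen

theorem inGraph_trans {m : Mem V Λ} {x y : Node V} (hx : InGraph m x)
    (h : Relation.ReflTransGen (Edge m) x y) : InGraph m y := hx.trans h

theorem view_nodup {m m' : Mem V Λ} {h : List (Access V Λ)} (hm : D.Reach m)
    (hr : D.SeqRun c m h m') : ((viewOf h).map Prod.fst).Nodup := by
  rw [List.Nodup, List.pairwise_map]
  refine List.Pairwise.imp_of_mem ?_ (view_pairwise hr)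
  intro a b ha hb hab e
  rw [e] at hab
  exact D.acyclic m hm _ (view_inGraph hr b hb) hab

theorem completes_spec {m m' : Mem V Λ} {q : ℕ → Option V} {h : List (Access V Λ)}
    {r : DictResp V} (hm : D.Reach m) (hq : Represents m q) (hc : D.Completes c m h m' r) :
    ∃ q', dictSpec V q c.op q' r ∧ Represents m' q' := by
  obtain ⟨h1, m1, r1, q1, hc1, hs, hr⟩ := D.correct m hm q hq c
  obtain ⟨rfl, rfl, rfl⟩ := completes_det hc hc1
  exact ⟨q1, hs, hr⟩

theorem inGraph_empty {x : Node V} (h : InGraph (fun _ => (∅ : Edges V Λ)) x) : x = .root := by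
  induction h with
  | refl => rfl
  | tail _ h => obtain ⟨l, h⟩ := h; simp at h

theorem represents_empty : Represents (fun _ => (∅ : Edges V Λ)) (fun _ => (none : Option V)) := by
  intro k v
  simp only [reduceCtorEq, iff_false]
  intro h
  simpa using inGraph_empty h

theorem reach_represents {m : Mem V Λ} (hm : D.Reach m) : ∃ q, Represents m q := by
  induction hm with
  | init => exact ⟨_, represents_empty⟩
  | step hm hc ih =>
    obtain ⟨q, hq⟩ := ih
    obtain ⟨q', -, h⟩ := completes_spec hm hq hc
    exact ⟨q', h⟩

theorem completes_exists {m : Mem V Λ} (hm : D.Reach m) (c : Call V Ω) :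
    ∃ h m' r, D.Completes c m h m' r := by
  obtain ⟨q, hq⟩ := reach_represents hm
  obtain ⟨h, m', r, q', hc, -⟩ := D.correct m hm q hq c
  exact ⟨h, m', r, hc⟩

/-- A search makes no writes; its response is the node with key `k` that it visited, if any. -/
theorem update_find (D : SearchData V Λ Ω) (c : Call V Ω) (w : View V Λ) (k : ℕ)
    (hk : c.op = .find k) :
    (D.update c w).1 = [] ∧
    ((∃ y ∈ w, y.1.key? = some k ∧ (D.update c w).2 = .ptr y.1) ∨
      ((∀ y ∈ w, y.1.key? ≠ some k) ∧ (D.update c w).2 = .bool false)) := by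
  obtain ⟨o, ω⟩ := c
  simp only at hk
  subst hk
  unfold SearchData.update
  simp only
  cases hf : w.find? (fun y => decide (y.1.key? = some k)) with
  | none =>
    simp only [List.find?_eq_none, decide_eq_true_eq] at hf
    exact ⟨rfl, .inr ⟨hf, rfl⟩⟩
  | some y =>
    exact ⟨rfl, .inl ⟨y, List.mem_of_find?_eq_some hf, by simpa using List.find?_some hf, rfl⟩⟩

/-- A deletion rewrites the visited predecessors of the visited node with the deleted key. -/
theorem update_delete (D : SearchData V Λ Ω) (c : Call V Ω) (w : View V Λ) (k : ℕ)
    (hk : c.op = .delete k) :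
    (∃ b ∈ w, b.1.key? = some k ∧ (D.update c w).2 = .bool true ∧
      (D.update c w).1 = w.filterMap fun p =>
        if Leads p.2 b.1 then some (p.1, D.unlink b.1 b.2 p.1 p.2) else none) ∨
    ((∀ y ∈ w, y.1.key? ≠ some k) ∧ D.update c w = ([], .bool false)) := by
  obtain ⟨o, ω⟩ := c
  simp only at hk
  subst hk
  unfold SearchData.update
  simp only
  cases hf : w.find? (fun y => decide (y.1.key? = some k)) with
  | none =>
    simp only [List.find?_eq_none, decide_eq_true_eq] at hf
    exact .inr ⟨hf, rfl⟩
  | some b =>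
    exact .inl ⟨b, List.mem_of_find?_eq_some hf, by simpa using List.find?_some hf, rfl, rfl⟩

theorem node_of_key {x : Node V} {k : ℕ} (h : x.key? = some k) : ∃ v, x = .pair k v := by
  cases x with
  | root => simp [Node.key?] at h
  | pair k' v => simp only [Node.key?, Option.some.injEq] at h; subst h; exact ⟨v, rfl⟩

theorem find_no_write {m m' : Mem V Λ} {h : List (Access V Λ)} {k : ℕ} (hk : c.op = .find k)
    (hr : D.SeqRun c m h m') : m' = m ∧ numWrites h = 0 ∧
      h = (viewOf h).map (fun a => .read a.1 a.2) := by
  obtain ⟨h1, h2, h3, -⟩ := seqRun_shape hr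
  rw [(update_find D.toSearchData c _ k hk).1] at h1 h2 h3
  simp only [List.take_nil, List.map_nil, List.append_nil, List.length_nil, Nat.le_zero] at h1 h2 h3
  exact ⟨h2, h3, h1⟩

/-- The result of a find, run sequentially. -/
theorem find_result {m m' : Mem V Λ} {q : ℕ → Option V} {h : List (Access V Λ)} {k : ℕ}
    {r : DictResp V} (hm : D.Reach m) (hq : Represents m q) (hk : c.op = .find k)
    (hc : D.Completes c m h m' r) :
    (∀ u, q k = some u → (∃ e, (.pair k u, e) ∈ viewOf h) ∧ r = .ptr (.pair k u)) ∧
    (q k = none → (∀ y ∈ viewOf h, y.1.key? ≠ some k) ∧ r = .bool false) := by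
  obtain ⟨q', hs, hq'⟩ := completes_spec hm hq hc
  rw [hk] at hs
  obtain ⟨-, hs⟩ := hs
  obtain ⟨-, hr, -⟩ := completes_shape hc
  have hu := (update_find D.toSearchData c (viewOf h) k hk).2
  rw [← hr] at hu
  constructor
  · intro u hu'
    rcases hs with ⟨v, hv, rfl⟩ | ⟨hs, -⟩
    · rw [hu'] at hv
      simp only [Option.some.injEq] at hv
      subst hv
      rcases hu with ⟨y, hy, -, h2⟩ | ⟨-, h2⟩
      · simp only [DictResp.ptr.injEq] at h2
        exact ⟨⟨y.2, by rw [h2]; exact hy⟩, rfl⟩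
      · simp at h2
    · rw [hs] at hu'; simp at hu'
  · intro hn
    rcases hs with ⟨v, hv, rfl⟩ | ⟨-, rfl⟩
    · rw [hn] at hv; simp at hv
    · rcases hu with ⟨y, hy, -, h2⟩ | ⟨h1, -⟩
      · simp at h2
      · exact ⟨h1, rfl⟩

/-- The effect of a successful deletion: exactly the predecessors of the removed node are
rewritten, and all of them have been visited. -/
theorem delete_effect {m m' : Mem V Λ} {q : ℕ → Option V} {h : List (Access V Λ)} {k : ℕ} {u : V}
    {r : DictResp V} (hm : D.Reach m) (hq : Represents m q) (hk : c.op = .delete k)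
    (hu : q k = some u) (hc : D.Completes c m h m' r) :
    Represents m' (Function.update q k none) ∧ r = .bool true ∧
    (∀ y, InGraph m y → Edge m y (.pair k u) →
      (y, D.unlink (.pair k u) (m (.pair k u)) y (m y)) ∈ (D.update c (viewOf h)).1) ∧
    (∀ a ∈ (D.update c (viewOf h)).1, InGraph m a.1 ∧ Edge m a.1 (.pair k u) ∧
      a.2 = D.unlink (.pair k u) (m (.pair k u)) a.1 (m a.1)) := by
  obtain ⟨q', hs, hq'⟩ := completes_spec hm hq hc
  rw [hk] at hs
  obtain ⟨-, rfl, rfl⟩ : q k ≠ none ∧ q' = Function.update q k none ∧ r = .bool true := by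
    rcases hs with hs | hs
    · exact hs
    · rw [hu] at hs; simp at hs
  obtain ⟨hm', hr, -, -, h5⟩ := completes_shape hc
  have hG := view_inGraph hc.1
  rcases update_delete D.toSearchData c (viewOf h) k hk with ⟨b, hb, hbk, -, hw⟩ | ⟨-, h2⟩
  swap
  · rw [h2] at hr; simp at hr
  obtain ⟨u', hu'⟩ := node_of_key hbk
  have : u' = u := by
    have := hG b hb
    rw [hu', hq, hu] at this
    simpa using this.symm
  subst this
  have hb2 := h5 b hb
  rw [hu'] at hw hb2
  rw [hb2] at hw
  have hmem : ∀ a ∈ (D.update c (viewOf h)).1, InGraph m a.1 ∧ Edge m a.1 (.pair k u') ∧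
      a.2 = D.unlink (.pair k u') (m (.pair k u')) a.1 (m a.1) ∧ ∃ e, (a.1, e) ∈ viewOf h := by
    intro a ha
    rw [hw, List.mem_filterMap] at ha
    obtain ⟨p, hp, ha⟩ := ha
    split at ha
    · rename_i hl
      simp only [Option.some.injEq] at ha
      subst ha
      have h6 := h5 p hp
      refine ⟨hG p hp, ?_, by simp [h6], p.2, hp⟩
      simpa [Edge, ← h6] using hl
    · simp at ha
  refine ⟨hq', rfl, ?_, fun a ha => ⟨(hmem a ha).1, (hmem a ha).2.1, (hmem a ha).2.2.1⟩⟩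
  intro y hy hyb
  -- an unvisited predecessor would keep its edge and stay in the graph
  have hvis : (y, m y) ∈ viewOf h := by
    by_contra hnv
    have hy' : m' y = m y := by
      rw [hm']
      apply writeMem_of_not_mem
      rintro a ha rfl
      obtain ⟨e, he⟩ := (hmem a ha).2.2.2
      have := h5 _ he
      simp only at this
      rw [this] at he
      exact hnv he
    have hyG : InGraph m' y := by
      cases y with
      | root => exact .refl
      | pair j v =>
        rw [hq']
        have hj : j ≠ k := by
          rintro rfl
          have : v = u' := by
            have := (hq _ _).1 hy; rw [hu] at this; simpa using this.symm
          subst this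
          exact D.acyclic m hm _ hy (.single hyb)
        rw [Function.update_of_ne hj]
        exact (hq _ _).1 hy
    have : InGraph m' (.pair k u') := by
      refine Relation.ReflTransGen.tail hyG ?_
      unfold Edge
      rw [hy']
      exact hyb
    rw [hq'] at this
    simp at this
  rw [hw, List.mem_filterMap]
  exact ⟨(y, m y), hvis, if_pos hyb⟩

theorem delete_mem {m m' : Mem V Λ} {q : ℕ → Option V} {h : List (Access V Λ)} {k : ℕ} {u : V}
    {r : DictResp V} (hm : D.Reach m) (hq : Represents m q) (hk : c.op = .delete k)
    (hu : q k = some u) (hc : D.Completes c m h m' r) (y : Node V) :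
    (InGraph m y ∧ Edge m y (.pair k u) →
      m' y = D.unlink (.pair k u) (m (.pair k u)) y (m y)) ∧
    (¬ (InGraph m y ∧ Edge m y (.pair k u)) → m' y = m y) := by
  obtain ⟨-, -, h1, h2⟩ := delete_effect hm hq hk hu hc
  obtain ⟨hm', -⟩ := completes_shape hc
  rw [hm']
  constructor
  · rintro ⟨hy, he⟩
    apply writeMem_of_const
    · rintro a ha rfl
      exact (h2 a ha).2.2
    · exact ⟨_, h1 y hy he, rfl⟩
  · intro hn
    apply writeMem_of_not_mem
    rintro a ha rfl
    exact hn ⟨(h2 a ha).1, (h2 a ha).2.1⟩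

theorem delete_absent {m m' : Mem V Λ} {q : ℕ → Option V} {h : List (Access V Λ)} {k : ℕ}
    {r : DictResp V} (hm : D.Reach m) (hq : Represents m q) (hk : c.op = .delete k)
    (hu : q k = none) (hc : D.Completes c m h m' r) :
    m' = m ∧ r = .bool false ∧ (D.update c (viewOf h)).1 = [] := by
  obtain ⟨q', hs, hq'⟩ := completes_spec hm hq hc
  rw [hk] at hs
  simp only [dictSpec, hu, ne_eq, not_true_eq_false, false_and, true_and, false_or] at hs
  obtain ⟨hm', hr, -⟩ := completes_shape hc
  rcases update_delete D.toSearchData c (viewOf h) k hk with ⟨b, hb, hbk, h2, hw⟩ | ⟨-, h2⟩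
  · rw [← hr, hs.2] at h2; simp at h2
  · rw [h2] at hm'; exact ⟨hm', hs.2, by rw [h2]⟩

/-- Every edge after a deletion joins two nodes that a path joined before it. -/
theorem delete_edge {m m' : Mem V Λ} {q : ℕ → Option V} {h : List (Access V Λ)} {k : ℕ}
    {r : DictResp V} (hm : D.Reach m) (hq : Represents m q) (hk : c.op = .delete k)
    (hc : D.Completes c m h m' r) {x y : Node V} (hxy : Edge m' x y) :
    Relation.TransGen (Edge m) x y := by
  cases hu : q k with
  | none =>
    rw [(delete_absent hm hq hk hu hc).1] at hxy
    exact .single hxy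
  | some u =>
    obtain ⟨d1, d2⟩ := delete_mem hm hq hk hu hc x
    unfold Edge at hxy
    by_cases hx : InGraph m x ∧ Edge m x (.pair k u)
    · rw [d1 hx] at hxy
      obtain ⟨l, hl⟩ := hxy
      rcases D.proper_unlink _ _ _ _ _ _ hl with h1 | h1
      · exact .single ⟨l, h1⟩
      · exact .tail (.single hx.2) h1
    · rw [d2 hx] at hxy
      exact .single hxy

theorem delete_path {m m' : Mem V Λ} {q : ℕ → Option V} {h : List (Access V Λ)} {k : ℕ}
    {r : DictResp V} (hm : D.Reach m) (hq : Represents m q) (hk : c.op = .delete k)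
    (hc : D.Completes c m h m' r) {x y : Node V} (hxy : Relation.TransGen (Edge m') x y) :
    Relation.TransGen (Edge m) x y := by
  induction hxy with
  | single h => exact delete_edge hm hq hk hc h
  | tail _ h ih => exact ih.trans (delete_edge hm hq hk hc h)

end Structures

/-! ### The events of operations in executions -/

section Executions

variable {V Λ Ω : Type} {n : ℕ} {D : SearchData V Λ Ω} {I : Impl V Λ Ω n}

/-- The events of an operation: its invocation, some accesses, and then the events `t`. -/
def opEvents (π : OpId n) (c : Call V Ω) (h : List (Access V Λ)) (t : List (EvKind V Λ Ω)) :
    List (Event V Λ Ω n) :=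
  ⟨π, .inv c⟩ :: h.flatMap (accessEvents π) ++ t.map fun k => ⟨π, k⟩

/-- The request of an access. -/
def reqOf : Access V Λ → Req V Λ
  | .read x _ => .read x
  | .write x e => .write x e

/-- The accesses `h` are those that the sequential code of `c` prescribes, given the values
that were read. -/
def Follows (D : SearchData V Λ Ω) (c : Call V Ω) (h : List (Access V Λ)) : Prop :=
  ∀ h₁ a h₂, h = h₁ ++ a :: h₂ → D.next c h₁ = .req (reqOf a)

theorem follows_nil {c : Call V Ω} : Follows D c [] := by
  intro h₁ a h₂ e
  simp at e

theorem follows_snoc {c : Call V Ω} {h : List (Access V Λ)} {a : Access V Λ}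
    (hf : Follows D c h) (ha : D.next c h = .req (reqOf a)) : Follows D c (h ++ [a]) := by
  intro h₁ b h₂ e
  rcases List.eq_nil_or_concat' h₂ with rfl | ⟨l, d, rfl⟩
  · have := List.append_inj' e rfl
    simp only [List.cons.injEq, and_true] at this
    obtain ⟨rfl, rfl⟩ := this
    exact ha
  · rw [← List.cons_append, ← List.append_assoc] at e
    have := List.append_inj' e rfl
    exact hf _ _ _ this.1

theorem reqOf_replyAccess (e : Edges V Λ) (a : Req V Λ) : reqOf (Impl.replyAccess e a) = a := by
  cases a <;> rfl

theorem accessEvents_replyAccess (π : OpId n) (e : Edges V Λ) (a : Req V Λ) :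
    accessEvents (Ω := Ω) π (Impl.replyAccess e a) =
      [⟨π, Impl.reqKind a⟩, ⟨π, Impl.replyKind e a⟩] := by
  cases a <;> rfl

theorem opEvents_snoc (π : OpId n) (c : Call V Ω) (h : List (Access V Λ)) (e : Edges V Λ)
    (a : Req V Λ) :
    opEvents π c (h ++ [Impl.replyAccess e a]) [] =
      opEvents π c h [Impl.reqKind a] ++ [⟨π, Impl.replyKind e a⟩] := by
  simp [opEvents, accessEvents_replyAccess]

theorem opEvents_tail (π : OpId n) (c : Call V Ω) (h : List (Access V Λ))
    (t : List (EvKind V Λ Ω)) (k : EvKind V Λ Ω) :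
    opEvents π c h (t ++ [k]) = opEvents π c h t ++ [⟨π, k⟩] := by
  simp [opEvents]

theorem op_of_mem_opEvents {π : OpId n} {c : Call V Ω} {h : List (Access V Λ)}
    {t : List (EvKind V Λ Ω)} {e : Event V Λ Ω n} (he : e ∈ opEvents π c h t) : e.op = π := by
  simp only [opEvents, List.cons_append, List.mem_cons, List.mem_append, List.mem_flatMap,
    List.mem_map] at he
  rcases he with rfl | ⟨a, -, ha⟩ | ⟨k, -, rfl⟩
  · rfl
  · cases a <;> simp only [accessEvents, List.mem_cons, List.not_mem_nil, or_false] at ha <;>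
      rcases ha with rfl | rfl <;> rfl
  · rfl

/-- Kinds of the events of accesses. -/
theorem kind_of_mem_opEvents {π : OpId n} {c : Call V Ω} {h : List (Access V Λ)}
    {t : List (EvKind V Λ Ω)} {e : Event V Λ Ω n} (he : e ∈ opEvents π c h t) :
    e.kind = .inv c ∨ (¬ e.kind.IsInv ∧ ¬ e.kind.IsEnd) ∨ e.kind ∈ t := by
  simp only [opEvents, List.cons_append, List.mem_cons, List.mem_append, List.mem_flatMap,
    List.mem_map] at he
  rcases he with rfl | ⟨a, -, ha⟩ | ⟨k, hk, rfl⟩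
  · exact .inl rfl
  · refine .inr (.inl ?_)
    cases a <;> simp only [accessEvents, List.mem_cons, List.not_mem_nil, or_false] at ha <;>
      rcases ha with rfl | rfl <;> simp [EvKind.IsInv, EvKind.IsEnd]
  · exact .inr (.inr hk)

/-- The events `l` of the current operation of a process agree with the status of the process. -/
def PhaseEvents (D : SearchData V Λ Ω) (π : OpId n) (l : List (Event V Λ Ω n)) :
    Phase V Λ Ω → Prop
  | .idle => l = []
  | .ready c h => l = opEvents π c h [] ∧ Follows D c h
  | .pending c h a => l = opEvents π c h [Impl.reqKind a] ∧ Follows D c h ∧ D.next c h = .req a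

/-- The events `l` are those of an operation that has ended. -/
def EndedEvents (D : SearchData V Λ Ω) (π : OpId n) (l : List (Event V Λ Ω n)) : Prop :=
  ∃ c h, Follows D c h ∧
    ((∃ r, D.next c h = .ret r ∧ l = opEvents π c h [.res r]) ∨
      (∃ a, D.next c h = .req a ∧ l = opEvents π c h [Impl.reqKind a, .abort]))

/-- The events of the operation `π`. -/
def opHist (α : List (Event V Λ Ω n)) (π : OpId n) : List (Event V Λ Ω n) :=
  α.filter fun e => e.op = π

theorem opHist_append (α β : List (Event V Λ Ω n)) (π : OpId n) :
    opHist (α ++ β) π = opHist α π ++ opHist β π := by simp [opHist]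

theorem mem_opHist {α : List (Event V Λ Ω n)} {π : OpId n} {e : Event V Λ Ω n} :
    e ∈ opHist α π ↔ e ∈ α ∧ e.op = π := by simp [opHist]

theorem occurs_iff {α : List (Event V Λ Ω n)} {π : OpId n} :
    Occurs α π ↔ opHist α π ≠ [] := by
  simp [Occurs, opHist]

theorem step_op {C C' : I.Conf} {p : Fin n} {e : Event V Λ Ω n}
    (hs : Impl.Step D C p (some e) C') : e.op = (p, C.cnt p) := by
  cases hs <;> rfl

/-- A step changes the status, the counter and the local state of the process that takes it only;
this is its effect on them and on the events of the current operation. -/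
theorem step_local {C C' : I.Conf} {p : Fin n} {e : Option (Event V Λ Ω n)}
    (hs : Impl.Step D C p e C') :
    (∀ q, q ≠ p → C'.phase q = C.phase q ∧ C'.cnt q = C.cnt q ∧ C'.loc q = C.loc q) ∧
    ((C'.cnt p = C.cnt p ∧ ∀ l, PhaseEvents D (p, C.cnt p) l (C.phase p) →
        PhaseEvents D (p, C.cnt p) (l ++ e.toList) (C'.phase p)) ∨
      (C'.cnt p = C.cnt p + 1 ∧ C'.phase p = .idle ∧ C.phase p ≠ .idle ∧
        ∀ l, PhaseEvents D (p, C.cnt p) l (C.phase p) →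
        EndedEvents D (p, C.cnt p) (l ++ e.toList))) := by
  cases hs with
  | invoke c hp =>
    refine ⟨fun q hq => by simp [Impl.afterEvent, hq], .inl ⟨by simp [Impl.afterEvent], ?_⟩⟩
    intro l hl
    rw [hp] at hl
    simp only [PhaseEvents] at hl
    subst hl
    simp [PhaseEvents, Impl.afterEvent, opEvents, follows_nil]
  | readyPrim hp hr hf =>
    refine ⟨fun q hq => by simp [Impl.afterPrim, hq], .inl ⟨by simp [Impl.afterPrim], ?_⟩⟩
    intro l hl
    simpa [Impl.afterPrim] using hl
  | request hp hr hn =>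
    refine ⟨fun q hq => by simp [Impl.afterEvent, hq], .inl ⟨by simp [Impl.afterEvent], ?_⟩⟩
    intro l hl
    rw [hp] at hl
    obtain ⟨rfl, hf⟩ := hl
    simp only [Impl.afterEvent, Function.update_self, PhaseEvents, Option.toList_some]
    exact ⟨(opEvents_tail _ _ _ [] _).symm, hf, hn⟩
  | respond hp hr hn =>
    refine ⟨fun q hq => by simp [Impl.afterEnd, hq], .inr ⟨by simp [Impl.afterEnd],
      by simp [Impl.afterEnd], by simp [hp], ?_⟩⟩
    intro l hl
    rw [hp] at hl
    obtain ⟨rfl, hf⟩ := hl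
    exact ⟨_, _, hf, .inl ⟨_, hn, (opEvents_tail _ _ _ [] _).symm⟩⟩
  | servePrim hp hr hf =>
    refine ⟨fun q hq => by simp [Impl.afterPrim, hq], .inl ⟨by simp [Impl.afterPrim], ?_⟩⟩
    intro l hl
    simpa [Impl.afterPrim] using hl
  | reply hp hr =>
    refine ⟨fun q hq => by simp [Impl.afterEvent, hq], .inl ⟨by simp [Impl.afterEvent], ?_⟩⟩
    intro l hl
    rw [hp] at hl
    obtain ⟨rfl, hf, hn⟩ := hl
    simp only [Impl.afterEvent, Function.update_self, PhaseEvents, Option.toList_some]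
    refine ⟨(opEvents_snoc _ _ _ _ _).symm, follows_snoc hf ?_⟩
    rw [reqOf_replyAccess]
    exact hn
  | abort hp hr =>
    refine ⟨fun q hq => by simp [Impl.afterEnd, hq], .inr ⟨by simp [Impl.afterEnd],
      by simp [Impl.afterEnd], by simp [hp], ?_⟩⟩
    intro l hl
    rw [hp] at hl
    obtain ⟨rfl, hf, hn⟩ := hl
    exact ⟨_, _, hf, .inr ⟨_, hn, (opEvents_tail _ _ _ [_] _).symm⟩⟩

theorem opHist_step {C C' : I.Conf} {p : Fin n} {e : Option (Event V Λ Ω n)}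
    (hs : Impl.Step D C p e C') (α : List (Event V Λ Ω n)) (π : OpId n)
    (hπ : π ≠ (p, C.cnt p)) : opHist (α ++ e.toList) π = opHist α π := by
  rw [opHist_append]
  cases e with
  | none => simp [opHist]
  | some e =>
    have := step_op hs
    simp [opHist, this, hπ.symm]

theorem opHist_step_self {C C' : I.Conf} {p : Fin n} {e : Option (Event V Λ Ω n)}
    (hs : Impl.Step D C p e C') (α : List (Event V Λ Ω n)) :
    opHist (α ++ e.toList) (p, C.cnt p) = opHist α (p, C.cnt p) ++ e.toList := by
  rw [opHist_append]
  cases e with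
  | none => simp [opHist]
  | some e =>
    have := step_op hs
    simp [opHist, this]

/-- The events of each operation in an execution. -/
theorem exec_local {α : List (Event V Λ Ω n)} {C : I.Conf} (hα : I.Exec D α C) (p : Fin n) :
    (∀ j, C.cnt p < j → opHist α (p, j) = []) ∧
    PhaseEvents D (p, C.cnt p) (opHist α (p, C.cnt p)) (C.phase p) ∧
    (∀ j, j < C.cnt p → EndedEvents D (p, j) (opHist α (p, j))) := by
  induction hα with
  | nil => simp [opHist, Impl.start, PhaseEvents]
  | @step α C C' r e hα hs ih =>
    obtain ⟨i1, i2, i3⟩ := ih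
    obtain ⟨s1, s2⟩ := step_local hs
    by_cases hpr : p = r
    · subst hpr
      rcases s2 with ⟨s2, s3⟩ | ⟨s2, s3, s4, s5⟩
      · rw [s2]
        refine ⟨fun j hj => ?_, ?_, fun j hj => ?_⟩
        · rw [opHist_step hs _ _ (by simp; omega)]
          exact i1 j hj
        · rw [opHist_step_self hs]
          exact s3 _ i2
        · rw [opHist_step hs _ _ (by simp; omega)]
          exact i3 j hj
      · rw [s2, s3]
        refine ⟨fun j hj => ?_, ?_, fun j hj => ?_⟩
        · rw [opHist_step hs _ _ (by simp; omega)]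
          exact i1 j (by omega)
        · rw [opHist_step hs _ _ (by simp)]
          exact i1 _ (by omega)
        · by_cases hj' : j = C.cnt p
          · subst hj'
            rw [opHist_step_self hs]
            exact s5 _ i2
          · rw [opHist_step hs _ _ (by simp; omega)]
            exact i3 j (by omega)
    · obtain ⟨t1, t2, -⟩ := s1 p hpr
      have : ∀ j, opHist (α ++ e.toList) (p, j) = opHist α (p, j) :=
        fun j => opHist_step hs _ _ (by simp [hpr])
      simp only [this, t1, t2]
      exact ⟨i1, i2, i3⟩

theorem exec_prefix {α β : List (Event V Λ Ω n)} {C : I.Conf} (hα : I.Exec D α C)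
    (hβ : β <+: α) : ∃ C', I.Exec D β C' := by
  induction hα with
  | nil =>
    have := List.prefix_nil.1 hβ
    subst this
    exact ⟨_, .nil⟩
  | @step α C C' p e hα hs ih =>
    cases e with
    | none => exact ih (by simpa using hβ)
    | some e =>
      simp only [Option.toList_some] at hβ
      rw [List.prefix_concat_iff] at hβ
      rcases hβ with rfl | hβ
      · exact ⟨_, .step hα hs⟩
      · exact ih hβ

theorem exec_last {α : List (Event V Λ Ω n)} {e : Event V Λ Ω n} {C : I.Conf}
    (hα : I.Exec D (α ++ [e]) C) :
    ∃ C₀ C₁, I.Exec D α C₀ ∧ Impl.Step D C₀ e.op.1 (some e) C₁ ∧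
      e.op = (e.op.1, C₀.cnt e.op.1) := by
  generalize hβ : α ++ [e] = β at hα
  induction hα with
  | nil => simp at hβ
  | @step γ C C' p e' hγ hs ih =>
    cases e' with
    | none => exact ih (by simpa using hβ)
    | some e' =>
      have := List.append_inj' hβ rfl
      simp only [Option.toList_some, List.cons.injEq, and_true] at this
      obtain ⟨rfl, rfl⟩ := this
      have ho := step_op hs
      have hp : e.op.1 = p := by rw [ho]
      refine ⟨C, C', hγ, hp ▸ hs, ?_⟩
      rw [hp]
      exact ho

theorem step_inv {C C' : I.Conf} {p : Fin n} {e : Event V Λ Ω n}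
    (hs : Impl.Step D C p (some e) C') : (e.kind.IsInv ↔ C.phase p = .idle) := by
  cases hs
  case invoke c hp => simp [EvKind.IsInv, hp]
  case request a hp hr hn => cases a <;> simp [EvKind.IsInv, hp, Impl.reqKind]
  case respond hp hr hn => simp [EvKind.IsInv, hp]
  case reply e hp hr => rename_i a; cases a <;> simp [EvKind.IsInv, hp, Impl.replyKind]
  case abort hp hr => simp [EvKind.IsInv, hp]

theorem exec_inv_first {α : List (Event V Λ Ω n)} {C : I.Conf} (hα : I.Exec D α C)
    (l₁ : List (Event V Λ Ω n)) (e : Event V Λ Ω n) (l₂ : List (Event V Λ Ω n))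
    (hl : α = l₁ ++ e :: l₂) : (e.kind.IsInv ↔ ¬ Occurs l₁ e.op) := by
  obtain ⟨C', h'⟩ := exec_prefix hα (β := l₁ ++ [e]) ⟨l₂, by simp [hl]⟩
  obtain ⟨C₀, C₁, h0, hs, ho⟩ := exec_last h'
  rw [step_inv hs, occurs_iff, not_not, ho]
  have := (exec_local h0 e.op.1).2.1
  cases hp : C₀.phase e.op.1 <;> rw [hp] at this
  · simpa [PhaseEvents] using this
  · simp only [reduceCtorEq, false_iff]
    rw [this.1]; simp [opEvents]
  · simp only [reduceCtorEq, false_iff]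
    rw [this.1]; simp [opEvents]

theorem reqKind_not_end (a : Req V Λ) : ¬ (Impl.reqKind (Ω := Ω) a).IsEnd := by
  cases a <;> simp [Impl.reqKind, EvKind.IsEnd]

theorem reqKind_not_inv (a : Req V Λ) : ¬ (Impl.reqKind (Ω := Ω) a).IsInv := by
  cases a <;> simp [Impl.reqKind, EvKind.IsInv]

theorem phaseEvents_not_end {π : OpId n} {l : List (Event V Λ Ω n)} {φ : Phase V Λ Ω}
    (h : PhaseEvents D π l φ) : ∀ e ∈ l, ¬ e.kind.IsEnd := by
  intro e he hend
  cases φ with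
  | idle => simp only [PhaseEvents] at h; subst h; simp at he
  | ready c h' =>
    obtain ⟨rfl, -⟩ := h
    rcases kind_of_mem_opEvents he with h1 | h1 | h1
    · rw [h1] at hend; exact hend
    · exact h1.2 hend
    · simp at h1
  | pending c h' a =>
    obtain ⟨rfl, -⟩ := h
    rcases kind_of_mem_opEvents he with h1 | h1 | h1
    · rw [h1] at hend; exact hend
    · exact h1.2 hend
    · rw [List.mem_singleton.1 h1] at hend; exact reqKind_not_end a hend

theorem endedEvents_ended {π : OpId n} {l : List (Event V Λ Ω n)}
    (h : EndedEvents D π l) : ∃ e ∈ l, e.op = π ∧ e.kind.IsEnd := by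
  obtain ⟨c, h', -, ⟨r, -, rfl⟩ | ⟨a, -, rfl⟩⟩ := h
  · exact ⟨⟨π, .res r⟩, by simp [opEvents], rfl, trivial⟩
  · exact ⟨⟨π, .abort⟩, by simp [opEvents], rfl, trivial⟩

/-- An operation has ended iff its process has counted it. -/
theorem exec_ended_iff {α : List (Event V Λ Ω n)} {C : I.Conf} (hα : I.Exec D α C) (π : OpId n) :
    Ended α π ↔ π.2 < C.cnt π.1 := by
  obtain ⟨h1, h2, h3⟩ := exec_local hα π.1
  constructor
  · rintro ⟨e, he, heo, hend⟩
    by_contra hc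
    have hm : e ∈ opHist α π := mem_opHist.2 ⟨he, heo⟩
    rcases Nat.lt_or_ge (C.cnt π.1) π.2 with hlt | hge
    · have := h1 _ hlt
      rw [Prod.mk.eta] at this
      rw [this] at hm; simp at hm
    · have : C.cnt π.1 = π.2 := by omega
      rw [this, Prod.mk.eta] at h2
      exact phaseEvents_not_end h2 e hm hend
  · intro hlt
    obtain ⟨e, he, heo, hend⟩ := endedEvents_ended (h3 _ hlt)
    exact ⟨e, (mem_opHist.1 he).1, heo, hend⟩

theorem exec_occurs_le {α : List (Event V Λ Ω n)} {C : I.Conf} (hα : I.Exec D α C) {π : OpId n}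
    (h : Occurs α π) : π.2 ≤ C.cnt π.1 := by
  by_contra hc
  rw [occurs_iff] at h
  exact h ((exec_local hα π.1).1 π.2 (by omega))

theorem exists_first_event {α : List (Event V Λ Ω n)} {π : OpId n} (h : Occurs α π) :
    ∃ l₁ e l₂, α = l₁ ++ e :: l₂ ∧ e.op = π ∧ ¬ Occurs l₁ π := by
  obtain ⟨x, hx, hxo⟩ := h
  induction α with
  | nil => simp at hx
  | cons b α ih =>
    by_cases hb : b.op = π
    · exact ⟨[], b, α, rfl, hb, by simp [Occurs]⟩
    · have hx' : x ∈ α := by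
        rcases List.mem_cons.1 hx with rfl | hx
        · exact absurd hxo hb
        · exact hx
      obtain ⟨m₁, e', m₂, rfl, h2, h3⟩ := ih hx'
      refine ⟨b :: m₁, e', m₂, rfl, h2, ?_⟩
      rintro ⟨y, hy, hyo⟩
      rcases List.mem_cons.1 hy with rfl | hy
      · exact hb hyo
      · exact h3 ⟨y, hy, hyo⟩

theorem exec_starts {α : List (Event V Λ Ω n)} {C : I.Conf} (hα : I.Exec D α C) {π : OpId n}
    (h : Occurs α π) : ∃ l₁ c l₂, α = l₁ ++ ⟨π, .inv c⟩ :: l₂ ∧ ¬ Occurs l₁ π := by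
  obtain ⟨m₁, e', m₂, h2, rfl, h4⟩ := exists_first_event h
  have := (exec_inv_first hα _ _ _ h2).2 h4
  obtain ⟨o, k⟩ := e'
  cases k <;> simp only [EvKind.IsInv] at this
  exact ⟨m₁, _, m₂, h2, h4⟩

theorem exec_end_last {α : List (Event V Λ Ω n)} {C : I.Conf} (hα : I.Exec D α C)
    (l₁ : List (Event V Λ Ω n)) (e : Event V Λ Ω n) (l₂ : List (Event V Λ Ω n))
    (hl : α = l₁ ++ e :: l₂) (he : e.kind.IsEnd) : ¬ Occurs l₂ e.op := by
  rintro ⟨e', he', ho⟩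
  obtain ⟨m₁, m₂, rfl⟩ := List.append_of_mem he'
  obtain ⟨C', h'⟩ := exec_prefix hα (β := (l₁ ++ e :: m₁) ++ [e']) ⟨m₂, by simp [hl]⟩
  obtain ⟨C₀, C₁, h0, hs, ho'⟩ := exec_last h'
  have := (exec_ended_iff h0 e.op).1 ⟨e, by simp, rfl, he⟩
  rw [← ho, ho'] at this
  simp at this

theorem exec_precedes {α : List (Event V Λ Ω n)} {C : I.Conf} (hα : I.Exec D α C) {p : Fin n}
    {i j : ℕ} (hij : i < j) (hj : Occurs α (p, j)) : Precedes α (p, i) (p, j) := by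
  obtain ⟨l₁, c, l₂, rfl, -⟩ := exec_starts hα hj
  refine ⟨l₁, _, rfl, ?_, _, List.mem_cons_self, rfl, trivial⟩
  obtain ⟨C', h'⟩ := exec_prefix hα (β := l₁ ++ [⟨(p, j), .inv c⟩]) ⟨l₂, by simp⟩
  obtain ⟨C₀, C₁, h0, hs, ho'⟩ := exec_last h'
  rw [exec_ended_iff h0]
  simp only [Prod.mk.injEq, true_and] at ho'
  simpa [← ho'] using hij

/-- Executions are well-formed. -/
theorem exec_wellFormed {α : List (Event V Λ Ω n)} {C : I.Conf} (hα : I.Exec D α C) :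
    WellFormed α where
  starts π h := by
    obtain ⟨l₁, c, l₂, rfl, -⟩ := exec_starts hα h
    exact ⟨c, by simp⟩
  inv_first l₁ e l₂ hl he := (exec_inv_first hα l₁ e l₂ hl).1 he
  end_last := exec_end_last hα
  one_at_a_time π π' h h' hp hne := by
    obtain ⟨p, i⟩ := π
    obtain ⟨p', j⟩ := π'
    simp only at hp
    subst hp
    rcases Nat.lt_trichotomy i j with hij | rfl | hij
    · exact .inl (exec_precedes hα hij h')
    · exact absurd rfl hne
    · exact .inr (exec_precedes hα hij h)

theorem precedes_snoc {α : List (Event V Λ Ω n)} {e : Event V Λ Ω n} {π π' : OpId n} :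
    Precedes (α ++ [e]) π π' ↔
      Precedes α π π' ∨ (e.op = π' ∧ e.kind.IsInv ∧ Ended α π) := by
  constructor
  · rintro ⟨l₁, l₂, hl, hE, e', he', ho, hi⟩
    rcases List.eq_nil_or_concat' l₂ with rfl | ⟨l, d, rfl⟩
    · simp at he'
    · rw [← List.append_assoc] at hl
      have := List.append_inj' hl rfl
      simp only [List.cons.injEq, and_true] at this
      obtain ⟨rfl, rfl⟩ := this
      rcases List.mem_append.1 he' with he' | he'
      · exact .inl ⟨l₁, l, rfl, hE, e', he', ho, hi⟩
      · obtain rfl := List.mem_singleton.1 he'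
        refine .inr ⟨ho, hi, ?_⟩
        obtain ⟨x, hx, h⟩ := hE
        exact ⟨x, by simp [hx], h⟩
  · rintro (⟨l₁, l₂, rfl, hE, e', he', ho, hi⟩ | ⟨ho, hi, hE⟩)
    · exact ⟨l₁, l₂ ++ [e], by simp, hE, e', by simp [he'], ho, hi⟩
    · exact ⟨α, [e], rfl, hE, e, by simp, ho, hi⟩

theorem precedes_ended {α : List (Event V Λ Ω n)} {π π' : OpId n} (h : Precedes α π π') :
    Ended α π ∧ Occurs α π' := by
  obtain ⟨l₁, l₂, rfl, ⟨x, hx, h⟩, e', he', ho, hi⟩ := h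
  exact ⟨⟨x, by simp [hx], h⟩, ⟨e', by simp [he'], ho⟩⟩

/-! ### Exported histories -/

theorem history_of_no_abort {α : List (Event V Λ Ω n)} (h : ∀ e ∈ α, e.kind ≠ .abort) :
    history α = α := by
  induction α with
  | nil => rfl
  | cons e l ih =>
    rw [history, if_neg, ih (fun e' he' => h e' (by simp [he']))]
    rintro ⟨-, hf⟩
    exact h _ (List.mem_cons_of_mem _ (List.mem_of_find?_eq_some hf)) rfl

theorem find?_filter_op (l : List (Event V Λ Ω n)) (π : OpId n) :
    (l.filter fun e => e.op = π).find? (fun e => e.op = π) = l.find? (fun e => e.op = π) := by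
  induction l with
  | nil => rfl
  | cons a l ih => by_cases h : a.op = π <;> simp [h, ih]

theorem opHist_history (α : List (Event V Λ Ω n)) (π : OpId n) :
    opHist (history α) π = history (opHist α π) := by
  induction α with
  | nil => rfl
  | cons e l ih =>
    by_cases he : e.op = π
    · have h1 : opHist (e :: l) π = e :: opHist l π := by simp [opHist, he]
      rw [h1, history, history]
      have h2 : (opHist l π).find? (fun e' => e'.op = e.op) = l.find? (fun e' => e'.op = e.op) := by
        rw [he]; exact find?_filter_op l π
      rw [h2]
      split
      · exact ih
      · simp only [opHist, he, decide_true, List.filter_cons_of_pos] at ih ⊢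
        rw [ih]
    · have h1 : opHist (e :: l) π = opHist l π := by simp [opHist, he]
      rw [h1, history, ← ih]
      split
      · rfl
      · simp [opHist, he]

theorem history_append_of_op {π : OpId n} {l t : List (Event V Λ Ω n)}
    (hl : ∀ e ∈ l, e.op = π)
    (hlast : ∀ l₁ e, l = l₁ ++ [e] → ¬ e.kind.IsAccInv) (hna : ∀ e ∈ l, e.kind ≠ .abort) :
    history (l ++ t) = l ++ history t := by
  induction l with
  | nil => rfl
  | cons a l ih =>
    simp only [List.cons_append]
    rw [history, if_neg, ih (fun e he => hl e (by simp [he]))]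
    · rintro l₁ e rfl
      exact hlast (a :: l₁) e rfl
    · exact fun e he => hna e (by simp [he])
    · rintro ⟨h1, h2⟩
      cases l with
      | nil => exact hlast [] a rfl h1
      | cons b l =>
        simp only [List.cons_append, List.find?_cons, hl a (by simp), hl b (by simp),
          decide_true, Option.some.injEq] at h2
        exact hna b (by simp) (by rw [h2])

theorem history_opEvents (π : OpId n) (c : Call V Ω) (h : List (Access V Λ))
    (t : List (EvKind V Λ Ω)) :
    history (opEvents π c h t) =
      opEvents π c h [] ++ history (t.map fun k => (⟨π, k⟩ : Event V Λ Ω n)) := by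
  have : opEvents π c h t = opEvents π c h [] ++ t.map fun k => (⟨π, k⟩ : Event V Λ Ω n) := by
    simp [opEvents]
  rw [this]
  apply history_append_of_op (π := π)
  · exact fun e he => op_of_mem_opEvents he
  · intro l₁ e hl
    rcases List.eq_nil_or_concat' h with rfl | ⟨h', a, rfl⟩
    · simp only [opEvents, List.flatMap_nil, List.map_nil, List.append_nil] at hl
      have := List.append_inj' (s₁ := []) hl rfl
      simp only [List.cons.injEq, and_true] at this
      rw [← this.2]
      simp [EvKind.IsAccInv]
    · cases a
      · rename_i x ex
        have : opEvents π c (h' ++ [Access.read x ex]) [] =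
          (opEvents π c h' [.invRead x]) ++ [(⟨π, .resRead x ex⟩ : Event V Λ Ω n)] := by
          simp [opEvents, accessEvents]
        rw [this] at hl
        have := List.append_inj' hl rfl
        simp only [List.cons.injEq, and_true] at this
        rw [← this.2]
        simp [EvKind.IsAccInv]
      · rename_i x ex
        have : opEvents π c (h' ++ [Access.write x ex]) [] =
          (opEvents π c h' [.invWrite x ex]) ++ [(⟨π, .resWrite x ex⟩ : Event V Λ Ω n)] := by
          simp [opEvents, accessEvents]
        rw [this] at hl
        have := List.append_inj' hl rfl
        simp only [List.cons.injEq, and_true] at this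
        rw [← this.2]
        simp [EvKind.IsAccInv]
  · intro e he hk
    rcases kind_of_mem_opEvents he with h1 | h1 | h1
    · rw [h1] at hk; simp at hk
    · rw [hk] at h1; simp [EvKind.IsEnd] at h1
    · simp at h1

theorem localHist_eq_filter (H : List (Event V Λ Ω n)) (π : OpId n) :
    localHist H π = (opHist H π).filter fun e => e.kind ≠ .abort := by
  simp [localHist, opHist, List.filter_filter, Bool.and_comm]

theorem opEvents_filter_abort (π : OpId n) (c : Call V Ω) (h : List (Access V Λ))
    (t : List (EvKind V Λ Ω)) :
    (opEvents π c h t).filter (fun e => e.kind ≠ .abort) =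
      opEvents π c h (t.filter fun k => k ≠ .abort) := by
  have h1 : (h.flatMap (accessEvents (Ω := Ω) π)).filter (fun e => e.kind ≠ .abort) =
      h.flatMap (accessEvents π) := by
    rw [List.filter_eq_self]
    intro e he
    rw [List.mem_flatMap] at he
    obtain ⟨a, -, ha⟩ := he
    cases a <;> simp only [accessEvents, List.mem_cons, List.not_mem_nil, or_false] at ha <;>
      rcases ha with rfl | rfl <;> simp
  simp only [opEvents, List.cons_append]
  rw [List.filter_cons_of_pos (by simp), List.filter_append, h1, List.filter_map]
  rfl

/-- The events of an unfinished operation of a process with the given status. -/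
def phaseHist (π : OpId n) : Phase V Λ Ω → List (Event V Λ Ω n)
  | .idle => []
  | .ready c h => opEvents π c h []
  | .pending c h a => opEvents π c h [Impl.reqKind a]

theorem phaseEvents_opHist {π : OpId n} {l : List (Event V Λ Ω n)} {φ : Phase V Λ Ω}
    (h : PhaseEvents D π l φ) : l = phaseHist π φ := by
  cases φ with
  | idle => exact h
  | ready c h' => exact h.1
  | pending c h' a => exact h.1

theorem phaseEvents_localHist {π : OpId n} {α : List (Event V Λ Ω n)} {φ : Phase V Λ Ω}
    (h : PhaseEvents D π (opHist α π) φ) : localHist (history α) π = phaseHist π φ := by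
  rw [localHist_eq_filter, opHist_history, phaseEvents_opHist h]
  cases φ with
  | idle => rfl
  | ready c h' =>
    simp only [phaseHist]
    rw [history_opEvents, List.map_nil, history, List.append_nil, opEvents_filter_abort]
    rfl
  | pending c h' a =>
    simp only [phaseHist]
    have : history (([Impl.reqKind a] : List (EvKind V Λ Ω)).map fun k => (⟨π, k⟩ : Event V Λ Ω n))
        = [⟨π, Impl.reqKind a⟩] := by
      simp [history]
    rw [history_opEvents, this, ← opEvents_tail, opEvents_filter_abort]
    cases a <;> simp [Impl.reqKind]

/-- What an ended operation shows in an execution and in its history: its invocation and its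
accesses, followed by its response, or by an aborted request that the history omits. -/
theorem endedEvents_history {π : OpId n} {α : List (Event V Λ Ω n)}
    (h : EndedEvents D π (opHist α π)) : ∃ c h, Follows D c h ∧
      ((∃ r, D.next c h = .ret r ∧ opHist α π = opEvents π c h [.res r] ∧
        opHist (history α) π = opEvents π c h [.res r] ∧
        localHist (history α) π = opEvents π c h [.res r]) ∨
      (∃ a, D.next c h = .req a ∧ opHist α π = opEvents π c h [Impl.reqKind a, .abort] ∧
        opHist (history α) π = opEvents π c h [.abort] ∧
        localHist (history α) π = opEvents π c h [])) := by
  rw [localHist_eq_filter, opHist_history]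
  obtain ⟨c, h', hf, ⟨r, hn, hr⟩ | ⟨a, hn, ha⟩⟩ := h
  · refine ⟨c, h', hf, .inl ⟨r, hn, hr, ?_⟩⟩
    have : history (([.res r] : List (EvKind V Λ Ω)).map fun k => (⟨π, k⟩ : Event V Λ Ω n))
        = [⟨π, .res r⟩] := by
      simp [history]
    rw [hr, history_opEvents, this, ← opEvents_tail, opEvents_filter_abort]
    simp
  · refine ⟨c, h', hf, .inr ⟨a, hn, ha, ?_⟩⟩
    have : history (([Impl.reqKind a, .abort] : List (EvKind V Λ Ω)).map
        fun k => (⟨π, k⟩ : Event V Λ Ω n)) = [⟨π, .abort⟩] := by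
      cases a <;> simp [history, EvKind.IsAccInv, Impl.reqKind]
    rw [ha, history_opEvents, this, ← opEvents_tail, opEvents_filter_abort]
    simp

theorem history_sublist (α : List (Event V Λ Ω n)) : (history α).Sublist α := by
  induction α with
  | nil => exact .slnil
  | cons e l ih =>
    rw [history]
    split
    · exact ih.cons _
    · exact ih.cons_cons _

theorem mem_history_of_not_accInv {α : List (Event V Λ Ω n)} {e : Event V Λ Ω n}
    (he : e ∈ α) (hk : ¬ e.kind.IsAccInv) : e ∈ history α := by
  induction α with
  | nil => simp at he
  | cons a l ih =>
    rw [history]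
    rcases List.mem_cons.1 he with rfl | he
    · rw [if_neg (fun h => hk h.1)]; simp
    · split
      · exact ih he
      · exact List.mem_cons_of_mem _ (ih he)

end Executions

/-! ### Linearizations -/

section Linearizations

variable {V Λ Ω : Type} {n : ℕ}

/-- The dictionary runs from state `q` through the operations and responses `l` to state `q'`. -/
def DictRun : (ℕ → Option V) → List (DictOp V × DictResp V) → (ℕ → Option V) → Prop
  | q, [], q' => q' = q
  | q, a :: l, q' => ∃ q₁, dictSpec V q a.1 q₁ a.2 ∧ DictRun q₁ l q'

theorem dictRun_append {q q' : ℕ → Option V} {l l' : List (DictOp V × DictResp V)} :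
    DictRun q (l ++ l') q' ↔ ∃ q₁, DictRun q l q₁ ∧ DictRun q₁ l' q' := by
  induction l generalizing q with
  | nil => simp [DictRun]
  | cons a l ih =>
    simp only [List.cons_append, DictRun, ih]
    constructor
    · rintro ⟨q₁, h1, q₂, h2, h3⟩
      exact ⟨q₂, ⟨q₁, h1, h2⟩, h3⟩
    · rintro ⟨q₂, ⟨q₁, h1, h2⟩, h3⟩
      exact ⟨q₁, h1, q₂, h2, h3⟩

theorem dictRun_snoc {q q₁ q' : ℕ → Option V} {l : List (DictOp V × DictResp V)}
    {a : DictOp V × DictResp V} (h : DictRun q l q₁) (ha : dictSpec V q₁ a.1 q' a.2) :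
    DictRun q (l ++ [a]) q' :=
  dictRun_append.2 ⟨q₁, h, q', ha, rfl⟩

/-- An operation that does not change the dictionary can be inserted anywhere. -/
theorem dictRun_insert {q q₁ q' : ℕ → Option V} {l l' : List (DictOp V × DictResp V)}
    {a : DictOp V × DictResp V} (h : DictRun q l q₁) (h' : DictRun q₁ l' q')
    (ha : dictSpec V q₁ a.1 q₁ a.2) : DictRun q (l ++ a :: l') q' :=
  dictRun_append.2 ⟨q₁, h, q₁, ha, h'⟩

theorem dictRun_consistent {q q' : ℕ → Option V} {l : List (DictOp V × DictResp V)}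
    (h : DictRun q l q') : (dictType V).Consistent q l := by
  induction l generalizing q with
  | nil => exact SeqType.Consistent.nil (τ := dictType V) q
  | cons a l ih =>
    obtain ⟨q₁, h1, h2⟩ := h
    exact .cons (τ := dictType V) h1 (ih h2)

/-- A linearization: the operations, in the order in which they take effect. -/
abbrev LinOrder (V : Type) (n : ℕ) := List (OpId n × DictOp V × DictResp V)

/-- `L` lists distinct invoked and not aborted operations in an order that respects the
precedence order of `α`. -/
structure LinInv (α : List (Event V Λ Ω n)) (L : LinOrder V n) : Prop where
  nodup : (L.map fun a => a.1).Nodup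
  invoked : ∀ a ∈ L, ∃ ω, ⟨a.1, .inv ⟨a.2.1, ω⟩⟩ ∈ α
  no_abort : ∀ a ∈ L, ⟨a.1, .abort⟩ ∉ α
  order : L.Pairwise (fun a b => ¬ Precedes α b.1 a.1)

theorem LinInv.occurs {α : List (Event V Λ Ω n)} {L : LinOrder V n} (h : LinInv α L)
    {a : OpId n × DictOp V × DictResp V} (ha : a ∈ L) : Occurs α a.1 := by
  obtain ⟨ω, hω⟩ := h.invoked a ha
  exact ⟨_, hω, rfl⟩

theorem LinInv.event {D : SearchData V Λ Ω} {I : Impl V Λ Ω n} {C : I.Conf}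
    {α : List (Event V Λ Ω n)} {L : LinOrder V n} (h : LinInv α L) {e : Event V Λ Ω n}
    (hα : I.Exec D (α ++ [e]) C) (he : e.kind = .abort → ∀ a ∈ L, a.1 ≠ e.op) :
    LinInv (α ++ [e]) L where
  nodup := h.nodup
  invoked a ha := by
    obtain ⟨ω, hω⟩ := h.invoked a ha
    exact ⟨ω, by simp [hω]⟩
  no_abort a ha hab := by
    rcases List.mem_append.1 hab with hab | hab
    · exact h.no_abort a ha hab
    · have := List.mem_singleton.1 hab
      subst this
      exact he rfl a ha rfl
  order := by
    refine List.Pairwise.imp_of_mem ?_ h.order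
    intro a b ha hb hab hp
    rcases precedes_snoc.1 hp with hp | ⟨ho, hi, -⟩
    · exact hab hp
    · have := (exec_inv_first hα α e [] rfl).1 hi
      rw [ho] at this
      exact this (h.occurs ha)

/-- An operation in progress can be linearized before all operations `B` that do not precede it. -/
theorem LinInv.insert {α : List (Event V Λ Ω n)} {A B : LinOrder V n} (h : LinInv α (A ++ B))
    {a : OpId n × DictOp V × DictResp V} (hn : ∀ b ∈ A ++ B, b.1 ≠ a.1)
    (hi : ∃ ω, ⟨a.1, .inv ⟨a.2.1, ω⟩⟩ ∈ α) (hE : ¬ Ended α a.1)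
    (hB : ∀ b ∈ B, ¬ Precedes α b.1 a.1) : LinInv α (A ++ a :: B) := by
  have hmem : ∀ b, b ∈ A ++ a :: B ↔ b = a ∨ b ∈ A ++ B := by
    intro b; simp only [List.mem_append, List.mem_cons]; tauto
  refine ⟨?_, ?_, ?_, ?_⟩
  · have hp : ((A ++ a :: B).map fun a => a.1).Perm ((a :: (A ++ B)).map fun a => a.1) :=
      List.Perm.map _ List.perm_middle
    rw [hp.nodup_iff, List.map_cons, List.nodup_cons]
    refine ⟨?_, h.nodup⟩
    intro hm
    obtain ⟨b, hb, hba⟩ := List.mem_map.1 hm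
    exact hn b hb hba
  · intro b hb
    rcases (hmem b).1 hb with rfl | hb
    · exact hi
    · exact h.invoked b hb
  · intro b hb hab
    rcases (hmem b).1 hb with rfl | hb
    · exact hE ⟨_, hab, rfl, trivial⟩
    · exact h.no_abort b hb hab
  · have ho := h.order
    rw [List.pairwise_append] at ho ⊢
    obtain ⟨o1, o2, o3⟩ := ho
    refine ⟨o1, List.pairwise_cons.2 ⟨fun b hb => hB b hb, o2⟩, ?_⟩
    intro x hx y hy
    rcases List.mem_cons.1 hy with rfl | hy
    · exact fun hp => hE (precedes_ended hp).1
    · exact o3 x hx y hy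

theorem precedes_of_sublist {H H' : List (Event V Λ Ω n)} (hs : H.Sublist H') {π π' : OpId n}
    (h : Precedes H π π') : Precedes H' π π' := by
  obtain ⟨l₁, l₂, rfl, ⟨x, hx, hxo⟩, y, hy, hyo⟩ := h
  obtain ⟨r₁, r₂, rfl, h1, h2⟩ := List.append_sublist_iff.1 hs
  exact ⟨r₁, r₂, rfl, ⟨x, h1.subset hx, hxo⟩, y, h2.subset hy, hyo⟩

/-- A linearization by a run of the dictionary, in which all responses occur, shows that the history
is linearizable. -/
theorem linearizable_of_linInv {α : List (Event V Λ Ω n)} {L : LinOrder V n}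
    {q : ℕ → Option V} (h : LinInv α L)
    (hr : ∀ π r, ⟨π, .res r⟩ ∈ α → ∃ o, (π, o, r) ∈ L)
    (hd : DictRun (fun _ => none) (L.map fun a => a.2) q) : Linearizable (history α) := by
  have hsub := history_sublist α
  refine ⟨L, h.nodup, fun a ha => ⟨?_, ?_⟩, ?_, ?_, dictRun_consistent hd⟩
  · obtain ⟨ω, hω⟩ := h.invoked a ha
    exact ⟨ω, mem_history_of_not_accInv hω (by simp [EvKind.IsAccInv])⟩
  · exact fun hm => h.no_abort a ha (hsub.subset hm)
  · exact fun π r hm => hr π r (hsub.subset hm)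
  · exact h.order.imp fun hab hp => hab (precedes_of_sublist hsub hp)

end Linearizations

/-! ### Local serializability -/

section LocalSerializability

variable {V Λ Ω : Type} {n : ℕ} {D : SearchStructure V Λ Ω}

/-- The accesses `h` can be performed by `c` alone, from a memory reached sequentially. -/
def SeqPossible (D : SearchData V Λ Ω) (c : Call V Ω) (h : List (Access V Λ)) : Prop :=
  ∃ m m', D.Reach m ∧ D.SeqRun c m h m'

theorem follows_of_runs {D : SearchData V Λ Ω} {c : Call V Ω} {m : Mem V Λ}
    {h : List (Access V Λ)} (hr : Runs D c m [] h) : Follows D c h := by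
  rintro h₁ a h₂ rfl
  rw [runs_append] at hr
  cases a
  · exact hr.2.1
  · exact hr.2.1

theorem opHist_opEvents (π : OpId n) (c : Call V Ω) (h : List (Access V Λ))
    (t : List (EvKind V Λ Ω)) : opHist (opEvents π c h t) π = opEvents π c h t := by
  rw [opHist, List.filter_eq_self]
  intro e he
  simp [op_of_mem_opEvents he]

theorem opHist_eq_nil {α : List (Event V Λ Ω n)} {π : OpId n} (h : ¬ Occurs α π) :
    opHist α π = [] := by
  rw [occurs_iff, not_not] at h
  exact h

/-- A reachable memory is the final one of a sequential history of a single process, which can use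
operation identifiers from any number `N` on. -/
theorem reach_seqHistory {D : SearchData V Λ Ω} {m : Mem V Λ} (hm : D.Reach m) (p : Fin n) (N : ℕ) :
    ∃ (S : List (Event V Λ Ω n)) (K : ℕ), SeqHistory D S m ∧ N ≤ K ∧
      ∀ e ∈ S, N ≤ e.op.2 ∧ e.op.2 < K := by
  induction hm with
  | init => exact ⟨[], N, .nil, le_rfl, by simp⟩
  | @step m m' c h r hm hc ih =>
    obtain ⟨S, K, hS, hK, hb⟩ := ih
    refine ⟨_, K + 1, SeqHistory.op (π := (p, K)) hS ?_ hc, by omega, ?_⟩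
    · rintro ⟨e, he, ho⟩
      have := hb e he
      rw [ho] at this
      simp at this
    · intro e he
      rw [List.mem_append, List.mem_append] at he
      have aux : e ∈ opEvents (p, K) c h [.res r] → N ≤ e.op.2 ∧ e.op.2 < K + 1 := by
        intro he
        rw [op_of_mem_opEvents he]
        exact ⟨hK, by simp⟩
      rcases he with (he | he) | he
      · have := hb e he
        omega
      · apply aux
        simp only [opEvents, List.cons_append, List.mem_cons, List.mem_append] at he ⊢
        tauto
      · apply aux
        simp only [opEvents, List.cons_append, List.mem_cons, List.mem_append, List.map_cons,
          List.map_nil] at he ⊢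
        tauto

theorem opEvents_prefix {D : SearchData V Λ Ω} {π : OpId n} {c : Call V Ω} {m m' : Mem V Λ}
    {h h' : List (Access V Λ)} {r : DictResp V} (hc : D.Completes c m h' m' r) (hh : h <+: h')
    {t : List (EvKind V Λ Ω)}
    (ht : t = [] ∨ (∃ a, D.next c h = .req a ∧ t = [Impl.reqKind a]) ∨
      (∃ r, D.next c h = .ret r ∧ t = [.res r])) :
    opEvents π c h t <+: opEvents π c h' [.res r] := by
  obtain ⟨l, rfl⟩ := hh
  have hf := follows_of_runs (seqRun_iff.1 hc.1).1
  cases l with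
  | nil =>
    have hn := hc.2
    rw [List.append_nil] at hn ⊢
    rcases ht with rfl | ⟨a, ha, rfl⟩ | ⟨r', hr', rfl⟩
    · exact ⟨[⟨π, .res r⟩], by simp [opEvents]⟩
    · rw [ha] at hn; simp at hn
    · rw [hr'] at hn
      simp only [Cmd.ret.injEq] at hn
      rw [hn]
  | cons b l =>
    have hb := hf _ _ _ rfl
    rcases ht with rfl | ⟨a, ha, rfl⟩ | ⟨r', hr', rfl⟩
    · exact ⟨(b :: l).flatMap (accessEvents π) ++ [⟨π, .res r⟩], by simp [opEvents]⟩
    · rw [ha] at hb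
      simp only [Cmd.req.injEq] at hb
      subst hb
      cases b with
      | read x e =>
        refine ⟨⟨π, .resRead x e⟩ :: l.flatMap (accessEvents π) ++ [⟨π, .res r⟩], ?_⟩
        simp [opEvents, accessEvents, reqOf, Impl.reqKind]
      | write x e =>
        refine ⟨⟨π, .resWrite x e⟩ :: l.flatMap (accessEvents π) ++ [⟨π, .res r⟩], ?_⟩
        simp [opEvents, accessEvents, reqOf, Impl.reqKind]
    · rw [hr'] at hb; simp at hb

/-- Accesses that an operation can perform alone occur in a sequential history, under any operation
identifier. -/
theorem seqPossible_seqHist {π : OpId n} {c : Call V Ω} {h : List (Access V Λ)}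
    (hp : SeqPossible D.toSearchData c h) {t : List (EvKind V Λ Ω)}
    (ht : t = [] ∨ (∃ a, D.next c h = .req a ∧ t = [Impl.reqKind a]) ∨
      (∃ r, D.next c h = .ret r ∧ t = [.res r])) :
    ∃ S : List (Event V Λ Ω n), IsSeqHist D.toSearchData S ∧ localHist S π = opEvents π c h t := by
  obtain ⟨m, m', hm, hr⟩ := hp
  obtain ⟨S, K, hS, -, hb⟩ := reach_seqHistory hm π.1 (π.2 + 1)
  have hπ : ¬ Occurs S π := by
    rintro ⟨e, he, rfl⟩
    have := hb e he
    omega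
  obtain ⟨h', m₁, r, hc⟩ := completes_exists hm c
  have hpre := opEvents_prefix (π := π) hc (completes_extends hr hc) ht
  refine ⟨S ++ opEvents π c h t, ⟨_, _, SeqHistory.op hS hπ hc, ?_⟩, ?_⟩
  · obtain ⟨l, hl⟩ := hpre
    refine ⟨l, ?_⟩
    rw [List.append_assoc, hl]
    simp [opEvents]
  · rw [localHist_eq_filter, opHist_append, opHist_eq_nil hπ, List.nil_append, opHist_opEvents,
      opEvents_filter_abort]
    congr 1
    rw [List.filter_eq_self]
    rcases ht with rfl | ⟨a, -, rfl⟩ | ⟨r', -, rfl⟩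
    · simp
    · cases a <;> simp [Impl.reqKind]
    · simp

/-- The step by which an operation ends. -/
theorem exec_end_step {D : SearchData V Λ Ω} {I : Impl V Λ Ω n} {α : List (Event V Λ Ω n)}
    {C : I.Conf} (hα : I.Exec D α C) {π : OpId n} (hE : Ended α π) :
    ∃ l₁ e l₂ C₀ C₁, α = l₁ ++ e :: l₂ ∧ e.op = π ∧ e.kind.IsEnd ∧ I.Exec D l₁ C₀ ∧
      Impl.Step D C₀ π.1 (some e) C₁ ∧ π = (π.1, C₀.cnt π.1) ∧
      opHist α π = opHist l₁ π ++ [e] := by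
  obtain ⟨e, he, rfl, hend⟩ := hE
  obtain ⟨l₁, l₂, rfl⟩ := List.append_of_mem he
  obtain ⟨C', h'⟩ := exec_prefix hα (β := l₁ ++ [e]) ⟨l₂, by simp⟩
  obtain ⟨C₀, C₁, h0, hs, ho⟩ := exec_last h'
  have hno := opHist_eq_nil (exec_end_last hα _ _ _ rfl hend)
  refine ⟨l₁, e, l₂, C₀, C₁, rfl, rfl, hend, h0, hs, ho, ?_⟩
  rw [opHist_append]
  congr 1
  rw [show e :: l₂ = [e] ++ l₂ from rfl, opHist_append, hno]
  simp [opHist]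

/-- It suffices that the operation in progress of each process could have made its accesses alone:
an ended operation was in progress before its last event. -/
theorem locallySerializable_of_phases {I : Impl V Λ Ω n}
    (H : ∀ α C, I.Exec D.toSearchData α C → ∀ p c h,
      (C.phase p = .ready c h ∨ ∃ a, C.phase p = .pending c h a) →
        SeqPossible D.toSearchData c h)
    {α : List (Event V Λ Ω n)} {C : I.Conf} (hα : I.Exec D.toSearchData α C) :
    LocallySerializable D.toSearchData (history α) := by
  intro π hπ
  have hπ' : Occurs α π := by
    obtain ⟨e, he, ho⟩ := hπ
    exact ⟨e, (history_sublist α).subset he, ho⟩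
  by_cases hE : Ended α π
  · obtain ⟨l₁, e, l₂, C₀, C₁, -, -, hend, h0, hs, ho, hh⟩ := exec_end_step hα hE
    have hph := (exec_local h0 π.1).2.1
    rw [← ho] at hph
    rw [localHist_eq_filter, opHist_history, hh, phaseEvents_opHist hph]
    cases hs with
    | invoke => exact absurd hend (by simp [EvKind.IsEnd])
    | request _ _ _ => exact absurd hend (reqKind_not_end _)
    | respond hp hr hn =>
      obtain ⟨S, hS, hl⟩ := seqPossible_seqHist (π := π) (H _ _ h0 π.1 _ _ (.inl hp))
        (.inr (.inr ⟨_, hn, rfl⟩))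
      refine ⟨S, hS, ?_⟩
      rw [hl, hp, ← ho]
      simp only [phaseHist]
      rw [← opEvents_tail, history_opEvents]
      simp only [List.nil_append, List.map_cons, List.map_nil, history, List.find?_nil,
        reduceCtorEq, and_false, if_false]
      rw [← opEvents_tail, opEvents_filter_abort]
      simp
    | reply hp hr =>
      exact absurd hend (by rename_i a e; cases a <;> simp [Impl.replyKind, EvKind.IsEnd])
    | abort hp hr =>
      obtain ⟨S, hS, hl⟩ := seqPossible_seqHist (π := π) (H _ _ h0 π.1 _ _ (.inr ⟨_, hp⟩))
        (.inl rfl)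
      refine ⟨S, hS, ?_⟩
      rename_i a
      have : history (([Impl.reqKind a, .abort] : List (EvKind V Λ Ω)).map
          fun k => (⟨π, k⟩ : Event V Λ Ω n)) = [⟨π, .abort⟩] := by
        cases a <;> simp [history, EvKind.IsAccInv, Impl.reqKind]
      rw [hl, hp, ← ho]
      simp only [phaseHist]
      rw [← opEvents_tail, history_opEvents, List.cons_append, List.nil_append, this,
        ← opEvents_tail, opEvents_filter_abort]
      simp
  · have hle := exec_occurs_le hα hπ'
    have heq : C.cnt π.1 = π.2 := by
      rw [exec_ended_iff hα] at hE
      omega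
    have hph := (exec_local hα π.1).2.1
    rw [heq, Prod.mk.eta] at hph
    rw [phaseEvents_localHist hph]
    cases hp : C.phase π.1 with
    | idle =>
      rw [hp] at hph
      exact absurd hph (occurs_iff.1 hπ')
    | ready c h =>
      obtain ⟨S, hS, hl⟩ := seqPossible_seqHist (π := π) (H _ _ hα π.1 _ _ (.inl hp))
        (.inl rfl)
      exact ⟨S, hS, hl.symm⟩
    | pending c h a =>
      rw [hp] at hph
      obtain ⟨S, hS, hl⟩ := seqPossible_seqHist (π := π) (H _ _ hα π.1 _ _ (.inr ⟨_, hp⟩))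
        (.inr (.inl ⟨_, hph.2.2, rfl⟩))
      exact ⟨S, hS, hl.symm⟩

end LocalSerializability

/-! ### Sequences of complete operations -/

section Serializations

variable {V Λ Ω : Type} {n : ℕ}

/-- A complete operation, with its accesses and its response. -/
structure Block (V Λ Ω : Type) (n : ℕ) where
  op : OpId n
  call : Call V Ω
  acc : List (Access V Λ)
  resp : DictResp V

/-- The events of a complete operation. -/
def Block.events (b : Block V Λ Ω n) : List (Event V Λ Ω n) :=
  opEvents b.op b.call b.acc [.res b.resp]

/-- The entry of a complete operation in a linearization. -/
def Block.entry (b : Block V Λ Ω n) : OpId n × DictOp V × DictResp V :=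
  (b.op, b.call.op, b.resp)

/-- The events of a sequence of complete operations. -/
def flat (A : List (Block V Λ Ω n)) : List (Event V Λ Ω n) := A.flatMap Block.events

/-- Run one after the other from memory `m`, the operations lead to memory `m'`. -/
def Chain (D : SearchData V Λ Ω) : Mem V Λ → List (Block V Λ Ω n) → Mem V Λ → Prop
  | m, [], m' => m' = m
  | m, b :: l, m' => ∃ m₁, D.Completes b.call m b.acc m₁ b.resp ∧ Chain D m₁ l m'

theorem chain_append {D : SearchData V Λ Ω} {m m' : Mem V Λ} {A B : List (Block V Λ Ω n)} :
    Chain D m (A ++ B) m' ↔ ∃ m₁, Chain D m A m₁ ∧ Chain D m₁ B m' := by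
  induction A generalizing m with
  | nil => simp [Chain]
  | cons b A ih =>
    simp only [List.cons_append, Chain, ih]
    constructor
    · rintro ⟨q₁, h1, q₂, h2, h3⟩
      exact ⟨q₂, ⟨q₁, h1, h2⟩, h3⟩
    · rintro ⟨q₂, ⟨q₁, h1, h2⟩, h3⟩
      exact ⟨q₁, h1, q₂, h2, h3⟩

theorem chain_det {D : SearchData V Λ Ω} {m m₁ m₂ : Mem V Λ} {A : List (Block V Λ Ω n)}
    (h₁ : Chain D m A m₁) (h₂ : Chain D m A m₂) : m₁ = m₂ := by
  induction A generalizing m with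
  | nil => simp only [Chain] at h₁ h₂; rw [h₁, h₂]
  | cons b A ih =>
    obtain ⟨x, hx, h1⟩ := h₁
    obtain ⟨y, hy, h2⟩ := h₂
    obtain ⟨-, rfl, -⟩ := completes_det hx hy
    exact ih h1 h2

/-- An operation that leaves the memory as it is can be inserted. -/
theorem chain_insert {D : SearchData V Λ Ω} {m s m' : Mem V Λ} {A B : List (Block V Λ Ω n)}
    {b : Block V Λ Ω n} (hA : Chain D m A s) (h : Chain D m (A ++ B) m')
    (hb : D.Completes b.call s b.acc s b.resp) : Chain D m (A ++ b :: B) m' := by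
  obtain ⟨s', h1, h2⟩ := chain_append.1 h
  obtain rfl := chain_det hA h1
  exact chain_append.2 ⟨_, hA, _, hb, h2⟩

theorem chain_reach {D : SearchData V Λ Ω} {m m' : Mem V Λ} {A : List (Block V Λ Ω n)}
    (hm : D.Reach m) (h : Chain D m A m') : D.Reach m' ∧ ∀ b ∈ A, SeqPossible D b.call b.acc ∧
      D.next b.call b.acc = .ret b.resp := by
  induction A generalizing m with
  | nil => simp only [Chain] at h; subst h; exact ⟨hm, by simp⟩
  | cons b A ih =>
    obtain ⟨x, hx, h1⟩ := h
    obtain ⟨i1, i2⟩ := ih (.step hm hx) h1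
    refine ⟨i1, ?_⟩
    intro b' hb'
    rcases List.mem_cons.1 hb' with rfl | hb'
    · exact ⟨⟨m, x, hm, hx.1⟩, hx.2⟩
    · exact i2 b' hb'

/-- Complete operations run one after the other respond as the dictionary does. -/
theorem chain_dictRun {D : SearchStructure V Λ Ω} {m m' : Mem V Λ} {q : ℕ → Option V}
    {A : List (Block V Λ Ω n)} (hm : D.Reach m) (hq : Represents m q)
    (h : Chain D.toSearchData m A m') :
    ∃ q', Represents m' q' ∧ DictRun q ((A.map Block.entry).map fun a => a.2) q' := by
  induction A generalizing m q with
  | nil => simp only [Chain] at h; subst h; exact ⟨q, hq, rfl⟩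
  | cons b A ih =>
    obtain ⟨x, hx, h1⟩ := h
    obtain ⟨q₁, hs, hq₁⟩ := completes_spec hm hq hx
    obtain ⟨q', hq', hr⟩ := ih (.step hm hx) hq₁ h1
    exact ⟨q', hq', q₁, hs, hr⟩

/-! ### Legality -/

/-- The memory after the writes that have responded in `l`. -/
noncomputable def evMem : Mem V Λ → List (Event V Λ Ω n) → Mem V Λ
  | m, [] => m
  | m, e :: l => match e.kind with
    | .resWrite x ex => evMem (Function.update m x ex) l
    | _ => evMem m l

theorem legalFrom_append {m : Mem V Λ} {l l' : List (Event V Λ Ω n)} :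
    LegalFrom m (l ++ l') ↔ LegalFrom m l ∧ LegalFrom (evMem m l) l' := by
  induction l generalizing m with
  | nil => simp [LegalFrom, evMem]
  | cons e l ih =>
    obtain ⟨π, k⟩ := e
    cases k <;> simp [LegalFrom, evMem, ih, and_assoc]

theorem evMem_append {m : Mem V Λ} {l l' : List (Event V Λ Ω n)} :
    evMem m (l ++ l') = evMem (evMem m l) l' := by
  induction l generalizing m with
  | nil => simp [evMem]
  | cons e l ih =>
    obtain ⟨π, k⟩ := e
    cases k <;> simp [evMem, ih]

theorem evMem_accesses {m : Mem V Λ} {π : OpId n} {h : List (Access V Λ)} :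
    evMem m (h.flatMap (accessEvents (Ω := Ω) π)) = accMem m h := by
  induction h generalizing m with
  | nil => rfl
  | cons a h ih =>
    cases a <;> simp [accessEvents, evMem, accMem, ih]

theorem legal_accesses_iff {D : SearchData V Λ Ω} {c : Call V Ω} {m : Mem V Λ} {π : OpId n}
    {h₀ h : List (Access V Λ)}
    (hf : ∀ h₁ a h₂, h = h₁ ++ a :: h₂ → D.next c (h₀ ++ h₁) = .req (reqOf a)) :
    LegalFrom m (h.flatMap (accessEvents (Ω := Ω) π)) ↔ Runs D c m h₀ h := by
  induction h generalizing m h₀ with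
  | nil => simp [LegalFrom, Runs]
  | cons a h ih =>
    have h0 := hf [] a h rfl
    rw [List.append_nil] at h0
    have ih' := fun m => ih (m := m) (h₀ := h₀ ++ [a]) (fun h₁ b h₂ e => by
      have := hf (a :: h₁) b h₂ (by rw [e]; rfl)
      simpa using this)
    cases a with
    | read x e =>
      simp only [List.flatMap_cons, accessEvents, List.cons_append, List.nil_append, LegalFrom, ih',
        Runs]
      exact ⟨fun h => ⟨h0, h⟩, fun h => h.2⟩
    | write x e =>
      simp only [List.flatMap_cons, accessEvents, List.cons_append, List.nil_append, LegalFrom, ih',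
        Runs]
      exact ⟨fun h => ⟨h0, h⟩, fun h => h.2⟩

/-- Events that neither read nor write. -/
def Silent (t : List (EvKind V Λ Ω)) : Prop :=
  ∀ k ∈ t, (∀ x e, k ≠ .resRead x e) ∧ ∀ x e, k ≠ .resWrite x e

theorem silent_legal {m : Mem V Λ} {π : OpId n} {t : List (EvKind V Λ Ω)} (ht : Silent t) :
    LegalFrom m (t.map fun k => (⟨π, k⟩ : Event V Λ Ω n)) ∧
      evMem m (t.map fun k => (⟨π, k⟩ : Event V Λ Ω n)) = m := by
  induction t with
  | nil => simp [LegalFrom, evMem]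
  | cons k t ih =>
    have h1 := ht k (by simp)
    have h2 := ih (fun k' hk' => ht k' (by simp [hk']))
    cases k <;> simp_all [LegalFrom, evMem]

/-- The events of an operation run alone are legal iff the accesses are those of a sequential run.
-/
theorem legal_opEvents_iff {D : SearchData V Λ Ω} {c : Call V Ω} {m : Mem V Λ} {π : OpId n}
    {h : List (Access V Λ)} {t : List (EvKind V Λ Ω)} (hf : Follows D c h) (ht : Silent t) :
    (LegalFrom m (opEvents π c h t) ↔ Runs D c m [] h) ∧
      evMem m (opEvents π c h t) = accMem m h := by
  have h1 : LegalFrom m (opEvents π c h t) ↔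
      LegalFrom m (h.flatMap (accessEvents (Ω := Ω) π) ++ t.map fun k => ⟨π, k⟩) := by
    simp [opEvents, LegalFrom]
  have h2 : evMem m (opEvents π c h t) =
      evMem m (h.flatMap (accessEvents (Ω := Ω) π) ++ t.map fun k => ⟨π, k⟩) := by
    simp [opEvents, evMem]
  rw [h1, h2, legalFrom_append, evMem_append, (silent_legal ht).2, evMem_accesses]
  refine ⟨?_, rfl⟩
  rw [legal_accesses_iff (D := D) (c := c) (h₀ := [])]
  · exact and_iff_left (silent_legal ht).1
  · exact fun h₁ a h₂ e => by simpa using hf h₁ a h₂ e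

theorem silent_res (r : DictResp V) : Silent (Λ := Λ) (Ω := Ω) [.res r] := by
  simp [Silent]

theorem chain_legal {D : SearchData V Λ Ω} {m m' : Mem V Λ} {A : List (Block V Λ Ω n)}
    (h : Chain D m A m') : LegalFrom m (flat A) ∧ evMem m (flat A) = m' := by
  induction A generalizing m with
  | nil => simp only [Chain] at h; subst h; simp [flat, LegalFrom, evMem]
  | cons b A ih =>
    obtain ⟨m₁, hb, h⟩ := h
    obtain ⟨i1, i2⟩ := ih h
    obtain ⟨r1, rfl⟩ := seqRun_iff.1 hb.1
    have := legal_opEvents_iff (m := m) (π := b.op) (follows_of_runs r1)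
      (silent_res (Λ := Λ) (Ω := Ω) b.resp)
    have e : flat (b :: A) = b.events ++ flat A := by simp [flat]
    rw [e, legalFrom_append, evMem_append]
    unfold Block.events
    rw [this.2]
    exact ⟨⟨this.1.2 r1, i1⟩, i2⟩

/-! ### Sequences of blocks -/

theorem mem_flat {A : List (Block V Λ Ω n)} {e : Event V Λ Ω n} :
    e ∈ flat A ↔ ∃ b ∈ A, e ∈ b.events := by simp [flat]

theorem flat_append (A B : List (Block V Λ Ω n)) : flat (A ++ B) = flat A ++ flat B := by
  simp [flat]

theorem flat_cons (b : Block V Λ Ω n) (A : List (Block V Λ Ω n)) :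
    flat (b :: A) = b.events ++ flat A := by
  simp [flat]

theorem op_of_mem_events {b : Block V Λ Ω n} {e : Event V Λ Ω n} (he : e ∈ b.events) :
    e.op = b.op := op_of_mem_opEvents he

theorem inv_mem_events (b : Block V Λ Ω n) : ⟨b.op, .inv b.call⟩ ∈ b.events := by
  simp [Block.events, opEvents]

theorem res_mem_events (b : Block V Λ Ω n) : ⟨b.op, .res b.resp⟩ ∈ b.events := by
  simp [Block.events, opEvents]

theorem occurs_flat {A : List (Block V Λ Ω n)} {π : OpId n} :
    Occurs (flat A) π ↔ ∃ b ∈ A, b.op = π := by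
  constructor
  · rintro ⟨e, he, rfl⟩
    obtain ⟨b, hb, heb⟩ := mem_flat.1 he
    exact ⟨b, hb, (op_of_mem_events heb).symm⟩
  · rintro ⟨b, hb, rfl⟩
    exact ⟨_, mem_flat.2 ⟨b, hb, inv_mem_events b⟩, rfl⟩

theorem opHist_flat {A : List (Block V Λ Ω n)} (hn : (A.map Block.op).Nodup) {b : Block V Λ Ω n}
    (hb : b ∈ A) : opHist (flat A) b.op = b.events := by
  obtain ⟨X, Y, rfl⟩ := List.append_of_mem hb
  simp only [List.map_append, List.map_cons] at hn
  have hn' := List.nodup_append.1 hn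
  have hX : ¬ Occurs (flat X) b.op := by
    rw [occurs_flat]
    rintro ⟨b', hb', ho⟩
    exact hn'.2.2 b'.op (List.mem_map_of_mem hb') b.op (by simp) ho
  have hY : ¬ Occurs (flat Y) b.op := by
    rw [occurs_flat]
    rintro ⟨b', hb', ho⟩
    exact (List.nodup_cons.1 hn'.2.1).1 (ho ▸ List.mem_map_of_mem hb')
  rw [flat_append, flat_cons, opHist_append, opHist_append, opHist_eq_nil hX, opHist_eq_nil hY,
    List.nil_append, List.append_nil]
  exact opHist_opEvents _ _ _ _

theorem precedes_flat {X Y : List (Block V Λ Ω n)} {b : Block V Λ Ω n} {R : List (Event V Λ Ω n)}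
    {π : OpId n} (h : ∃ c, ⟨π, .inv c⟩ ∈ flat Y ++ R) :
    Precedes (flat (X ++ b :: Y) ++ R) b.op π := by
  obtain ⟨c, hc⟩ := h
  refine ⟨flat X ++ b.events, flat Y ++ R, by simp [flat], ⟨⟨b.op, .res b.resp⟩, ?_, rfl, trivial⟩,
    _, hc, rfl, trivial⟩
  exact List.mem_append_right _ (res_mem_events b)

/-- A sequence of complete operations, possibly followed by some events of one more operation,
is sequential. -/
theorem sequential_flat {A : List (Block V Λ Ω n)} {π : OpId n} {R : List (Event V Λ Ω n)}
    (hR : ∀ e ∈ R, e.op = π) (hi : R ≠ [] → ∃ c, ⟨π, .inv c⟩ ∈ R) (hπ : ∀ b ∈ A, b.op ≠ π) :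
    Sequential (flat A ++ R) := by
  have hin : ∀ b ∈ A, ∀ π', Occurs (flat A ++ R) π' → b.op ≠ π' →
      Precedes (flat A ++ R) b.op π' ∨ Precedes (flat A ++ R) π' b.op := by
    intro b hb π' ho hne
    obtain ⟨X, Y, rfl⟩ := List.append_of_mem hb
    obtain ⟨e, he, rfl⟩ := ho
    rcases List.mem_append.1 he with he | he
    · obtain ⟨b', hb', heb⟩ := mem_flat.1 he
      have := op_of_mem_events heb
      rcases List.mem_append.1 hb' with hb' | hb'
      · right
        obtain ⟨X₁, X₂, rfl⟩ := List.append_of_mem hb'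
        rw [this, List.append_assoc, List.cons_append]
        apply precedes_flat
        exact ⟨b.call, List.mem_append_left _ (mem_flat.2 ⟨b, by simp, inv_mem_events b⟩)⟩
      · rcases List.mem_cons.1 hb' with rfl | hb'
        · exact absurd this.symm hne
        · left
          rw [this]
          apply precedes_flat
          exact ⟨b'.call, List.mem_append_left _ (mem_flat.2 ⟨b', hb', inv_mem_events b'⟩)⟩
    · left
      apply precedes_flat
      obtain ⟨c, hc⟩ := hi (List.ne_nil_of_mem he)
      rw [hR e he]
      exact ⟨c, List.mem_append_right _ hc⟩
  intro π₁ π₂ h1 h2 hne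
  by_cases hb1 : ∃ b ∈ A, b.op = π₁
  · obtain ⟨b, hb, rfl⟩ := hb1
    exact hin b hb π₂ h2 hne
  by_cases hb2 : ∃ b ∈ A, b.op = π₂
  · obtain ⟨b, hb, rfl⟩ := hb2
    exact (hin b hb π₁ h1 hne.symm).symm
  · exfalso
    have aux : ∀ π', Occurs (flat A ++ R) π' → (¬ ∃ b ∈ A, b.op = π') → π' = π := by
      rintro π' ⟨e, he, rfl⟩ hno
      rcases List.mem_append.1 he with he | he
      · exact absurd (occurs_flat.1 ⟨e, he, rfl⟩) hno
      · exact hR e he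
    exact hne ((aux _ h1 hb1).trans (aux _ h2 hb2).symm)

/-- Two event sequences in which the operations of each process come in order are equal for a
process if they have the same events for each operation. -/
theorem eq_of_opHist_eq {p : Fin n} {X Y : List (Event V Λ Ω n)} (hX : ∀ e ∈ X, e.op.1 = p)
    (hY : ∀ e ∈ Y, e.op.1 = p) (sX : X.Pairwise fun e e' => e.op.2 ≤ e'.op.2)
    (sY : Y.Pairwise fun e e' => e.op.2 ≤ e'.op.2) (h : ∀ π, opHist X π = opHist Y π) : X = Y := by
  induction X generalizing Y with
  | nil =>
    cases Y with
    | nil => rfl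
    | cons b Y =>
      have := h b.op
      simp [opHist] at this
  | cons a X ih =>
    cases Y with
    | nil =>
      have := h a.op
      simp [opHist] at this
    | cons b Y =>
      rw [List.pairwise_cons] at sX sY
      have hab : a.op = b.op := by
        have h1 : b.op.2 ≤ a.op.2 := by
          have : a ∈ b :: Y := by
            have : a ∈ opHist (b :: Y) a.op := by rw [← h]; simp [opHist]
            exact (mem_opHist.1 this).1
          rcases List.mem_cons.1 this with rfl | this
          · rfl
          · exact sY.1 a this
        have h2 : a.op.2 ≤ b.op.2 := by
          have : b ∈ a :: X := by
            have : b ∈ opHist (a :: X) b.op := by rw [h]; simp [opHist]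
            exact (mem_opHist.1 this).1
          rcases List.mem_cons.1 this with rfl | this
          · rfl
          · exact sX.1 b this
        exact Prod.ext ((hX a (by simp)).trans (hY b (by simp)).symm) (le_antisymm h2 h1)
      have hd : a = b := by
        have := h a.op
        simp only [opHist, decide_true, List.filter_cons_of_pos, hab] at this
        simpa using (List.cons.inj this).1
      subst hd
      congr 1
      refine ih (fun e he => hX e (by simp [he])) (fun e he => hY e (by simp [he])) sX.2 sY.2 ?_
      intro π
      have := h π
      by_cases hπ : a.op = π
      · simpa [opHist, hπ] using this
      · simpa [opHist, hπ] using this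

end Serializations

/-! ### Serializations of an execution -/

section SerializationInvariant

variable {V Λ Ω : Type} {n : ℕ} {D : SearchStructure V Λ Ω} {I : Impl V Λ Ω n}

/-- `A` is a serialization of the operations that have taken effect in the execution `α`: run in
this order they lead to memory `m`. All operations that have returned are listed; a listed
operation has at least finished its accesses. -/
structure SerInv (D : SearchData V Λ Ω) (α : List (Event V Λ Ω n)) (A : List (Block V Λ Ω n))
    (m : Mem V Λ) : Prop where
  chain : Chain D (fun _ => ∅) A m
  lin : LinInv α (A.map Block.entry)
  blocks : ∀ b ∈ A, opHist α b.op = b.events ∨ opHist α b.op = opEvents b.op b.call b.acc []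
  returned : ∀ π, Returned α π → ∃ b ∈ A, b.op = π

theorem entry_ops (A : List (Block V Λ Ω n)) :
    ((A.map Block.entry).map fun a => a.1) = A.map Block.op := by
  rw [List.map_map]; rfl

theorem SerInv.nodup {D : SearchData V Λ Ω} {α : List (Event V Λ Ω n)}
    {A : List (Block V Λ Ω n)} {m : Mem V Λ}
    (h : SerInv D α A m) : (A.map Block.op).Nodup := by
  rw [← entry_ops]; exact h.lin.nodup

theorem SerInv.block_unique {D : SearchData V Λ Ω} {α : List (Event V Λ Ω n)}
    {A : List (Block V Λ Ω n)} {m : Mem V Λ}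
    (h : SerInv D α A m) {b b' : Block V Λ Ω n} (hb : b ∈ A) (hb' : b' ∈ A) (e : b.op = b'.op) :
    b = b' := List.inj_on_of_nodup_map h.nodup hb hb' e

theorem serInv_nil (D : SearchData V Λ Ω) :
    SerInv D ([] : List (Event V Λ Ω n)) [] (fun _ => ∅) where
  chain := rfl
  lin := ⟨by simp, by simp, by simp, by simp⟩
  blocks := by simp
  returned := by rintro π ⟨r, h⟩; simp at h

/-- An event of an operation that has not taken effect. -/
theorem SerInv.event {D : SearchData V Λ Ω} {α : List (Event V Λ Ω n)}
    {A : List (Block V Λ Ω n)} {m : Mem V Λ}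
    (h : SerInv D α A m) {e : Event V Λ Ω n} {C : I.Conf} (hα : I.Exec D (α ++ [e]) C)
    (he : ∀ b ∈ A, b.op ≠ e.op) (hr : ∀ r, e.kind ≠ .res r) : SerInv D (α ++ [e]) A m where
  chain := h.chain
  lin := by
    refine h.lin.event hα ?_
    rintro - a ha
    obtain ⟨b, hb, rfl⟩ := List.mem_map.1 ha
    exact he b hb
  blocks b hb := by
    rw [opHist_append, opHist_eq_nil (α := [e]), List.append_nil]
    · exact h.blocks b hb
    · rintro ⟨e', he', ho⟩
      rw [List.mem_singleton.1 he'] at ho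
      exact he b hb ho.symm
  returned π := by
    rintro ⟨r, hr'⟩
    rcases List.mem_append.1 hr' with hr' | hr'
    · exact h.returned π ⟨r, hr'⟩
    · have := List.mem_singleton.1 hr'
      exact absurd (by rw [← this]) (hr r)

/-- The response of an operation that has taken effect. -/
theorem SerInv.respond {D : SearchData V Λ Ω} {α : List (Event V Λ Ω n)}
    {A : List (Block V Λ Ω n)} {m : Mem V Λ} (h : SerInv D α A m) {b : Block V Λ Ω n} {C : I.Conf}
    (hα : I.Exec D (α ++ [⟨b.op, .res b.resp⟩]) C) (hb : b ∈ A)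
    (hl : opHist α b.op = opEvents b.op b.call b.acc []) :
    SerInv D (α ++ [⟨b.op, .res b.resp⟩]) A m where
  chain := h.chain
  lin := by
    refine h.lin.event hα ?_
    simp
  blocks b' hb' := by
    by_cases e : b' = b
    · subst e
      left
      rw [opHist_append, hl]
      unfold Block.events
      rw [show ([.res b'.resp] : List (EvKind V Λ Ω)) = [] ++ [.res b'.resp] from rfl,
        opEvents_tail]
      simp [opHist]
    · have hne : b'.op ≠ b.op := fun e' => e (h.block_unique hb' hb e')
      rw [opHist_append, opHist_eq_nil (α := [_]), List.append_nil]
      · exact h.blocks b' hb'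
      · rintro ⟨e', he', ho⟩
        rw [List.mem_singleton.1 he'] at ho
        exact hne ho.symm
  returned π := by
    rintro ⟨r, hr'⟩
    rcases List.mem_append.1 hr' with hr' | hr'
    · exact h.returned π ⟨r, hr'⟩
    · have := List.mem_singleton.1 hr'
      simp only [Event.mk.injEq] at this
      exact ⟨b, hb, this.1.symm⟩

/-- An operation that has finished its accesses takes effect. -/
theorem SerInv.insert {D : SearchData V Λ Ω} {α : List (Event V Λ Ω n)}
    {A B : List (Block V Λ Ω n)} {m m' : Mem V Λ}
    (h : SerInv D α (A ++ B) m) {b : Block V Λ Ω n}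
    (hc : Chain D (fun _ => ∅) (A ++ b :: B) m') (hb : ∀ b' ∈ A ++ B, b'.op ≠ b.op)
    (hl : opHist α b.op = opEvents b.op b.call b.acc [])
    (hB : ∀ b' ∈ B, ¬ Precedes α b'.op b.op) : SerInv D α (A ++ b :: B) m' where
  chain := hc
  lin := by
    have h1 := h.lin
    simp only [List.map_append, List.map_cons] at h1 ⊢
    apply h1.insert
    · intro a ha
      rw [← List.map_append] at ha
      obtain ⟨b', hb', rfl⟩ := List.mem_map.1 ha
      exact hb b' hb'
    · refine ⟨b.call.coin, ?_⟩
      have : ⟨b.op, .inv b.call⟩ ∈ opHist α b.op := by rw [hl]; simp [opEvents]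
      exact (mem_opHist.1 this).1
    · rintro ⟨e, he, ho, hend⟩
      have : e ∈ opHist α b.op := mem_opHist.2 ⟨he, ho⟩
      rw [hl] at this
      rcases kind_of_mem_opEvents this with h1 | h1 | h1
      · rw [h1] at hend; exact hend
      · exact h1.2 hend
      · simp at h1
    · intro a ha
      obtain ⟨b', hb', rfl⟩ := List.mem_map.1 ha
      exact hB b' hb'
  blocks b' hb' := by
    rw [List.mem_append, List.mem_cons] at hb'
    rcases hb' with hb' | rfl | hb'
    · exact h.blocks b' (by simp [hb'])
    · exact .inr hl
    · exact h.blocks b' (by simp [hb'])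
  returned π hr := by
    obtain ⟨b', hb', rfl⟩ := h.returned π hr
    refine ⟨b', ?_, rfl⟩
    simp only [List.mem_append, List.mem_cons] at hb' ⊢
    tauto

/-- Events recorded for an operation determine its response. -/
theorem SerInv.resp {D : SearchData V Λ Ω} {α : List (Event V Λ Ω n)}
    {A : List (Block V Λ Ω n)} {m : Mem V Λ} (h : SerInv D α A m) {b : Block V Λ Ω n} (hb : b ∈ A)
    {r : DictResp V} (hr : ⟨b.op, .res r⟩ ∈ α) : r = b.resp ∧ opHist α b.op = b.events := by
  have hm : ⟨b.op, .res r⟩ ∈ opHist α b.op := mem_opHist.2 ⟨hr, rfl⟩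
  rcases h.blocks b hb with h1 | h1
  · refine ⟨?_, h1⟩
    rw [h1] at hm
    rcases kind_of_mem_opEvents hm with h2 | h2 | h2
    · simp at h2
    · exact absurd trivial h2.2
    · simpa using h2
  · exfalso
    rw [h1] at hm
    rcases kind_of_mem_opEvents hm with h2 | h2 | h2
    · simp at h2
    · exact h2.2 trivial
    · simp at h2

theorem SerInv.linearizable {α : List (Event V Λ Ω n)}
    {A : List (Block V Λ Ω n)} {m : Mem V Λ} (h : SerInv D.toSearchData α A m) :
    Linearizable (history α) := by
  obtain ⟨q, -, hq⟩ := chain_dictRun (D := D) .init represents_empty h.chain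
  refine linearizable_of_linInv h.lin ?_ hq
  intro π r hr
  obtain ⟨b, hb, rfl⟩ := h.returned π ⟨r, hr⟩
  obtain ⟨rfl, -⟩ := h.resp hb hr
  exact ⟨b.call.op, List.mem_map.2 ⟨b, hb, rfl⟩⟩

/-- The missing responses of the operations in `A`. -/
noncomputable def missing (α : List (Event V Λ Ω n)) (A : List (Block V Λ Ω n)) :
    List (Event V Λ Ω n) :=
  (A.filter fun b => ¬ Ended α b.op).map fun b => ⟨b.op, .res b.resp⟩

theorem mem_missing {α : List (Event V Λ Ω n)} {A : List (Block V Λ Ω n)} {e : Event V Λ Ω n} :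
    e ∈ missing α A ↔ ∃ b ∈ A, ¬ Ended α b.op ∧ e = ⟨b.op, .res b.resp⟩ := by
  simp only [missing, List.mem_map, List.mem_filter, decide_eq_true_eq]
  constructor
  · rintro ⟨b, ⟨h1, h2⟩, rfl⟩; exact ⟨b, h1, h2, rfl⟩
  · rintro ⟨b, h1, h2, rfl⟩; exact ⟨b, ⟨h1, h2⟩, rfl⟩

theorem history_events (b : Block V Λ Ω n) : history b.events = b.events := by
  apply history_of_no_abort
  intro e he hk
  rcases kind_of_mem_opEvents he with h2 | h2 | h2
  · rw [hk] at h2; simp at h2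
  · rw [hk] at h2; exact h2.2 trivial
  · rw [hk] at h2; simp at h2

theorem opHist_missing_not_mem {α : List (Event V Λ Ω n)} {A : List (Block V Λ Ω n)} {π : OpId n}
    (h : ∀ b ∈ A, b.op ≠ π) : opHist (missing α A) π = [] := by
  apply opHist_eq_nil
  rintro ⟨e, he, ho⟩
  obtain ⟨b, hb, -, rfl⟩ := mem_missing.1 he
  exact h b hb ho

theorem opHist_missing {α : List (Event V Λ Ω n)} {A : List (Block V Λ Ω n)}
    (hn : (A.map Block.op).Nodup) {b : Block V Λ Ω n} (hb : b ∈ A) :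
    opHist (missing α A) b.op = if Ended α b.op then [] else [⟨b.op, .res b.resp⟩] := by
  obtain ⟨X, Y, rfl⟩ := List.append_of_mem hb
  simp only [List.map_append, List.map_cons] at hn
  have hn' := List.nodup_append.1 hn
  have hX : opHist (missing α X) b.op = [] := opHist_missing_not_mem fun b' hb' ho =>
    hn'.2.2 b'.op (List.mem_map_of_mem hb') b.op (by simp) ho
  have hY : opHist (missing α Y) b.op = [] := opHist_missing_not_mem fun b' hb' ho =>
    (List.nodup_cons.1 hn'.2.1).1 (ho ▸ List.mem_map_of_mem hb')
  have e : missing α (X ++ b :: Y) =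
      missing α X ++ ((if Ended α b.op then [] else [⟨b.op, .res b.resp⟩]) ++ missing α Y) := by
    unfold missing
    rw [List.filter_append, List.map_append]
    congr 1
    by_cases hE : Ended α b.op <;> simp [hE]
  rw [e, opHist_append, opHist_append, hX, hY, List.nil_append, List.append_nil]
  by_cases hE : Ended α b.op <;> simp [hE, opHist]

/-- In the completion, the operations that have taken effect are complete. -/
theorem SerInv.opHist_completion {D : SearchData V Λ Ω} {α : List (Event V Λ Ω n)}
    {A : List (Block V Λ Ω n)} {m : Mem V Λ} (h : SerInv D α A m) {b : Block V Λ Ω n}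
    (hb : b ∈ A) : opHist (history α ++ missing α A) b.op = b.events := by
  rw [opHist_append, opHist_history, opHist_missing h.nodup hb]
  rcases h.blocks b hb with h1 | h1
  · have hE : Ended α b.op := by
      have : ⟨b.op, .res b.resp⟩ ∈ opHist α b.op := by rw [h1]; exact res_mem_events b
      exact ⟨_, (mem_opHist.1 this).1, rfl, trivial⟩
    rw [h1, if_pos hE, history_events, List.append_nil]
  · have hE : ¬ Ended α b.op := by
      rintro ⟨e, he, ho, hend⟩
      have : e ∈ opHist α b.op := mem_opHist.2 ⟨he, ho⟩
      rw [h1] at this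
      rcases kind_of_mem_opEvents this with h1 | h1 | h1
      · rw [h1] at hend; exact hend
      · exact h1.2 hend
      · simp at h1
    rw [h1, if_neg hE, history_opEvents, List.map_nil, history, List.append_nil]
    unfold Block.events
    rw [show ([.res b.resp] : List (EvKind V Λ Ω)) = [] ++ [.res b.resp] from rfl, opEvents_tail]

theorem events_filter_abort (b : Block V Λ Ω n) :
    b.events.filter (fun e => e.kind ≠ .abort) = b.events := by
  unfold Block.events
  rw [opEvents_filter_abort]
  simp

/-- The missing responses complete the execution. -/
theorem SerInv.completion {α : List (Event V Λ Ω n)}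
    {A : List (Block V Λ Ω n)} {m : Mem V Λ} (h : SerInv D.toSearchData α A m) :
    Completion D.toSearchData (history α) (history α ++ missing α A) := by
  refine ⟨_, rfl, ?_⟩
  intro e he
  obtain ⟨b, hb, hE, rfl⟩ := mem_missing.1 he
  refine ⟨⟨_, rfl⟩, ?_, ?_, ?_⟩
  · obtain ⟨ω, hω⟩ := h.lin.invoked _ (List.mem_map_of_mem hb)
    exact ⟨_, mem_history_of_not_accInv hω (by simp [EvKind.IsAccInv]), rfl⟩
  · rintro ⟨e, he, h⟩
    exact hE ⟨e, (history_sublist α).subset he, h⟩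
  · obtain ⟨h1, h2⟩ := (chain_reach .init h.chain).2 b hb
    obtain ⟨S, hS, hl⟩ := seqPossible_seqHist (π := b.op) h1 (.inr (.inr ⟨_, h2, rfl⟩))
    refine ⟨S, hS, ?_⟩
    rw [hl, localHist_eq_filter, h.opHist_completion hb, events_filter_abort]
    rfl

theorem returned_completion_iff {α : List (Event V Λ Ω n)} {D : SearchData V Λ Ω}
    {A : List (Block V Λ Ω n)} {m : Mem V Λ} (h : SerInv D α A m) (π : OpId n) :
    Returned (history α ++ missing α A) π ↔ ∃ b ∈ A, b.op = π := by
  constructor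
  · rintro ⟨r, hr⟩
    rcases List.mem_append.1 hr with hr | hr
    · exact h.returned π ⟨r, (history_sublist α).subset hr⟩
    · obtain ⟨b, hb, -, e⟩ := mem_missing.1 hr
      simp only [Event.mk.injEq] at e
      exact ⟨b, hb, e.1.symm⟩
  · rintro ⟨b, hb, rfl⟩
    have : ⟨b.op, .res b.resp⟩ ∈ opHist (history α ++ missing α A) b.op := by
      rw [h.opHist_completion hb]; exact res_mem_events b
    exact ⟨_, (mem_opHist.1 this).1⟩

theorem exec_sorted {D : SearchData V Λ Ω} {α : List (Event V Λ Ω n)} {C : I.Conf}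
    (hα : I.Exec D α C) :
    α.Pairwise fun e e' => e.op.1 = e'.op.1 → e.op.2 ≤ e'.op.2 := by
  induction hα with
  | nil => simp
  | @step α C C' p e hα hs ih =>
    cases e with
    | none => simpa using ih
    | some e =>
      rw [Option.toList_some, List.pairwise_append]
      refine ⟨ih, by simp, ?_⟩
      intro a ha b hb hab
      rw [List.mem_singleton.1 hb] at hab ⊢
      have := exec_occurs_le hα ⟨a, ha, rfl⟩
      rw [step_op hs] at hab ⊢
      simp only at hab ⊢
      rw [← hab]
      exact this

theorem not_precedes_self {D : SearchData V Λ Ω} {α : List (Event V Λ Ω n)} {C : I.Conf}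
    (hα : I.Exec D α C) (π : OpId n) : ¬ Precedes α π π := by
  rintro ⟨l₁, l₂, rfl, ⟨x, hx, hxo, hE⟩, y, hy, hyo, -⟩
  obtain ⟨m₁, m₂, rfl⟩ := List.append_of_mem hx
  exact exec_end_last hα m₁ x (m₂ ++ l₂) (by simp) hE ⟨y, by simp [hy], by rw [hxo, hyo]⟩

theorem precedes_completion {α : List (Event V Λ Ω n)}
    {A : List (Block V Λ Ω n)} {π π' : OpId n}
    (h : Precedes (history α ++ missing α A) π π') : Precedes α π π' := by
  apply precedes_of_sublist (history_sublist α)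
  obtain ⟨l₁, l₂, hl, hE, y, hy, hyo, hi⟩ := h
  rcases List.append_eq_append_iff.1 hl with ⟨t, h1, h2⟩ | ⟨t, h1, h2⟩
  · -- the second part consists of missing responses only
    exfalso
    have : y ∈ missing α A := by rw [h2]; simp [hy]
    obtain ⟨b, -, -, rfl⟩ := mem_missing.1 this
    exact hi
  · refine ⟨l₁, t, h1, hE, y, ?_, hyo, hi⟩
    rw [h2] at hy
    rcases List.mem_append.1 hy with hy | hy
    · exact hy
    · obtain ⟨b, -, -, rfl⟩ := mem_missing.1 hy
      exact absurd hi id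

/-- In a serialization, earlier operations of a process come first. -/
theorem SerInv.sorted {D : SearchData V Λ Ω} {α : List (Event V Λ Ω n)}
    {A : List (Block V Λ Ω n)} {m : Mem V Λ} {C : I.Conf} (hα : I.Exec D α C)
    (h : SerInv D α A m) :
    (flat A).Pairwise fun e e' => e.op.1 = e'.op.1 → e.op.2 ≤ e'.op.2 := by
  have h1 := h.lin.order
  rw [List.pairwise_map] at h1
  rw [flat, List.pairwise_flatMap]
  constructor
  · intro b hb
    refine List.Pairwise.imp_of_mem (R := fun _ _ => True) ?_
      (by simp [List.pairwise_iff_forall_sublist])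
    intro e e' he he' _ _
    rw [op_of_mem_events he, op_of_mem_events he']
  · refine List.Pairwise.imp_of_mem ?_ h1
    intro b b' hb hb' hbb e he e' he' hp
    rw [op_of_mem_events he, op_of_mem_events he'] at hp ⊢
    by_contra hc
    apply hbb
    have := h.lin.occurs (List.mem_map_of_mem hb)
    have h2 : b.op = (b'.op.1, b.op.2) := by rw [← hp]
    simp only [Block.entry] at this ⊢
    rw [h2] at this ⊢
    exact exec_precedes hα (i := b'.op.2) (j := b.op.2) (by omega) this

theorem opHist_filter_proc (H : List (Event V Λ Ω n)) (p : Fin n) (π : OpId n) :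
    opHist (procHist H p) π = if π.1 = p then opHist H π else [] := by
  unfold procHist opHist
  rw [List.filter_filter]
  split
  · rename_i h
    congr 1
    funext e
    by_cases he : e.op = π <;> simp [he, h]
  · rename_i h
    rw [List.filter_eq_nil_iff]
    intro e _ he
    simp only [Bool.and_eq_true, decide_eq_true_eq] at he
    exact h (by rw [← he.1]; exact he.2)

theorem opHist_completeHist (H : List (Event V Λ Ω n)) (π : OpId n) :
    opHist (completeHist H) π = if Returned H π then opHist H π else [] := by
  unfold completeHist opHist
  rw [List.filter_filter]
  split
  · rename_i h
    congr 1
    funext e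
    by_cases he : e.op = π <;> simp [he, h]
  · rename_i h
    rw [List.filter_eq_nil_iff]
    intro e _ he
    simp only [Bool.and_eq_true, decide_eq_true_eq] at he
    exact h (by rw [← he.1]; exact he.2)

/-- Completed by the missing responses, the execution has the same complete operations as the
serialization. -/
theorem SerInv.strictlySerializable {α : List (Event V Λ Ω n)}
    {A : List (Block V Λ Ω n)} {m : Mem V Λ} {C : I.Conf} (hα : I.Exec D.toSearchData α C)
    (h : SerInv D.toSearchData α A m) : StrictlySerializable D.toSearchData α := by
  refine ⟨_, flat A, h.completion, ?_, (chain_legal h.chain).1, ?_, ?_⟩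
  · by_cases hA : A = []
    · subst hA
      rintro π π' ⟨e, he, -⟩
      simp [flat] at he
    · have := sequential_flat (A := A) (R := [])
        (π := ((A.head hA).op.1, (A.map fun b => b.op.2).sum + 1))
        (by simp) (by simp) (by
          intro b hb e
          have h2 : b.op.2 ≤ (A.map fun b => b.op.2).sum :=
            List.single_le_sum (by simp) _
              (List.mem_map_of_mem (f := fun b : Block V Λ Ω n => b.op.2) hb)
          rw [e] at h2
          simp at h2)
      simpa using this
  · intro p
    apply eq_of_opHist_eq (p := p)
    · simp [procHist]
    · simp [procHist]
    · have := (h.sorted hα).filter (fun e => e.op.1 = p)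
      refine List.Pairwise.imp_of_mem ?_ this
      intro e e' he he' hee
      simp only [procHist, List.mem_filter, decide_eq_true_eq] at he he'
      exact hee (he.2.trans he'.2.symm)
    · have h1 : (history α ++ missing α A).Pairwise
          (fun e e' => e.op.1 = e'.op.1 → e.op.2 ≤ e'.op.2) := by
        rw [List.pairwise_append]
        have hmis : ∀ e ∈ missing α A, Occurs α e.op ∧ C.cnt e.op.1 ≤ e.op.2 := by
          intro e he
          obtain ⟨b, hb, hE, rfl⟩ := mem_missing.1 he
          refine ⟨h.lin.occurs (List.mem_map_of_mem hb), ?_⟩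
          rw [exec_ended_iff hα] at hE
          simpa using hE
        refine ⟨(exec_sorted hα).sublist (history_sublist α), ?_, ?_⟩
        · refine List.Pairwise.imp_of_mem (R := fun _ _ => True) ?_
            (by simp [List.pairwise_iff_forall_sublist])
          intro e e' he he' _ hee
          have h1 := exec_occurs_le hα (hmis e he).1
          have h2 := (hmis e' he').2
          rw [← hee] at h2
          omega
        · intro e he e' he' hee
          have h1 := exec_occurs_le hα ⟨e, (history_sublist α).subset he, rfl⟩
          have h2 := (hmis e' he').2
          rw [← hee] at h2
          omega
      have h2 := (h1.sublist (List.filter_sublist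
        (p := fun e => decide (Returned (history α ++ missing α A) e.op)))).filter
        (fun e => e.op.1 = p)
      refine List.Pairwise.imp_of_mem ?_ h2
      intro e e' he he' hee
      simp only [procHist, List.mem_filter, decide_eq_true_eq] at he he'
      exact hee (he.2.trans he'.2.symm)
    · intro π
      rw [opHist_filter_proc, opHist_filter_proc]
      split
      · rw [opHist_completeHist]
        by_cases hπ : ∃ b ∈ A, b.op = π
        · rw [if_pos ((returned_completion_iff h π).2 hπ)]
          obtain ⟨b, hb, rfl⟩ := hπ
          rw [h.opHist_completion hb, opHist_flat h.nodup hb]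
        · rw [if_neg (mt (returned_completion_iff h π).1 hπ)]
          exact opHist_eq_nil (mt occurs_flat.1 hπ)
      · rfl
  · intro π π' hp
    have hp' := precedes_completion
      (precedes_of_sublist List.filter_sublist hp)
    have hocc : ∀ π, Occurs (completeHist (history α ++ missing α A)) π → ∃ b ∈ A, b.op = π := by
      rintro π ⟨e, he, rfl⟩
      rw [completeHist, List.mem_filter, decide_eq_true_eq] at he
      exact (returned_completion_iff h _).1 he.2
    obtain ⟨⟨e, he, ho, -⟩, h2⟩ := precedes_ended hp
    obtain ⟨b, hb, rfl⟩ := hocc π ⟨e, he, ho⟩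
    obtain ⟨b', hb', rfl⟩ := hocc π' h2
    have hne : b ≠ b' := by
      rintro rfl
      exact not_precedes_self hα _ hp'
    obtain ⟨X, Y, rfl⟩ := List.append_of_mem hb
    have hY : b' ∈ Y := by
      rcases List.mem_append.1 hb' with hb' | hb'
      · exfalso
        have h1 := h.lin.order
        rw [List.map_append, List.pairwise_append] at h1
        exact h1.2.2 _ (List.mem_map_of_mem hb') _ (List.mem_map_of_mem List.mem_cons_self) hp'
      · rcases List.mem_cons.1 hb' with rfl | hb'
        · exact absurd rfl hne
        · exact hb'
    have := precedes_flat (X := X) (Y := Y) (b := b) (R := []) (π := b'.op)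
      ⟨b'.call, List.mem_append_left _ (mem_flat.2 ⟨b', hY, inv_mem_events b'⟩)⟩
    simpa using this

/-- An operation whose reads come from the memory after the operations `A` observes the legal
sequential execution of the operations `A`. -/
theorem SerInv.safe {α : List (Event V Λ Ω n)} {A B : List (Block V Λ Ω n)} {m s : Mem V Λ}
    (h : SerInv D.toSearchData α (A ++ B) m) (hA : Chain D.toSearchData (fun _ => ∅) A s)
    {π : OpId n} (hπ : ∀ b ∈ A, b.op ≠ π) {c : Call V Ω} {l : List (Access V Λ)}
    {t : List (EvKind V Λ Ω)} (hl : localHist (history α) π = opEvents π c l t)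
    (hr : Runs D.toSearchData c s [] l) (ht : Silent t) :
    ∃ H' α' : List (Event V Λ Ω n), Completion D.toSearchData (history α) H' ∧
      Sequential α' ∧ Legal α' ∧
      (∀ π', Occurs α' π' → π' ≠ π → Returned H' π' ∧ Precedes α' π' π ∧
        localHist α' π' = localHist H' π') ∧
      localHist α' π = localHist (history α) π := by
  have hnodup : (A.map Block.op).Nodup := by
    have := h.nodup
    rw [List.map_append] at this
    exact (List.nodup_append.1 this).1
  have hinv : ⟨π, .inv c⟩ ∈ opEvents π c l t := by simp [opEvents]
  refine ⟨_, flat A ++ opEvents π c l t, h.completion, ?_, ?_, ?_, ?_⟩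
  · exact sequential_flat (π := π) (fun e he => op_of_mem_opEvents he) (fun _ => ⟨c, hinv⟩) hπ
  · obtain ⟨h1, h2⟩ := chain_legal hA
    refine legalFrom_append.2 ⟨h1, ?_⟩
    rw [h2]
    exact (legal_opEvents_iff (follows_of_runs hr) ht).1.2 hr
  · rintro π' ⟨e, he, rfl⟩ hne
    rcases List.mem_append.1 he with he | he
    · obtain ⟨b, hb, heb⟩ := mem_flat.1 he
      have ho := op_of_mem_events heb
      rw [ho] at hne ⊢
      have hb' : b ∈ A ++ B := by simp [hb]
      refine ⟨(returned_completion_iff h _).2 ⟨b, hb', rfl⟩, ?_, ?_⟩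
      · obtain ⟨X, Y, rfl⟩ := List.append_of_mem hb
        exact precedes_flat ⟨c, List.mem_append_right _ hinv⟩
      · rw [localHist_eq_filter, localHist_eq_filter, h.opHist_completion hb', opHist_append,
          opHist_flat hnodup hb, opHist_eq_nil (α := opEvents π c l t), List.append_nil]
        rintro ⟨e', he', ho'⟩
        rw [op_of_mem_opEvents he'] at ho'
        exact hne ho'.symm
    · exact absurd (op_of_mem_opEvents he) hne
  · rw [localHist_eq_filter, opHist_append, opHist_eq_nil (α := flat A), List.nil_append,
      opHist_opEvents, ← hl]
    · rw [localHist_eq_filter, List.filter_filter]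
      simp
    · rw [occurs_flat]
      rintro ⟨b, hb, ho⟩
      exact hπ b hb ho

end SerializationInvariant

/-! ### An implementation with snapshots -/

section Snapshots

variable {V Λ Ω : Type} {n : ℕ}

/-- The base objects of the snapshot implementation: the committed memory, the number of
commits, and the process that holds the right to commit. -/
structure SnapState (V Λ : Type) (n : ℕ) where
  mem : Mem V Λ
  ver : ℕ
  owner : Option (Fin n)

/-- Local states of the snapshot implementation: no snapshot yet; working on a snapshot `s` of
version `v`; having acquired the right to commit; having failed to acquire it; having
committed. -/
inductive SnapLoc (V Λ : Type) where
  | start : SnapLoc V Λ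
  | running (s : Mem V Λ) (v : ℕ) : SnapLoc V Λ
  | locked (s : Mem V Λ) : SnapLoc V Λ
  | failed (s : Mem V Λ) : SnapLoc V Λ
  | published : SnapLoc V Λ

/-- The snapshot implementation. An operation takes a snapshot of the committed memory and reads
from it; writes are buffered. The last write succeeds only if nothing has been committed since
the snapshot and no commit is in progress, and otherwise aborts the operation. The writes are
committed, all at once, between the last write and the response. -/
noncomputable abbrev snapshotImpl (D : SearchData V Λ Ω) (n : ℕ) : Impl V Λ Ω n where
  Sh := SnapState V Λ n
  Loc := SnapLoc V Λ
  sh₀ := ⟨fun _ => ∅, 0, none⟩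
  loc₀ := fun _ => .start
  ready := fun _ l _ h => match l with
    | .start => .prim fun sh => some (sh, .running sh.mem sh.ver)
    | .locked s => .prim fun sh => some (⟨accMem s h, sh.ver + 1, none⟩, .published)
    | _ => .proceed
  serve := fun p l c h a => match l, a with
    | .running s _, .read x => .reply (s x)
    | .running s v, .write x e => match D.next c (h ++ [.write x e]) with
      | .ret _ => .prim fun sh =>
          if sh.owner = none ∧ sh.ver = v then some ({ sh with owner := some p }, .locked s)
          else some (sh, .failed s)
      | .req _ => .reply e
    | .locked _, _ => .reply ∅
    | _, _ => .abort
  obs := fun _ l k => match k with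
    | .inv _ => .start
    | .res _ => .start
    | .abort => .start
    | _ => l

/-- `s` is the memory at a point of the serialization `A` after all operations that precede
`π`. -/
def SnapOk (D : SearchData V Λ Ω) (α : List (Event V Λ Ω n)) (A : List (Block V Λ Ω n))
    (π : OpId n) (s : Mem V Λ) : Prop :=
  ∃ A₁ A₂, A = A₁ ++ A₂ ∧ Chain D (fun _ => ∅) A₁ s ∧ ∀ b ∈ A₂, ¬ Precedes α b.op π

/-- The invariant of a process in the snapshot implementation. -/
def SnapProc (D : SearchData V Λ Ω) (α : List (Event V Λ Ω n)) (A : List (Block V Λ Ω n))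
    (sh : SnapState V Λ n) (π : OpId n) : SnapLoc V Λ → Phase V Λ Ω → Prop
  | .start, .idle => True
  | .start, .ready _ h => h = []
  | .running s v, .ready c h => SnapOk D α A π s ∧ Runs D c s [] h ∧ v ≤ sh.ver ∧
      (v = sh.ver → s = sh.mem) ∧ ((∃ r, D.next c h = .ret r) → numWrites h = 0)
  | .running s v, .pending c h _ => SnapOk D α A π s ∧ Runs D c s [] h ∧ v ≤ sh.ver ∧
      (v = sh.ver → s = sh.mem)
  | .locked s, .ready c h => SnapOk D α A π s ∧ Runs D c s [] h ∧ s = sh.mem ∧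
      ∃ r, D.next c h = .ret r
  | .locked s, .pending c h a => SnapOk D α A π s ∧ Runs D c s [] h ∧ s = sh.mem ∧
      ∃ x e r, a = .write x e ∧ D.next c (h ++ [.write x e]) = .ret r
  | .failed s, .pending c h _ => SnapOk D α A π s ∧ Runs D c s [] h
  | .published, .ready c h => ∃ b ∈ A, b.op = π ∧ b.call = c ∧ b.acc = h ∧
      D.next c h = .ret b.resp
  | _, _ => False

/-- The invariant of the snapshot implementation. -/
structure SnapInv (D : SearchData V Λ Ω) (α : List (Event V Λ Ω n))
    (C : (snapshotImpl D n).Conf) (A : List (Block V Λ Ω n)) : Prop where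
  ser : SerInv D α A C.sh.mem
  owner : ∀ p, C.sh.owner = some p ↔ ∃ s, C.loc p = .locked s
  unended : ∀ b ∈ A, ¬ Ended α b.op → C.loc b.op.1 = .published
  procs : ∀ p, SnapProc D α A C.sh (p, C.cnt p) (C.loc p) (C.phase p)

theorem SnapOk.event {D : SearchData V Λ Ω} {α : List (Event V Λ Ω n)}
    {A : List (Block V Λ Ω n)} {π : OpId n} {s : Mem V Λ} (h : SnapOk D α A π s)
    {e : Event V Λ Ω n} (he : e.kind.IsInv → e.op ≠ π) : SnapOk D (α ++ [e]) A π s := by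
  obtain ⟨A₁, A₂, rfl, h1, h2⟩ := h
  refine ⟨A₁, A₂, rfl, h1, fun b hb hp => ?_⟩
  rcases precedes_snoc.1 hp with hp | ⟨ho, hi, -⟩
  · exact h2 b hb hp
  · exact he hi ho

/-- An operation that has not ended precedes no other, so it can take effect last. -/
theorem SnapOk.append {D : SearchData V Λ Ω} {α : List (Event V Λ Ω n)}
    {A : List (Block V Λ Ω n)} {π : OpId n} {s : Mem V Λ} (h : SnapOk D α A π s)
    {b : Block V Λ Ω n} (hE : ¬ Ended α b.op) : SnapOk D α (A ++ [b]) π s := by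
  obtain ⟨A₁, A₂, rfl, h1, h2⟩ := h
  refine ⟨A₁, A₂ ++ [b], by simp, h1, ?_⟩
  intro b' hb' hp
  rcases List.mem_append.1 hb' with hb' | hb'
  · exact h2 b' hb' hp
  · rw [List.mem_singleton.1 hb'] at hp
    exact hE (precedes_ended hp).1

/-- Inserting a read-only operation leaves all points of the serialization available. -/
theorem SnapOk.insert {D : SearchData V Λ Ω} {α : List (Event V Λ Ω n)}
    {A B : List (Block V Λ Ω n)} {π : OpId n} {s s' : Mem V Λ} (h : SnapOk D α (A ++ B) π s)
    {b : Block V Λ Ω n} (hE : ¬ Ended α b.op) (hA : Chain D (fun _ => ∅) A s')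
    (hb : D.Completes b.call s' b.acc s' b.resp) : SnapOk D α (A ++ b :: B) π s := by
  obtain ⟨A₁, A₂, hAB, h1, h2⟩ := h
  rcases List.append_eq_append_iff.1 hAB with ⟨t, ht1, ht2⟩ | ⟨t, ht1, ht2⟩
  · subst ht1 ht2
    exact ⟨A ++ b :: t, A₂, by simp, chain_insert hA h1 hb, h2⟩
  · subst ht1 ht2
    refine ⟨A₁, t ++ b :: B, by simp, h1, ?_⟩
    intro b' hb' hp
    rw [List.mem_append, List.mem_cons] at hb'
    rcases hb' with hb' | rfl | hb'
    · exact h2 b' (by simp [hb']) hp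
    · exact hE (precedes_ended hp).1
    · exact h2 b' (by simp [hb']) hp

/-- The steps of other processes preserve the invariant of a process, if they do not change the
committed memory without changing the version, and not while this process commits. -/
theorem SnapProc.mono {D : SearchData V Λ Ω} {α α' : List (Event V Λ Ω n)}
    {A A' : List (Block V Λ Ω n)} {sh sh' : SnapState V Λ n} {π : OpId n} {l : SnapLoc V Λ}
    {φ : Phase V Λ Ω} (h : SnapProc D α A sh π l φ)
    (hs : ∀ s, SnapOk D α A π s → SnapOk D α' A' π s) (hA : ∀ b ∈ A, b ∈ A')
    (hv : sh.ver ≤ sh'.ver) (hm : sh'.ver = sh.ver → sh'.mem = sh.mem)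
    (hl : ∀ s, l = .locked s → sh'.mem = sh.mem) : SnapProc D α' A' sh' π l φ := by
  cases l <;> cases φ <;> simp only [SnapProc] at h ⊢
  · exact h
  · obtain ⟨h1, h2, h3, h4, h5⟩ := h
    refine ⟨hs _ h1, h2, h3.trans hv, fun e => ?_, h5⟩
    have : sh'.ver = sh.ver := by omega
    rw [hm this]
    exact h4 (by omega)
  · obtain ⟨h1, h2, h3, h4⟩ := h
    refine ⟨hs _ h1, h2, h3.trans hv, fun e => ?_⟩
    have : sh'.ver = sh.ver := by omega
    rw [hm this]
    exact h4 (by omega)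
  · rw [hl _ rfl]
    exact ⟨hs _ h.1, h.2⟩
  · rw [hl _ rfl]
    exact ⟨hs _ h.1, h.2⟩
  · exact ⟨hs _ h.1, h.2⟩
  · obtain ⟨b, hb, h⟩ := h
    exact ⟨b, hA b hb, h⟩

variable {D : SearchData V Λ Ω} {α : List (Event V Λ Ω n)} {C C' : (snapshotImpl D n).Conf}
  {A : List (Block V Λ Ω n)} {p : Fin n}

theorem SnapInv.fresh (h : SnapInv D α C A) (hα : (snapshotImpl D n).Exec D α C)
    (hp : C.loc p ≠ .published) : ∀ b ∈ A, b.op ≠ (p, C.cnt p) := by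
  intro b hb e
  have hE : ¬ Ended α b.op := by
    rw [exec_ended_iff hα, e]; simp
  have := h.unended b hb hE
  rw [e] at this
  exact hp this

theorem SnapInv.event (h : SnapInv D α C A) (hα : (snapshotImpl D n).Exec D α C)
    {e : Event V Λ Ω n} (hs : Impl.Step D C p (some e) C') (hsh : C'.sh = C.sh)
    (hp : C.loc p ≠ .published) (hr : ∀ r, e.kind ≠ .res r)
    (hlock : ∀ s, C'.loc p = .locked s ↔ C.loc p = .locked s)
    (hproc : SnapProc D (α ++ [e]) A C.sh (p, C'.cnt p) (C'.loc p) (C'.phase p)) :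
    SnapInv D (α ++ [e]) C' A := by
  have hfresh := h.fresh hα hp
  have ho := step_op hs
  obtain ⟨hoth, -⟩ := step_local hs
  refine ⟨?_, ?_, ?_, ?_⟩
  · rw [hsh]
    exact h.ser.event (.step hα hs) (fun b hb => by rw [ho]; exact hfresh b hb) hr
  · intro q
    rw [hsh, h.owner q]
    by_cases hq : q = p
    · subst hq; simp only [hlock]
    · rw [(hoth q hq).2.2]
  · intro b hb hE
    have hE' : ¬ Ended α b.op := by
      rintro ⟨x, hx, h⟩
      exact hE ⟨x, by simp [hx], h⟩
    have h1 := h.unended b hb hE'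
    by_cases hq : b.op.1 = p
    · exact absurd (by rw [← hq]; exact h1) hp
    · rw [(hoth _ hq).2.2]; exact h1
  · intro q
    rw [hsh]
    by_cases hq : q = p
    · subst hq; exact hproc
    · obtain ⟨h1, h2, h3⟩ := hoth q hq
      rw [h1, h2, h3]
      refine (h.procs q).mono ?_ (fun b hb => hb) le_rfl (fun _ => rfl) (fun _ _ => rfl)
      intro s hso
      refine hso.event ?_
      rintro - e'
      rw [ho] at e'
      simp only [Prod.mk.injEq] at e'
      exact hq e'.1.symm

theorem completes_readOnly {c : Call V Ω} {s : Mem V Λ} {h : List (Access V Λ)} {r : DictResp V}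
    (hr : Runs D c s [] h) (hn : D.next c h = .ret r) (hw : numWrites h = 0) :
    D.Completes c s h s r := by
  refine ⟨seqRun_iff.2 ⟨hr, ?_⟩, hn⟩
  have := (seqRun_shape (seqRun_iff.2 ⟨hr, rfl⟩)).2.1
  rw [hw, List.take_zero] at this
  exact this.symm

/-- An operation that writes takes effect at its commit, at the end of the serialization; a
read-only operation takes effect at the point of its snapshot, when it responds. -/
theorem SnapInv.step (h : SnapInv D α C A) (hα : (snapshotImpl D n).Exec D α C)
    {e : Option (Event V Λ Ω n)} (hs : Impl.Step D C p e C') :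
    ∃ A', SnapInv D (α ++ e.toList) C' A' := by
  have hproc := h.procs p
  have hloc := exec_local hα p
  obtain ⟨hoth, -⟩ := step_local hs
  have hnE : ¬ Ended α (p, C.cnt p) := by rw [exec_ended_iff hα]; simp
  cases hs with
  | invoke c hp =>
    rw [hp] at hproc
    cases hl : C.loc p <;> rw [hl] at hproc <;> simp only [SnapProc] at hproc
    refine ⟨A, h.event hα (.invoke c hp) rfl (by rw [hl]; nofun) (by simp) ?_ ?_⟩
    · simp [Impl.afterEvent, snapshotImpl, hl]
    · simp [Impl.afterEvent, snapshotImpl, SnapProc]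
  | @readyPrim c h' f s l hp hr hf =>
    rw [hp] at hproc hloc
    cases hl : C.loc p <;> rw [hl] at hproc hr <;> simp only [SnapProc] at hproc <;>
      simp only [snapshotImpl, reduceCtorEq] at hr
    · -- a snapshot of the committed memory is taken
      obtain rfl := ReadyAct.prim.inj hr
      simp only [Option.some.injEq, Prod.mk.injEq] at hf
      obtain ⟨rfl, rfl⟩ := hf
      subst hproc
      refine ⟨A, ?_⟩
      rw [Option.toList_none, List.append_nil]
      refine ⟨h.ser, ?_, ?_, ?_⟩
      · intro q
        by_cases hq : q = p
        · subst hq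
          simp only [Impl.afterPrim, Function.update_self, reduceCtorEq, exists_false, iff_false]
          intro ho
          obtain ⟨s, hs⟩ := (h.owner q).1 ho
          rw [hl] at hs; simp at hs
        · simpa [Impl.afterPrim, hq] using h.owner q
      · intro b hb hE
        have h1 := h.unended b hb hE
        by_cases hq : b.op.1 = p
        · rw [hq, hl] at h1; simp at h1
        · simpa [Impl.afterPrim, hq] using h1
      · intro q
        by_cases hq : q = p
        · subst hq
          simp only [Impl.afterPrim, Function.update_self, hp, SnapProc]
          refine ⟨⟨A, [], by simp, h.ser.chain, by simp⟩, trivial, le_rfl,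
            fun _ => trivial, fun _ => rfl⟩
        · simpa [Impl.afterPrim, hq] using h.procs q
    · -- the writes are committed
      obtain rfl := ReadyAct.prim.inj hr
      simp only [Option.some.injEq, Prod.mk.injEq] at hf
      obtain ⟨rfl, rfl⟩ := hf
      obtain ⟨h1, h2, h3, r, h4⟩ := hproc
      simp only [Option.toList_none, List.append_nil]
      have hfresh := h.fresh hα (p := p) (by rw [hl]; nofun)
      have hc : D.Completes c C.sh.mem h' (accMem C.sh.mem h') r :=
        ⟨seqRun_iff.2 ⟨h3 ▸ h2, rfl⟩, h4⟩
      have hser : SerInv D α (A ++ [⟨(p, C.cnt p), c, h', r⟩]) (accMem C.sh.mem h') := by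
        have := h.ser
        rw [← List.append_nil A] at this
        refine this.insert (b := ⟨(p, C.cnt p), c, h', r⟩) ?_ (by simpa using hfresh)
          hloc.2.1.1 (by simp)
        exact chain_append.2 ⟨_, h.ser.chain, _, hc, rfl⟩
      refine ⟨_, ⟨by rw [h3]; exact hser, ?_, ?_, ?_⟩⟩
      · intro q
        simp only [Impl.afterPrim, reduceCtorEq, false_iff, not_exists]
        intro s' hs'
        by_cases hq : q = p
        · subst hq; simp at hs'
        · rw [Function.update_of_ne hq] at hs'
          have h5 := (h.owner q).2 ⟨s', hs'⟩
          have h6 := (h.owner p).2 ⟨_, hl⟩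
          rw [h6] at h5
          exact hq (by simpa using h5.symm)
      · intro b hb hE
        by_cases hq : b.op.1 = p
        · simp [Impl.afterPrim, hq]
        · rcases List.mem_append.1 hb with hb | hb
          · simpa [Impl.afterPrim, hq] using h.unended b hb hE
          · rw [List.mem_singleton.1 hb] at hq
            exact absurd rfl hq
      · intro q
        by_cases hq : q = p
        · subst hq
          simp only [Impl.afterPrim, Function.update_self, hp, SnapProc]
          exact ⟨⟨(q, C.cnt q), c, h', r⟩, by simp, rfl, rfl, rfl, h4⟩
        · simp only [Impl.afterPrim, Function.update_of_ne hq]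
          refine (h.procs q).mono (fun s hso => hso.append hnE) (by simp; tauto) (by simp)
            (by simp) ?_
          intro s' hs'
          have h5 := (h.owner q).2 ⟨s', hs'⟩
          have h6 := (h.owner p).2 ⟨_, hl⟩
          rw [h6] at h5
          exact absurd (by simpa using h5.symm) hq
  | @request c h' a hp hr hn =>
    rw [hp] at hproc
    cases hl : C.loc p <;> rw [hl] at hproc hr <;> simp only [SnapProc] at hproc <;>
      simp only [snapshotImpl, reduceCtorEq] at hr
    · refine ⟨A, h.event hα (.request hp (by simp [hl, snapshotImpl]) hn) rfl (by rw [hl]; nofun)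
        (by cases a <;> simp [Impl.reqKind]) ?_ ?_⟩
      · intro s'; cases a <;> simp [Impl.afterEvent, snapshotImpl, Impl.reqKind, hl]
      · have h1 := hproc.1.event (e := ⟨(p, C.cnt p), Impl.reqKind a⟩)
          (fun hi => absurd hi (reqKind_not_inv a))
        have : (Impl.afterEvent C p (Impl.reqKind a) (.pending c h' a)).loc p = C.loc p := by
          cases a <;> simp [Impl.afterEvent, snapshotImpl, Impl.reqKind]
        rw [this, hl]
        simp only [Impl.afterEvent, Function.update_self, SnapProc]
        exact ⟨h1, hproc.2.1, hproc.2.2.1, hproc.2.2.2.1⟩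
    · obtain ⟨b, -, -, -, -, h4⟩ := hproc
      rw [h4] at hn; simp at hn
  | @respond c h' r hp hr hn =>
    rw [hp] at hproc hloc
    have hE' : (snapshotImpl D n).Exec D (α ++ [⟨(p, C.cnt p), .res r⟩]) _ :=
      .step hα (.respond hp hr hn)
    have hmine : ∀ A' : List (Block V Λ Ω n),
        (∀ b ∈ A', b.op = (p, C.cnt p) ∨ b ∈ A) →
        ∀ b ∈ A', ¬ Ended (α ++ [⟨(p, C.cnt p), .res r⟩]) b.op →
        (Impl.afterEnd C p (.res r)).loc b.op.1 = .published := by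
      intro A' hA' b hb hE
      rcases hA' b hb with ho | hb'
      · exact absurd ⟨_, List.mem_append_right _ (List.mem_singleton_self _), ho.symm, trivial⟩ hE
      · have hE₀ : ¬ Ended α b.op := by
          rintro ⟨x, hx, h⟩
          exact hE ⟨x, by simp [hx], h⟩
        have h1 := h.unended b hb' hE₀
        have hocc := exec_occurs_le hα (h.ser.lin.occurs (List.mem_map_of_mem hb'))
        rw [exec_ended_iff hα] at hE₀
        by_cases hq : b.op.1 = p
        · exfalso
          apply hE
          refine ⟨_, List.mem_append_right _ (List.mem_singleton_self _), ?_, trivial⟩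
          simp only [Block.entry] at hocc
          have : b.op.2 = C.cnt b.op.1 := by omega
          rw [← hq, ← this]
        · simpa [Impl.afterEnd, hq] using h1
    have hown : ∀ q, (∀ s, C.loc p ≠ .locked s) → (C.sh.owner = some q ↔
        ∃ s, (Impl.afterEnd C p (.res r)).loc q = .locked s) := by
      intro q hnl
      rw [h.owner q]
      by_cases hq : q = p
      · subst hq
        simp only [Impl.afterEnd, Function.update_self, snapshotImpl, reduceCtorEq, exists_false,
          iff_false, not_exists]
        exact hnl
      · simp [Impl.afterEnd, hq]
    cases hl : C.loc p <;> rw [hl] at hproc hr <;> simp only [SnapProc] at hproc <;>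
      simp only [snapshotImpl, reduceCtorEq] at hr
    · -- a read-only operation takes effect at its snapshot
      obtain ⟨⟨A₁, A₂, rfl, h1, h2⟩, h3, -, -, h4⟩ := hproc
      rename_i s v
      have hc := completes_readOnly h3 hn (h4 ⟨r, hn⟩)
      have hfresh := h.fresh hα (p := p) (by rw [hl]; nofun)
      have hser := h.ser.insert (b := ⟨(p, C.cnt p), c, h', r⟩)
        (chain_insert h1 h.ser.chain hc) hfresh hloc.2.1.1 h2
      have hser' := hser.respond hE' (List.mem_append_right _ (List.mem_cons_self)) hloc.2.1.1
      refine ⟨_, hser', ?_, ?_, ?_⟩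
      · exact fun q => hown q (fun s => by rw [hl]; nofun)
      · apply hmine
        intro b hb
        rw [List.mem_append, List.mem_cons] at hb
        rcases hb with hb | rfl | hb
        · exact .inr (by simp [hb])
        · exact .inl rfl
        · exact .inr (by simp [hb])
      · intro q
        by_cases hq : q = p
        · subst hq
          simp [Impl.afterEnd, snapshotImpl, SnapProc]
        · simp only [Impl.afterEnd, Function.update_of_ne hq]
          refine (h.procs q).mono (fun s' hso => ?_) (by simp; tauto) le_rfl (fun _ => rfl)
            (fun _ _ => rfl)
          refine (hso.insert hnE h1 hc).event ?_
          simp [EvKind.IsInv]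
    · -- an operation that has committed responds
      obtain ⟨b, hb, hbo, rfl, rfl, h4⟩ := hproc
      rw [h4] at hn
      simp only [Cmd.ret.injEq] at hn
      subst hn
      rw [← hbo] at hE'
      have hser' := h.ser.respond hE' hb (by rw [hbo]; exact hloc.2.1.1)
      rw [hbo] at hser'
      refine ⟨_, hser', ?_, ?_, ?_⟩
      · exact fun q => hown q (fun s => by rw [hl]; nofun)
      · exact hmine A (fun b hb => .inr hb)
      · intro q
        by_cases hq : q = p
        · subst hq
          simp [Impl.afterEnd, snapshotImpl, SnapProc]
        · simp only [Impl.afterEnd, Function.update_of_ne hq]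
          refine (h.procs q).mono (fun s' hso => ?_) (fun _ hb => hb) le_rfl (fun _ => rfl)
            (fun _ _ => rfl)
          exact hso.event (by simp [EvKind.IsInv])
  | @servePrim c h' a f s l hp hr hf =>
    rw [hp] at hproc hloc
    cases hl : C.loc p <;> rw [hl] at hproc hr <;> simp only [SnapProc] at hproc <;> cases a <;>
      simp only [snapshotImpl, reduceCtorEq] at hr
    rename_i s₀ v x e
    split at hr
    swap
    · simp at hr
    rename_i r hn
    obtain rfl := ServeAct.prim.inj hr
    obtain ⟨h1, h2, h3, h4⟩ := hproc
    simp only [Option.toList_none, List.append_nil]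
    have hun : ∀ sh l', ∀ b ∈ A, ¬ Ended α b.op →
        (Impl.afterPrim C p sh l').loc b.op.1 = .published := by
      intro sh l' b hb hE
      have h1 := h.unended b hb hE
      by_cases hq : b.op.1 = p
      · rw [hq, hl] at h1; simp at h1
      · simpa [Impl.afterPrim, hq] using h1
    beta_reduce at hf
    split at hf
    · -- the right to commit is acquired
      rename_i hv
      simp only [Option.some.injEq, Prod.mk.injEq] at hf
      obtain ⟨rfl, rfl⟩ := hf
      refine ⟨A, h.ser, ?_, hun _ _, ?_⟩
      · intro q
        by_cases hq : q = p
        · subst hq; simp [Impl.afterPrim]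
        · have h5 := h.owner q
          rw [hv.1] at h5
          simp only [reduceCtorEq, false_iff, not_exists] at h5
          simp [Impl.afterPrim, hq, h5, Ne.symm hq]
      · intro q
        by_cases hq : q = p
        · subst hq
          simp only [Impl.afterPrim, Function.update_self, hp, SnapProc]
          exact ⟨h1, h2, h4 hv.2.symm, x, e, r, rfl, hn⟩
        · simp only [Impl.afterPrim, Function.update_of_ne hq]
          exact (h.procs q).mono (fun _ hs => hs) (fun _ hb => hb) le_rfl (fun _ => rfl)
            (fun _ _ => rfl)
    · -- the validation fails
      simp only [Option.some.injEq, Prod.mk.injEq] at hf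
      obtain ⟨rfl, rfl⟩ := hf
      refine ⟨A, h.ser, ?_, hun _ _, ?_⟩
      · intro q
        by_cases hq : q = p
        · subst hq
          have h5 := h.owner q
          rw [hl] at h5
          simpa [Impl.afterPrim] using h5
        · simpa [Impl.afterPrim, hq] using h.owner q
      · intro q
        by_cases hq : q = p
        · subst hq
          simp only [Impl.afterPrim, Function.update_self, hp, SnapProc]
          exact ⟨h1, h2⟩
        · simpa [Impl.afterPrim, hq] using h.procs q
  | @reply c h' a ex hp hr =>
    rw [hp] at hproc hloc
    have hn := hloc.2.1.2.2
    have hke : ∀ l : SnapLoc V Λ, (snapshotImpl D n).obs p l (Impl.replyKind ex a) = l := by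
      intro l; cases a <;> simp [snapshotImpl, Impl.replyKind]
    have hloc' : (Impl.afterEvent C p (Impl.replyKind ex a)
        (.ready c (h' ++ [Impl.replyAccess ex a]))).loc p = C.loc p := by
      simp only [Impl.afterEvent, Function.update_self]
      exact hke _
    have hki : ¬ (Impl.replyKind (Ω := Ω) ex a).IsInv := by
      cases a <;> simp [Impl.replyKind, EvKind.IsInv]
    have hphase : (Impl.afterEvent C p (Impl.replyKind ex a)
        (.ready c (h' ++ [Impl.replyAccess ex a]))).phase p =
          .ready c (h' ++ [Impl.replyAccess ex a]) := by
      simp [Impl.afterEvent]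
    have hnp : C.loc p ≠ .published := by
      intro hl; rw [hl] at hproc; exact hproc
    refine ⟨A, h.event hα (.reply hp hr) rfl hnp
        (by cases a <;> simp [Impl.replyKind]) (fun s => by rw [hloc']) ?_⟩
    rw [hloc', hphase]
    have hev : ∀ s, SnapOk D α A (p, C.cnt p) s →
        SnapOk D (α ++ [⟨(p, C.cnt p), Impl.replyKind ex a⟩]) A (p, C.cnt p) s :=
      fun s hs => hs.event (fun hi => absurd hi hki)
    cases hl : C.loc p <;> rw [hl] at hproc hr <;> simp only [SnapProc] at hproc
    · obtain ⟨h1, h2, h3, h4⟩ := hproc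
      rename_i s v
      cases a with
      | read x =>
        simp only [snapshotImpl, ServeAct.reply.injEq] at hr
        subst hr
        -- an operation that still reads has not written
        have hsh := seqRun_shape (seqRun_iff.2 ⟨h2, rfl⟩)
        have h0 : numWrites h' = 0 := by
          by_contra hc
          obtain ⟨n1, n2⟩ := hsh.2.2.2.1 hc
          rw [next_read_iff] at hn
          rcases hn with hn | hn
          · exact n1 hn.1
          · rw [n2] at hn; simp at hn
        have hw : accMem s h' = s := by rw [hsh.2.1, h0]; rfl
        refine ⟨hev _ h1, ?_, h3, h4, fun _ => by simp [Impl.replyAccess, h0]⟩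
        rw [runs_append, hw]
        exact ⟨h2, hn, rfl, trivial⟩
      | write x e =>
        simp only [snapshotImpl] at hr
        split at hr
        · simp at hr
        · rename_i a' hn'
          refine ⟨hev _ h1, ?_, h3, h4, ?_⟩
          · rw [runs_append]
            exact ⟨h2, hn, trivial⟩
          · rintro ⟨r, hr'⟩
            simp only [Impl.replyAccess] at hr'
            rw [hn'] at hr'; simp at hr'
    · obtain ⟨h1, h2, h3, x, e, r, rfl, h5⟩ := hproc
      refine ⟨hev _ h1, ?_, h3, r, h5⟩
      rw [runs_append]
      exact ⟨h2, hn, trivial⟩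
    · simp [snapshotImpl] at hr
  | @abort c h' a hp hr =>
    rw [hp] at hproc hloc
    cases hl : C.loc p <;> rw [hl] at hproc hr <;> simp only [SnapProc] at hproc
    · cases a <;> simp only [snapshotImpl, reduceCtorEq] at hr
      split at hr <;> simp at hr
    · simp [snapshotImpl] at hr
    · refine ⟨A, h.event hα (.abort hp (by simp [hl, snapshotImpl])) rfl (by rw [hl]; nofun)
        (by simp) ?_ ?_⟩
      · intro s'; simp [Impl.afterEnd, snapshotImpl, hl]
      · simp [Impl.afterEnd, snapshotImpl, SnapProc]

theorem snapInv_exec (hα : (snapshotImpl D n).Exec D α C) : ∃ A, SnapInv D α C A := by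
  induction hα with
  | nil =>
    refine ⟨[], serInv_nil D, ?_, by simp, ?_⟩
    · intro q; simp [Impl.start, snapshotImpl]
    · intro q; simp [Impl.start, snapshotImpl, SnapProc]
  | step hα hs ih =>
    obtain ⟨A, hA⟩ := ih
    exact hA.step hα hs

end Snapshots

/-! ### Safe-strict serializability of the snapshot implementation -/

section SnapshotClass

variable {V Λ Ω : Type} {n : ℕ}

/-- An operation of the snapshot implementation that has not ended observes a point of the
serialization. -/
theorem SnapInv.snapshot {D : SearchData V Λ Ω} {α : List (Event V Λ Ω n)}
    {C : (snapshotImpl D n).Conf} {A : List (Block V Λ Ω n)} {p : Fin n} {c : Call V Ω}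
    {h : List (Access V Λ)} (hI : SnapInv D α C A) (hα : (snapshotImpl D n).Exec D α C)
    (hp : C.phase p = .ready c h ∨ ∃ a, C.phase p = .pending c h a) :
    ∃ A₁ A₂ s, A = A₁ ++ A₂ ∧ Chain D (fun _ => ∅) A₁ s ∧ (∀ b ∈ A₁, b.op ≠ (p, C.cnt p)) ∧
      Runs D c s [] h := by
  have hproc := hI.procs p
  have key : ∀ s, C.loc p ≠ .published → SnapOk D α A (p, C.cnt p) s → Runs D c s [] h →
      ∃ A₁ A₂ s, A = A₁ ++ A₂ ∧ Chain D (fun _ => ∅) A₁ s ∧ (∀ b ∈ A₁, b.op ≠ (p, C.cnt p)) ∧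
        Runs D c s [] h := by
    rintro s hl ⟨A₁, A₂, h1, h2, -⟩ hr
    refine ⟨A₁, A₂, s, h1, h2, fun b hb => hI.fresh hα hl b ?_, hr⟩
    rw [h1]; exact List.mem_append_left _ hb
  rcases hp with hp | ⟨a, hp⟩
  · rw [hp] at hproc
    cases hl : C.loc p <;> rw [hl] at hproc key <;> simp only [SnapProc] at hproc
    · subst hproc
      exact ⟨[], A, _, rfl, rfl, by simp, trivial⟩
    · exact key _ nofun hproc.1 hproc.2.1
    · exact key _ nofun hproc.1 hproc.2.1
    · obtain ⟨b, hb, ho, rfl, rfl, -⟩ := hproc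
      obtain ⟨A₁, A₂, rfl⟩ := List.append_of_mem hb
      obtain ⟨s, h1, s', h2, -⟩ := chain_append.1 hI.ser.chain
      refine ⟨A₁, b :: A₂, s, rfl, h1, fun b' hb' he => ?_, (seqRun_iff.1 h2.1).1⟩
      have hn := hI.ser.nodup
      rw [List.map_append, List.nodup_append] at hn
      exact hn.2.2 _ (List.mem_map_of_mem hb') _ (List.mem_map_of_mem List.mem_cons_self)
        (he.trans ho.symm)
  · rw [hp] at hproc
    cases hl : C.loc p <;> rw [hl] at hproc key <;> simp only [SnapProc] at hproc
    · exact key _ nofun hproc.1 hproc.2.1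
    · exact key _ nofun hproc.1 hproc.2.1
    · exact key _ nofun hproc.1 hproc.2

theorem snapshot_isLSL (D : SearchStructure V Λ Ω) :
    (snapshotImpl D.toSearchData n).IsLSL D.toSearchData := by
  rintro H ⟨α, C, hα, rfl⟩
  refine ⟨locallySerializable_of_phases (I := snapshotImpl D.toSearchData n) ?_ hα, ?_⟩
  · intro α C hα p c h hp
    obtain ⟨A, hA⟩ := snapInv_exec hα
    obtain ⟨A₁, A₂, s, -, h1, -, h2⟩ := hA.snapshot hα hp
    exact ⟨s, _, (chain_reach .init h1).1, seqRun_iff.2 ⟨h2, rfl⟩⟩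
  · obtain ⟨A, hA⟩ := snapInv_exec hα
    exact hA.ser.linearizable

theorem localHist_of_aborted {α : List (Event V Λ Ω n)} {π : OpId n} {c : Call V Ω}
    {h : List (Access V Λ)} {a : Req V Λ}
    (ha : opHist α π = opEvents π c h [Impl.reqKind a, .abort]) :
    localHist (history α) π = opEvents π c h [] := by
  have : history (([Impl.reqKind a, .abort] : List (EvKind V Λ Ω)).map
      fun k => (⟨π, k⟩ : Event V Λ Ω n)) = [⟨π, .abort⟩] := by
    cases a <;> simp [history, EvKind.IsAccInv, Impl.reqKind]
  rw [localHist_eq_filter, opHist_history, ha, history_opEvents, this, ← opEvents_tail,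
    opEvents_filter_abort]
  simp

/-- Every operation, even one that is aborted or incomplete, observes a point of the serialization
of the operations that have taken effect: that of its snapshot. -/
theorem snapshot_safe (D : SearchStructure V Λ Ω) {β : List (Event V Λ Ω n)}
    {e : Event V Λ Ω n} {C : (snapshotImpl D.toSearchData n).Conf}
    (hα : (snapshotImpl D.toSearchData n).Exec D.toSearchData (β ++ [e]) C) :
    ∃ H' α' : List (Event V Λ Ω n), Completion D.toSearchData (history (β ++ [e])) H' ∧
      Sequential α' ∧ Legal α' ∧
      (∀ π, Occurs α' π → π ≠ e.op → Returned H' π ∧ Precedes α' π e.op ∧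
        localHist α' π = localHist H' π) ∧
      localHist α' e.op = localHist (history (β ++ [e])) e.op := by
  obtain ⟨C₀, C₁, hα₀, hs, ho⟩ := exec_last hα
  have hα₁ := Impl.Exec.step hα₀ hs
  simp only [Option.toList_some] at hα₁
  obtain ⟨A, hA⟩ := snapInv_exec hα₁
  have hloc := exec_local hα₁ e.op.1
  have hmem : e ∈ opHist (β ++ [e]) e.op := mem_opHist.2 ⟨by simp, rfl⟩
  by_cases hE : Ended (β ++ [e]) e.op
  · have hE' := (exec_ended_iff hα₁ _).1 hE
    obtain ⟨c, h, hf, ⟨r, hn, h1, h2, h3⟩ | ⟨a, hn, h1, h2, h3⟩⟩ :=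
      endedEvents_history (hloc.2.2 _ hE')
    · have hmem' : (⟨e.op, .res r⟩ : Event V Λ Ω n) ∈ β ++ [e] := by
        refine (mem_opHist (π := e.op)).1 ?_ |>.1
        rw [h1]; simp [opEvents]
      obtain ⟨b, hb, hbo⟩ := hA.ser.returned _ ⟨r, hmem'⟩
      obtain ⟨A₁, A₂, rfl⟩ := List.append_of_mem hb
      obtain ⟨s, h4, s', h5, -⟩ := chain_append.1 hA.ser.chain
      have hn := hA.ser.nodup
      rw [List.map_append, List.nodup_append] at hn
      have h6 : ∀ b' ∈ A₁, b'.op ≠ e.op := fun b' hb' he =>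
        hn.2.2 _ (List.mem_map_of_mem hb') _ (List.mem_map_of_mem List.mem_cons_self)
          (he.trans hbo.symm)
      have h7 := (hA.ser.resp hb (r := r) (by rw [hbo]; exact hmem')).2
      rw [hbo] at h7
      have h8 : localHist (history (β ++ [e])) e.op = opEvents e.op b.call b.acc [.res b.resp] := by
        have : opEvents e.op c h [.res r] = b.events := by rw [← h7]; exact h1.symm
        rw [h3, this, ← hbo]; rfl
      exact hA.ser.safe h4 h6 h8 (seqRun_iff.1 h5.1).1 (silent_res _)
    · -- an aborted operation: its snapshot is known before the abort
      have h4 : opHist β e.op ++ [e] = opEvents e.op c h [Impl.reqKind a] ++ [⟨e.op, .abort⟩] := by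
        rw [← opEvents_tail, List.singleton_append, ← h1, opHist_append]
        simp [opHist]
      obtain ⟨-, h5⟩ := List.append_inj' h4 rfl
      obtain ⟨π, k⟩ := e
      simp only [List.cons.injEq, Event.mk.injEq, true_and, and_true] at h5
      subst h5
      simp only at ho hs hE' ⊢
      obtain ⟨A₀, hA₀⟩ := snapInv_exec hα₀
      obtain ⟨c', h', a', hp⟩ : ∃ c' h' a', C₀.phase π.1 = .pending c' h' a' := by
        generalize hk : (some ⟨π, .abort⟩ : Option (Event V Λ Ω n)) = x at hs
        cases hs <;> simp [Impl.reqKind] at hk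
        case request a _ _ _ => cases a <;> simp at hk
        case reply a _ _ _ => cases a <;> simp [Impl.replyKind] at hk
        case abort hp _ => exact ⟨_, _, _, hp⟩
      have hnp : C₀.loc π.1 ≠ .published := by
        intro hl
        have := hA₀.procs π.1
        rw [hl, hp] at this
        exact this
      have hfr := hA₀.fresh hα₀ hnp
      rw [← ho] at hfr
      have hser := hA₀.ser.event hα₁ hfr (by simp)
      obtain ⟨A₁, A₂, s, rfl, h6, h7, h8⟩ := hA₀.snapshot hα₀ (.inr ⟨a', hp⟩)
      rw [← ho] at h7
      have hph := (exec_local hα₀ π.1).2.1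
      rw [← ho, hp] at hph
      refine hser.safe h6 h7 (t := []) (localHist_of_aborted (a := a') ?_) h8 (by simp [Silent])
      have : opHist (β ++ [⟨π, .abort⟩]) π = opHist β π ++ [⟨π, .abort⟩] := by
        rw [opHist_append]; simp [opHist]
      rw [this, hph.1, ← opEvents_tail]
      rfl
  · have hcnt : C₁.cnt e.op.1 = e.op.2 := by
      have h1 := exec_occurs_le hα₁ (π := e.op) ⟨e, by simp, rfl⟩
      rw [exec_ended_iff hα₁] at hE
      omega
    have hph := hloc.2.1
    rw [hcnt] at hph
    have hlh := phaseEvents_localHist hph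
    cases hp : C₁.phase e.op.1 with
    | idle =>
      rw [hp] at hph
      simp only [PhaseEvents] at hph
      rw [hph] at hmem
      simp at hmem
    | ready c h =>
      obtain ⟨A₁, A₂, s, rfl, h1, h2, h3⟩ := hA.snapshot hα₁ (.inl hp)
      rw [hcnt] at h2
      rw [hp] at hlh
      exact hA.ser.safe h1 h2 hlh h3 (by simp [Silent])
    | pending c h a =>
      obtain ⟨A₁, A₂, s, rfl, h1, h2, h3⟩ := hA.snapshot hα₁ (.inr ⟨a, hp⟩)
      rw [hcnt] at h2
      rw [hp] at hlh
      exact hA.ser.safe h1 h2 hlh h3 (by cases a <;> simp [Silent, Impl.reqKind])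

theorem snapshotImpl_mem_classSM (D : SearchStructure V Λ Ω) :
    snapshotImpl D.toSearchData n ∈ classSM D.toSearchData n := by
  refine ⟨snapshot_isLSL D, fun α C hα => ⟨?_, ?_⟩⟩
  · obtain ⟨A, hA⟩ := snapInv_exec hα
    exact hA.ser.strictlySerializable hα
  · rintro β e γ rfl -
    obtain ⟨C', hC'⟩ := exec_prefix hα (β := β ++ [e]) (by simp)
    exact snapshot_safe D hC'

end SnapshotClass

/-! ### Schedules -/

section Schedules

variable {V Λ Ω : Type} {n : ℕ}

/-- What a schedule records of an event. -/
def Event.label (e : Event V Λ Ω n) : Fin n × Shape V Λ Ω := (e.op.1, e.kind.shape)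

/-- What a schedule records of an access. -/
def accShape : Access V Λ → List (Shape V Λ Ω)
  | .read x _ => [.invRead x, .resRead x]
  | .write x e => [.invWrite x e, .resWrite x e]

/-- What a schedule records of a complete operation `c` of process `p` with accesses `h`. -/
def opShapes (p : Fin n) (c : Call V Ω) (h : List (Access V Λ)) : Schedule V Λ Ω n :=
  (p, .inv c) :: (h.flatMap accShape).map (Prod.mk p) ++ [(p, .res)]

theorem accessEvents_label (π : OpId n) (h : List (Access V Λ)) :
    (h.flatMap (accessEvents (Ω := Ω) π)).map Event.label =
      (h.flatMap accShape).map (Prod.mk π.1) := by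
  induction h with
  | nil => rfl
  | cons a h ih =>
    simp only [List.flatMap_cons, List.map_append, ih]
    cases a <;> rfl

theorem opEvents_label (π : OpId n) (c : Call V Ω) (h : List (Access V Λ))
    (t : List (EvKind V Λ Ω)) :
    (opEvents π c h t).map Event.label = (π.1, .inv c) :: (h.flatMap accShape).map (Prod.mk π.1) ++
      t.map fun k => (π.1, k.shape) := by
  simp [opEvents, accessEvents_label, Event.label, EvKind.shape, Function.comp_def]

theorem opEvents_label_res (π : OpId n) (c : Call V Ω) (h : List (Access V Λ)) (r : DictResp V) :
    (opEvents π c h [.res r]).map Event.label = opShapes π.1 c h := by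
  rw [opEvents_label]; rfl

theorem reqs_of_accShape {h h' : List (Access V Λ)}
    (e : h.flatMap (accShape (Ω := Ω)) = h'.flatMap accShape) : h.map reqOf = h'.map reqOf := by
  induction h generalizing h' with
  | nil => cases h' with
    | nil => rfl
    | cons a h' => cases a <;> simp [accShape] at e
  | cons a h ih => cases h' with
    | nil => cases a <;> simp [accShape] at e
    | cons a' h' =>
      cases a <;> cases a' <;> simp only [List.flatMap_cons, accShape, List.cons_append,
        List.nil_append, List.cons.injEq, reduceCtorEq, false_and, Shape.invRead.injEq,
        Shape.resRead.injEq, Shape.invWrite.injEq, Shape.resWrite.injEq] at e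
      · obtain ⟨rfl, -, e⟩ := e
        simp [reqOf, ih e]
      · obtain ⟨⟨rfl, rfl⟩, -, e⟩ := e
        simp [reqOf, ih e]

/-- A schedule determines the call and the requests of an operation. -/
theorem opShapes_inj {p p' : Fin n} {c c' : Call V Ω} {h h' : List (Access V Λ)}
    (e : opShapes p c h = opShapes p' c' h') : c = c' ∧ h.map reqOf = h'.map reqOf := by
  simp only [opShapes, List.cons_append, List.cons.injEq, Prod.mk.injEq, Shape.inv.injEq] at e
  obtain ⟨⟨rfl, rfl⟩, e⟩ := e
  refine ⟨rfl, reqs_of_accShape (Ω := Ω) ?_⟩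
  exact List.map_injective_iff.2 (Prod.mk_right_injective p) (List.append_cancel_right e)

/-- The memory after some scheduled events: the written values are part of the schedule. -/
noncomputable def shapeMem : Mem V Λ → Schedule V Λ Ω n → Mem V Λ
  | m, [] => m
  | m, s :: l => match s.2 with
    | .resWrite x e => shapeMem (Function.update m x e) l
    | _ => shapeMem m l

theorem evMem_eq_shapeMem (m : Mem V Λ) (l : List (Event V Λ Ω n)) :
    evMem m l = shapeMem m (l.map Event.label) := by
  induction l generalizing m with
  | nil => rfl
  | cons e l ih =>
    obtain ⟨π, k⟩ := e
    cases k <;> simp [evMem, shapeMem, Event.label, EvKind.shape, ih]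

theorem shapeMem_append (m : Mem V Λ) (l l' : Schedule V Λ Ω n) :
    shapeMem m (l ++ l') = shapeMem (shapeMem m l) l' := by
  induction l generalizing m with
  | nil => rfl
  | cons s l ih =>
    obtain ⟨p, s⟩ := s
    cases s <;> simp [shapeMem, ih]

theorem shapeMem_opShapes (m : Mem V Λ) (p : Fin n) (c : Call V Ω) (h : List (Access V Λ)) :
    shapeMem m (opShapes p c h) = accMem m h := by
  have : ∀ (l : List (Access V Λ)) (m : Mem V Λ) (t : Schedule V Λ Ω n),
      shapeMem m ((l.flatMap accShape).map (Prod.mk p) ++ t) = shapeMem (accMem m l) t := by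
    intro l
    induction l with
    | nil => intro m t; rfl
    | cons a l ih =>
      intro m t
      cases a <;> simp [accShape, shapeMem, accMem, ih]
  simp only [opShapes, List.cons_append, shapeMem]
  rw [this]
  rfl

/-- In a list of events that is sorted by the operations of each process, the operations in `S`
come after those in `R`. If every process has an event of an operation in `R` after the
scheduled part `pre`, then only operations in `R` contribute to `pre`. -/
theorem filter_prefix {α : List (Event V Λ Ω n)}
    (hsort : α.Pairwise fun e e' => e.op.1 = e'.op.1 → e.op.2 ≤ e'.op.2) {R S : OpId n → Prop}
    (hRS : ∀ π, R π → S π)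
    (hlt : ∀ π π', S π → ¬ R π → R π' → Occurs α π → Occurs α π' → π.1 = π'.1 → π'.2 < π.2)
    {pre tail : Schedule V Λ Ω n}
    (h : (α.filter fun e => R e.op).map Event.label = pre ++ tail)
    (ht : ∀ p, ∃ s, (p, s) ∈ tail) :
    ∃ β γ, α.filter (fun e => S e.op) = β ++ γ ∧ β.map Event.label = pre ∧
      (∀ e ∈ β, R e.op) ∧ (γ.filter fun e => R e.op).map Event.label = tail := by
  obtain ⟨X, Y, hXY, rfl, rfl⟩ := List.map_eq_append_iff.1 h
  obtain ⟨m₁, m₂, rfl, rfl, rfl⟩ := List.filter_eq_append_iff.1 hXY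
  refine ⟨m₁.filter fun e => S e.op, m₂.filter fun e => S e.op, by simp, ?_, ?_, ?_⟩
  · congr 1
    refine List.filter_congr fun e he => ?_
    by_cases hS : S e.op
    · have : R e.op := by
        by_contra hR
        obtain ⟨s, hs⟩ := ht e.op.1
        obtain ⟨e', he', hl⟩ := List.mem_map.1 hs
        rw [List.mem_filter] at he'
        have h1 : e'.op.1 = e.op.1 := (Prod.ext_iff.1 hl).1
        have h2 := hlt _ _ hS hR (by simpa using he'.2) ⟨e, by simp [he], rfl⟩
          ⟨e', by simp [he'.1], rfl⟩ h1.symm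
        have h3 := (List.pairwise_append.1 hsort).2.2 e he e' he'.1 h1.symm
        omega
      simp [hS, this]
    · simp [hS, show ¬ R e.op from fun h => hS (hRS _ h)]
  · intro e he
    rw [List.mem_filter] at he
    by_contra hR
    obtain ⟨s, hs⟩ := ht e.op.1
    obtain ⟨e', he', hl⟩ := List.mem_map.1 hs
    rw [List.mem_filter] at he'
    have h1 : e'.op.1 = e.op.1 := (Prod.ext_iff.1 hl).1
    have h2 := hlt _ _ (by simpa using he.2) hR (by simpa using he'.2) ⟨e, by simp [he.1], rfl⟩
      ⟨e', by simp [he'.1], rfl⟩ h1.symm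
    have h3 := (List.pairwise_append.1 hsort).2.2 e he.1 e' he'.1 h1.symm
    omega
  · rw [List.filter_filter]
    congr 1
    refine List.filter_congr fun e he => ?_
    by_cases hR : R e.op
    · simp [hR, hRS]
    · simp [hR]

/-- Events are sorted by the operations of each process, and exactly the first event of each
operation is an invocation. -/
structure Tidy (H : List (Event V Λ Ω n)) : Prop where
  sorted : H.Pairwise fun e e' => e.op.1 = e'.op.1 → e.op.2 ≤ e'.op.2
  inv_iff : ∀ l₁ e l₂, H = l₁ ++ e :: l₂ → (e.kind.IsInv ↔ ¬ Occurs l₁ e.op)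

theorem Tidy.of_exec {D : SearchData V Λ Ω} {I : Impl V Λ Ω n} {α : List (Event V Λ Ω n)}
    {C : I.Conf} (hα : I.Exec D α C) : Tidy α := ⟨exec_sorted hα, exec_inv_first hα⟩

/-- The events of a process that follow an event of `a` are of the same operation until the
process invokes another one. -/
theorem Tidy.same_op {H X Y : List (Event V Λ Ω n)} {a : Event V Λ Ω n} (h : Tidy H)
    (hH : X ++ a :: Y <+: H) (hY : ∀ y ∈ Y, y.op.1 = a.op.1 → ¬ y.kind.IsInv) :
    ∀ y ∈ Y, y.op.1 = a.op.1 → y.op = a.op := by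
  obtain ⟨Z, rfl⟩ := hH
  induction Y using List.reverseRecOn generalizing Z with
  | nil => simp
  | append_singleton Y y ih =>
    have hY' := ih (fun z hz => hY z (by simp [hz])) (y :: Z) (by simpa using h)
    intro z hz hp
    rcases List.mem_append.1 hz with hz | hz
    · exact hY' z hz hp
    rw [List.mem_singleton] at hz
    subst hz
    have hocc : Occurs (X ++ a :: Y) z.op := by
      by_contra hc
      exact hY z (by simp) hp ((h.inv_iff _ z Z (by simp)).2 hc)
    obtain ⟨e, he, ho⟩ := hocc
    rcases List.mem_append.1 he with he | he
    · have hs := h.sorted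
      have h1 : e.op.2 ≤ a.op.2 := by
        have hs' : List.Pairwise (fun e e' : Event V Λ Ω n => e.op.1 = e'.op.1 → e.op.2 ≤ e'.op.2)
          (X ++ a :: (Y ++ [z] ++ Z)) := by simpa using hs
        exact (List.pairwise_append.1 hs').2.2 e he a (by simp) (by rw [ho, hp])
      have h2 : a.op.2 ≤ z.op.2 := by
        have hs' : List.Pairwise (fun e e' : Event V Λ Ω n => e.op.1 = e'.op.1 → e.op.2 ≤ e'.op.2)
          ((X ++ [a]) ++ (Y ++ [z] ++ Z)) := by simpa using hs
        exact (List.pairwise_append.1 hs').2.2 a (by simp) z (by simp) hp.symm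
      rw [ho] at h1
      exact Prod.ext hp (by omega)
    · rcases List.mem_cons.1 he with rfl | he
      · exact ho.symm
      · rw [← ho]
        exact hY' e he (by rw [ho, hp])

theorem Tidy.filter {H : List (Event V Λ Ω n)} (h : Tidy H) (R : OpId n → Prop) :
    Tidy (H.filter fun e => R e.op) where
  sorted := h.sorted.filter _
  inv_iff := by
    intro l₁ e l₂ hl
    obtain ⟨m₁, m₂, rfl, rfl, h2⟩ := List.filter_eq_append_iff.1 hl
    obtain ⟨m₃, m₄, rfl, h3, h4, h5⟩ := List.filter_eq_cons_iff.1 h2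
    rw [h.inv_iff (m₁ ++ m₃) e m₄ (by simp)]
    refine not_congr ⟨?_, ?_⟩
    · rintro ⟨x, hx, ho⟩
      have hR : R e.op := by simpa using h4
      rcases List.mem_append.1 hx with hx | hx
      · exact ⟨x, by simp [hx, ho, hR], ho⟩
      · have : ¬ R x.op := by simpa using h3 x hx
        exact absurd (by rw [ho]; exact hR) this
    · rintro ⟨x, hx, ho⟩
      exact ⟨x, by simp [(List.mem_filter.1 hx).1], ho⟩

/-- In a quiescent configuration of an execution without aborts the whole execution is
scheduled. -/
theorem scheduleOf_quiescent {D : SearchData V Λ Ω} {I : Impl V Λ Ω n} {α : List (Event V Λ Ω n)}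
    {C : I.Conf} (hα : I.Exec D α C) (hi : ∀ p, C.phase p = .idle)
    (hσ : ∀ s ∈ α.map Event.label, s.2 ≠ .abort) : scheduleOf (history α) = α.map Event.label := by
  have hna : ∀ e ∈ α, e.kind ≠ .abort := fun e he hk =>
    hσ _ (List.mem_map_of_mem he) (by simp [Event.label, hk, EvKind.shape])
  rw [history_of_no_abort hna, scheduleOf, completeHist, List.filter_eq_self.2]
  · rfl
  intro e he
  have hle := exec_occurs_le hα (π := e.op) ⟨e, he, rfl⟩
  have hlt : e.op.2 < C.cnt e.op.1 := by
    refine lt_of_le_of_ne hle fun hc => ?_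
    have := (exec_local hα e.op.1).2.1
    rw [hi, ← hc] at this
    simp only [PhaseEvents] at this
    have h2 : e ∈ opHist α e.op := mem_opHist.2 ⟨he, rfl⟩
    rw [this] at h2
    simp at h2
  obtain ⟨c, h, -, ⟨r, -, hr⟩ | ⟨a, -, ha⟩⟩ := (exec_local hα e.op.1).2.2 _ hlt
  · have : (⟨e.op, .res r⟩ : Event V Λ Ω n) ∈ opHist α e.op := by
      rw [hr]; simp [opEvents]
    simpa using ⟨r, (mem_opHist.1 this).1⟩
  · have : (⟨e.op, .abort⟩ : Event V Λ Ω n) ∈ opHist α e.op := by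
      rw [ha]; simp [opEvents]
    exact absurd rfl (hna _ (mem_opHist.1 this).1)

/-- From configurations that satisfy `Q` for the memory `m`, an operation can be run alone, as in
the sequential implementation. -/
def RunsAlone (D : SearchData V Λ Ω) (I : Impl V Λ Ω n) (Q : I.Conf → Mem V Λ → Prop) : Prop :=
  ∀ ⦃α : List (Event V Λ Ω n)⦄ ⦃C : I.Conf⦄ ⦃m : Mem V Λ⦄ ⦃p : Fin n⦄ ⦃c : Call V Ω⦄
    ⦃h : List (Access V Λ)⦄ ⦃m' : Mem V Λ⦄ ⦃r : DictResp V⦄, I.Exec D α C → C.phase p = .idle →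
    Q C m → D.Completes c m h m' r →
    ∃ α' C', I.Exec D (α ++ α') C' ∧ α'.map Event.label = opShapes p c h ∧ Q C' m' ∧
      C'.phase p = .idle ∧ ∀ q, q ≠ p → C'.phase q = C.phase q ∧ C'.loc q = C.loc q

/-- The operations `l` run one after the other from memory `m`, with resulting memory `m'`. -/
def RunList (D : SearchData V Λ Ω) : Mem V Λ → List (Call V Ω × List (Access V Λ)) → Mem V Λ → Prop
  | m, [], m' => m' = m
  | m, a :: l, m' => ∃ m₁ r, D.Completes a.1 m a.2 m₁ r ∧ RunList D m₁ l m'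

theorem runList_append {D : SearchData V Λ Ω} {m m₁ m' : Mem V Λ}
    {l l' : List (Call V Ω × List (Access V Λ))} (h : RunList D m l m₁) (h' : RunList D m₁ l' m') :
    RunList D m (l ++ l') m' := by
  induction l generalizing m with
  | nil => obtain rfl := h; exact h'
  | cons a l ih =>
    obtain ⟨m₂, r, h1, h2⟩ := h
    exact ⟨m₂, r, h1, ih h2⟩

theorem reach_runList {D : SearchData V Λ Ω} {m : Mem V Λ} (hm : D.Reach m) :
    ∃ l, RunList D (fun _ => ∅) l m := by
  induction hm with
  | init => exact ⟨[], rfl⟩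
  | step hm hc ih =>
    obtain ⟨l, hl⟩ := ih
    exact ⟨l ++ [(_, _)], runList_append hl ⟨_, _, hc, rfl⟩⟩

/-- Operations can be run one after the other by the same process. -/
theorem RunsAlone.list {D : SearchData V Λ Ω} {I : Impl V Λ Ω n} {Q : I.Conf → Mem V Λ → Prop}
    (hQ : RunsAlone D I Q) {α : List (Event V Λ Ω n)} {C : I.Conf} {m m' : Mem V Λ} {p : Fin n}
    {l : List (Call V Ω × List (Access V Λ))} (hα : I.Exec D α C) (hp : C.phase p = .idle)
    (hm : Q C m) (hl : RunList D m l m') :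
    ∃ α' C', I.Exec D (α ++ α') C' ∧ α'.map Event.label = l.flatMap (fun a => opShapes p a.1 a.2) ∧
      Q C' m' ∧ C'.phase p = .idle ∧ ∀ q, q ≠ p → C'.phase q = C.phase q ∧ C'.loc q = C.loc q := by
  induction l generalizing α C m with
  | nil =>
    obtain rfl := hl
    exact ⟨[], C, by simpa using hα, rfl, hm, hp, fun _ _ => ⟨rfl, rfl⟩⟩
  | cons a l ih =>
    obtain ⟨m₁, r, h1, h2⟩ := hl
    obtain ⟨α₁, C₁, h3, h4, h5, h6, h7⟩ := hQ hα hp hm h1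
    obtain ⟨α₂, C₂, g3, g4, g5, g6, g7⟩ := ih h3 h6 h5 h2
    refine ⟨α₁ ++ α₂, C₂, by simpa using g3, by simp [h4, g4], g5, g6, fun q hq => ?_⟩
    rw [(g7 q hq).1, (g7 q hq).2]
    exact h7 q hq

/-- Every process runs the operation `c`, one after the other. At the end of a schedule, such rounds
ensure that no operation that the schedule omits has events among the scheduled ones before the
rounds. -/
def rounds (n : ℕ) (c : Call V Ω) (h : List (Access V Λ)) : Schedule V Λ Ω n :=
  (List.finRange n).flatMap fun p => opShapes p c h

theorem mem_rounds (n : ℕ) (c : Call V Ω) (h : List (Access V Λ)) (p : Fin n) :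
    ∃ s, (p, s) ∈ rounds n c h :=
  ⟨.res, List.mem_flatMap.2 ⟨p, List.mem_finRange p, by simp [opShapes]⟩⟩

theorem no_abort_opShapes {p : Fin n} {c : Call V Ω} {h : List (Access V Λ)} :
    ∀ s ∈ opShapes p c h, s.2 ≠ .abort := by
  intro s hs
  simp only [opShapes, List.cons_append, List.mem_cons, List.mem_append, List.mem_map,
    List.mem_flatMap, List.not_mem_nil, or_false] at hs
  rcases hs with rfl | ⟨t, ⟨a, -, hs⟩, rfl⟩ | rfl
  · simp
  · cases a <;> simp only [accShape, List.mem_cons, List.not_mem_nil, or_false] at hs <;>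
      rcases hs with rfl | rfl <;> simp
  · simp

/-- Every process in turn can run an operation that leaves the memory as it is. -/
theorem RunsAlone.rounds {D : SearchData V Λ Ω} {I : Impl V Λ Ω n} {Q : I.Conf → Mem V Λ → Prop}
    (hQ : RunsAlone D I Q) {α : List (Event V Λ Ω n)} {C : I.Conf} {m : Mem V Λ}
    {c : Call V Ω} {h : List (Access V Λ)} {r : DictResp V} (hα : I.Exec D α C)
    (hp : ∀ p, C.phase p = .idle) (hm : Q C m) (hc : D.Completes c m h m r) :
    ∃ α' C', I.Exec D (α ++ α') C' ∧ α'.map Event.label = SearchConc.rounds n c h ∧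
      ∀ p, C'.phase p = .idle := by
  have : ∀ l : List (Fin n), ∃ α' C', I.Exec D (α ++ α') C' ∧
      α'.map Event.label = l.flatMap (fun p => opShapes p c h) ∧ Q C' m ∧
      ∀ p, C'.phase p = .idle := by
    intro l
    induction l using List.reverseRecOn with
    | nil => exact ⟨[], C, by simpa using hα, rfl, hm, hp⟩
    | append_singleton l p ih =>
      obtain ⟨α₁, C₁, h3, h4, h5, h6⟩ := ih
      obtain ⟨α₂, C₂, g3, g4, g5, g6, g7⟩ := hQ h3 (h6 p) h5 hc
      refine ⟨α₁ ++ α₂, C₂, by simpa using g3, by simp [h4, g4], g5, fun q => ?_⟩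
      by_cases hq : q = p
      · rw [hq, g6]
      · rw [(g7 q hq).1, h6]
  obtain ⟨α', C', h1, h2, -, h3⟩ := this (List.finRange n)
  exact ⟨α', C', h1, h2, h3⟩

end Schedules

/-! ### Solo operations of the snapshot implementation -/

section SnapshotAccepts

variable {V Λ Ω : Type} {n : ℕ}

/-- Before its first write an operation has left the memory as it was. -/
theorem accMem_of_next_read {D : SearchData V Λ Ω} {c : Call V Ω} {m : Mem V Λ}
    {h : List (Access V Λ)} {x : Node V} (hr : Runs D c m [] h) (hn : D.next c h = .req (.read x)) :
    accMem m h = m := by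
  have hsh := seqRun_shape (seqRun_iff.2 ⟨hr, rfl⟩)
  have : numWrites h = 0 := by
    by_contra hc
    obtain ⟨n1, n2⟩ := hsh.2.2.2.1 hc
    rw [next_read_iff] at hn
    rcases hn with hn | hn
    · exact n1 hn.1
    · rw [n2] at hn; simp at hn
  rw [hsh.2.1, this]; rfl

/-- With a snapshot of the committed memory, an operation that runs alone passes validation and
commits. -/
theorem snapshot_solo {D : SearchData V Λ Ω} {p : Fin n} {c : Call V Ω} {m : Mem V Λ}
    {r : DictResp V} (l : List (Access V Λ)) {h : List (Access V Λ)} {α : List (Event V Λ Ω n)}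
    {C : (snapshotImpl D n).Conf} {v : ℕ} (hα : (snapshotImpl D n).Exec D α C)
    (hp : C.phase p = .ready c h) (hl : C.loc p = .running m v) (hsh : C.sh = ⟨m, v, none⟩)
    (hr : Runs D c m [] (h ++ l)) (hn : D.next c (h ++ l) = .ret r) :
    ∃ α' C', (snapshotImpl D n).Exec D (α ++ α') C' ∧
      α'.map Event.label = (l.flatMap accShape).map (Prod.mk p) ++ [(p, .res)] ∧
      (C'.sh.mem = accMem m (h ++ l) ∧ C'.sh.owner = none) ∧ C'.phase p = .idle ∧
      ∀ q, q ≠ p → C'.phase q = C.phase q ∧ C'.loc q = C.loc q := by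
  induction l generalizing h α C with
  | nil =>
    rw [List.append_nil] at hr hn
    obtain ⟨A, hA⟩ := snapInv_exec hα
    have h0 := hA.procs p
    rw [hl, hp] at h0
    have hw := completes_readOnly hr hn (h0.2.2.2.2 ⟨r, hn⟩)
    refine ⟨_, _, Impl.Exec.step hα (.respond hp (by simp [hl]) hn), rfl, ⟨?_, ?_⟩, ?_, ?_⟩
    · rw [List.append_nil, ← (seqRun_iff.1 hw.1).2]
      simp [Impl.afterEnd, hsh]
    · simp [Impl.afterEnd, hsh]
    · simp [Impl.afterEnd]
    · intro q hq; simp [Impl.afterEnd, hq]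
  | cons a l ih =>
    have hr' := runs_append.1 hr
    have hra : Runs D c m [] (h ++ [a]) := runs_prefix (by simp) hr
    rw [List.append_cons] at hr hn
    cases a with
    | read x e =>
      obtain ⟨hn1, he, -⟩ := hr'.2
      rw [List.nil_append] at hn1
      rw [accMem_of_next_read hr'.1 hn1] at he
      have s1 := Impl.Step.request (I := snapshotImpl D n) hp (by simp [hl]) hn1
      have e1 := Impl.Exec.step hα s1
      have s2 := Impl.Step.reply (I := snapshotImpl D n) (D := D) (p := p) (c := c) (h := h)
        (a := .read x) (e := e)
        (C := Impl.afterEvent C p (Impl.reqKind (.read x)) (.pending c h (.read x)))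
        (by simp [Impl.afterEvent]) (by simp [Impl.afterEvent, Impl.reqKind, hl, he])
      have e2 := Impl.Exec.step e1 s2
      obtain ⟨α', C', i1, i2, i3, i4, i5⟩ := ih e2 (by simp [Impl.afterEvent, Impl.replyAccess])
        (by simp [Impl.afterEvent, Impl.reqKind, Impl.replyKind, hl])
        (by simp [Impl.afterEvent, hsh]) hr hn
      refine ⟨_ :: _ :: α', C', by simpa using i1, ?_, by rw [List.append_cons]; exact i3, i4, ?_⟩
      · simp [i2, accShape, Event.label, Impl.reqKind, Impl.replyKind, EvKind.shape]
      · intro q hq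
        rw [(i5 q hq).1, (i5 q hq).2]
        simp [Impl.afterEvent, hq]
    | write x e =>
      obtain ⟨hn1, -⟩ := hr'.2
      rw [List.nil_append] at hn1
      have s1 := Impl.Step.request (I := snapshotImpl D n) hp (by simp [hl]) hn1
      have e1 := Impl.Exec.step hα s1
      cases hn2 : D.next c (h ++ [.write x e]) with
      | req a =>
        have s2 := Impl.Step.reply (I := snapshotImpl D n) (D := D) (p := p) (c := c) (h := h)
          (a := .write x e) (e := e)
          (C := Impl.afterEvent C p (Impl.reqKind (.write x e)) (.pending c h (.write x e)))
          (by simp [Impl.afterEvent]) (by simp [Impl.afterEvent, Impl.reqKind, hl, hn2])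
        have e2 := Impl.Exec.step e1 s2
        obtain ⟨α', C', i1, i2, i3, i4, i5⟩ := ih e2 (by simp [Impl.afterEvent, Impl.replyAccess])
          (by simp [Impl.afterEvent, Impl.reqKind, Impl.replyKind, hl])
          (by simp [Impl.afterEvent, hsh]) hr hn
        refine ⟨_ :: _ :: α', C', by simpa using i1, ?_, by rw [List.append_cons]; exact i3, i4, ?_⟩
        · simp [i2, accShape, Event.label, Impl.reqKind, Impl.replyKind, EvKind.shape]
        · intro q hq
          rw [(i5 q hq).1, (i5 q hq).2]
          simp [Impl.afterEvent, hq]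
      | ret r' =>
        have hnil : l = [] := by
          cases l with
          | nil => rfl
          | cons b l =>
            have := (runs_append.1 hr).2
            rw [List.nil_append] at this
            cases b <;> (have h9 := this.1; rw [hn2] at h9; simp at h9)
        subst hnil
        rw [List.append_nil] at hn
        have s2 := Impl.Step.servePrim (I := snapshotImpl D n) (D := D) (p := p) (c := c) (h := h)
          (a := .write x e) (s := ⟨m, v, some p⟩) (l := .locked m)
          (C := Impl.afterEvent C p (Impl.reqKind (.write x e)) (.pending c h (.write x e)))
          (f := fun sh => if sh.owner = none ∧ sh.ver = v then
            some ({ sh with owner := some p }, .locked m) else some (sh, .failed m))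
          (by simp [Impl.afterEvent]) (by simp [Impl.afterEvent, Impl.reqKind, hl, hn2])
          (by simp [Impl.afterEvent, hsh])
        have e2 := Impl.Exec.step e1 s2
        have s3 := Impl.Step.reply (I := snapshotImpl D n) (D := D) (p := p) (c := c) (h := h)
          (a := .write x e) (e := ∅) (C := Impl.afterPrim (Impl.afterEvent C p
            (Impl.reqKind (.write x e)) (.pending c h (.write x e))) p ⟨m, v, some p⟩ (.locked m))
          (by simp [Impl.afterPrim, Impl.afterEvent]) (by simp [Impl.afterPrim])
        have e3 := Impl.Exec.step e2 s3
        have s4 := Impl.Step.readyPrim (I := snapshotImpl D n) (D := D) (p := p) (c := c)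
          (h := h ++ [.write x e]) (s := ⟨accMem m (h ++ [.write x e]), v + 1, none⟩)
          (l := .published)
          (f := fun sh => some (⟨accMem m (h ++ [.write x e]), sh.ver + 1, none⟩, .published))
          (C := Impl.afterEvent (Impl.afterPrim (Impl.afterEvent C p
            (Impl.reqKind (.write x e)) (.pending c h (.write x e))) p ⟨m, v, some p⟩ (.locked m)) p
            (Impl.replyKind ∅ (.write x e)) (.ready c (h ++ [Impl.replyAccess ∅ (.write x e)])))
          (by simp [Impl.afterEvent, Impl.replyAccess])
          (by simp [Impl.afterEvent, Impl.afterPrim, Impl.replyKind])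
          (by simp [Impl.afterEvent, Impl.afterPrim])
        have e4 := Impl.Exec.step e3 s4
        have s5 := Impl.Step.respond (I := snapshotImpl D n) (D := D) (p := p) (c := c)
          (h := h ++ [.write x e]) (r := r) (C := Impl.afterPrim (Impl.afterEvent (Impl.afterPrim
            (Impl.afterEvent C p (Impl.reqKind (.write x e)) (.pending c h (.write x e))) p
            ⟨m, v, some p⟩ (.locked m)) p
            (Impl.replyKind ∅ (.write x e)) (.ready c (h ++ [Impl.replyAccess ∅ (.write x e)])))
            p ⟨accMem m (h ++ [.write x e]), v + 1, none⟩ .published)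
          (by simp [Impl.afterPrim, Impl.afterEvent, Impl.replyAccess])
          (by simp [Impl.afterPrim]) hn
        have e5 := Impl.Exec.step e4 s5
        refine ⟨[_, _, _], _, by simpa using e5, ?_, ⟨?_, ?_⟩, ?_, ?_⟩
        · simp [accShape, Event.label, Impl.reqKind, Impl.replyKind, EvKind.shape]
        · simp [Impl.afterEnd, Impl.afterPrim]
        · simp [Impl.afterEnd, Impl.afterPrim]
        · simp [Impl.afterEnd]
        · intro q hq
          simp [Impl.afterEnd, Impl.afterPrim, Impl.afterEvent, hq]

/-- The invocation of an operation, and its snapshot. -/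
theorem snapshot_begin {D : SearchData V Λ Ω} {p : Fin n} {m : Mem V Λ}
    {α : List (Event V Λ Ω n)} {C : (snapshotImpl D n).Conf}
    (hα : (snapshotImpl D n).Exec D α C) (hp : C.phase p = .idle) (hm : C.sh.mem = m)
    (c : Call V Ω) :
    ∃ C', (snapshotImpl D n).Exec D (α ++ [⟨(p, C.cnt p), .inv c⟩]) C' ∧ C'.sh = C.sh ∧
      C'.phase p = .ready c [] ∧ C'.loc p = .running m C.sh.ver ∧
      ∀ q, q ≠ p → C'.phase q = C.phase q ∧ C'.loc q = C.loc q := by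
  have e1 := Impl.Exec.step hα (.invoke c hp)
  have s2 := Impl.Step.readyPrim (I := snapshotImpl D n) (D := D) (p := p) (c := c) (h := [])
    (s := C.sh) (l := .running m C.sh.ver) (f := fun sh => some (sh, .running sh.mem sh.ver))
    (C := Impl.afterEvent C p (.inv c) (.ready c []))
    (by simp [Impl.afterEvent]) (by simp [Impl.afterEvent]) (by simp [Impl.afterEvent, hm])
  have e2 := Impl.Exec.step e1 s2
  rw [Option.toList_none, List.append_nil] at e2
  refine ⟨_, e2, rfl, ?_, ?_, ?_⟩
  · simp [Impl.afterPrim, Impl.afterEvent]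
  · simp [Impl.afterPrim]
  · intro q hq; simp [Impl.afterPrim, Impl.afterEvent, hq]

theorem snapshot_runsAlone (D : SearchData V Λ Ω) :
    RunsAlone D (snapshotImpl D n) fun C m => C.sh.mem = m ∧ C.sh.owner = none := by
  intro α C m p c h m' r hα hp hm hc
  obtain ⟨C₁, e1, h1, h2, h3, h4⟩ := snapshot_begin hα hp hm.1 c
  have hr := seqRun_iff.1 hc.1
  obtain ⟨α', C', i1, i2, i3, i4, i5⟩ := snapshot_solo h e1 h2 h3
    (by rw [h1]; obtain ⟨s, hs⟩ : ∃ s, s = C.sh := ⟨_, rfl⟩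
        rw [← hs] at hm ⊢; obtain ⟨a, b, d⟩ := s; simp at hm; simp [hm]) (by simpa using hr.1)
    (by simpa using hc.2)
  refine ⟨_ :: α', C', by simpa using i1, ?_, ?_, i4, ?_⟩
  · simp [i2, opShapes, Event.label, EvKind.shape]
  · rw [hr.2]; simpa using i3
  · intro q hq
    rw [(i5 q hq).1, (i5 q hq).2]
    exact h4 q hq

end SnapshotAccepts

/-! ### The schedule of a stale read -/

section StaleRead

variable {V Λ Ω : Type} {n : ℕ}

/-- The search for `k` by `p₁` starts, `p₂` inserts `k` into the empty structure, and then the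
search finds the root without successors. Finally every process searches for `k`. -/
def staleSchedule (n : ℕ) (p₁ p₂ : Fin n) (k : ℕ) (v : V) (ω : Ω) (h h' : List (Access V Λ)) :
    Schedule V Λ Ω n :=
  ((p₁, .inv ⟨.find k, ω⟩) :: opShapes p₂ ⟨.insert k v, ω⟩ h ++
    [(p₁, .invRead .root), (p₁, .resRead .root), (p₁, .res)]) ++ rounds n ⟨.find k, ω⟩ h'

theorem no_abort_staleSchedule {p₁ p₂ : Fin n} {k : ℕ} {v : V} {ω : Ω}
    {h h' : List (Access V Λ)} : ∀ s ∈ staleSchedule n p₁ p₂ k v ω h h', s.2 ≠ .abort := by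
  intro s hs
  simp only [staleSchedule, rounds, List.mem_append, List.mem_cons, List.mem_flatMap,
    List.not_mem_nil, or_false] at hs
  rcases hs with ((rfl | hs) | rfl | rfl | rfl) | ⟨q, -, hs⟩
  · simp
  · exact no_abort_opShapes s hs
  · simp
  · simp
  · simp
  · exact no_abort_opShapes s hs

/-- In the empty structure a search reads the root only. -/
theorem find_completes_empty (D : SearchStructure V Λ Ω) (k : ℕ) (ω : Ω) :
    ∃ r, D.Completes ⟨.find k, ω⟩ (fun _ => ∅) [.read .root ∅] (fun _ => ∅) r := by
  have h1 : D.next ⟨.find k, ω⟩ [] = .req (.read .root) := by simp [SearchData.next, viewOf]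
  have h2 : D.trav (.find k) ω [(.root, ∅)] = none := by
    cases ht : D.trav (.find k) ω [(.root, ∅)] with
    | none => rfl
    | some y =>
      obtain ⟨l, hl⟩ := D.proper_trav (.find k) ω [] .root ∅ y ht
      simp at hl
  refine ⟨(D.update ⟨.find k, ω⟩ [(.root, ∅)]).2, seqRun_iff.2 ⟨⟨h1, rfl, trivial⟩, rfl⟩, ?_⟩
  rw [next_ret_iff]
  refine ⟨by simp [viewOf], by simpa [viewOf] using h2, ?_, by simp [viewOf]⟩
  have := (update_find D.toSearchData ⟨.find k, ω⟩ [(.root, ∅)] k rfl).1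
  simp [viewOf, this]

/-- The snapshot implementation has an execution with the schedule of the stale read. -/
theorem snapshot_runs_stale (D : SearchStructure V Λ Ω) {p₁ p₂ : Fin n} (hp : p₁ ≠ p₂)
    {k : ℕ} {v : V}
    {ω : Ω} {h h' : List (Access V Λ)} {m : Mem V Λ} {r r' : DictResp V}
    (hc : D.Completes ⟨.insert k v, ω⟩ (fun _ => ∅) h m r)
    (hc' : D.Completes ⟨.find k, ω⟩ m h' m r') :
    ∃ α C, (snapshotImpl D.toSearchData n).Exec D.toSearchData α C ∧ (∀ p, C.phase p = .idle) ∧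
      α.map Event.label = staleSchedule n p₁ p₂ k v ω h h' := by
  obtain ⟨r₀, hr₀⟩ := find_completes_empty D k ω
  obtain ⟨C₁, e1, h1, h2, h3, h4⟩ := snapshot_begin (Impl.Exec.nil (D := D.toSearchData)
    (I := snapshotImpl D.toSearchData n)) (p := p₁) rfl (m := fun _ => ∅) rfl ⟨.find k, ω⟩
  have hA := snapshot_runsAlone (n := n) D.toSearchData
  obtain ⟨α₂, C₂, e2, g2, g3, g4, g5⟩ := hA e1 (p := p₂) (by rw [(h4 p₂ hp.symm).1]; rfl)
    ⟨by rw [h1]; rfl, by rw [h1]; rfl⟩ hc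
  have s3 := Impl.Step.request (I := snapshotImpl D.toSearchData n) (D := D.toSearchData)
    (C := C₂) (p := p₁) (a := .read .root)
    (by rw [(g5 p₁ hp).1, h2]) (by rw [(g5 p₁ hp).2, h3]) (by simp [SearchData.next, viewOf])
  have e3 := Impl.Exec.step e2 s3
  have s4 := Impl.Step.reply (I := snapshotImpl D.toSearchData n) (D := D.toSearchData) (p := p₁)
    (c := ⟨.find k, ω⟩) (h := []) (a := .read .root) (e := ∅)
    (C := Impl.afterEvent C₂ p₁ (Impl.reqKind (.read .root))
      (.pending ⟨.find k, ω⟩ [] (.read .root)))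
    (by simp [Impl.afterEvent]) (by simp [Impl.afterEvent, Impl.reqKind, (g5 p₁ hp).2, h3])
  have e4 := Impl.Exec.step e3 s4
  have s5 := Impl.Step.respond (I := snapshotImpl D.toSearchData n) (D := D.toSearchData) (p := p₁)
    (c := ⟨.find k, ω⟩) (h := [.read .root ∅]) (r := r₀)
    (C := Impl.afterEvent (Impl.afterEvent C₂ p₁ (Impl.reqKind (.read .root))
      (.pending ⟨.find k, ω⟩ [] (.read .root))) p₁ (Impl.replyKind ∅ (.read .root))
      (.ready ⟨.find k, ω⟩ ([] ++ [Impl.replyAccess ∅ (.read .root)])))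
    (by simp [Impl.afterEvent, Impl.replyAccess])
    (by simp [Impl.afterEvent, Impl.reqKind, Impl.replyKind, (g5 p₁ hp).2, h3]) hr₀.2
  have e5 := Impl.Exec.step e4 s5
  obtain ⟨α₆, C₆, e6, i6, hi⟩ := hA.rounds e5 (m := m) (h := h') (c := ⟨.find k, ω⟩) (r := r')
    (by
      intro q
      by_cases hq : q = p₁
      · subst hq; simp [Impl.afterEnd]
      · simp only [Impl.afterEnd, Impl.afterEvent, Function.update_of_ne hq]
        by_cases hq2 : q = p₂
        · rw [hq2, g4]
        · rw [(g5 q hq2).1, (h4 q hq).1]; rfl)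
    (by simpa [Impl.afterEnd, Impl.afterEvent] using g3) hc'
  refine ⟨_, _, e6, hi, ?_⟩
  simp [staleSchedule, g2, i6, Event.label, EvKind.shape, Impl.reqKind, Impl.replyKind]

end StaleRead

/-! ### Accesses in place -/

section InPlace

variable {V Λ Ω : Type} {n : ℕ}

/-- The invocation of a read or write is directly followed by an event of the same operation. -/
def AtomicAccesses (α : List (Event V Λ Ω n)) : Prop :=
  ∀ l₁ e e' l₂, α = l₁ ++ e :: e' :: l₂ → e.kind.IsAccInv → e'.op = e.op

/-- Invariant of a lock-based implementation while reads and writes do not overlap: the elements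
hold the values written so far, except for a write in progress. -/
structure InPlace (L : LockProgram V Λ Ω n) (α : List (Event V Λ Ω n)) (C : L.toImpl.Conf) :
    Prop where
  legal : Legal α
  quiet : (∀ p c h a, C.phase p ≠ .pending c h a) → C.sh.1 = evMem (fun _ => ∅) α
  pending : ∀ p c h a, C.phase p = .pending c h a →
    (∃ β, α = β ++ [⟨(p, C.cnt p), Impl.reqKind a⟩]) ∧
    match (C.loc p).2, a with
    | none, _ => C.sh.1 = evMem (fun _ => ∅) α
    | some e, .read x => C.sh.1 = evMem (fun _ => ∅) α ∧ e = C.sh.1 x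
    | some _, .write x e => C.sh.1 = Function.update (evMem (fun _ => ∅) α) x e

theorem legal_snoc {α : List (Event V Λ Ω n)} {e : Event V Λ Ω n} :
    Legal (α ++ [e]) ↔ Legal α ∧ LegalFrom (evMem (fun _ => ∅) α) [e] := legalFrom_append

theorem lockPrim_mem {L : LockProgram V Λ Ω n} {p : Fin n} {k : LockPrim} {x : Node V} {l : L.Loc}
    {b : Option (Edges V Λ)} {s s' : Mem V Λ × Locks V n} {l' : L.Loc × Option (Edges V Λ)}
    (h : L.lockPrim p k x l b s = some (s', l')) : s'.1 = s.1 ∧ l' = (l, b) := by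
  simp only [LockProgram.lockPrim, Option.map_eq_some_iff, Prod.mk.injEq] at h
  obtain ⟨t, -, rfl, rfl⟩ := h
  exact ⟨rfl, rfl⟩

/-- While no two reads or writes overlap, the elements of a lock-based implementation hold the
latest written values, so the reads are legal. -/
theorem inPlace_exec {D : SearchData V Λ Ω} {L : LockProgram V Λ Ω n} {α : List (Event V Λ Ω n)}
    {C : L.toImpl.Conf} (hα : L.toImpl.Exec D α C) (hat : AtomicAccesses α) : InPlace L α C := by
  induction hα with
  | nil => exact ⟨trivial, fun _ => rfl, fun p c h a hp => by simp [Impl.start] at hp⟩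
  | @step α C C' p e hα hs ih =>
    have hI := ih fun l₁ e₁ e₂ l₂ hl hk => hat l₁ e₁ e₂ (l₂ ++ e.toList) (by simp [hl]) hk
    have hlocal := (step_local hs).1
    -- while an access is pending only the accessing process has an event
    have hone : ∀ e', e = some e' → ∀ q c h a, q ≠ p → C.phase q ≠ .pending c h a := by
      rintro e' rfl q c h a hq hpq
      obtain ⟨⟨β, hβ⟩, -⟩ := hI.pending q c h a hpq
      have h1 := hat β ⟨(q, C.cnt q), Impl.reqKind a⟩ e' [] (by rw [hβ]; simp)
        (by cases a <;> trivial)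
      rw [step_op hs] at h1
      exact hq (congrArg Prod.fst h1).symm
    cases hs with
    | invoke c hp =>
      have hno := hone _ rfl
      simp only [Option.toList_some]
      have hq : ∀ q c h a, C.phase q ≠ .pending c h a := by
        intro q c h a
        by_cases hqp : q = p
        · rw [hqp, hp]; simp
        · exact hno q c h a hqp
      refine ⟨legal_snoc.2 ⟨hI.legal, by simp [LegalFrom]⟩, fun _ => ?_, ?_⟩
      · rw [evMem_append]; exact hI.quiet hq
      · intro q c' h a hph
        exfalso
        by_cases hqp : q = p
        · subst hqp; simp [Impl.afterEvent] at hph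
        · rw [(hlocal q hqp).1] at hph; exact hq _ _ _ _ hph
    | @readyPrim c h f s l hp hr hf =>
      have hsync : s.1 = C.sh.1 := by
        simp only [LockProgram.toImpl] at hr
        split at hr
        · obtain rfl := ReadyAct.prim.inj hr
          exact (lockPrim_mem hf).1
        · simp at hr
      simp only [Option.toList_none, List.append_nil]
      refine ⟨hI.legal, fun hq => ?_, ?_⟩
      · rw [← hI.quiet hq]; exact hsync
      · intro q c' h' a hph
        have hqp : q ≠ p := by
          rintro rfl
          have : (Impl.afterPrim C q s l).phase q = C.phase q := rfl
          rw [this, hp] at hph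
          simp at hph
        have := hI.pending q c' h' a hph
        have h1 : (Impl.afterPrim C p s l).loc q = C.loc q := (hlocal q hqp).2.2
        rw [h1]
        have h2 : (Impl.afterPrim C p s l).sh.1 = C.sh.1 := hsync
        rw [h2]
        exact this
    | @request c h a hp hr hn =>
      have hno := hone _ rfl
      simp only [Option.toList_some]
      have hq : ∀ q c h a, C.phase q ≠ .pending c h a := by
        intro q c h a
        by_cases hqp : q = p
        · rw [hqp, hp]; simp
        · exact hno q c h a hqp
      have hev : evMem (fun _ => ∅) (α ++ [⟨(p, C.cnt p), Impl.reqKind a⟩]) =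
          evMem (fun _ => ∅) α := by
        rw [evMem_append]; cases a <;> rfl
      refine ⟨legal_snoc.2 ⟨hI.legal, by cases a <;> simp [LegalFrom, Impl.reqKind]⟩,
        fun hq' => ?_, ?_⟩
      · exact absurd (by simp [Impl.afterEvent]) (hq' p c h a)
      · intro q c' h' a' hph
        by_cases hqp : q = p
        · subst hqp
          simp only [Impl.afterEvent, Function.update_self, Phase.pending.injEq] at hph
          obtain ⟨rfl, rfl, rfl⟩ := hph
          refine ⟨⟨α, rfl⟩, ?_⟩
          have : ((Impl.afterEvent C q (Impl.reqKind a) (.pending c h a)).loc q).2 = none := by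
            simp only [Impl.afterEvent, Function.update_self]; rfl
          rw [this, hev]
          exact hI.quiet hq
        · rw [(hlocal q hqp).1] at hph; exact absurd hph (hq _ _ _ _)
    | @respond c h r hp hr hn =>
      have hno := hone _ rfl
      simp only [Option.toList_some]
      have hq : ∀ q c h a, C.phase q ≠ .pending c h a := by
        intro q c h a
        by_cases hqp : q = p
        · rw [hqp, hp]; simp
        · exact hno q c h a hqp
      refine ⟨legal_snoc.2 ⟨hI.legal, by simp [LegalFrom]⟩, fun _ => ?_, ?_⟩
      · rw [evMem_append]; exact hI.quiet hq
      · intro q c' h a hph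
        exfalso
        by_cases hqp : q = p
        · subst hqp; simp [Impl.afterEnd] at hph
        · rw [(hlocal q hqp).1] at hph; exact hq _ _ _ _ hph
    | @servePrim c h a f s l hp hr hf =>
      obtain ⟨hβ, hm⟩ := hI.pending p c h a hp
      simp only [Option.toList_none, List.append_nil]
      refine ⟨hI.legal, fun hq => absurd hp (hq p c h a), ?_⟩
      intro q c' h' a' hph
      have hqp : q = p := by
        obtain ⟨⟨β', hβ'⟩, -⟩ := hI.pending q c' h' a' hph
        obtain ⟨β, hβ⟩ := hβ
        have := (List.append_inj' (hβ'.symm.trans hβ) rfl).2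
        simp only [List.cons.injEq, Event.mk.injEq, Prod.mk.injEq] at this
        exact this.1.1.1
      subst hqp
      have hph' : C.phase q = .pending c' h' a' := hph
      rw [hp] at hph'
      simp only [Phase.pending.injEq] at hph'
      obtain ⟨rfl, rfl, rfl⟩ := hph'
      refine ⟨hβ, ?_⟩
      have h1 : (Impl.afterPrim C q s l).loc q = l := by simp [Impl.afterPrim]
      have h2 : (Impl.afterPrim C q s l).sh = s := rfl
      rw [h1, h2]
      simp only [LockProgram.toImpl] at hr
      split at hr
      · obtain rfl := ServeAct.prim.inj hr
        obtain ⟨h3, rfl⟩ := lockPrim_mem hf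
        rw [h3]
        exact hm
      · cases hb : (C.loc q).2 with
        | some e => simp [hb] at hr
        | none =>
          simp only [hb] at hr hm
          obtain rfl := ServeAct.prim.inj hr
          cases a with
          | read x =>
            simp only [LockProgram.accessPrim] at hf
            obtain ⟨rfl, rfl⟩ := Prod.mk.inj (Option.some.inj hf)
            exact ⟨hm, rfl⟩
          | write x e =>
            simp only [LockProgram.accessPrim] at hf
            obtain ⟨rfl, rfl⟩ := Prod.mk.inj (Option.some.inj hf)
            rw [← hm]
    | @reply c h a e hp hr =>
      have hno := hone _ rfl
      obtain ⟨-, hm⟩ := hI.pending p c h a hp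
      simp only [Option.toList_some]
      have hb : (C.loc p).2 = some e := by
        simp only [LockProgram.toImpl] at hr
        split at hr
        · simp at hr
        · cases hb : (C.loc p).2 with
          | none => simp [hb] at hr
          | some e' => simp only [hb, ServeAct.reply.injEq] at hr; rw [hr]
      rw [hb] at hm
      have hq' : ∀ q c' h' a', (Impl.afterEvent C p (Impl.replyKind e a)
          (.ready c (h ++ [Impl.replyAccess e a]))).phase q ≠ .pending c' h' a' := by
        intro q c' h' a' hph
        by_cases hqp : q = p
        · subst hqp; simp [Impl.afterEvent] at hph
        · rw [(hlocal q hqp).1] at hph; exact hno _ _ _ _ hqp hph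
      refine ⟨legal_snoc.2 ⟨hI.legal, ?_⟩, fun _ => ?_, fun q c' h' a' hph =>
        absurd hph (hq' q c' h' a')⟩
      · cases a with
        | read x =>
          simp only [LegalFrom, Impl.replyKind, and_true]
          rw [← hm.1]; exact hm.2
        | write x e' => simp [LegalFrom, Impl.replyKind]
      · rw [evMem_append]
        cases a with
        | read x => exact hm.1
        | write x e' => exact hm
    | @abort c h a hp hr =>
      exfalso
      simp only [LockProgram.toImpl] at hr
      split at hr
      · simp at hr
      · cases hb : (C.loc p).2 <;> simp [hb] at hr

/-- The invocation of a read or write is directly followed by an event of the same process that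
is not an invocation of an operation. -/
def Direct (s s' : Fin n × Shape V Λ Ω) : Prop :=
  ((∃ x, s.2 = .invRead x) ∨ ∃ x e, s.2 = .invWrite x e) → s'.1 = s.1 ∧ ∀ c, s'.2 ≠ .inv c

theorem direct_accesses {p : Fin n} (h : List (Access V Λ)) {t : Schedule V Λ Ω n}
    (ht : t.IsChain Direct) : ((h.flatMap accShape).map (Prod.mk p) ++ t).IsChain Direct := by
  induction h with
  | nil => exact ht
  | cons a h ih =>
    cases a <;>
    · simp only [accShape, List.flatMap_cons, List.cons_append, List.nil_append, List.map_cons,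
        List.isChain_cons_cons]
      refine ⟨fun _ => ⟨rfl, by simp⟩, List.isChain_cons.2 ⟨fun y _ h => ?_, ih⟩⟩
      simp at h

theorem direct_opShapes {p : Fin n} {c : Call V Ω} (h : List (Access V Λ)) {t : Schedule V Λ Ω n}
    (ht : t.IsChain Direct) : (opShapes p c h ++ t).IsChain Direct := by
  simp only [opShapes, List.cons_append, List.append_assoc, List.nil_append]
  refine List.isChain_cons.2 ⟨fun y _ h => by simp at h, direct_accesses h ?_⟩
  exact List.isChain_cons.2 ⟨fun y _ h => by simp at h, ht⟩

theorem atomicAccesses_of_direct {α : List (Event V Λ Ω n)} (ht : Tidy α)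
    (h : (α.map Event.label).IsChain Direct) : AtomicAccesses α := by
  rintro l₁ e e' l₂ rfl hk
  simp only [List.map_append, List.map_cons] at h
  have h1 := (List.isChain_append.1 h).2.1
  rw [List.isChain_cons_cons] at h1
  have h2 := h1.1 (by
    obtain ⟨π, k⟩ := e
    cases k <;> simp [EvKind.IsAccInv] at hk <;> simp [Event.label, EvKind.shape])
  refine ht.same_op (X := l₁) (Y := [e']) ⟨l₂, by simp⟩ ?_ e' (by simp) h2.1
  intro y hy _ hi
  rw [List.mem_singleton] at hy
  subst hy
  obtain ⟨π, k⟩ := y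
  cases k <;> simp [EvKind.IsInv] at hi
  exact h2.2 _ rfl

end InPlace

/-! ### Lock-based implementations reject the stale read -/

section StaleReadRejected

variable {V Λ Ω : Type} {n : ℕ}

/-- The scheduled events before the final rounds are a prefix of an execution without aborts. -/
theorem exec_prefix_of_schedule {D : SearchData V Λ Ω} {I : Impl V Λ Ω n}
    {α : List (Event V Λ Ω n)} {C : I.Conf} (hα : I.Exec D α C)
    (hna : ∀ e ∈ α, e.kind ≠ .abort) {pre tail : Schedule V Λ Ω n}
    (hσ : scheduleOf (history α) = pre ++ tail) (ht : ∀ p, ∃ s, (p, s) ∈ tail) :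
    ∃ β C', I.Exec D β C' ∧ β.map Event.label = pre ∧ ∀ e ∈ β, e.kind ≠ .abort := by
  rw [history_of_no_abort hna] at hσ
  have hR : ∀ π, Ended α π → Returned α π := by
    rintro ⟨p, j⟩ ⟨⟨o, k⟩, he, rfl, hk⟩
    cases k <;> simp [EvKind.IsEnd] at hk
    · exact ⟨_, he⟩
    · exact absurd rfl (hna _ he)
  obtain ⟨β, γ, h1, h2, -, -⟩ := filter_prefix (exec_sorted hα) (R := Returned α)
    (S := fun _ => True) (fun _ _ => trivial) (by
      rintro π π' - hnR ⟨r, hr⟩ hocc - hpp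
      have h1 : ¬ Ended α π := fun h => hnR (hR _ h)
      have h2 : Ended α π' := ⟨_, hr, rfl, trivial⟩
      rw [exec_ended_iff hα] at h1 h2
      rw [hpp] at h1
      omega) hσ ht
  simp only [decide_true, List.filter_true] at h1
  obtain ⟨C', hC'⟩ := exec_prefix hα (β := β) ⟨γ, h1.symm⟩
  exact ⟨β, C', hC', h2, fun e he => hna e (by rw [h1]; simp [he])⟩

/-- The search reads the root after the insertion has written its edges. A search that reads nothing
else misses the key, although it is stored. -/
theorem lock_rejects (D : SearchStructure V Λ Ω) {p₁ p₂ : Fin n} (hp : p₁ ≠ p₂) {k : ℕ} {v : V}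
    {ω : Ω} {h h' : List (Access V Λ)} {m : Mem V Λ} {r : DictResp V}
    (hc : D.Completes ⟨.insert k v, ω⟩ (fun _ => ∅) h m r) (L : LockProgram V Λ Ω n)
    (hL : L.toImpl.Pessimistic D.toSearchData) :
    ¬ L.toImpl.Accepts D.toSearchData (staleSchedule n p₁ p₂ k v ω h h') := by
  rintro ⟨H, ⟨α, C, hα, rfl⟩, hσ⟩
  obtain ⟨β, C', hβ, hlab, hna⟩ := exec_prefix_of_schedule hα (hL α C hα) hσ (mem_rounds n _ _)
  have htidy := Tidy.of_exec hβ
  have hlegal := (inPlace_exec hβ (atomicAccesses_of_direct htidy (by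
    rw [hlab, List.cons_append]
    refine List.isChain_cons.2 ⟨fun y _ h => by simp at h, direct_opShapes h ?_⟩
    simp [Direct]))).legal
  obtain ⟨X, Z, rfl, hX, hZ⟩ := List.map_eq_append_iff.1 hlab
  obtain ⟨e₀, Y, rfl, he₀, hY⟩ := List.map_eq_cons_iff.1 hX
  obtain ⟨a, Z, rfl, ha, hZ⟩ := List.map_eq_cons_iff.1 hZ
  obtain ⟨b, Z, rfl, hb, hZ⟩ := List.map_eq_cons_iff.1 hZ
  obtain ⟨d, Z, rfl, hd, hZ⟩ := List.map_eq_cons_iff.1 hZ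
  obtain rfl := List.map_eq_nil_iff.1 hZ
  -- the search of the first process
  have hYp : ∀ y ∈ Y, y.op.1 = p₂ := by
    intro y hy
    have : y.label ∈ opShapes p₂ ⟨.insert k v, ω⟩ h := by rw [← hY]; exact List.mem_map_of_mem hy
    simp only [opShapes, List.cons_append, List.mem_cons, List.mem_append, List.mem_map,
      List.not_mem_nil, or_false] at this
    rcases this with h | ⟨_, _, h⟩ | h
    · exact (Prod.ext_iff.1 h).1
    · exact (Prod.ext_iff.1 h).1.symm
    · exact (Prod.ext_iff.1 h).1
  have hk : ∀ {e : Event V Λ Ω n} {s}, e.label = s → e.op.1 = s.1 ∧ e.kind.shape = s.2 := by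
    rintro e s rfl; exact ⟨rfl, rfl⟩
  have hni : ∀ {e : Event V Λ Ω n} {s}, e.label = s → (∀ c, s.2 ≠ .inv c) → ¬ e.kind.IsInv := by
    rintro ⟨π, κ⟩ s rfl hs hi
    cases κ <;> simp [EvKind.IsInv] at hi
    exact hs _ rfl
  have hsame := htidy.same_op (X := []) (a := e₀) (Y := Y ++ [a, b, d]) (by simp) (by
    intro y hy hyp hi
    simp only [List.mem_append, List.mem_cons, List.not_mem_nil, or_false] at hy
    rw [(hk he₀).1] at hyp
    rcases hy with hy | rfl | rfl | rfl
    · exact hp (hyp.symm.trans (hYp y hy))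
    · exact hni ha (by simp) hi
    · exact hni hb (by simp) hi
    · exact hni hd (by simp) hi)
  have hao := hsame a (by simp) ((hk ha).1.trans (hk he₀).1.symm)
  have hbo := hsame b (by simp) ((hk hb).1.trans (hk he₀).1.symm)
  have hdo := hsame d (by simp) ((hk hd).1.trans (hk he₀).1.symm)
  have hop : opHist (e₀ :: Y ++ [a, b, d]) e₀.op = [e₀, a, b, d] := by
    have : Y.filter (fun e => e.op = e₀.op) = [] := by
      rw [List.filter_eq_nil_iff]
      intro y hy hye
      simp only [decide_eq_true_eq] at hye
      have h1 := hYp y hy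
      rw [hye, (hk he₀).1] at h1
      exact hp h1
    simp [opHist, this, hao, hbo, hdo]
  have hend : Ended (e₀ :: Y ++ [a, b, d]) e₀.op := by
    refine ⟨d, by simp, hdo, ?_⟩
    obtain ⟨π, κ⟩ := d
    have := (hk hd).2
    cases κ <;> simp [EvKind.shape] at this
    trivial
  obtain ⟨c, l, hf, ⟨r₁, hn, hr₁⟩ | ⟨_, -, ha'⟩⟩ :=
    (exec_local hβ e₀.op.1).2.2 _ ((exec_ended_iff hβ _).1 hend)
  swap
  · have : (⟨e₀.op, .abort⟩ : Event V Λ Ω n) ∈ opHist (e₀ :: Y ++ [a, b, d]) e₀.op := by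
      rw [show e₀.op = (e₀.op.1, e₀.op.2) from rfl, ha']; simp [opEvents]
    exact hna _ (mem_opHist.1 this).1 rfl
  rw [show (e₀.op.1, e₀.op.2) = e₀.op from rfl, hop] at hr₁
  have hsh : opShapes p₁ ⟨.find k, ω⟩ [Access.read .root ∅] = opShapes e₀.op.1 c l := by
    rw [← opEvents_label_res e₀.op c l r₁, ← hr₁]
    simp [he₀, ha, hb, hd, opShapes, accShape]
  obtain ⟨rfl, hreq⟩ := opShapes_inj hsh
  obtain ⟨ac, rfl⟩ : ∃ ac, l = [ac] := by
    rw [← List.length_eq_one_iff]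
    simpa using congrArg List.length hreq.symm
  simp only [List.map_cons, List.map_nil, List.cons.injEq, and_true, reqOf] at hreq
  cases ac with
  | write x e => simp at hreq
  | read x e =>
    simp only [Req.read.injEq] at hreq
    subst hreq
    simp only [opEvents, List.flatMap_cons, accessEvents, List.flatMap_nil, List.append_nil,
      List.map_cons, List.map_nil, List.cons_append, List.nil_append, List.cons.injEq] at hr₁
    obtain ⟨-, -, hb', -⟩ := hr₁
    -- it reads the root that the insertion has written
    have hmem : evMem (fun _ => ∅) (e₀ :: Y ++ [a]) = m := by
      rw [evMem_eq_shapeMem]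
      simp only [List.map_append, List.map_cons, List.map_nil, List.cons_append, he₀, hY, ha,
        shapeMem, shapeMem_append, shapeMem_opShapes]
      exact (seqRun_iff.1 hc.1).2.symm
    have hleg : Legal ((e₀ :: Y ++ [a]) ++ [b, d]) := by simpa using hlegal
    have he : e = m .root := by
      have := (legalFrom_append.1 hleg).2
      rw [hmem, hb'] at this
      exact this.1
    obtain ⟨q, hq, hspec⟩ := completes_spec .init represents_empty hc
    have hfind : D.Completes ⟨.find k, ω⟩ m [.read .root e] m r₁ :=
      ⟨seqRun_iff.2 ⟨⟨hf [] _ [] rfl, he, trivial⟩, rfl⟩, hn⟩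
    have hq' : q k = some v := by
      simp only [dictSpec] at hq
      rcases hq with ⟨-, rfl, -⟩ | ⟨h, -⟩
      · simp
      · simp at h
    obtain ⟨e', he'⟩ := ((find_result (.step .init hc) hspec rfl hfind).1 v hq').1
    simp [viewOf] at he'

end StaleReadRejected

/-! ### A search on a detour -/

section Detour

variable {V Λ Ω : Type}

/-- Two states of the search structure in which a search for `k` starts at the root and visits
the node `(kx, vx)`. The structure holds `(kx, vx)` and `(k, v)` in the memory `m`. Deleting
first `kx`, by the accesses `h₁`, and then `k`, by the accesses `h₂`, leads to memories `m₁` and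
`m₂`. The search that has visited the root and `(kx, vx)` in `m` and goes on in `m₂`, with
accesses `rest`, proceeds as it does in the memory `m₀` reached from `m` by deleting `k` only. -/
structure Detour (D : SearchStructure V Λ Ω) where
  k : ℕ
  v : V
  ω : Ω
  kx : ℕ
  vx : V
  m : Mem V Λ
  m₀ : Mem V Λ
  m₁ : Mem V Λ
  m₂ : Mem V Λ
  h₁ : List (Access V Λ)
  h₂ : List (Access V Λ)
  rest : List (Access V Λ)
  r : DictResp V
  r₁ : DictResp V
  r₂ : DictResp V
  reach : D.Reach m
  ne : kx ≠ k
  search : D.Completes ⟨.find k, ω⟩ m₀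
    (.read .root (m .root) :: .read (.pair kx vx) (m (.pair kx vx)) :: rest) m₀ r
  search_rest : Runs D.toSearchData ⟨.find k, ω⟩ m₂
    [.read .root (m .root), .read (.pair kx vx) (m (.pair kx vx))] rest
  root_leads : ∀ u, ¬ Leads (m .root) (.pair k u)
  node_leads : ∀ u, ¬ Leads (m (.pair kx vx)) (.pair k u)
  delete₁ : D.Completes ⟨.delete kx, ω⟩ m h₁ m₁ r₁
  delete₂ : D.Completes ⟨.delete k, ω⟩ m₁ h₂ m₂ r₂
  single : (D.update ⟨.delete k, ω⟩ (viewOf h₂)).1.length ≤ 1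
  present : InGraph m (.pair k v)
  present₁ : InGraph m₁ (.pair k v)
  absent₀ : ∀ u, ¬ InGraph m₀ (.pair k u)
  absent₂ : ¬ InGraph m₂ (.pair kx vx)

theorem inGraph_of_delete {D : SearchStructure V Λ Ω} {c : Call V Ω} {m m' : Mem V Λ}
    {q : ℕ → Option V} {h : List (Access V Λ)} {k : ℕ} {r : DictResp V} (hm : D.Reach m)
    (hq : Represents m q) (hk : c.op = .delete k) (hc : D.Completes c m h m' r) {x : Node V}
    (hx : InGraph m' x) : InGraph m x := by
  rcases Relation.reflTransGen_iff_eq_or_transGen.1 hx with rfl | hx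
  · exact .refl
  · exact (delete_path hm hq hk hc hx).to_reflTransGen

/-- From a node that is not a predecessor of the removed node `b`, a deletion does not change
anything on the descendants of `b`. -/
theorem delete_below {D : SearchStructure V Λ Ω} {c : Call V Ω} {m m' : Mem V Λ}
    {q : ℕ → Option V} {h : List (Access V Λ)} {k : ℕ} {u : V} {r : DictResp V} (hm : D.Reach m)
    (hq : Represents m q) (hk : c.op = .delete k) (hu : q k = some u)
    (hc : D.Completes c m h m' r) {y : Node V}
    (hy : Relation.ReflTransGen (Edge m) (.pair k u) y) : m' y = m y := by
  refine (delete_mem hm hq hk hu hc y).2 fun ⟨hy', he⟩ => ?_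
  exact D.acyclic m hm _ ((hq k u).2 hu) (Relation.TransGen.tail' hy he)

/-- The first node that a search visits after the root. -/
theorem view_second {D : SearchStructure V Λ Ω} {c : Call V Ω} {m m' : Mem V Λ}
    {h : List (Access V Λ)} (hr : D.SeqRun c m h m') {y : Node V} {e : Edges V Λ}
    (hy : (y, e) ∈ viewOf h) (hroot : y ≠ .root) (hne : ¬ Edge m .root y) :
    ∃ x w, viewOf h = (.root, m .root) :: (x, m x) :: w ∧ Edge m .root x ∧ (y, e) ∈ w ∧
      Relation.TransGen (Edge m) x y := by
  obtain ⟨w, hw⟩ := view_root hr (by intro h0; rw [h0] at hy; simp at hy)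
  have hval := (seqRun_shape hr).2.2.2.2
  have hch := view_chain hr
  have hpw := view_pairwise hr
  rw [hw] at hy hval hch hpw
  rcases List.mem_cons.1 hy with h0 | hy
  · exact absurd (congrArg Prod.fst h0) hroot
  cases w with
  | nil => simp at hy
  | cons x w =>
    obtain ⟨x, ex⟩ := x
    rw [List.isChain_cons_cons] at hch
    have hex : ex = m x := hval _ (List.mem_cons_of_mem _ List.mem_cons_self)
    subst hex
    rcases List.mem_cons.1 hy with h0 | hy
    · rw [Prod.mk.injEq] at h0
      rw [h0.1] at hne
      exact absurd hch.1 hne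
    · refine ⟨x, w, hw, hch.1, hy, ?_⟩
      exact (List.pairwise_cons.1 (List.pairwise_cons.1 hpw).2).1 _ hy

/-- By non-triviality, the node `(k, v)` has a unique predecessor `a`, which is at distance at least
two from the root; the first node after the root on the way of a search is therefore a node `(kx,
vx)` other than `a`. Deleting `kx` does not change the graph below `(kx, vx)`, and deleting `k`
rewrites no node there but `a`. -/
theorem exists_detour (D : SearchStructure V Λ Ω) : Nonempty (Detour D) := by
  obtain ⟨k, v, ω, mᵢ, hᵢ, m, rᵢ, a, hmᵢ, habs, hins, ha, hedge, haroot, hroota⟩ := D.nontrivial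
  have hm : D.Reach m := .step hmᵢ hins
  -- the inserted node is present
  obtain ⟨qᵢ, hqᵢ⟩ := reach_represents hmᵢ
  obtain ⟨q, hspec, hq⟩ := completes_spec hmᵢ hqᵢ hins
  have hqk : q k = some v := by
    simp only [dictSpec] at hspec
    rcases hspec with ⟨-, rfl, -⟩ | ⟨h, -⟩
    · simp
    · obtain ⟨u, hu⟩ := Option.ne_none_iff_exists'.1 h
      exact absurd ((hqᵢ k u).2 hu) (habs u)
  have hkin : InGraph m (.pair k v) := (hq k v).2 hqk
  -- the search for `k` in `m` visits the root and then a node that is not a predecessor of `k`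
  obtain ⟨hf, mf, rf, hfc⟩ := completes_exists hm ⟨.find k, ω⟩
  obtain ⟨e, hkv⟩ := ((find_result hm hq rfl hfc).1 v hqk).1
  obtain ⟨hmf, -, hfreads⟩ := find_no_write rfl hfc.1
  subst mf
  obtain ⟨x, w, hview, hrx, hw, hxk⟩ := view_second hfc.1 hkv (by simp) (fun h0 =>
    haroot ((hedge .root v .refl).1 h0).1.symm)
  have hxin : InGraph m x := .single hrx
  have hxa : x ≠ a := by rintro rfl; exact hroota hrx
  have hxroot : x ≠ .root := by
    rintro rfl
    exact D.acyclic m hm .root .refl (.single hrx)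
  cases x with
  | root => exact absurd rfl hxroot
  | pair kx vx =>
  have hqx : q kx = some vx := (hq kx vx).1 hxin
  have hne : kx ≠ k := by
    rintro rfl
    exact haroot ((hedge .root vx .refl).1 hrx).1.symm
  -- the deletions
  obtain ⟨h₁, m₁, r₁, hd₁⟩ := completes_exists hm ⟨.delete kx, ω⟩
  have hm₁ : D.Reach m₁ := .step hm hd₁
  have hq₁ := (delete_effect hm hq rfl hqx hd₁).1
  have hqk₁ : Function.update q kx none k = some v := by
    rw [Function.update_of_ne hne.symm, hqk]
  obtain ⟨h₂, m₂, r₂, hd₂⟩ := completes_exists hm₁ ⟨.delete k, ω⟩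
  have hq₂ := (delete_effect hm₁ hq₁ rfl hqk₁ hd₂).1
  obtain ⟨h₀, m₀, r₀, hd₀⟩ := completes_exists hm ⟨.delete k, ω⟩
  have hm₀ : D.Reach m₀ := .step hm hd₀
  have hq₀ := (delete_effect hm hq rfl hqk hd₀).1
  -- the only predecessor of `k` in the memories before its deletion is `a`
  have hin₁ : ∀ y, InGraph m₁ y → InGraph m y := fun y => inGraph_of_delete hm hq rfl hd₁
  have hpred₁ : ∀ y, InGraph m₁ y → Edge m₁ y (.pair k v) → y = a := by
    intro y hy he
    by_cases hyx : Edge m y (.pair kx vx)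
    · have h1 := (delete_mem hm hq rfl hqx hd₁ y).1 ⟨hin₁ y hy, hyx⟩
      obtain ⟨l, hl⟩ := he
      rw [h1] at hl
      rcases D.proper_unlink _ _ _ _ _ _ hl with h2 | h2
      · exact ((hedge y v (hin₁ y hy)).1 ⟨l, h2⟩).1
      · exact absurd ((hedge _ v hxin).1 h2).1 hxa
    · have h1 := (delete_mem hm hq rfl hqx hd₁ y).2 fun h0 => hyx h0.2
      rw [Edge, h1] at he
      exact ((hedge y v (hin₁ y hy)).1 he).1
  have hbelow : ∀ y, Relation.ReflTransGen (Edge m) (.pair kx vx) y → m₁ y = m y :=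
    fun y => delete_below hm hq rfl hqx hd₁
  -- below `(kx, vx)` the deletion of `k` has the same effect, whether or not `kx` is deleted
  have hagree : ∀ y, Relation.ReflTransGen (Edge m) (.pair kx vx) y → m₂ y = m₀ y := by
    intro y hy
    have hyin : InGraph m y := hxin.trans hy
    have hk₁ : m₁ (.pair k v) = m (.pair k v) := hbelow _ hxk.to_reflTransGen
    by_cases hya : y = a
    · subst hya
      have hey : Edge m y (.pair k v) := (hedge y v hyin).2 ⟨rfl, rfl⟩
      have hy₁ : InGraph m₁ y := by
        cases y with
        | root => exact .refl
        | pair ky vy =>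
          have hqy := (hq ky vy).1 hyin
          have : ky ≠ kx := by
            rintro rfl
            rw [hqx] at hqy
            exact hxa (by rw [Option.some.inj hqy])
          exact (hq₁ ky vy).2 (by rw [Function.update_of_ne this, hqy])
      rw [(delete_mem hm₁ hq₁ rfl hqk₁ hd₂ y).1 ⟨hy₁, by rw [Edge, hbelow y hy]; exact hey⟩,
        (delete_mem hm hq rfl hqk hd₀ y).1 ⟨hyin, hey⟩, hk₁, hbelow y hy]
    · rw [(delete_mem hm₁ hq₁ rfl hqk₁ hd₂ y).2 fun h0 => hya (hpred₁ y h0.1 h0.2),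
        (delete_mem hm hq rfl hqk hd₀ y).2 fun h0 => hya ((hedge y v hyin).1 h0.2).1,
        hbelow y hy]
  have hroot₀ : m₀ .root = m .root :=
    (delete_mem hm hq rfl hqk hd₀ .root).2 fun h0 => haroot ((hedge _ v h0.1).1 h0.2).1.symm
  have hnode₀ : m₀ (.pair kx vx) = m (.pair kx vx) :=
    (delete_mem hm hq rfl hqk hd₀ _).2 fun h0 => hxa ((hedge _ v h0.1).1 h0.2).1
  -- the search for `k` in `m₀`
  have hpre : Runs D.toSearchData ⟨.find k, ω⟩ m₀ []
      [.read .root (m .root), .read (.pair kx vx) (m (.pair kx vx))] := by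
    have h1 := (seqRun_iff.1 hfc.1).1
    rw [hfreads, hview] at h1
    simp only [List.map_cons] at h1
    exact ⟨h1.1, hroot₀.symm, h1.2.2.1, hnode₀.symm, trivial⟩
  obtain ⟨hs, ms, rs, hsc⟩ := completes_exists hm₀ ⟨.find k, ω⟩
  obtain ⟨hms, -, hsreads⟩ := find_no_write rfl hsc.1
  subst ms
  obtain ⟨rest, rfl⟩ := runs_le_of_ret hpre (seqRun_iff.1 hsc.1).1 hsc.2
  have hrun := runs_append.1 (seqRun_iff.1 hsc.1).1
  have hdesc : ∀ l₁ x e l₂, rest = l₁ ++ .read x e :: l₂ →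
      Relation.TransGen (Edge m) (.pair kx vx) x := by
    intro l₁ x e l₂ hl
    have hpw := view_pairwise hsc.1
    rw [hl] at hpw
    simp only [viewOf, List.filterMap_append, List.filterMap_cons, List.cons_append,
      List.nil_append, List.pairwise_cons] at hpw
    exact delete_path hm hq rfl hd₀ (hpw.2.1 (x, e) (by simp))
  have hrest : ∀ l₁ l₂, rest = l₁ ++ l₂ → Runs D.toSearchData ⟨.find k, ω⟩ m₀
      ([.read .root (m .root), .read (.pair kx vx) (m (.pair kx vx))] ++ l₁) l₂ →
      Runs D.toSearchData ⟨.find k, ω⟩ m₂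
      ([.read .root (m .root), .read (.pair kx vx) (m (.pair kx vx))] ++ l₁) l₂ := by
    intro l₁ l₂
    induction l₂ generalizing l₁ with
    | nil => intros; trivial
    | cons b l₂ ih =>
      intro hl hr
      cases b with
      | read x e =>
        obtain ⟨hn, he, hr⟩ := hr
        refine ⟨hn, ?_, ?_⟩
        · rw [hagree x (hdesc l₁ x e l₂ hl).to_reflTransGen]; exact he
        · have := ih (l₁ ++ [.read x e]) (by simp [hl]) (by simpa using hr)
          simpa using this
      | write x e =>
        exfalso
        have : Access.write x e ∈ (viewOf ([Access.read .root (m .root),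
            .read (.pair kx vx) (m (.pair kx vx))] ++ rest)).map fun a => Access.read a.1 a.2 := by
          rw [← hsreads, hl]; simp
        simp at this
  refine ⟨⟨k, v, ω, kx, vx, m, m₀, m₁, m₂, h₁, h₂, rest, rs, r₁, r₂, hm, hne, hsc, ?_, ?_, ?_,
    hd₁, hd₂, ?_, hkin, (hq₁ k v).2 hqk₁, ?_, ?_⟩⟩
  · have := hrest [] rest rfl (by simpa [accMem] using hrun.2)
    simpa using this
  · exact fun u h0 => haroot ((hedge _ u .refl).1 h0).1.symm
  · exact fun u h0 => hxa ((hedge _ u hxin).1 h0).1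
  · -- the deletion of `k` writes only to `a`
    have hw := (delete_effect hm₁ hq₁ rfl hqk₁ hd₂).2.2.2
    have hnd := view_nodup hm₁ hd₂.1
    rcases update_delete D.toSearchData ⟨.delete k, ω⟩ (viewOf h₂) k rfl with
      ⟨b, -, -, -, hu⟩ | ⟨-, hu⟩
    · have hnd' : ((D.update ⟨.delete k, ω⟩ (viewOf h₂)).1.map Prod.fst).Nodup := by
        rw [hu, List.map_filterMap]
        refine List.Nodup.sublist ?_ hnd
        rw [← List.filterMap_eq_map]
        generalize viewOf h₂ = w'
        induction w' with
        | nil => simp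
        | cons y w' ih =>
          simp only [List.filterMap_cons, Function.comp_apply]
          by_cases hy : Leads y.2 b.1
          · simpa [hy] using ih
          · simp only [hy, if_false, Option.map_none]
            exact ih.cons _
      by_contra hlen
      push Not at hlen
      match hU : (D.update ⟨.delete k, ω⟩ (viewOf h₂)).1 with
      | [] => rw [hU] at hlen; simp at hlen
      | [_] => rw [hU] at hlen; simp at hlen
      | y :: z :: l =>
        rw [hU] at hw hnd'
        have h1 := hw y (by simp)
        have h2 := hw z (by simp)
        have h3 := hpred₁ _ h1.1 h1.2.1
        have h4 := hpred₁ _ h2.1 h2.2.1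
        simp [h3, h4] at hnd'
    · rw [hu]; simp
  · intro u h0
    have := (hq₀ k u).1 h0
    simp at this
  · intro h0
    have := (hq₂ kx vx).1 h0
    simp [hne] at this

end Detour

/-! ### Serializable implementations reject the detour -/

section DetourSchedule

variable {V Λ Ω : Type} {n : ℕ}

/-- What a schedule records of an operation that has started. -/
def openShapes (p : Fin n) (c : Call V Ω) (h : List (Access V Λ)) : Schedule V Λ Ω n :=
  (p, .inv c) :: (h.flatMap accShape).map (Prod.mk p)

/-- What a schedule records of the last accesses of an operation and its response. -/
def closeShapes (p : Fin n) (h : List (Access V Λ)) : Schedule V Λ Ω n :=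
  (h.flatMap accShape).map (Prod.mk p) ++ [(p, .res)]

/-- The accesses of the search in a detour before the deletions. -/
def Detour.first {D : SearchStructure V Λ Ω} (d : Detour D) : List (Access V Λ) :=
  [.read .root (d.m .root), .read (.pair d.kx d.vx) (d.m (.pair d.kx d.vx))]

/-- After the operations `l`, the process `p₁` starts to search for `k`; then `p₂` deletes `kx` and
`k`, and the search goes on. Finally every process searches for `k`. -/
def detourSchedule {D : SearchStructure V Λ Ω} (d : Detour D) (n : ℕ) (p₁ p₂ : Fin n)
    (l : List (Call V Ω × List (Access V Λ))) (h' : List (Access V Λ)) : Schedule V Λ Ω n :=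
  (l.flatMap (fun a => opShapes p₂ a.1 a.2) ++ (openShapes p₁ ⟨.find d.k, d.ω⟩ d.first ++
    (opShapes p₂ ⟨.delete d.kx, d.ω⟩ d.h₁ ++ (opShapes p₂ ⟨.delete d.k, d.ω⟩ d.h₂ ++
    closeShapes p₁ d.rest)))) ++ rounds n ⟨.find d.k, d.ω⟩ h'

theorem open_append_close (p : Fin n) (c : Call V Ω) (h h' : List (Access V Λ)) :
    openShapes p c h ++ closeShapes p h' = opShapes p c (h ++ h') := by
  simp [openShapes, closeShapes, opShapes]

theorem proc_of_accShapes {p : Fin n} {h : List (Access V Λ)} {s : Fin n × Shape V Λ Ω}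
    (hs : s ∈ (h.flatMap accShape).map (Prod.mk p)) : s.1 = p ∧ ∀ c, s.2 ≠ .inv c := by
  obtain ⟨t, ht, rfl⟩ := List.mem_map.1 hs
  obtain ⟨a, -, ht⟩ := List.mem_flatMap.1 ht
  refine ⟨rfl, fun c hc => ?_⟩
  simp only at hc
  subst hc
  cases a <;> simp [accShape] at ht

theorem proc_of_opShapes {p : Fin n} {c : Call V Ω} {h : List (Access V Λ)}
    {s : Fin n × Shape V Λ Ω} (hs : s ∈ opShapes p c h) : s.1 = p := by
  simp only [opShapes, List.cons_append, List.mem_cons, List.mem_append,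
    List.not_mem_nil, or_false] at hs
  rcases hs with rfl | hs | rfl
  · rfl
  · exact (proc_of_accShapes hs).1
  · rfl

theorem not_inv_of_label {e : Event V Λ Ω n} {s : Fin n × Shape V Λ Ω} (h : e.label = s)
    (hs : ∀ c, s.2 ≠ .inv c) : ¬ e.kind.IsInv := by
  obtain ⟨π, κ⟩ := e
  subst h
  intro hi
  cases κ <;> simp [EvKind.IsInv] at hi
  exact hs _ rfl

/-- The events scheduled as a complete operation are events of a single operation, and the last
one is its response. -/
theorem Tidy.block {H X W : List (Event V Λ Ω n)} (hH : Tidy H) (hX : X ++ W <+: H) {p : Fin n}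
    {c : Call V Ω} {h : List (Access V Λ)} (hW : W.map Event.label = opShapes p c h) :
    ∃ π, (∀ e ∈ W, e.op = π) ∧ ∃ e ∈ W, e.kind.IsEnd := by
  obtain ⟨a, Y, rfl, ha, hY⟩ := List.map_eq_cons_iff.1 hW
  replace hY : Y.map Event.label = (h.flatMap accShape).map (Prod.mk p) ++ [(p, .res)] := hY
  have hYs : ∀ y ∈ Y, y.op.1 = p ∧ ¬ y.kind.IsInv := by
    intro y hy
    have : y.label ∈ (h.flatMap accShape).map (Prod.mk p) ++ [(p, .res)] := by
      rw [← hY]; exact List.mem_map_of_mem hy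
    rcases List.mem_append.1 this with h1 | h1
    · exact ⟨(proc_of_accShapes h1).1, not_inv_of_label rfl (proc_of_accShapes h1).2⟩
    · rw [List.mem_singleton] at h1
      exact ⟨(Prod.ext_iff.1 h1).1, not_inv_of_label h1 (by simp)⟩
  have hap : a.op.1 = p := (Prod.ext_iff.1 ha).1
  refine ⟨a.op, ?_, ?_⟩
  · intro e he
    rcases List.mem_cons.1 he with rfl | he
    · rfl
    · exact hH.same_op hX (fun y hy _ => (hYs y hy).2) e he ((hYs e he).1.trans hap.symm)
  · obtain ⟨Y₁, Y₂, rfl, -, hY₂⟩ := List.map_eq_append_iff.1 hY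
    obtain ⟨z, Y₃, rfl, hz, -⟩ := List.map_eq_cons_iff.1 hY₂
    refine ⟨z, by simp, ?_⟩
    obtain ⟨π, κ⟩ := z
    have := (Prod.ext_iff.1 hz).2
    cases κ <;> simp [Event.label, EvKind.shape] at this
    trivial

theorem Tidy.blocks {H : List (Event V Λ Ω n)} (hH : Tidy H) {p : Fin n}
    (l : List (Call V Ω × List (Access V Λ))) {X W : List (Event V Λ Ω n)} (hX : X ++ W <+: H)
    (hW : W.map Event.label = l.flatMap fun a => opShapes p a.1 a.2) :
    ∀ e ∈ W, ∃ e' ∈ W, e'.op = e.op ∧ e'.kind.IsEnd := by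
  induction l generalizing X W with
  | nil => simp only [List.flatMap_nil, List.map_eq_nil_iff] at hW; simp [hW]
  | cons a l ih =>
    obtain ⟨W₁, W₂, rfl, h1, h2⟩ := List.map_eq_append_iff.1 hW
    obtain ⟨π, h3, z, h4, h5⟩ := hH.block (X := X) (W := W₁)
      ((List.prefix_append _ W₂).trans (by simpa using hX)) h1
    have := ih (X := X ++ W₁) (W := W₂) (by simpa using hX) h2
    intro e he
    rcases List.mem_append.1 he with he | he
    · exact ⟨z, by simp [h4], by rw [h3 z h4, h3 e he], h5⟩
    · obtain ⟨e', h6, h7⟩ := this e he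
      exact ⟨e', by simp [h6], h7⟩

/-- A property of pairs of events of the same process can be checked process by process. -/
theorem pairwise_of_procHist {R : Event V Λ Ω n → Event V Λ Ω n → Prop}
    (hR : ∀ e e', e.op.1 ≠ e'.op.1 → R e e') {X : List (Event V Λ Ω n)}
    (h : ∀ p, (procHist X p).Pairwise R) : X.Pairwise R := by
  induction X with
  | nil => exact .nil
  | cons e X ih =>
    refine List.pairwise_cons.2 ⟨fun e' he' => ?_, ih fun p => ?_⟩
    · by_cases hp : e.op.1 = e'.op.1
      · have := h e'.op.1
        simp only [procHist, List.filter_cons, hp, decide_true, if_true] at this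
        exact (List.pairwise_cons.1 this).1 e' (by simp [he'])
      · exact hR _ _ hp
    · have := h p
      simp only [procHist, List.filter_cons] at this
      split at this
      · exact (List.pairwise_cons.1 this).2
      · exact this

theorem history_filter {α : List (Event V Λ Ω n)} {R : OpId n → Prop}
    (h : ∀ e ∈ α, R e.op → e.kind ≠ .abort) :
    (history α).filter (fun e => R e.op) = α.filter fun e => R e.op := by
  induction α with
  | nil => rfl
  | cons e α ih =>
    have ih' := ih fun e' he' => h e' (by simp [he'])
    rw [history]
    split
    · rename_i hc
      have hm := List.mem_of_find?_eq_some hc.2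
      have : ¬ R e.op := fun hR => h _ (List.mem_cons_of_mem _ hm) hR rfl
      simp [this, ih']
    · simp only [List.filter_cons, ih']

/-- If the lists `Q` and `A` have a common prefix order and an operation of `A` has no event in
the rest of `Q`, then `A` cannot end inside a block of a single operation. -/
theorem block_boundary {W Q A A' : List (Event V Λ Ω n)} {π : OpId n} (h : W ++ Q = A ++ A')
    (hW : ∀ e ∈ W, e.op = π) (hA : ∀ e ∈ A, ∀ e' ∈ A', e.op ≠ e'.op) (hne : A ≠ []) :
    ∃ A₁, A = W ++ A₁ ∧ Q = A₁ ++ A' := by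
  rcases List.append_eq_append_iff.1 h with ⟨t, h1, h2⟩ | ⟨t, h1, h2⟩
  · exact ⟨t, h1, h2⟩
  · cases t with
    | nil => exact ⟨[], by simpa using h1.symm, by simpa using h2.symm⟩
    | cons y t =>
      obtain ⟨x, A, rfl⟩ := List.exists_cons_of_ne_nil hne
      exact absurd ((hW x (by simp [h1])).trans (hW y (by simp [h1])).symm)
        (hA x (by simp) y (by simp [h2]))

/-- An operation `π` starts after `B` and ends after `D₁` and `D₂`, two operations of the other
process. In every serialization of this history the operation `π` runs without interruption, and
the part before it is `B`, `B ++ D₁` or `B ++ D₁ ++ D₂`. -/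
theorem serialization_point {B P D₁ D₂ Q γ α' : List (Event V Λ Ω n)} {e₀ : Event V Λ Ω n}
    {p₂ : Fin n} {δ₁ δ₂ : OpId n} (hp : e₀.op.1 ≠ p₂) (he₀ : e₀.kind.IsInv)
    (hP : ∀ e ∈ P ++ Q, e.op = e₀.op) (hQ : ∃ e ∈ Q, e.kind.IsEnd)
    (hB : ∀ e ∈ B, e.op.1 = p₂) (hBend : ∀ e ∈ B, ∃ e' ∈ B, e'.op = e.op ∧ e'.kind.IsEnd)
    (hδ₁ : δ₁.1 = p₂) (hD₁ : ∀ e ∈ D₁, e.op = δ₁) (hE₁ : ∃ e ∈ D₁, e.kind.IsEnd)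
    (hδ₂ : δ₂.1 = p₂) (hD₂ : ∀ e ∈ D₂, e.op = δ₂) (hE₂ : ∃ e ∈ D₂, e.kind.IsEnd)
    {β G : List (Event V Λ Ω n)} (hβ : β = B ++ (e₀ :: P ++ (D₁ ++ (D₂ ++ Q)))) (hG : G = β ++ γ)
    (hI : G.Pairwise fun e e' => e'.kind.IsInv → e.op ≠ e'.op)
    (hE : G.Pairwise fun e e' => Occurs β e.op → e.kind.IsEnd → e.op ≠ e'.op)
    (hγ : ∀ x ∈ γ, ∃ y ∈ G, y.op = x.op ∧ y.kind.IsInv)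
    (hseq : Sequential α') (hproc : ∀ p, procHist α' p = procHist G p)
    (hprec : ∀ π π', Precedes G π π' → Precedes α' π π') :
    ∃ A A', α' = A ++ (opHist G e₀.op ++ A') ∧ opHist G e₀.op = e₀ :: (P ++ Q) ∧
      (A = B ∨ A = B ++ D₁ ∨ A = B ++ (D₁ ++ D₂)) := by
  obtain ⟨zq, hzq, hzqE⟩ := hQ
  obtain ⟨z₁, hz₁, hz₁E⟩ := hE₁
  obtain ⟨z₂, hz₂, hz₂E⟩ := hE₂
  have hmemβ : ∀ e, e ∈ β ↔ e ∈ B ∨ e ∈ D₁ ∨ e ∈ D₂ ∨ e = e₀ ∨ e ∈ P ++ Q := by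
    intro e
    simp only [hβ, List.mem_append, List.mem_cons]
    tauto
  -- no operation that occurs in `β` has events after `β`
  have hβend : ∀ e ∈ β, ∃ e' ∈ β, e'.op = e.op ∧ e'.kind.IsEnd := by
    intro e he
    rcases (hmemβ e).1 he with h | h | h | h | h
    · obtain ⟨e', h1, h2⟩ := hBend e h
      exact ⟨e', (hmemβ e').2 (.inl h1), h2⟩
    · exact ⟨z₁, (hmemβ _).2 (by tauto), by rw [hD₁ _ h, hD₁ _ hz₁], hz₁E⟩
    · exact ⟨z₂, (hmemβ _).2 (by tauto), by rw [hD₂ _ h, hD₂ _ hz₂], hz₂E⟩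
    · exact ⟨zq, (hmemβ _).2 (by simp [hzq]), by rw [h, hP _ (by simp [hzq])], hzqE⟩
    · exact ⟨zq, (hmemβ _).2 (by simp [hzq]), by rw [hP _ h, hP _ (by simp [hzq])], hzqE⟩
  have hγβ : ∀ x ∈ γ, ¬ Occurs β x.op := by
    rintro x hx ⟨e, he, ho⟩
    obtain ⟨e', h1, h2, h3⟩ := hβend e he
    rw [hG] at hE
    exact (List.pairwise_append.1 hE).2.2 e' h1 x hx ⟨e', h1, rfl⟩ h3 (h2.trans ho)
  have hsub : ∀ p, (procHist G p).Sublist G := fun p => List.filter_sublist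
  have hI' : α'.Pairwise fun e e' => e'.kind.IsInv → e.op ≠ e'.op :=
    pairwise_of_procHist (fun e e' h _ h' => h (by rw [h'])) fun p => by
      rw [hproc]; exact hI.sublist (hsub p)
  have hE' : α'.Pairwise fun e e' => Occurs β e.op → e.kind.IsEnd → e.op ≠ e'.op :=
    pairwise_of_procHist (fun e e' h _ _ h' => h (by rw [h'])) fun p => by
      rw [hproc]; exact hE.sublist (hsub p)
  have hπβ : Occurs β e₀.op := ⟨e₀, (hmemβ _).2 (by simp), rfl⟩
  have hfilt : ∀ {p} {l : List (Event V Λ Ω n)}, (∀ e ∈ l, e.op.1 = p) → procHist l p = l :=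
    fun h => List.filter_eq_self.2 fun e he => by simp [h e he]
  have hfilt' : ∀ {p} {l : List (Event V Λ Ω n)}, (∀ e ∈ l, e.op.1 ≠ p) → procHist l p = [] :=
    fun h => List.filter_eq_nil_iff.2 fun e he => by simp [h e he]
  have hpapp : ∀ (l l' : List (Event V Λ Ω n)) p,
      procHist (l ++ l') p = procHist l p ++ procHist l' p := fun l l' p => by simp [procHist]
  have hPp : ∀ {q} {l : List (Event V Λ Ω n)}, (∀ e ∈ l, e ∈ P ++ Q) → e₀.op.1 ≠ q →
      procHist l q = [] := fun h hq => hfilt' fun e he => by rw [hP e (h e he)]; exact hq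
  have hp₂ : procHist G p₂ = (B ++ (D₁ ++ D₂)) ++ procHist γ p₂ := by
    have h0 : procHist (e₀ :: P) p₂ = [] := hfilt' fun e he => by
      rcases List.mem_cons.1 he with rfl | he
      · exact hp
      · rw [hP e (by simp [he])]; exact hp
    rw [hG, hβ]
    simp only [hpapp, h0]
    rw [hfilt hB, hfilt fun e he => by rw [hD₁ e he, hδ₁], hfilt fun e he => by rw [hD₂ e he, hδ₂],
      hPp (l := Q) (by simp; tauto) hp]
    simp
  obtain ⟨t, ht⟩ : ∃ t, procHist G e₀.op.1 = e₀ :: t := by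
    refine ⟨procHist (P ++ (D₁ ++ (D₂ ++ Q))) e₀.op.1 ++ procHist γ e₀.op.1, ?_⟩
    have : procHist B e₀.op.1 = [] := hfilt' fun e he => by rw [hB e he]; exact hp.symm
    rw [hG, hβ, List.append_assoc, hpapp, this]
    simp [procHist]
  obtain ⟨A, B₁, hα', hAp, -, -⟩ := List.filter_eq_cons_iff.1 ((hproc _).trans ht)
  have hAp' : ∀ x ∈ A, x.op.1 ≠ e₀.op.1 := fun x hx => by simpa using hAp x hx
  -- operations in `A` are not preceded by `π`, and operations that precede `π` end in `A`
  have hnot_after : ∀ x ∈ A, ¬ Precedes α' e₀.op x.op := by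
    rintro x hx ⟨l₁, l₂, hl, ⟨z, hz, hzo, -⟩, y, hy, hyo, hyi⟩
    rcases List.append_eq_append_iff.1 (hα'.symm.trans hl) with ⟨t, h1, h2⟩ | ⟨t, h1, h2⟩
    · rw [hl] at hI'
      exact (List.pairwise_append.1 hI').2.2 x (by simp [h1, hx]) y hy hyi hyo.symm
    · exact hAp' z (by simp [h1, hz]) (by rw [hzo])
  have hA_mem : ∀ x ∈ A, x ∈ β := by
    intro x hx
    have hxG : x ∈ procHist G x.op.1 := by
      rw [← hproc]; simp [procHist, hα', hx]
    have hxG := (hsub _).subset hxG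
    rw [hG, List.mem_append] at hxG
    rcases hxG with h | h
    · exact h
    · obtain ⟨y, hy, hyo, hyi⟩ := hγ x h
      rw [hG, List.mem_append] at hy
      rcases hy with hy | hy
      · exact absurd ⟨y, hy, hyo⟩ (hγβ x h)
      · refine absurd (hprec _ _ ⟨β, γ, hG, ⟨zq, (hmemβ _).2 (by simp [hzq]),
          hP _ (by simp [hzq]), hzqE⟩, y, hy, hyo, hyi⟩) (hnot_after x hx)
  have hA₂ : ∀ x ∈ A, x.op.1 = p₂ := by
    intro x hx
    rcases (hmemβ x).1 (hA_mem x hx) with h | h | h | h | h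
    · exact hB x h
    · rw [hD₁ x h, hδ₁]
    · rw [hD₂ x h, hδ₂]
    · exact absurd (by rw [h]) (hAp' x hx)
    · exact absurd (by rw [hP x h]) (hAp' x hx)
  obtain ⟨A', hA'1, hA'2⟩ : ∃ A', B ++ (D₁ ++ D₂) = A ++ A' ∧
      procHist (e₀ :: B₁) p₂ = A' ++ procHist γ p₂ := by
    have h := (hproc p₂).trans hp₂
    rw [hα', hpapp, hfilt hA₂] at h
    rcases List.append_eq_append_iff.1 h with ⟨t, h1, h2⟩ | ⟨t, h1, h2⟩
    · exact ⟨t, h1, h2⟩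
    · cases t with
      | nil => exact ⟨[], by simpa using h1.symm, by simpa using h2.symm⟩
      | cons y t =>
        have hy : y ∈ γ := List.filter_sublist.subset (show y ∈ procHist γ p₂ by rw [h2]; simp)
        exact absurd ⟨y, hA_mem y (by rw [h1]; simp), rfl⟩ (hγβ y hy)
  have hends : ∀ ρ, Precedes α' ρ e₀.op → ∃ z ∈ A, z.op = ρ ∧ z.kind.IsEnd := by
    rintro ρ ⟨l₁, l₂, hl, ⟨z, hz, hzo⟩, y, hy, hyo, hyi⟩
    rcases List.append_eq_append_iff.1 (hα'.symm.trans hl) with ⟨t, h1, h2⟩ | ⟨t, h1, h2⟩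
    · cases t with
      | nil => exact ⟨z, by simpa [h1] using hz, hzo⟩
      | cons w t =>
        exfalso
        obtain ⟨rfl, -⟩ := List.cons_eq_cons.1 h2
        rw [hl] at hI'
        exact (List.pairwise_append.1 hI').2.2 e₀ (by simp [h1]) y hy hyi hyo.symm
    · exact ⟨z, by simp [h1, hz], hzo⟩
  have hQsub : (A ++ A').Sublist G := by
    rw [← hA'1]
    refine List.Sublist.trans ?_ (hsub p₂)
    rw [hp₂]
    exact List.sublist_append_left _ _
  have hsplit : ∀ e ∈ A, ∀ e' ∈ A', e.op ≠ e'.op := by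
    intro e he e' he' heq
    have hne : e.op ≠ e₀.op := fun h => hAp' e he (by rw [h])
    rcases hseq e.op e₀.op ⟨e, by simp [hα', he], rfl⟩ ⟨e₀, by simp [hα'], rfl⟩ hne with h | h
    · obtain ⟨z, hz, hzo, hzE⟩ := hends _ h
      exact (List.pairwise_append.1 (hE.sublist hQsub)).2.2 z hz e' he' ⟨z, hA_mem z hz, rfl⟩ hzE
        (hzo.trans heq)
    · exact hnot_after e he h
  have hpoint : A = B ∨ A = B ++ D₁ ∨ A = B ++ (D₁ ++ D₂) := by
    obtain ⟨A₁, h1, h2⟩ : ∃ A₁, A = B ++ A₁ ∧ D₁ ++ D₂ = A₁ ++ A' := by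
      rcases List.append_eq_append_iff.1 hA'1 with ⟨t, h1, h2⟩ | ⟨t, h1, h2⟩
      · exact ⟨t, h1, h2⟩
      · cases t with
        | nil => exact ⟨[], by simpa using h1.symm, by simpa using h2.symm⟩
        | cons y t =>
          obtain ⟨z, hz, hzo, hzE⟩ := hBend y (by simp [h1])
          obtain ⟨z', hz', hzo', -⟩ := hends _ (hprec y.op e₀.op ⟨B, _, by
            rw [hG, hβ, List.append_assoc], ⟨z, hz, hzo, hzE⟩, e₀, by simp, rfl, he₀⟩)
          exact absurd hzo' (hsplit z' hz' y (by simp [h2]))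
    rw [h1] at hsplit
    by_cases hA₁ : A₁ = []
    · exact .inl (by simp [h1, hA₁])
    obtain ⟨A₂, rfl, h3⟩ := block_boundary h2 hD₁
      (fun e he e' he' => hsplit e (by simp [he]) e' he') hA₁
    by_cases hA₂ : A₂ = []
    · exact .inr (.inl (by simp [h1, hA₂]))
    obtain ⟨A₃, rfl, h4⟩ := block_boundary (Q := []) (by simpa using h3) hD₂
      (fun e he e' he' => hsplit e (by simp [he]) e' he') hA₂
    obtain ⟨rfl, -⟩ := List.append_eq_nil_iff.1 h4.symm
    exact .inr (.inr (by simp [h1]))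
  -- the operation `π` runs without interruption
  have hblock : ∀ u x w, B₁ = u ++ x :: w → x.op ≠ e₀.op → ∀ y ∈ w, y.op ≠ e₀.op := by
    intro u x w hB₁ hx y hy hyo
    rcases hseq x.op e₀.op ⟨x, by simp [hα', hB₁], rfl⟩ ⟨e₀, by simp [hα'], rfl⟩ hx with h | h
    · obtain ⟨z, hz, hzo, hzE⟩ := hends _ h
      have : x ∈ procHist (e₀ :: B₁) p₂ := by
        rw [procHist, List.mem_filter]
        refine ⟨by simp [hB₁], ?_⟩
        rw [← hzo, hA₂ z hz]; simp
      rw [hA'2, List.mem_append] at this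
      rcases this with h' | h'
      · exact hsplit z hz x h' hzo
      · exact hγβ x (List.filter_sublist.subset h') ⟨z, hA_mem z hz, hzo⟩
    · obtain ⟨l₁, l₂, hl, ⟨z, hz, hzo, hzE⟩, i, hi, hio, hii⟩ := h
      have h' : (A ++ e₀ :: u) ++ x :: w = l₁ ++ l₂ := by
        rw [← hl, hα', hB₁]; simp
      rcases List.append_eq_append_iff.1 h' with ⟨t, h1, h2⟩ | ⟨t, h1, h2⟩
      · cases t with
        | nil =>
          rw [hl] at hE'
          rw [List.nil_append] at h2
          refine (List.pairwise_append.1 hE').2.2 z hz y (by simp [← h2, hy]) ?_ hzE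
            (hzo.trans hyo.symm)
          rw [hzo]; exact hπβ
        | cons x' t =>
          obtain ⟨rfl, -⟩ := List.cons_eq_cons.1 h2
          rw [hl] at hI'
          exact (List.pairwise_append.1 hI').2.2 x (by simp [h1]) i hi hii hio.symm
      · rw [hl] at hE'
        refine (List.pairwise_append.1 hE').2.2 z hz y (by simp [h2, hy]) ?_ hzE
          (hzo.trans hyo.symm)
        rw [hzo]; exact hπβ
  have hop : opHist G e₀.op = opHist α' e₀.op := by
    have h1 := opHist_filter_proc G e₀.op.1 e₀.op
    have h2 := opHist_filter_proc α' e₀.op.1 e₀.op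
    simp only [if_true] at h1 h2
    rw [← h1, ← h2, hproc]
  have hAop : opHist A e₀.op = [] :=
    List.filter_eq_nil_iff.2 fun x hx => by
      have := hAp' x hx
      simp only [decide_eq_true_eq]
      intro h; exact this (by rw [h])
  set u := B₁.takeWhile fun e => decide (e.op = e₀.op) with hu
  set w := B₁.dropWhile fun e => decide (e.op = e₀.op) with hw
  have huw : B₁ = u ++ w := (List.takeWhile_append_dropWhile).symm
  have hwop : opHist w e₀.op = [] := by
    refine List.filter_eq_nil_iff.2 fun y hy => ?_
    simp only [decide_eq_true_eq]
    cases hw' : w with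
    | nil => rw [hw'] at hy; simp at hy
    | cons x w' =>
      have hx : x.op ≠ e₀.op := by
        have := List.head?_dropWhile_not (fun e => decide (e.op = e₀.op)) B₁
        rw [← hw, hw'] at this
        simpa using this
      rw [hw'] at hy huw
      rcases List.mem_cons.1 hy with rfl | hy
      · exact hx
      · exact hblock u x w' huw hx y hy
  have huop : opHist u e₀.op = u := List.filter_eq_self.2 fun x hx => by
    have := List.mem_takeWhile_imp (p := fun e : Event V Λ Ω n => decide (e.op = e₀.op)) hx
    simpa using this
  have hnot : ∀ {l : List (Event V Λ Ω n)}, (∀ e ∈ l, e.op.1 = p₂) → opHist l e₀.op = [] :=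
    fun hl => List.filter_eq_nil_iff.2 fun e he => by
      simp only [decide_eq_true_eq]
      intro h; exact hp (by rw [← h]; exact hl e he)
  have hself : opHist (e₀ :: (P ++ Q)) e₀.op = e₀ :: (P ++ Q) :=
    List.filter_eq_self.2 fun e he => by
      rcases List.mem_cons.1 he with rfl | he
      · simp
      · simp [hP e he]
  have hγop : opHist γ e₀.op = [] := List.filter_eq_nil_iff.2 fun x hx => by
    simp only [decide_eq_true_eq]
    intro h; exact hγβ x hx (by rw [h]; exact hπβ)
  refine ⟨A, w, ?_, ?_, hpoint⟩
  swap
  · rw [hG, hβ]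
    simp only [opHist_append, hnot hB, hγop, hnot fun e he => by rw [hD₁ e he, hδ₁],
      hnot fun e he => by rw [hD₂ e he, hδ₂]]
    rw [← hself]
    simp [opHist]
  rw [hop, hα', huw, opHist_append, hAop]
  have : opHist (e₀ :: (u ++ w)) e₀.op = e₀ :: u := by
    have : opHist (e₀ :: (u ++ w)) e₀.op = e₀ :: opHist (u ++ w) e₀.op := by simp [opHist]
    rw [this, opHist_append, huop, hwop, List.append_nil]
  rw [this]
  simp

theorem pairwise_of_split {R : Event V Λ Ω n → Event V Λ Ω n → Prop} {α : List (Event V Λ Ω n)}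
    (h : ∀ l₁ e l₂, α = l₁ ++ e :: l₂ → ∀ x ∈ l₂, R e x) : α.Pairwise R := by
  induction α with
  | nil => exact .nil
  | cons e α ih =>
    exact List.pairwise_cons.2 ⟨h [] e α rfl,
      ih fun l₁ e' l₂ hl => h (e :: l₁) e' l₂ (by simp [hl])⟩

theorem exec_inv_pairwise {D : SearchData V Λ Ω} {I : Impl V Λ Ω n} {α : List (Event V Λ Ω n)}
    {C : I.Conf} (hα : I.Exec D α C) :
    α.Pairwise fun e e' => e'.kind.IsInv → e.op ≠ e'.op := by
  refine pairwise_of_split fun l₁ e l₂ hl x hx hi ho => ?_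
  obtain ⟨u, w, rfl⟩ := List.append_of_mem hx
  exact (exec_inv_first hα (l₁ ++ e :: u) x w (by simp [hl])).1 hi ⟨e, by simp, ho⟩

theorem exec_end_pairwise {D : SearchData V Λ Ω} {I : Impl V Λ Ω n} {α : List (Event V Λ Ω n)}
    {C : I.Conf} (hα : I.Exec D α C) :
    α.Pairwise fun e e' => e.kind.IsEnd → e.op ≠ e'.op :=
  pairwise_of_split fun l₁ e l₂ hl x hx hi ho => exec_end_last hα l₁ e l₂ hl hi ⟨x, hx, ho.symm⟩

theorem shapeMem_runList {D : SearchData V Λ Ω} {m m' : Mem V Λ} {p : Fin n}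
    {l : List (Call V Ω × List (Access V Λ))} (h : RunList D m l m') :
    shapeMem m (l.flatMap fun a => opShapes p a.1 a.2) = m' := by
  induction l generalizing m with
  | nil => exact h.symm
  | cons a l ih =>
    obtain ⟨m₁, r, h1, h2⟩ := h
    rw [List.flatMap_cons, shapeMem_append, shapeMem_opShapes, ← (seqRun_iff.1 h1.1).2]
    exact ih h2

theorem mem_viewOf {h : List (Access V Λ)} {x : Node V} {e : Edges V Λ} :
    (x, e) ∈ viewOf h ↔ Access.read x e ∈ h := by
  induction h with
  | nil => simp [viewOf]
  | cons a h ih =>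
    cases a with
    | read y f =>
      have : viewOf (Access.read y f :: h) = (y, f) :: viewOf h := by simp [viewOf]
      rw [this]; simp [ih]
    | write y f =>
      have : viewOf (Access.write y f :: h) = viewOf h := by simp [viewOf]
      rw [this]; simp [ih]

/-- Whatever memory the search of a detour starts from, it cannot have seen `k` absent and the node
`(kx, vx)` present. -/
theorem Detour.not_completes {D : SearchStructure V Λ Ω} (d : Detour D) {m : Mem V Λ}
    (hm : m = d.m ∨ m = d.m₁ ∨ m = d.m₂) {h : List (Access V Λ)} {m' : Mem V Λ} {r : DictResp V}
    (hc : D.Completes ⟨.find d.k, d.ω⟩ m h m' r)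
    (hh : h.map reqOf = (d.first ++ d.rest).map reqOf) : False := by
  have hm₁ : D.Reach d.m₁ := .step d.reach d.delete₁
  have key : D.Reach m → InGraph m (.pair d.k d.v) → False := by
    intro hm hin
    obtain ⟨q, hq⟩ := reach_represents hm
    obtain ⟨e, he⟩ := ((find_result hm hq rfl hc).1 d.v ((hq _ _).1 hin)).1
    have h1 : Req.read (.pair d.k d.v) ∈ (d.first ++ d.rest).map reqOf := by
      rw [← hh]
      exact List.mem_map.2 ⟨_, mem_viewOf.1 he, rfl⟩
    obtain ⟨a, ha, hreq⟩ := List.mem_map.1 h1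
    cases a with
    | write x e => simp [reqOf] at hreq
    | read x e =>
      simp only [reqOf, Req.read.injEq] at hreq
      subst hreq
      exact d.absent₀ d.v (view_inGraph d.search.1 _ (mem_viewOf.2 (by
        simpa [Detour.first] using ha)))
  rcases hm with rfl | rfl | rfl
  · exact key d.reach d.present
  · exact key hm₁ d.present₁
  · have h1 : Req.read (.pair d.kx d.vx) ∈ h.map reqOf := by
      rw [hh]; simp [Detour.first, reqOf]
    obtain ⟨a, ha, hreq⟩ := List.mem_map.1 h1
    cases a with
    | write x e => simp [reqOf] at hreq
    | read x e =>
      simp only [reqOf, Req.read.injEq] at hreq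
      subst hreq
      exact d.absent₂ (view_inGraph hc.1 _ (mem_viewOf.2 ha))

/-- In a serialization, the search runs from one of the memories before, between and after the
deletions. Each of them contradicts one of its reads. -/
theorem serializable_rejects {D : SearchStructure V Λ Ω} (d : Detour D) {p₁ p₂ : Fin n}
    (hp : p₁ ≠ p₂) {l : List (Call V Ω × List (Access V Λ))} {h' : List (Access V Λ)}
    (hl : RunList D.toSearchData (fun _ => ∅) l d.m) {I : Impl V Λ Ω n}
    (hI : ∀ α C, I.Exec D.toSearchData α C → StrictlySerializable D.toSearchData α) :
    ¬ I.Accepts D.toSearchData (detourSchedule d n p₁ p₂ l h') := by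
  rintro ⟨H, ⟨α, C, hα, rfl⟩, hσ⟩
  obtain ⟨H', α', ⟨t, rfl, ht⟩, hseq, hleg, hproc, hprec⟩ := hI α C hα
  have hret : ∀ π, Returned (history α) π ↔ Returned α π := fun π =>
    ⟨fun ⟨r, hr⟩ => ⟨r, (history_sublist α).subset hr⟩,
      fun ⟨r, hr⟩ => ⟨r, mem_history_of_not_accInv hr (by simp [EvKind.IsAccInv])⟩⟩
  have hended : ∀ π, Ended (history α) π ↔ Ended α π := fun π =>
    ⟨fun ⟨e, he, h⟩ => ⟨e, (history_sublist α).subset he, h⟩,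
      fun ⟨e, he, h⟩ => ⟨e, mem_history_of_not_accInv he (by
        obtain ⟨o, κ⟩ := e
        cases κ <;> simp_all [EvKind.IsAccInv, EvKind.IsEnd]), h⟩⟩
  have hre : ∀ π, Returned α π → Ended α π := fun π ⟨r, hr⟩ => ⟨_, hr, rfl, trivial⟩
  have hRS : ∀ π, Returned (history α) π → Returned (history α ++ t) π :=
    fun π ⟨r, hr⟩ => ⟨r, by simp [hr]⟩
  obtain ⟨β, γ, hβγ, hlab, hβR, -⟩ := filter_prefix
    ((exec_sorted hα).sublist (history_sublist α)) (R := Returned (history α))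
    (S := Returned (history α ++ t)) hRS (by
      rintro π π' ⟨r, hr⟩ hnR hR - - hpp
      have h1 : ¬ Ended α π := by
        rcases List.mem_append.1 hr with hr | hr
        · exact absurd ⟨r, hr⟩ hnR
        · rw [← hended]; exact (ht _ hr).2.2.1
      have h2 := hre _ ((hret _).1 hR)
      rw [exec_ended_iff hα] at h1 h2
      rw [hpp] at h1
      omega) hσ (mem_rounds n _ _)
  -- the scheduled events before the final rounds
  have hT : Tidy (β ++ γ.filter fun e => Returned (history α) e.op) := by
    have h1 : Tidy (α.filter fun e => Returned (history α) e.op) :=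
      (Tidy.of_exec hα).filter (Returned (history α))
    rw [← history_filter] at h1
    · have h2 : (history α).filter (fun e => Returned (history α) e.op) =
          ((history α).filter fun e => Returned (history α ++ t) e.op).filter
            fun e => Returned (history α) e.op := by
        rw [List.filter_filter]
        refine List.filter_congr fun e he => ?_
        by_cases hR : Returned (history α) e.op
        · simp [hR, hRS _ hR]
        · simp [hR]
      rw [h2, hβγ, List.filter_append, List.filter_eq_self.2 fun e he => by simp [hβR e he]] at h1
      exact h1
    · intro e he hR hk
      obtain ⟨r, hr⟩ := (hret _).1 hR
      have h3 := exec_end_pairwise hα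
      have hab : (⟨e.op, .abort⟩ : Event V Λ Ω n) ∈ α := by rw [← hk]; exact he
      have hne : (⟨e.op, .abort⟩ : Event V Λ Ω n) ≠ ⟨e.op, .res r⟩ := by simp
      obtain ⟨u, w, rfl⟩ := List.append_of_mem hab
      rw [List.mem_append, List.mem_cons] at hr
      rw [List.pairwise_append, List.pairwise_cons] at h3
      rcases hr with hr | hr | hr
      · exact h3.2.2 _ hr _ List.mem_cons_self trivial rfl
      · simp at hr
      · exact h3.2.1.1 _ hr trivial rfl
  have hpre : ∀ {X}, X <+: β → X <+: β ++ γ.filter fun e => Returned (history α) e.op :=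
    fun h => h.trans (List.prefix_append _ _)
  obtain ⟨B, Y, rfl, hB, hY⟩ := List.map_eq_append_iff.1 hlab
  obtain ⟨P', Y, rfl, hP', hY⟩ := List.map_eq_append_iff.1 hY
  obtain ⟨D₁, Y, rfl, hD₁, hY⟩ := List.map_eq_append_iff.1 hY
  obtain ⟨D₂, Q, rfl, hD₂, hQ⟩ := List.map_eq_append_iff.1 hY
  obtain ⟨e₀, P, rfl, he₀, hP⟩ := List.map_eq_cons_iff.1 hP'
  have hQ' : Q.map Event.label = (d.rest.flatMap accShape).map (Prod.mk p₁) ++ [(p₁, .res)] := hQ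
  have hproc₂ : ∀ {l : List (Event V Λ Ω n)} {c h}, l.map Event.label = opShapes p₂ c h →
      ∀ e ∈ l, e.op.1 = p₂ := by
    intro l c h hl e he
    exact proc_of_opShapes (s := e.label) (by rw [← hl]; exact List.mem_map_of_mem he)
  have he₀p : e₀.op.1 = p₁ := (Prod.ext_iff.1 he₀).1
  obtain ⟨δ₁, hδ₁, z₁, hz₁, hz₁E⟩ := hT.block (X := B ++ e₀ :: P) (W := D₁)
    (hpre ⟨D₂ ++ Q, by simp⟩) hD₁
  obtain ⟨δ₂, hδ₂, z₂, hz₂, hz₂E⟩ := hT.block (X := B ++ e₀ :: P ++ D₁) (W := D₂)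
    (hpre ⟨Q, by simp⟩) hD₂
  have hPs : ∀ y ∈ P, y.op.1 = p₁ ∧ ¬ y.kind.IsInv := by
    intro y hy
    have : y.label ∈ (d.first.flatMap accShape).map (Prod.mk p₁) := by
      rw [← hP]; exact List.mem_map_of_mem hy
    exact ⟨(proc_of_accShapes this).1, not_inv_of_label rfl (proc_of_accShapes this).2⟩
  have hQs : ∀ y ∈ Q, y.op.1 = p₁ ∧ ¬ y.kind.IsInv := by
    intro y hy
    have : y.label ∈ (d.rest.flatMap accShape).map (Prod.mk p₁) ++ [(p₁, .res)] := by
      rw [← hQ']; exact List.mem_map_of_mem hy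
    rcases List.mem_append.1 this with h1 | h1
    · exact ⟨(proc_of_accShapes h1).1, not_inv_of_label rfl (proc_of_accShapes h1).2⟩
    · rw [List.mem_singleton] at h1
      exact ⟨(Prod.ext_iff.1 h1).1, not_inv_of_label h1 (by simp)⟩
  have hsame := hT.same_op (X := B) (a := e₀) (Y := P ++ (D₁ ++ (D₂ ++ Q)))
    (hpre ⟨[], by simp⟩) (by
      intro y hy hyp
      rw [he₀p] at hyp
      simp only [List.mem_append] at hy
      rcases hy with hy | hy | hy | hy
      · exact (hPs y hy).2
      · exact absurd (hyp.symm.trans (hproc₂ hD₁ y hy)) hp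
      · exact absurd (hyp.symm.trans (hproc₂ hD₂ y hy)) hp
      · exact (hQs y hy).2)
  have hQE : ∃ e ∈ Q, e.kind.IsEnd := by
    obtain ⟨Q₁, Q₂, rfl, -, h2⟩ := List.map_eq_append_iff.1 hQ'
    obtain ⟨z, Q₃, rfl, hz, -⟩ := List.map_eq_cons_iff.1 h2
    refine ⟨z, by simp, ?_⟩
    obtain ⟨π, κ⟩ := z
    have := (Prod.ext_iff.1 hz).2
    cases κ <;> simp [Event.label, EvKind.shape] at this
    trivial
  have hG : completeHist (history α ++ t) = (B ++ (e₀ :: P ++ (D₁ ++ (D₂ ++ Q)))) ++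
      (γ ++ t.filter fun e => Returned (history α ++ t) e.op) := by
    rw [completeHist, List.filter_append, hβγ]; simp
  have hG' : completeHist (history α ++ t) =
      ((history α).filter fun e => Returned (history α ++ t) e.op) ++
      t.filter fun e => Returned (history α ++ t) e.op := by
    rw [completeHist, List.filter_append]
  have hβα : ∀ π, Occurs (B ++ (e₀ :: P ++ (D₁ ++ (D₂ ++ Q)))) π → Ended α π := by
    rintro π ⟨e, he, rfl⟩
    exact hre _ ((hret _).1 (hβR e he))
  have htE : ∀ e ∈ t, ¬ Ended α e.op := fun e he => by rw [← hended]; exact (ht e he).2.2.1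
  have hsubα : ((history α).filter fun e => Returned (history α ++ t) e.op).Sublist α :=
    List.filter_sublist.trans (history_sublist α)
  obtain ⟨A, A', hα', hopG, hA⟩ := serialization_point (p₂ := p₂) (by rw [he₀p]; exact hp) (by
      obtain ⟨π, κ⟩ := e₀
      have := (Prod.ext_iff.1 he₀).2
      cases κ <;> simp [Event.label, EvKind.shape] at this
      trivial)
    (P := P) (Q := Q) (fun e he => hsame e (by
        rcases List.mem_append.1 he with he | he
        · simp [he]
        · simp [he]) (by
        rw [he₀p]
        rcases List.mem_append.1 he with he | he
        · exact (hPs e he).1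
        · exact (hQs e he).1)) hQE
    (B := B) (by
      intro e he
      have : e.label ∈ l.flatMap fun a => opShapes p₂ a.1 a.2 := by
        rw [← hB]; exact List.mem_map_of_mem he
      obtain ⟨a, -, h⟩ := List.mem_flatMap.1 this
      exact proc_of_opShapes h)
    (hT.blocks l (X := []) (W := B) (hpre ⟨_, by simp; rfl⟩) hB)
    (by rw [← hδ₁ z₁ hz₁]; exact hproc₂ hD₁ z₁ hz₁) hδ₁ ⟨z₁, hz₁, hz₁E⟩
    (by rw [← hδ₂ z₂ hz₂]; exact hproc₂ hD₂ z₂ hz₂) hδ₂ ⟨z₂, hz₂, hz₂E⟩ rfl hG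
    (by
      rw [hG', List.pairwise_append]
      have hti : ∀ e ∈ t.filter fun e => Returned (history α ++ t) e.op, ¬ e.kind.IsInv := by
        intro e he hi
        obtain ⟨⟨r, hr⟩, -⟩ := ht e (List.mem_filter.1 he).1
        rw [hr] at hi
        exact hi
      refine ⟨(exec_inv_pairwise hα).sublist hsubα, ?_, ?_⟩
      · exact List.Pairwise.imp_of_mem (R := fun _ _ => True)
          (fun _ h2 _ hi => absurd hi (hti _ h2)) (List.pairwise_of_forall fun _ _ => trivial)
      · exact fun e _ e' he' hi => absurd hi (hti e' he'))
    (by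
      rw [hG', List.pairwise_append]
      refine ⟨((exec_end_pairwise hα).sublist hsubα).imp (by intro _ _ h _; exact h), ?_, ?_⟩
      · refine List.Pairwise.imp_of_mem (R := fun _ _ => True)
          (fun h1 _ _ ho => absurd (hβα _ ho) (htE _ (List.mem_filter.1 h1).1))
          (List.pairwise_of_forall fun _ _ => trivial)
      · intro e he e' he' _ hk ho
        refine htE e' (List.mem_filter.1 he').1 ?_
        exact ⟨e, hsubα.subset he, ho, hk⟩)
    (by
      intro x hx
      have hxG : x ∈ completeHist (history α ++ t) := by
        rw [hG]; simp only [List.mem_append] at hx ⊢; tauto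
      rw [completeHist, List.mem_filter] at hxG
      have hocc : Occurs α x.op := by
        rcases List.mem_append.1 hxG.1 with h | h
        · exact ⟨x, (history_sublist α).subset h, rfl⟩
        · obtain ⟨e, he, ho⟩ := (ht x h).2.1
          exact ⟨e, (history_sublist α).subset he, ho⟩
      obtain ⟨l₁, c, l₂, hαl, -⟩ := exec_starts hα hocc
      refine ⟨⟨x.op, .inv c⟩, ?_, rfl, trivial⟩
      rw [completeHist, List.mem_filter]
      refine ⟨List.mem_append_left _ (mem_history_of_not_accInv (by rw [hαl]; simp)
        (by simp [EvKind.IsAccInv])), by simpa using hxG.2⟩)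
    hseq hproc hprec
  -- the memory from which the search runs in the serialization
  have hmem : evMem (fun _ => ∅) A = d.m ∨ evMem (fun _ => ∅) A = d.m₁ ∨
      evMem (fun _ => ∅) A = d.m₂ := by
    rw [evMem_eq_shapeMem]
    have e1 := (seqRun_iff.1 d.delete₁.1).2
    have e2 := (seqRun_iff.1 d.delete₂.1).2
    rcases hA with rfl | rfl | rfl
    · left; rw [hB, shapeMem_runList hl]
    · right; left
      rw [List.map_append, hB, hD₁, shapeMem_append, shapeMem_runList hl, shapeMem_opShapes, ← e1]
    · right; right
      rw [List.map_append, List.map_append, hB, hD₁, hD₂, shapeMem_append, shapeMem_runList hl,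
        shapeMem_append, shapeMem_opShapes, shapeMem_opShapes, ← e1, ← e2]
  -- the events of the search
  have hR₀ : Returned α e₀.op := (hret _).1 (hβR e₀ (by simp))
  have hend : EndedEvents D.toSearchData e₀.op (opHist α e₀.op) :=
    (exec_local hα e₀.op.1).2.2 _ ((exec_ended_iff hα _).1 (hre _ hR₀))
  obtain ⟨c, h, hf, ⟨r, hn, -, h1, -⟩ | ⟨a, -, h1, -⟩⟩ := endedEvents_history hend
  swap
  · obtain ⟨r, hr⟩ := hR₀
    have := (mem_opHist (π := e₀.op)).2 ⟨hr, rfl⟩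
    rw [h1] at this
    rcases kind_of_mem_opEvents this with h2 | ⟨-, h2⟩ | h2
    · simp at h2
    · exact absurd trivial h2
    · cases a <;> simp [Impl.reqKind] at h2
  have hop : opHist (completeHist (history α ++ t)) e₀.op = opEvents e₀.op c h [.res r] := by
    rw [opHist_completeHist, if_pos (hRS _ ((hret _).2 hR₀)), opHist_append, h1]
    have : opHist t e₀.op = [] := List.filter_eq_nil_iff.2 fun e he => by
      simp only [decide_eq_true_eq]
      intro ho; exact htE e he (by rw [ho]; exact hre _ hR₀)
    rw [this, List.append_nil]
  have hsh : opShapes e₀.op.1 c h = opShapes p₁ ⟨.find d.k, d.ω⟩ (d.first ++ d.rest) := by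
    rw [← opEvents_label_res e₀.op c h r, ← hop, hopG, ← open_append_close]
    simp only [List.map_cons, List.map_append, he₀, hP, hQ, openShapes, List.cons_append]
  obtain ⟨rfl, hreq⟩ := opShapes_inj hsh
  have hlegA : LegalFrom (evMem (fun _ => ∅) A) (opEvents e₀.op ⟨.find d.k, d.ω⟩ h [.res r]) := by
    rw [← hop]
    rw [hα', Legal, legalFrom_append, legalFrom_append] at hleg
    exact hleg.2.1
  have hrun := ((legal_opEvents_iff hf (silent_res r)).1).1 hlegA
  exact d.not_completes hmem ⟨seqRun_iff.2 ⟨hrun, rfl⟩, hn⟩ hreq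

end DetourSchedule

/-! ### A lock-based implementation -/

section Bypass

variable {V Λ Ω : Type} {n : ℕ} {D : SearchStructure V Λ Ω}

/-- The value that an access returns, or writes, when it is performed in the memory `m`. -/
def Req.val (m : Mem V Λ) : Req V Λ → Edges V Λ
  | .read x => m x
  | .write _ e => e

/-- The memory after an access is performed in the memory `m`. -/
noncomputable def Req.mem (m : Mem V Λ) : Req V Λ → Mem V Λ
  | .read _ => m
  | .write x e => Function.update m x e

theorem seqRun_snoc {c : Call V Ω} {M m : Mem V Λ} {h : List (Access V Λ)} {a : Req V Λ}
    (hr : D.SeqRun c M h m) (hn : D.next c h = .req a) :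
    D.SeqRun c M (h ++ [Impl.replyAccess (a.val m) a]) (a.mem m) := by
  cases a with
  | read x => exact .read hr hn
  | write x e => exact .write hr hn

namespace Detour

variable (d : Detour D)

/-- A search for `k` that has visited the root and `(kx, vx)`, neither of which leads to `k`. -/
def Gapped (c : Call V Ω) (h : List (Access V Λ)) : Prop :=
  c.op = .find d.k ∧ ∃ e₀ e₁ w, viewOf h = (.root, e₀) :: (.pair d.kx d.vx, e₁) :: w ∧
    (∀ u, ¬ Leads e₀ (.pair d.k u)) ∧ ∀ u, ¬ Leads e₁ (.pair d.k u)

/-- A deletion that may run concurrently with a gapped search: that of `kx`, and that of `k`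
unless it is about to write to several elements. -/
def Light (c : Call V Ω) (h : List (Access V Λ)) : Prop :=
  c.op = .delete d.kx ∨ (c.op = .delete d.k ∧ ∀ x e, D.next c h = .req (.write x e) →
    (D.update c (viewOf h)).1.length ≤ 1)

/-- The elements whose locks are used: the root, and the node `(kx, vx)`. -/
def lockNode : Bool → Node V
  | false => .root
  | true => .pair d.kx d.vx

/-- The locks that an operation `c` needs after the accesses `h`. When only the response is
missing, it needs none. Before that, the lock on the root is dispensable for a gapped search, and
the lock on `(kx, vx)` for a light deletion. -/
def Wants (c : Call V Ω) (h : List (Access V Λ)) (i : Bool) : Prop :=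
  (∀ r, D.next c h ≠ .ret r) ∧ match i with
    | false => ¬ d.Gapped c h
    | true => ¬ d.Light c h

variable (n) in
/-- A lock-based program: between two accesses, each operation acquires and releases exclusive
locks until it holds exactly the locks that it needs, that on the root before that on `(kx, vx)`.
The local state records the locks held. -/
noncomputable def bypass : LockProgram V Λ Ω n where
  Loc := Bool → Bool
  loc₀ := fun _ _ => false
  ready := fun _ l c h =>
    if d.Wants c h false ∧ l false = false then .sync .lock (d.lockNode false)
      (Function.update l false true)
    else if d.Wants c h true ∧ l true = false then .sync .lock (d.lockNode true)
      (Function.update l true true)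
    else if ¬ d.Wants c h false ∧ l false = true then .sync .unlock (d.lockNode false)
      (Function.update l false false)
    else if ¬ d.Wants c h true ∧ l true = true then .sync .unlock (d.lockNode true)
      (Function.update l true false)
    else .proceed
  serve := fun _ _ _ _ _ _ => .proceed
  obs := fun _ l _ => l

variable (V Λ Ω n) in
/-- Configurations of the implementation defined by `bypass`. -/
abbrev _root_.SearchConc.BConf : Type :=
  Config V Λ Ω (Mem V Λ × Locks V n) ((Bool → Bool) × Option (Edges V Λ)) n

/-- The process holds exactly the locks that its operation needs. -/
def Settled (l : Bool → Bool) (c : Call V Ω) (h : List (Access V Λ)) : Prop :=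
  ∀ i, l i = true ↔ d.Wants c h i

/-- The steps of the lock-based implementation. -/
inductive Move (C : BConf V Λ Ω n) (p : Fin n) :
    Option (Event V Λ Ω n) → BConf V Λ Ω n → Prop
  | invoke (c : Call V Ω) : C.phase p = .idle →
      Move C p (some ⟨(p, C.cnt p), .inv c⟩)
        { C with
          loc := Function.update C.loc p ((C.loc p).1, none)
          phase := Function.update C.phase p (.ready c []) }
  | lock (c : Call V Ω) (h : List (Access V Λ)) (i : Bool) : C.phase p = .ready c h →
      (C.loc p).1 i = false → d.Wants c h i →
      (i = true → d.Wants c h false → (C.loc p).1 false = true) →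
      (∀ q, q ≠ p → ¬ C.sh.2.Holds q (d.lockNode i)) →
      Move C p none
        { C with
          sh := (C.sh.1, ⟨Function.update C.sh.2.excl (d.lockNode i) (some p), C.sh.2.shared⟩)
          loc := Function.update C.loc p (Function.update (C.loc p).1 i true, none) }
  | unlock (c : Call V Ω) (h : List (Access V Λ)) (i : Bool) : C.phase p = .ready c h →
      (C.loc p).1 i = true → ¬ d.Wants c h i →
      Move C p none
        { C with
          sh := (C.sh.1, if C.sh.2.excl (d.lockNode i) = some p then
            ⟨Function.update C.sh.2.excl (d.lockNode i) none, C.sh.2.shared⟩ else C.sh.2)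
          loc := Function.update C.loc p (Function.update (C.loc p).1 i false, none) }
  | request (c : Call V Ω) (h : List (Access V Λ)) (a : Req V Λ) : C.phase p = .ready c h →
      d.Settled (C.loc p).1 c h → D.next c h = .req a →
      Move C p (some ⟨(p, C.cnt p), Impl.reqKind a⟩)
        { C with
          loc := Function.update C.loc p ((C.loc p).1, none)
          phase := Function.update C.phase p (.pending c h a) }
  | respond (c : Call V Ω) (h : List (Access V Λ)) (r : DictResp V) : C.phase p = .ready c h →
      d.Settled (C.loc p).1 c h → D.next c h = .ret r →
      Move C p (some ⟨(p, C.cnt p), .res r⟩)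
        { C with
          loc := Function.update C.loc p ((C.loc p).1, none)
          phase := Function.update C.phase p .idle
          cnt := Function.update C.cnt p (C.cnt p + 1) }
  | access (c : Call V Ω) (h : List (Access V Λ)) (a : Req V Λ) : C.phase p = .pending c h a →
      (C.loc p).2 = none →
      Move C p none
        { C with
          sh := (a.mem C.sh.1, C.sh.2)
          loc := Function.update C.loc p ((C.loc p).1, some (a.val C.sh.1)) }
  | reply (c : Call V Ω) (h : List (Access V Λ)) (a : Req V Λ) (e : Edges V Λ) :
      C.phase p = .pending c h a → (C.loc p).2 = some e →
      Move C p (some ⟨(p, C.cnt p), Impl.replyKind e a⟩)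
        { C with
          loc := Function.update C.loc p ((C.loc p).1, none)
          phase := Function.update C.phase p (.ready c (h ++ [Impl.replyAccess e a])) }

theorem ready_proceed {p : Fin n} {l : Bool → Bool} {c : Call V Ω} {h : List (Access V Λ)} :
    (d.bypass n).ready p l c h = .proceed ↔ d.Settled l c h := by
  simp only [Settled, Bool.forall_bool, bypass]
  by_cases h1 : d.Wants c h false <;> by_cases h2 : d.Wants c h true <;>
    cases l false <;> cases l true <;> simp [h1, h2]

theorem ready_sync {p : Fin n} {l l' : Bool → Bool} {c : Call V Ω} {h : List (Access V Λ)}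
    {k : LockPrim} {x : Node V} (hs : (d.bypass n).ready p l c h = .sync k x l') :
    ∃ i, x = d.lockNode i ∧
      ((k = .lock ∧ l i = false ∧ d.Wants c h i ∧ l' = Function.update l i true ∧
        (i = true → d.Wants c h false → l false = true)) ∨
      (k = .unlock ∧ l i = true ∧ ¬ d.Wants c h i ∧ l' = Function.update l i false)) := by
  simp only [bypass] at hs
  by_cases h1 : d.Wants c h false <;> by_cases h2 : d.Wants c h true <;>
    cases h3 : l false <;> cases h4 : l true <;>
    simp [h1, h2, h3, h4] at hs
  all_goals
    obtain ⟨rfl, rfl, rfl⟩ := hs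
    first
    | exact ⟨false, rfl, Or.inl ⟨rfl, h3, h1, rfl, by simp⟩⟩
    | exact ⟨true, rfl, Or.inl ⟨rfl, h4, h2, rfl, by simp [h1]⟩⟩
    | exact ⟨false, rfl, Or.inr ⟨rfl, h3, h1, rfl⟩⟩
    | exact ⟨true, rfl, Or.inr ⟨rfl, h4, h2, rfl⟩⟩

theorem serve_eq {p : Fin n} {l : (d.bypass n).toImpl.Loc} {c : Call V Ω} {h : List (Access V Λ)}
    {a : Req V Λ} : (d.bypass n).toImpl.serve p l c h a = match l.2 with
      | none => .prim ((d.bypass n).accessPrim l.1 a)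
      | some e => .reply e := rfl

/-- There are no other steps. -/
theorem step_move {C C' : (d.bypass n).toImpl.Conf} {p : Fin n} {e : Option (Event V Λ Ω n)}
    (hs : Impl.Step D.toSearchData C p e C') : d.Move C p e C' := by
  cases hs with
  | invoke c hp => exact .invoke c hp
  | @readyPrim c h f s l hp hr hf =>
    simp only [LockProgram.toImpl] at hr
    split at hr
    · rename_i k x l' hsync
      have hf' := ReadyAct.prim.inj hr
      subst hf'
      obtain ⟨t, ht, hsl⟩ := Option.map_eq_some_iff.1 hf
      cases hsl
      obtain ⟨i, rfl, ⟨rfl, h1, h2, rfl, h4⟩ | ⟨rfl, h1, h2, rfl⟩⟩ := d.ready_sync hsync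
      · simp only [Locks.apply] at ht
        split at ht
        · rename_i hfree
          cases ht
          exact .lock c h i hp h1 h2 h4 hfree
        · cases ht
      · simp only [Locks.apply] at ht
        cases ht
        exact .unlock c h i hp h1 h2
    · cases hr
  | @request c h a hp hr hn =>
    simp only [LockProgram.toImpl] at hr
    split at hr
    · cases hr
    · rename_i hpr
      exact .request c h a hp (d.ready_proceed.1 hpr) hn
  | @respond c h r hp hr hn =>
    simp only [LockProgram.toImpl] at hr
    split at hr
    · cases hr
    · rename_i hpr
      exact .respond c h r hp (d.ready_proceed.1 hpr) hn
  | @servePrim c h a f s l hp hr hf =>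
    rw [d.serve_eq] at hr
    split at hr
    · rename_i hl
      have hf' := ServeAct.prim.inj hr
      subst hf'
      have := Move.access (d := d) (C := C) (p := p) c h a hp hl
      cases a <;> cases hf <;> exact this
    · cases hr
  | @reply c h a e hp hr =>
    rw [d.serve_eq] at hr
    split at hr
    · cases hr
    · rename_i e' hl
      cases hr
      exact .reply c h a e hp hl
  | @abort c h a hp hr =>
    rw [d.serve_eq] at hr
    split at hr <;> cases hr

theorem exists_step_of_settled {C : (d.bypass n).toImpl.Conf} {p : Fin n} {c : Call V Ω}
    {h : List (Access V Λ)} (hp : C.phase p = .ready c h) (hs : d.Settled (C.loc p).1 c h) :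
    (∀ a, D.next c h = .req a → Impl.Step D.toSearchData C p (some ⟨(p, C.cnt p), Impl.reqKind a⟩)
      (Impl.afterEvent C p (Impl.reqKind a) (.pending c h a))) ∧
    (∀ r, D.next c h = .ret r → Impl.Step D.toSearchData C p (some ⟨(p, C.cnt p), .res r⟩)
      (Impl.afterEnd C p (.res r))) := by
  have hr : (d.bypass n).toImpl.ready p (C.loc p) c h = .proceed := by
    have := (d.ready_proceed (p := p)).2 hs
    simp only [LockProgram.toImpl]
    split
    · rename_i hl
      exact absurd (this.symm.trans hl) (by simp)
    · rfl
  exact ⟨fun a => .request hp hr, fun r => .respond hp hr⟩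

theorem exists_step_of_pending {C : (d.bypass n).toImpl.Conf} {p : Fin n} {c : Call V Ω}
    {h : List (Access V Λ)} {a : Req V Λ} (hp : C.phase p = .pending c h a) :
    ((C.loc p).2 = none → Impl.Step D.toSearchData C p none
      (Impl.afterPrim C p (a.mem C.sh.1, C.sh.2) ((C.loc p).1, some (a.val C.sh.1)))) ∧
    ∀ e, (C.loc p).2 = some e → Impl.Step D.toSearchData C p
      (some ⟨(p, C.cnt p), Impl.replyKind e a⟩)
      (Impl.afterEvent C p (Impl.replyKind e a) (.ready c (h ++ [Impl.replyAccess e a]))) := by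
  constructor
  · intro hl
    refine .servePrim (f := (d.bypass n).accessPrim (C.loc p).1 a) hp ?_ ?_
    · rw [d.serve_eq, hl]
    · cases a <;> rfl
  · intro e hl
    refine .reply hp ?_
    rw [d.serve_eq, hl]

/-- A process that does not hold exactly the locks that it needs can release one, or acquire one
that no other process holds. -/
theorem exists_step_of_unsettled {C : (d.bypass n).toImpl.Conf} {p : Fin n} {c : Call V Ω}
    {h : List (Access V Λ)} (hp : C.phase p = .ready c h) (hs : ¬ d.Settled (C.loc p).1 c h) :
    ∃ (i : Bool) (t : Option ((d.bypass n).toImpl.Sh × (d.bypass n).toImpl.Loc)) (b : Bool),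
      (b = true ↔ d.Wants c h i) ∧ (C.loc p).1 i ≠ b ∧
      (t = none → b = true ∧ ∃ q, q ≠ p ∧ C.sh.2.Holds q (d.lockNode i)) ∧
      ∀ s l, t = some (s, l) → Impl.Step D.toSearchData C p none (Impl.afterPrim C p s l) := by
  cases hr : (d.bypass n).ready p (C.loc p).1 c h with
  | proceed => exact absurd (d.ready_proceed.1 hr) hs
  | sync k x l' =>
    have hr' : (d.bypass n).toImpl.ready p (C.loc p) c h =
        .prim ((d.bypass n).lockPrim p k x l' none) := by
      simp only [LockProgram.toImpl]
      split
      · rename_i hl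
        have := hr.symm.trans hl
        cases this
        rfl
      · rename_i hl
        exact absurd (hr.symm.trans hl) (by simp)
    obtain ⟨i, rfl, ⟨rfl, h1, h2, rfl, h4⟩ | ⟨rfl, h1, h2, rfl⟩⟩ := d.ready_sync hr
    · refine ⟨i, _, true, by simpa using h2, by simp [h1], ?_, fun s l ht => .readyPrim hp hr' ht⟩
      intro ht
      simp only [LockProgram.lockPrim, Locks.apply] at ht
      split at ht
      · cases ht
      · rename_i hq
        push Not at hq
        exact ⟨rfl, hq⟩
    · refine ⟨i, _, false, by simpa using h2, by simp [h1], ?_, fun s l ht => .readyPrim hp hr' ht⟩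
      intro ht
      simp [LockProgram.lockPrim, Locks.apply] at ht

end Detour

end Bypass

/-! ### The state of the locks -/

section LockState

variable {V Λ Ω : Type} {n : ℕ} {D : SearchStructure V Λ Ω}

/-- The operation that process `p` executes, with the accesses that it has performed, including
one that has not responded yet. -/
def current (C : BConf V Λ Ω n) (p : Fin n) : Option (Call V Ω × List (Access V Λ)) :=
  match C.phase p, (C.loc p).2 with
  | .idle, _ => none
  | .ready c h, _ => some (c, h)
  | .pending c h _, none => some (c, h)
  | .pending c h a, some e => some (c, h ++ [Impl.replyAccess e a])

theorem current_congr {C C' : BConf V Λ Ω n} {p : Fin n} (h : C'.phase p = C.phase p)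
    (h' : C'.loc p = C.loc p) : current C' p = current C p := by
  simp [current, h, h']

theorem current_ready {C : BConf V Λ Ω n} {p : Fin n} {c : Call V Ω} {h : List (Access V Λ)}
    (hp : C.phase p = .ready c h) : current C p = some (c, h) := by simp [current, hp]

theorem current_pending {C : BConf V Λ Ω n} {p : Fin n} {c : Call V Ω} {h : List (Access V Λ)}
    {a : Req V Λ} (hp : C.phase p = .pending c h a) (hl : (C.loc p).2 = none) :
    current C p = some (c, h) := by simp [current, hp, hl]

theorem current_pending' {C : BConf V Λ Ω n} {p : Fin n} {c : Call V Ω} {h : List (Access V Λ)}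
    {a : Req V Λ} {e : Edges V Λ} (hp : C.phase p = .pending c h a) (hl : (C.loc p).2 = some e) :
    current C p = some (c, h ++ [Impl.replyAccess e a]) := by simp [current, hp, hl]

theorem current_idle {C : BConf V Λ Ω n} {p : Fin n} (hp : C.phase p = .idle) :
    current C p = none := by simp [current, hp]

namespace Detour

variable {d : Detour D}

theorem Gapped.append {c : Call V Ω} {h : List (Access V Λ)} (hg : d.Gapped c h)
    (h' : List (Access V Λ)) : d.Gapped c (h ++ h') := by
  obtain ⟨ho, e₀, e₁, w, hv, h0, h1⟩ := hg
  exact ⟨ho, e₀, e₁, w ++ viewOf h', by rw [viewOf_append, hv]; rfl, h0, h1⟩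

theorem lockNode_injective : Function.Injective d.lockNode := by
  intro i j hij
  cases i <;> cases j <;> simp [lockNode] at hij ⊢

variable (d)

/-- The local states record the locks held, and an operation that needs the lock on the root but
does not hold it has not performed any access and does not hold the other lock either. -/
structure LockInv (C : BConf V Λ Ω n) : Prop where
  held : ∀ p i, (C.loc p).1 i = true ↔ C.sh.2.excl (d.lockNode i) = some p
  shared : ∀ x, C.sh.2.shared x = ∅
  idle : ∀ p, C.phase p = .idle → ∀ i, (C.loc p).1 i = false
  pending : ∀ p c h a, C.phase p = .pending c h a →
    d.Settled (C.loc p).1 c h ∧ D.next c h = .req a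
  order : ∀ p c h, current C p = some (c, h) → d.Wants c h false → (C.loc p).1 false = false →
    h = [] ∧ (C.loc p).1 true = false

variable {d}

theorem LockInv.unique {C : BConf V Λ Ω n} (hC : d.LockInv C) {p q : Fin n} {i : Bool}
    (hp : (C.loc p).1 i = true) (hq : (C.loc q).1 i = true) : p = q :=
  Option.some.inj (((hC.held p i).1 hp).symm.trans ((hC.held q i).1 hq))

theorem LockInv.holds_iff {C : BConf V Λ Ω n} (hC : d.LockInv C) {p : Fin n} {i : Bool} :
    C.sh.2.Holds p (d.lockNode i) ↔ (C.loc p).1 i = true := by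
  simp [Locks.Holds, hC.shared, hC.held]

theorem wants_of_append {c : Call V Ω} {h h' : List (Access V Λ)} {a : Req V Λ}
    (ha : D.next c h = .req a) (hw : d.Wants c (h ++ h') false) : d.Wants c h false :=
  ⟨fun r hr => by simp [ha] at hr, fun hg => hw.2 (hg.append h')⟩

theorem LockInv.move {C C' : BConf V Λ Ω n} {p : Fin n} {e : Option (Event V Λ Ω n)}
    (hC : d.LockInv C) (hm : d.Move C p e C') : d.LockInv C' := by
  -- the lock that changes hands belongs to `p` before or after the step
  have hheld : ∀ (l : Bool → Bool) (b : Option (Edges V Λ)), (∀ i, l i = (C.loc p).1 i) →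
      ∀ q i, (Function.update C.loc p (l, b) q).1 i = true ↔
        C.sh.2.excl (d.lockNode i) = some q := by
    intro l b hl q i
    by_cases hq : q = p
    · subst hq; simp [hl, hC.held]
    · simp [Function.update_of_ne hq, hC.held]
  cases hm with
  | invoke c hp =>
    refine ⟨hheld _ _ fun _ => rfl, hC.shared, fun q hq => ?_, fun q c' h' a hq => ?_,
      fun q c' h' hq hw hf => ?_⟩ <;> by_cases hqp : q = p
    · subst hqp; simp at hq
    · simp [Function.update_of_ne hqp, -Bool.forall_bool] at hq ⊢; exact hC.idle q hq
    · subst hqp; simp at hq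
    · simp [Function.update_of_ne hqp, -Bool.forall_bool] at hq ⊢; exact hC.pending q c' h' a hq
    · subst hqp
      rw [current_ready (c := c) (h := []) (by simp)] at hq
      cases hq
      exact ⟨rfl, by simpa using hC.idle q hp true⟩
    · simp only [Function.update_of_ne hqp] at hf ⊢
      exact hC.order q c' h'
        (by rw [← hq]; exact (current_congr (by simp [hqp]) (by simp [hqp])).symm) hw hf
  | lock c h i hp h1 h2 h3 h4 =>
    refine ⟨fun q j => ?_, hC.shared, fun q hq => ?_, fun q c' h' a hq => ?_,
      fun q c' h' hq hw hf => ?_⟩ <;> by_cases hqp : q = p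
    · subst hqp
      by_cases hij : j = i
      · subst hij; simp
      · simp [hij, hC.held, Function.update_of_ne (d.lockNode_injective.ne hij)]
    · by_cases hij : j = i
      · subst hij
        have := h4 q hqp
        rw [hC.holds_iff] at this
        simp [Function.update_of_ne hqp, this, Ne.symm hqp]
      · simp [hqp, hC.held, Function.update_of_ne (d.lockNode_injective.ne hij)]
    · subst hqp; simp [hp] at hq
    · simp [Function.update_of_ne hqp, -Bool.forall_bool]; exact hC.idle q hq
    · subst hqp; simp [hp] at hq
    · simp [Function.update_of_ne hqp, -Bool.forall_bool]; exact hC.pending q c' h' a hq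
    · subst hqp
      rw [current_ready (c := c) (h := h) (by exact hp)] at hq
      cases hq
      cases i
      · simp at hf
      · simp [h3 rfl hw] at hf
    · simp only [Function.update_of_ne hqp] at hf ⊢
      exact hC.order q c' h'
        (by rw [← hq]; exact (current_congr (by simp) (by simp [hqp])).symm) hw hf
  | unlock c h i hp h1 h2 =>
    have hif := (hC.held p i).1 h1
    rw [if_pos hif]
    refine ⟨fun q j => ?_, hC.shared, fun q hq => ?_, fun q c' h' a hq => ?_,
      fun q c' h' hq hw hf => ?_⟩ <;> by_cases hqp : q = p
    · subst hqp
      by_cases hij : j = i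
      · subst hij; simp
      · simp [hij, hC.held, Function.update_of_ne (d.lockNode_injective.ne hij)]
    · by_cases hij : j = i
      · subst hij
        have : (C.loc q).1 j = false := by
          by_contra h0
          exact hqp (hC.unique (by simpa using h0) h1)
        simp [Function.update_of_ne hqp, this]
      · simp [hqp, hC.held, Function.update_of_ne (d.lockNode_injective.ne hij)]
    · subst hqp; simp [hp] at hq
    · simp [Function.update_of_ne hqp, -Bool.forall_bool]; exact hC.idle q hq
    · subst hqp; simp [hp] at hq
    · simp [Function.update_of_ne hqp, -Bool.forall_bool]; exact hC.pending q c' h' a hq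
    · subst hqp
      rw [current_ready (c := c) (h := h) (by exact hp)] at hq
      cases hq
      cases i
      · exact absurd hw h2
      · simp at hf ⊢
        exact (hC.order q c h (current_ready hp) hw hf).1
    · simp only [Function.update_of_ne hqp] at hf ⊢
      exact hC.order q c' h'
        (by rw [← hq]; exact (current_congr (by simp) (by simp [hqp])).symm) hw hf
  | request c h a hp hs hn =>
    refine ⟨hheld _ _ fun _ => rfl, hC.shared, fun q hq => ?_, fun q c' h' a hq => ?_,
      fun q c' h' hq hw hf => ?_⟩ <;> by_cases hqp : q = p
    · subst hqp; simp at hq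
    · simp [Function.update_of_ne hqp, -Bool.forall_bool] at hq ⊢; exact hC.idle q hq
    · subst hqp
      simp at hq
      obtain ⟨rfl, rfl, rfl⟩ := hq
      simpa using ⟨hs, hn⟩
    · simp [Function.update_of_ne hqp, -Bool.forall_bool] at hq ⊢; exact hC.pending q c' h' _ hq
    · subst hqp
      rw [current_pending (c := c) (h := h) (a := a) (by simp) (by simp)] at hq
      cases hq
      simp only [Function.update_self] at hf ⊢
      exact hC.order q c h (current_ready hp) hw hf
    · simp only [Function.update_of_ne hqp] at hf ⊢
      exact hC.order q c' h'
        (by rw [← hq]; exact (current_congr (by simp [hqp]) (by simp [hqp])).symm) hw hf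
  | respond c h r hp hs hn =>
    refine ⟨hheld _ _ fun _ => rfl, hC.shared, fun q hq => ?_, fun q c' h' a hq => ?_,
      fun q c' h' hq hw hf => ?_⟩ <;> by_cases hqp : q = p
    · subst hqp
      intro i
      have := (hs i).1
      cases h0 : (C.loc q).1 i
      · simp [h0]
      · exact absurd hn ((this h0).1 r)
    · simp [Function.update_of_ne hqp, -Bool.forall_bool] at hq ⊢; exact hC.idle q hq
    · subst hqp; simp at hq
    · simp [Function.update_of_ne hqp, -Bool.forall_bool] at hq ⊢; exact hC.pending q c' h' _ hq
    · subst hqp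
      rw [current_idle (by simp)] at hq
      cases hq
    · simp only [Function.update_of_ne hqp] at hf ⊢
      exact hC.order q c' h'
        (by rw [← hq]; exact (current_congr (by simp [hqp]) (by simp [hqp])).symm) hw hf
  | access c h a hp hl =>
    obtain ⟨hs, hn⟩ := hC.pending p c h a hp
    refine ⟨hheld _ _ fun _ => rfl, hC.shared, fun q hq => ?_, fun q c' h' a hq => ?_,
      fun q c' h' hq hw hf => ?_⟩ <;> by_cases hqp : q = p
    · subst hqp; simp [hp] at hq
    · simp [Function.update_of_ne hqp, -Bool.forall_bool]; exact hC.idle q hq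
    · subst hqp
      simp only [Function.update_self]
      exact hC.pending q c' h' _ hq
    · simp only [Function.update_of_ne hqp]; exact hC.pending q c' h' _ hq
    · subst hqp
      rw [current_pending' (c := c) (h := h) (a := a) (e := a.val C.sh.1)
        (by exact hp) (by simp)] at hq
      cases hq
      simp only [Function.update_self] at hf
      rw [(hs false).2 (wants_of_append hn hw)] at hf
      cases hf
    · simp only [Function.update_of_ne hqp] at hf ⊢
      exact hC.order q c' h'
        (by rw [← hq]; exact (current_congr (by simp) (by simp [hqp])).symm) hw hf
  | reply c h a e hp hl =>
    refine ⟨hheld _ _ fun _ => rfl, hC.shared, fun q hq => ?_, fun q c' h' a hq => ?_,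
      fun q c' h' hq hw hf => ?_⟩ <;> by_cases hqp : q = p
    · subst hqp; simp at hq
    · simp [Function.update_of_ne hqp, -Bool.forall_bool] at hq ⊢; exact hC.idle q hq
    · subst hqp; simp at hq
    · simp [Function.update_of_ne hqp, -Bool.forall_bool] at hq ⊢; exact hC.pending q c' h' _ hq
    · subst hqp
      rw [current_ready (c := c) (h := h ++ [Impl.replyAccess e a]) (by simp)] at hq
      cases hq
      simp only [Function.update_self] at hf ⊢
      exact hC.order q c _ (current_pending' hp hl) hw hf
    · simp only [Function.update_of_ne hqp] at hf ⊢
      exact hC.order q c' h'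
        (by rw [← hq]; exact (current_congr (by simp [hqp]) (by simp [hqp])).symm) hw hf

theorem lockInv_exec {α : List (Event V Λ Ω n)} {C : (d.bypass n).toImpl.Conf}
    (hα : (d.bypass n).toImpl.Exec D.toSearchData α C) : d.LockInv C := by
  induction hα with
  | nil =>
    refine ⟨fun _ _ => ?_, fun _ => rfl, fun _ _ _ => rfl, fun _ _ _ _ h => (by cases h),
      fun _ _ _ h => (by cases h)⟩
    constructor <;> intro h <;> cases h
  | step _ hs ih => exact ih.move (d.step_move hs)

end Detour

end LockState

/-! ### Gapped searches -/

section GapInvariant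

variable {V Λ Ω : Type} {n : ℕ} {D : SearchStructure V Λ Ω}

/-- The nodes that the operations invoked in `α` may insert. -/
def insertedNodes (α : List (Event V Λ Ω n)) : List (Node V) :=
  α.filterMap fun e => match e.kind with
    | .inv ⟨.insert k v, _⟩ => some (.pair k v)
    | _ => none

theorem insertedNodes_append (α β : List (Event V Λ Ω n)) :
    insertedNodes (α ++ β) = insertedNodes α ++ insertedNodes β := by simp [insertedNodes]

theorem mem_insertedNodes {α : List (Event V Λ Ω n)} {π : OpId n} {k : ℕ} {v : V} {ω : Ω}
    (h : ⟨π, .inv ⟨.insert k v, ω⟩⟩ ∈ α) : Node.pair k v ∈ insertedNodes α :=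
  List.mem_filterMap.2 ⟨_, h, rfl⟩

/-- The pairs stored in a dictionary state are among those inserted in `α`. -/
def Stored (α : List (Event V Λ Ω n)) (q : ℕ → Option V) : Prop :=
  ∀ j u, q j = some u → Node.pair j u ∈ insertedNodes α

theorem Stored.append {α : List (Event V Λ Ω n)} {q : ℕ → Option V} (h : Stored α q)
    (β : List (Event V Λ Ω n)) : Stored (α ++ β) q := fun j u hj => by
  rw [insertedNodes_append]; exact List.mem_append_left _ (h j u hj)

theorem Stored.spec {α : List (Event V Λ Ω n)} {q q' : ℕ → Option V} {π : OpId n} {c : Call V Ω}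
    {r : DictResp V} (h : Stored α q) (hs : dictSpec V q c.op q' r) (hc : ⟨π, .inv c⟩ ∈ α) :
    Stored α q' := by
  obtain ⟨o, ω⟩ := c
  intro j u hj
  cases o with
  | insert k v =>
    rcases hs with ⟨-, rfl, -⟩ | ⟨-, rfl, -⟩
    · by_cases hjk : j = k
      · subst hjk
        rw [Function.update_self] at hj
        cases hj
        exact mem_insertedNodes hc
      · rw [Function.update_of_ne hjk] at hj
        exact h j u hj
    · exact h j u hj
  | delete k =>
    rcases hs with ⟨-, rfl, -⟩ | ⟨-, rfl, -⟩
    · by_cases hjk : j = k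
      · subst hjk
        simp at hj
      · rw [Function.update_of_ne hjk] at hj
        exact h j u hj
    · exact h j u hj
  | find k =>
    obtain ⟨rfl, -⟩ := hs
    exact h j u hj

/-- An operation visits each stored pair at most once. -/
theorem Stored.view_length {α : List (Event V Λ Ω n)} {q : ℕ → Option V} {c : Call V Ω}
    {m m' : Mem V Λ} {h : List (Access V Λ)} (hs : Stored α q) (hm : D.Reach m)
    (hq : Represents m q) (hr : D.SeqRun c m h m') :
    (viewOf h).length ≤ 1 + (insertedNodes α).length := by
  have hsub : (viewOf h).map Prod.fst ⊆ .root :: insertedNodes α := by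
    intro x hx
    obtain ⟨a, ha, rfl⟩ := List.mem_map.1 hx
    have hin := view_inGraph hr a ha
    cases hx' : a.1 with
    | root => simp
    | pair j u =>
      rw [hx'] at hin
      exact List.mem_cons_of_mem _ (hs j u ((hq j u).1 hin))
  have := ((view_nodup hm hr).subperm hsub).length_le
  simpa [Nat.add_comm] using this

/-- A deletion rewrites only predecessors of nodes with the deleted key. -/
theorem delete_touches {c : Call V Ω} {m m' : Mem V Λ} {h : List (Access V Λ)} {j : ℕ}
    {y : Node V} (hr : D.SeqRun c m h m') (hj : c.op = .delete j)
    (hy : ∀ u, ¬ Edge m y (.pair j u)) : m' y = m y := by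
  obtain ⟨-, hm', -, -, hval⟩ := seqRun_shape hr
  rw [hm']
  refine writeMem_of_not_mem fun a ha hay => ?_
  have ha := List.mem_of_mem_take ha
  rcases update_delete D.toSearchData c (viewOf h) j hj with ⟨b, hb, hbk, -, hu⟩ | ⟨-, hu⟩
  · rw [hu] at ha
    obtain ⟨p, hp, hpa⟩ := List.mem_filterMap.1 ha
    split at hpa
    · rename_i hl
      cases hpa
      obtain ⟨u, hu⟩ := node_of_key hbk
      rw [hu, hval p hp] at hl
      refine hy u ?_
      rw [← hay]
      exact hl
    · cases hpa
  · rw [hu] at ha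
    cases ha

/-- A run of accesses without writes is possible in every memory that agrees on the visited
nodes. -/
theorem runs_of_agree {c : Call V Ω} {m m' : Mem V Λ} {h l : List (Access V Λ)}
    (hl : l = (viewOf l).map fun a => .read a.1 a.2) (hr : Runs D.toSearchData c m h l)
    (ha : ∀ a ∈ viewOf l, m' a.1 = m a.1) : Runs D.toSearchData c m' h l := by
  rw [hl] at hr ⊢
  generalize viewOf l = w at hr ha
  clear hl
  induction w generalizing h with
  | nil => trivial
  | cons a w ih =>
    obtain ⟨h1, h2, h3⟩ := hr
    exact ⟨h1, by rw [h2, ha a (by simp)], ih h3 fun b hb => ha b (by simp [hb])⟩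

namespace Detour

variable (d : Detour D)

/-- A gapped search `π`, with the accesses `h`, runs as if it ran alone in the memory `N`, which
represents `qN`, while the shared elements are in the memory `m` and the last state between two
updates was `M`, with dictionary `q`. The search takes effect after the operations `L₀` and before
the operations `L₁` of the linearization, where the key `k` has the same value as in `qN`. The
memories agree with `N` on the nodes that the search may still visit, and either `k` has been
removed, or nothing but `kx` has been removed and `M` agrees with `N` below `(kx, vx)`. -/
structure Gap (α : List (Event V Λ Ω n)) (L₀ L₁ : LinOrder V n) (q₀ q : ℕ → Option V)
    (M m : Mem V Λ) (π : OpId n) (c : Call V Ω) (h : List (Access V Λ)) (N : Mem V Λ)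
    (qN : ℕ → Option V) : Prop where
  reach : D.Reach N
  rep : Represents N qN
  run : D.SeqRun c N h N
  gapped : d.Gapped c h
  start : DictRun (fun _ => none) (L₀.map fun a => a.2) q₀
  later : DictRun q₀ (L₁.map fun a => a.2) q
  key : q₀ d.k = qN d.k
  overlap : ∀ b ∈ L₁, ¬ Precedes α b.1 π
  stored : Stored α qN
  agree : ∀ y, (∀ a ∈ viewOf h, Relation.TransGen (Edge N) a.1 y) → M y = N y ∧ m y = N y
  stage : q d.k = none ∨ ((∀ j, j ≠ d.kx → q j = qN j) ∧
    ∀ y, Relation.TransGen (Edge N) (.pair d.kx d.vx) y → M y = N y)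

/-- The invariant of a gapped search. -/
def GapInv (α : List (Event V Λ Ω n)) (L : LinOrder V n) (q : ℕ → Option V) (M m : Mem V Λ)
    (π : OpId n) (c : Call V Ω) (h : List (Access V Λ)) : Prop :=
  ∃ L₀ L₁ q₀ N qN, L = L₀ ++ L₁ ∧ d.Gap α L₀ L₁ q₀ q M m π c h N qN

variable {d}

theorem GapInv.event {α : List (Event V Λ Ω n)} {L : LinOrder V n} {q : ℕ → Option V}
    {M m : Mem V Λ} {π : OpId n} {c : Call V Ω} {h : List (Access V Λ)}
    (hg : d.GapInv α L q M m π c h) (e : Event V Λ Ω n) (he : e.op = π → ¬ e.kind.IsInv) :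
    d.GapInv (α ++ [e]) L q M m π c h := by
  obtain ⟨L₀, L₁, q₀, N, qN, hL, hg⟩ := hg
  refine ⟨L₀, L₁, q₀, N, qN, hL, { hg with
    overlap := fun b hb hp => ?_
    stored := hg.stored.append _ }⟩
  rcases precedes_snoc.1 hp with hp | ⟨h1, h2, -⟩
  · exact hg.overlap b hb hp
  · exact he h1 h2

/-- When a search becomes gapped, it takes effect at the end of the linearization. -/
theorem GapInv.begin {α : List (Event V Λ Ω n)} {L : LinOrder V n} {q : ℕ → Option V}
    {M : Mem V Λ} {π : OpId n} {c : Call V Ω} {h : List (Access V Λ)} (hM : D.Reach M)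
    (hq : Represents M q) (hr : D.SeqRun c M h M) (hg : d.Gapped c h)
    (hd : DictRun (fun _ => none) (L.map fun a => a.2) q) (hs : Stored α q) :
    d.GapInv α L q M M π c h :=
  ⟨L, [], q, M, q, by simp, hM, hq, hr, hg, hd, rfl, rfl, by simp, hs, fun _ _ => ⟨rfl, rfl⟩,
    .inr ⟨fun _ _ => rfl, fun _ _ => rfl⟩⟩

theorem GapInv.possible {α : List (Event V Λ Ω n)} {L : LinOrder V n} {q : ℕ → Option V}
    {M m : Mem V Λ} {π : OpId n} {c : Call V Ω} {h : List (Access V Λ)}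
    (hg : d.GapInv α L q M m π c h) : SeqPossible D.toSearchData c h ∧
      (viewOf h).length ≤ 1 + (insertedNodes α).length := by
  obtain ⟨L₀, L₁, q₀, N, qN, hL, hg⟩ := hg
  exact ⟨⟨N, N, hg.reach, hg.run⟩, hg.stored.view_length hg.reach hg.rep hg.run⟩

/-- The next access of a gapped search is a read, of a node on which the memory agrees. -/
theorem GapInv.search {α : List (Event V Λ Ω n)} {L : LinOrder V n} {q : ℕ → Option V}
    {M m : Mem V Λ} {π : OpId n} {c : Call V Ω} {h : List (Access V Λ)}
    (hg : d.GapInv α L q M m π c h) {a : Req V Λ} (ha : D.next c h = .req a) :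
    a.mem m = m ∧ d.GapInv α L q M m π c (h ++ [Impl.replyAccess (a.val m) a]) := by
  obtain ⟨L₀, L₁, q₀, N, qN, hL, hg⟩ := hg
  have hr := seqRun_snoc hg.run ha
  cases a with
  | write x e =>
    have := (find_no_write hg.gapped.1 hr).2.1
    simp [Impl.replyAccess, numWrites] at this
  | read z =>
    have hpw := view_pairwise hr
    have hv : viewOf (h ++ [Impl.replyAccess ((Req.read z).val N) (.read z)]) =
        viewOf h ++ [(z, N z)] := by
      simp [viewOf, Impl.replyAccess, Req.val]
    rw [hv, List.pairwise_append] at hpw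
    have hz : m z = N z := (hg.agree z fun b hb => hpw.2.2 b hb (z, N z) (by simp)).2
    have he : (Req.read z : Req V Λ).val m = (Req.read z).val N := hz
    refine ⟨rfl, L₀, L₁, q₀, N, qN, hL, ?_⟩
    rw [he]
    exact { hg with
      run := hr
      gapped := hg.gapped.append _
      agree := fun y hy => hg.agree y fun b hb => hy b (by rw [hv]; simp [hb]) }

/-- The response of a gapped search is that of a search that takes effect at the split. -/
theorem GapInv.result {α : List (Event V Λ Ω n)} {L : LinOrder V n} {q : ℕ → Option V}
    {M m : Mem V Λ} {π : OpId n} {c : Call V Ω} {h : List (Access V Λ)}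
    (hg : d.GapInv α L q M m π c h) {r : DictResp V} (hr : D.next c h = .ret r) :
    ∃ L₀ L₁, L = L₀ ++ L₁ ∧ (∀ b ∈ L₁, ¬ Precedes α b.1 π) ∧
      DictRun (fun _ => none) ((L₀ ++ (π, c.op, r) :: L₁).map fun a => a.2) q := by
  obtain ⟨L₀, L₁, q₀, N, qN, hL, hg⟩ := hg
  refine ⟨L₀, L₁, hL, hg.overlap, ?_⟩
  rw [List.map_append, List.map_cons]
  refine dictRun_insert hg.start hg.later ?_
  obtain ⟨h1, h2⟩ := find_result hg.reach hg.rep hg.gapped.1 ⟨hg.run, hr⟩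
  simp only [hg.gapped.1, dictSpec, hg.key, true_and]
  cases hk : qN d.k with
  | none => exact .inr ⟨rfl, (h2 hk).2⟩
  | some u => exact .inl ⟨u, rfl, (h1 u hk).2⟩

theorem Gap.visited {α : List (Event V Λ Ω n)} {L₀ L₁ : LinOrder V n} {q₀ q : ℕ → Option V}
    {M m : Mem V Λ} {π : OpId n} {c : Call V Ω} {h : List (Access V Λ)} {N : Mem V Λ}
    {qN : ℕ → Option V} (hg : d.Gap α L₀ L₁ q₀ q M m π c h N qN) :
    ∃ e₁ w, viewOf h = (.root, N .root) :: (.pair d.kx d.vx, e₁) :: w ∧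
      InGraph N (.pair d.kx d.vx) ∧ (∀ u, ¬ Edge N .root (.pair d.k u)) ∧
      (∀ u, ¬ Edge N (.pair d.kx d.vx) (.pair d.k u)) ∧
      ∀ a ∈ w, Relation.TransGen (Edge N) (.pair d.kx d.vx) a.1 := by
  obtain ⟨-, e₀, e₁, w, hv, h0, h1⟩ := hg.gapped
  have hval := (seqRun_shape hg.run).2.2.2.2
  have hpw := view_pairwise hg.run
  rw [hv] at hval hpw
  have e0 : e₀ = N .root := hval (.root, e₀) (by simp)
  have e1 : e₁ = N (.pair d.kx d.vx) := hval (.pair d.kx d.vx, e₁) (by simp)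
  refine ⟨e₁, w, by rw [hv, e0], view_inGraph hg.run (.pair d.kx d.vx, e₁) (by rw [hv]; simp),
    by rw [e0] at h0; exact h0, by rw [e1] at h1; exact h1, ?_⟩
  exact (List.pairwise_cons.1 (List.pairwise_cons.1 hpw).2).1

/-- The deletion of `kx` does not write below `(kx, vx)`. -/
theorem Gap.delete_kx {α : List (Event V Λ Ω n)} {L₀ L₁ : LinOrder V n} {q₀ q : ℕ → Option V}
    {M m m' : Mem V Λ} {π : OpId n} {c c' : Call V Ω} {h h' : List (Access V Λ)} {N : Mem V Λ}
    {qN : ℕ → Option V} (hg : d.Gap α L₀ L₁ q₀ q M m π c h N qN) (hc : c'.op = .delete d.kx)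
    (hr : D.SeqRun c' M h' m') {y : Node V}
    (hy : Relation.TransGen (Edge N) (.pair d.kx d.vx) y) (he : M y = N y) : m' y = N y := by
  rw [← he]
  refine delete_touches hr hc fun u hu => ?_
  obtain ⟨e₁, w, hv, hin, -⟩ := hg.visited
  have hu' : Edge N y (.pair d.kx u) := by rw [Edge, ← he]; exact hu
  have hu'' := (hg.rep d.kx u).1 (inGraph_trans hin (hy.to_reflTransGen.tail hu'))
  rw [(hg.rep d.kx d.vx).1 hin, Option.some.injEq] at hu''
  subst hu''
  exact D.acyclic N hg.reach _ hin (hy.tail hu')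

theorem Gap.below {α : List (Event V Λ Ω n)} {L₀ L₁ : LinOrder V n} {q₀ q : ℕ → Option V}
    {M m : Mem V Λ} {π : OpId n} {c : Call V Ω} {h : List (Access V Λ)} {N : Mem V Λ}
    {qN : ℕ → Option V} (hg : d.Gap α L₀ L₁ q₀ q M m π c h N qN) {y : Node V}
    (hy : ∀ a ∈ viewOf h, Relation.TransGen (Edge N) a.1 y) :
    Relation.TransGen (Edge N) (.pair d.kx d.vx) y := by
  obtain ⟨e₁, w, hv, -⟩ := hg.visited
  exact hy (.pair d.kx d.vx, e₁) (by rw [hv]; simp)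

/-- The invariant of a gapped search survives the accesses of a light deletion. -/
theorem GapInv.light_run {α : List (Event V Λ Ω n)} {L : LinOrder V n} {q : ℕ → Option V}
    {M m m' : Mem V Λ} {π : OpId n} {c c' : Call V Ω} {h h' : List (Access V Λ)}
    (hg : d.GapInv α L q M m π c h) (hr : D.SeqRun c' M h' m')
    (hc : c'.op = .delete d.kx ∨ m' = M) : d.GapInv α L q M m' π c h := by
  obtain ⟨L₀, L₁, q₀, N, qN, hL, hg⟩ := hg
  refine ⟨L₀, L₁, q₀, N, qN, hL, { hg with agree := fun y hy => ?_ }⟩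
  have h1 := (hg.agree y hy).1
  refine ⟨h1, ?_⟩
  rcases hc with hc | rfl
  · exact hg.delete_kx hc hr (hg.below hy) h1
  · exact h1

/-- The invariant of a gapped search survives the deletion of `kx`. -/
theorem GapInv.delete_kx {α : List (Event V Λ Ω n)} {L : LinOrder V n} {q q' : ℕ → Option V}
    {M m m' : Mem V Λ} {π π' : OpId n} {c c' : Call V Ω} {h h' : List (Access V Λ)}
    {r : DictResp V} (hg : d.GapInv α L q M m π c h) (hc : c'.op = .delete d.kx)
    (hr : D.SeqRun c' M h' m') (hs : dictSpec V q c'.op q' r) (hπ : ¬ Precedes α π' π) :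
    d.GapInv α (L ++ [(π', c'.op, r)]) q' m' m' π c h := by
  obtain ⟨L₀, L₁, q₀, N, qN, hL, hg⟩ := hg
  have hq : ∀ j, j ≠ d.kx → q' j = q j := by
    rw [hc] at hs
    rcases hs with ⟨-, rfl, -⟩ | ⟨-, rfl, -⟩
    · exact fun j hj => Function.update_of_ne hj _ _
    · exact fun _ _ => rfl
  refine ⟨L₀, L₁ ++ [(π', c'.op, r)], q₀, N, qN, by rw [hL, List.append_assoc], { hg with
    later := by rw [List.map_append]; exact dictRun_snoc hg.later hs
    overlap := ?_
    agree := fun y hy => ?_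
    stage := ?_ }⟩
  · intro b hb
    rcases List.mem_append.1 hb with hb | hb
    · exact hg.overlap b hb
    · rw [List.mem_singleton.1 hb]; exact hπ
  · have := hg.delete_kx hc hr (hg.below hy) (hg.agree y hy).1
    exact ⟨this, this⟩
  · rcases hg.stage with h0 | ⟨h1, h2⟩
    · exact .inl (by rw [hq _ d.ne.symm, h0])
    · exact .inr ⟨fun j hj => by rw [hq j hj, h1 j hj], fun y hy => hg.delete_kx hc hr hy (h2 y hy)⟩

/-- The invariant of a gapped search survives the deletion of `k` by at most one write. If this
write is below all visited nodes, the search observes the deletion; otherwise it does not. -/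
theorem GapInv.delete_k {α : List (Event V Λ Ω n)} {L : LinOrder V n} {q q' : ℕ → Option V}
    {M m m' : Mem V Λ} {π π' : OpId n} {c c' : Call V Ω} {h h' : List (Access V Λ)}
    {r : DictResp V} (hg : d.GapInv α L q M m π c h) (hM : D.Reach M) (hq : Represents M q)
    (hd : DictRun (fun _ => none) (L.map fun a => a.2) q) (hc : c'.op = .delete d.k)
    (hr : D.Completes c' M h' m' r) (hs : dictSpec V q c'.op q' r)
    (hone : (D.update c' (viewOf h')).1.length ≤ 1) (hπ : ¬ Precedes α π' π) :
    d.GapInv α (L ++ [(π', c'.op, r)]) q' m' m' π c h := by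
  obtain ⟨L₀, L₁, q₀, N, qN, hL, hg⟩ := hg
  have hover : ∀ b ∈ L₁ ++ [(π', c'.op, r)], ¬ Precedes α b.1 π := by
    intro b hb
    rcases List.mem_append.1 hb with hb | hb
    · exact hg.overlap b hb
    · rw [List.mem_singleton.1 hb]; exact hπ
  have hlater : DictRun q₀ ((L₁ ++ [(π', c'.op, r)]).map fun a => a.2) q' := by
    rw [List.map_append]; exact dictRun_snoc hg.later hs
  have hsplit : L ++ [(π', c'.op, r)] = L₀ ++ (L₁ ++ [(π', c'.op, r)]) := by
    rw [hL, List.append_assoc]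
  have hk' : q' d.k = none := by
    rw [hc] at hs
    rcases hs with ⟨-, rfl, -⟩ | ⟨h0, rfl, -⟩
    · simp
    · exact h0
  cases hqk : q d.k with
  | none =>
    obtain ⟨rfl, -, -⟩ := delete_absent hM hq hc hqk hr
    exact ⟨L₀, _, q₀, N, qN, hsplit, { hg with
      later := hlater
      overlap := hover
      agree := fun y hy => ⟨(hg.agree y hy).1, (hg.agree y hy).1⟩
      stage := .inl hk' }⟩
  | some u =>
    have hm' := delete_mem hM hq hc hqk hr
    by_cases hy₀ : ∃ y, (∀ a ∈ viewOf h, Relation.TransGen (Edge N) a.1 y) ∧ InGraph M y ∧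
        Edge M y (.pair d.k u)
    swap
    · refine ⟨L₀, _, q₀, N, qN, hsplit, { hg with
        later := hlater
        overlap := hover
        agree := fun y hy => ?_
        stage := .inl hk' }⟩
      have : m' y = N y := by
        rw [(hm' y).2 fun h0 => hy₀ ⟨y, hy, h0.1, h0.2⟩]
        exact (hg.agree y hy).1
      exact ⟨this, this⟩
    -- the search observes the deletion: it runs as in the memory where `k` is deleted from `N`
    obtain ⟨y₀, hy₀, hy₀in, hy₀k⟩ := hy₀
    obtain ⟨hoff, hbelow⟩ := hg.stage.resolve_left (by rw [hqk]; simp)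
    obtain ⟨e₁, w, hv, hxin, hroot, hx, hw⟩ := hg.visited
    have hNk : qN d.k = some u := by rw [← hoff d.k d.ne.symm, hqk]
    obtain ⟨hN, N', r', hN'⟩ := completes_exists hg.reach c'
    obtain ⟨hN'rep, -⟩ := delete_effect hg.reach hg.rep hc hNk hN'
    have hmN := delete_mem hg.reach hg.rep hc hNk hN'
    -- nodes below `(kx, vx)` are in both graphs
    have hin : ∀ y, Relation.TransGen (Edge N) (.pair d.kx d.vx) y → InGraph N y ∧ InGraph M y := by
      intro y hy
      have hyN : InGraph N y := inGraph_trans hxin hy.to_reflTransGen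
      refine ⟨hyN, ?_⟩
      cases y with
      | root => exact .refl
      | pair j z =>
        refine (hq j z).2 ?_
        have hj := (hg.rep j z).1 hyN
        rw [hoff j, hj]
        rintro rfl
        rw [(hg.rep d.kx d.vx).1 hxin, Option.some.injEq] at hj
        subst hj
        exact D.acyclic N hg.reach _ hxin hy
    -- visited nodes are not predecessors of the deleted node
    have hvis : ∀ a ∈ viewOf h, ¬ Edge N a.1 (.pair d.k u) := by
      intro a ha he
      have ha' := ha
      rw [hv] at ha
      rcases List.mem_cons.1 ha with rfl | ha
      · exact hroot u he
      rcases List.mem_cons.1 ha with rfl | ha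
      · exact hx u he
      have haM : Edge M a.1 (.pair d.k u) := by rw [Edge, hbelow _ (hw a ha)]; exact he
      obtain ⟨-, -, hpred, -⟩ := delete_effect hM hq hc hqk hr
      have h1 := hpred _ (hin _ (hw a ha)).2 haM
      have h2 := hpred _ hy₀in hy₀k
      have h3 : a.1 = y₀ := by
        have hlen : ∀ l : List (Node V × Edges V Λ), l.length ≤ 1 → ∀ x ∈ l, ∀ y ∈ l, x = y := by
          intro l hl
          match l, hl with
          | [], _ => simp
          | [x], _ => simp
        exact congrArg Prod.fst (hlen _ hone _ h1 _ h2)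
      have h4 := hy₀ a ha'
      rw [h3] at h4
      exact D.acyclic N hg.reach _ (h3 ▸ (hin _ (hw a ha)).1) h4
    have hbM : M (.pair d.k u) = N (.pair d.k u) := by
      refine hbelow _ ((hg.below hy₀).tail ?_)
      rw [Edge, ← hbelow _ (hg.below hy₀)]
      exact hy₀k
    have hrun' : D.SeqRun c N' h N' := by
      obtain ⟨-, hnw, hform⟩ := find_no_write hg.gapped.1 hg.run
      have h1 := runs_of_agree (m' := N') hform (seqRun_iff.1 hg.run).1 fun a ha =>
        (hmN a.1).2 fun h0 => hvis a ha h0.2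
      refine seqRun_iff.2 ⟨h1, ?_⟩
      rw [hform, accMem_map_read]
    refine ⟨L ++ [(π', c'.op, r)], [], q', N', Function.update qN d.k none, by simp, {
      reach := .step hg.reach hN'
      rep := hN'rep
      run := hrun'
      gapped := hg.gapped
      start := by rw [List.map_append]; exact dictRun_snoc hd hs
      later := rfl
      key := by rw [hk', Function.update_self]
      overlap := by simp
      stored := fun j z hj => ?_
      agree := fun y hy => ?_
      stage := .inl hk' }⟩
    · by_cases hjk : j = d.k
      · subst hjk; simp at hj
      · rw [Function.update_of_ne hjk] at hj
        exact hg.stored j z hj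
    · have hy' : ∀ a ∈ viewOf h, Relation.TransGen (Edge N) a.1 y := fun a ha =>
        delete_path hg.reach hg.rep hc hN' (hy a ha)
      have hyx := hg.below hy'
      have heq : M y = N y := hbelow y hyx
      have : m' y = N' y := by
        by_cases he : Edge N y (.pair d.k u)
        · have heM : Edge M y (.pair d.k u) := by rw [Edge, heq]; exact he
          rw [(hm' y).1 ⟨(hin y hyx).2, heM⟩, (hmN y).1 ⟨(hin y hyx).1, he⟩, heq, hbM]
        · have heM : ¬ Edge M y (.pair d.k u) := by rw [Edge, heq]; exact he
          rw [(hm' y).2 fun h0 => heM h0.2, (hmN y).2 fun h0 => he h0.2, heq]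
      exact ⟨this, this⟩

end Detour

end GapInvariant

/-! ### LS-linearizability of the lock-based implementation -/

section BypassLSL

variable {V Λ Ω : Type} {n : ℕ} {D : SearchStructure V Λ Ω}

theorem invoked_of_current {I : Impl V Λ Ω n} {α : List (Event V Λ Ω n)} {C : I.Conf}
    (hα : I.Exec D.toSearchData α C) {p : Fin n} {c : Call V Ω} {h : List (Access V Λ)}
    (hp : C.phase p = .ready c h ∨ ∃ a, C.phase p = .pending c h a) :
    ⟨(p, C.cnt p), .inv c⟩ ∈ α := by
  have hl := (exec_local hα p).2.1
  have : (⟨(p, C.cnt p), .inv c⟩ : Event V Λ Ω n) ∈ opHist α (p, C.cnt p) := by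
    rcases hp with hp | ⟨a, hp⟩ <;> rw [hp] at hl <;> rw [hl.1] <;> simp [opEvents]
  exact (mem_opHist.1 this).1

namespace Detour

variable {d : Detour D}

theorem Gapped.not_light {c : Call V Ω} {h h' : List (Access V Λ)} (hg : d.Gapped c h) :
    ¬ d.Light c h' := by
  rintro (h0 | ⟨h0, -⟩) <;> rw [hg.1] at h0 <;> cases h0

/-- A light deletion of `k` has made no write, or has only one to make. -/
theorem light_writes {c : Call V Ω} {M m : Mem V Λ} {h : List (Access V Λ)} {a : Req V Λ}
    (hl : ∀ x e, D.next c h = .req (.write x e) → (D.update c (viewOf h)).1.length ≤ 1)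
    (hr : D.SeqRun c M h m) (ha : D.next c h = .req a) (e : Edges V Λ) :
    (D.update c (viewOf (h ++ [Impl.replyAccess e a]))).1.length ≤ 1 ∨
      numWrites (h ++ [Impl.replyAccess e a]) = 0 := by
  cases a with
  | write x e' =>
    have := hl x e' ha
    left
    simpa [viewOf, Impl.replyAccess] using this
  | read x =>
    right
    have h1 : numWrites (h ++ [Impl.replyAccess e (.read x)]) = numWrites h := by
      simp [numWrites, Impl.replyAccess]
    rw [h1]
    by_contra h0
    obtain ⟨h2, h3⟩ := (seqRun_shape hr).2.2.2.1 h0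
    rcases next_read_iff.1 ha with h4 | h4
    · exact h2 h4.1
    · rw [h3] at h4; cases h4.2

variable (d)

/-- The invariant of the lock-based implementation, for a linearization `L` of the operations that
have performed their last access, and the memory `M`, with dictionary `q`, after the last update.
The operation that holds the lock on the root runs alone from `M`; a gapped search has an invariant
of its own; other operations that have not performed their last access have not begun. -/
structure BypassInv (α : List (Event V Λ Ω n)) (C : BConf V Λ Ω n) (L : LinOrder V n)
    (M : Mem V Λ) (q : ℕ → Option V) : Prop where
  reach : D.Reach M
  rep : Represents M q
  lin : LinInv α L
  run : DictRun (fun _ => none) (L.map fun a => a.2) q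
  stored : Stored α q
  answered : ∀ π r, ⟨π, .res r⟩ ∈ α → ∃ o, (π, o, r) ∈ L
  done : ∀ p c h r, current C p = some (c, h) → D.next c h = .ret r →
    ((p, C.cnt p), c.op, r) ∈ L ∧ SeqPossible D.toSearchData c h
  fresh : ∀ p c h, current C p = some (c, h) → (∀ r, D.next c h ≠ .ret r) →
    ∀ b ∈ L, b.1 ≠ (p, C.cnt p)
  gap : ∀ p c h, current C p = some (c, h) → (∀ r, D.next c h ≠ .ret r) → d.Gapped c h →
    (C.loc p).1 true = true ∧ d.GapInv α L q M C.sh.1 (p, C.cnt p) c h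
  solo : ∀ p c h, current C p = some (c, h) → d.Wants c h false → (C.loc p).1 false = true →
    D.SeqRun c M h C.sh.1
  quiet : (∀ p c h, current C p = some (c, h) → d.Wants c h false → (C.loc p).1 false = false) →
    C.sh.1 = M

variable {d}

/-- Steps that change neither the memory nor the operations nor their accesses. -/
theorem BypassInv.stutter {α : List (Event V Λ Ω n)} {C C' : BConf V Λ Ω n} {L : LinOrder V n}
    {M : Mem V Λ} {q : ℕ → Option V} {e : Option (Event V Λ Ω n)} (hI : d.BypassInv α C L M q)
    (hC : d.LockInv C) (hC' : d.LockInv C') (hlin : LinInv (α ++ e.toList) L)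
    (he : ∀ e' ∈ e, ¬ e'.kind.IsInv ∧ ¬ e'.kind.IsEnd) (hsh : C'.sh.1 = C.sh.1)
    (hcnt : C'.cnt = C.cnt) (hcur : ∀ p, current C' p = current C p)
    (hmono : ∀ p c h i, current C p = some (c, h) → d.Wants c h i → (C.loc p).1 i = true →
      (C'.loc p).1 i = true) : d.BypassInv (α ++ e.toList) C' L M q := by
  refine {
    reach := hI.reach
    rep := hI.rep
    lin := hlin
    run := hI.run
    stored := hI.stored.append _
    answered := fun π r hr => ?_
    done := fun p c h r hp hr => by rw [hcnt]; exact hI.done p c h r (hcur p ▸ hp) hr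
    fresh := fun p c h hp hr => by rw [hcnt]; exact hI.fresh p c h (hcur p ▸ hp) hr
    gap := fun p c h hp hr hg => ?_
    solo := fun p c h hp hw hf => ?_
    quiet := fun hq => ?_ }
  · rcases List.mem_append.1 hr with hr | hr
    · exact hI.answered π r hr
    · exact absurd trivial (he _ (Option.mem_toList.1 hr)).2
  · rw [hcur] at hp
    obtain ⟨h1, h2⟩ := hI.gap p c h hp hr hg
    refine ⟨hmono p c h true hp ⟨hr, hg.not_light⟩ h1, ?_⟩
    rw [hsh, hcnt]
    cases e with
    | none => simpa using h2
    | some e => exact h2.event e fun _ => (he e rfl).1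
  · rw [hcur] at hp
    rw [hsh]
    by_cases hf' : (C.loc p).1 false = true
    · exact hI.solo p c h hp hw hf'
    · rw [(hC.order p c h hp hw (by simpa using hf')).1, hI.quiet fun p' c' h' hp' hw' => ?_]
      · exact .nil
      · by_contra h0
        have h1 := hmono p' c' h' false hp' hw' (by simpa using h0)
        rw [hC'.unique h1 hf] at h0
        exact hf' (by simpa using h0)
  · rw [hsh]
    refine hI.quiet fun p c h hp hw => ?_
    by_contra h0
    have h1 := hmono p c h false hp hw (by simpa using h0)
    rw [hq p c h (by rw [hcur]; exact hp) hw] at h1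
    cases h1

/-- An operation that has been invoked has performed no accesses and holds no locks. -/
theorem BypassInv.invoke {α : List (Event V Λ Ω n)} {C : BConf V Λ Ω n}
    {L : LinOrder V n} {M : Mem V Λ} {q : ℕ → Option V} {p : Fin n} {c : Call V Ω}
    (hα : (d.bypass n).toImpl.Exec D.toSearchData α C) (hI : d.BypassInv α C L M q)
    (hC : d.LockInv C) (hp : C.phase p = .idle)
    (hlin : LinInv (α ++ [⟨(p, C.cnt p), .inv c⟩]) L) :
    d.BypassInv (α ++ [⟨(p, C.cnt p), .inv c⟩])
      { C with
        loc := Function.update C.loc p ((C.loc p).1, none)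
        phase := Function.update C.phase p (.ready c []) } L M q := by
  have hcur : ∀ q, q ≠ p → current (V := V) (Λ := Λ) (Ω := Ω) (n := n) { C with
        loc := Function.update C.loc p ((C.loc p).1, none)
        phase := Function.update C.phase p (.ready c []) } q = current C q := fun q hq =>
    current_congr (by simp [hq]) (by simp [hq])
  have hcurp : current (V := V) (Λ := Λ) (Ω := Ω) (n := n) { C with
        loc := Function.update C.loc p ((C.loc p).1, none)
        phase := Function.update C.phase p (.ready c []) } p = some (c, []) :=
    current_ready (by simp)
  have hnext : D.next c [] = .req (.read .root) := next_read_iff.2 (.inl ⟨rfl, rfl⟩)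
  refine {
    reach := hI.reach
    rep := hI.rep
    lin := hlin
    run := hI.run
    stored := hI.stored.append _
    answered := fun π r hr => ?_
    done := fun p' c' h' r hp' hr => ?_
    fresh := fun p' c' h' hp' hr b hb => ?_
    gap := fun p' c' h' hp' hr hg => ?_
    solo := fun p' c' h' hp' hw hf => ?_
    quiet := fun hq => hI.quiet fun p' c' h' hp' hw => ?_ }
  · rcases List.mem_append.1 hr with hr | hr
    · exact hI.answered π r hr
    · simp at hr
  all_goals by_cases hpp : p' = p
  · subst hpp
    rw [hcurp] at hp'
    cases hp'
    rw [hnext] at hr; cases hr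
  · rw [hcur p' hpp] at hp'; exact hI.done p' c' h' r hp' hr
  · subst hpp
    intro h0
    have := hI.lin.occurs hb
    rw [h0, occurs_iff] at this
    have h1 := (exec_local hα p').2.1
    rw [hp] at h1
    exact this h1
  · rw [hcur p' hpp] at hp'; exact hI.fresh p' c' h' hp' hr b hb
  · subst hpp
    rw [hcurp] at hp'
    cases hp'
    obtain ⟨-, e₀, e₁, w, h0, -⟩ := hg
    cases h0
  · rw [hcur p' hpp] at hp'
    obtain ⟨h1, h2⟩ := hI.gap p' c' h' hp' hr hg
    refine ⟨by simpa [Function.update_of_ne hpp] using h1, h2.event _ fun h0 => ?_⟩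
    exact absurd (congrArg Prod.fst h0).symm hpp
  · subst hpp
    simp only [Function.update_self] at hf
    rw [hC.idle p' hp] at hf; cases hf
  · rw [hcur p' hpp] at hp'
    simp only [Function.update_of_ne hpp] at hf
    exact hI.solo p' c' h' hp' hw hf
  · subst hpp
    rw [current_idle hp] at hp'; cases hp'
  · have := hq p' c' h' (by rw [hcur p' hpp]; exact hp') hw
    simpa only [Function.update_of_ne hpp] using this

/-- An operation that responds has taken effect at its last access. -/
theorem BypassInv.respond {α : List (Event V Λ Ω n)} {C : BConf V Λ Ω n}
    {L : LinOrder V n} {M : Mem V Λ} {q : ℕ → Option V} {p : Fin n} {c : Call V Ω}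
    {h : List (Access V Λ)} {r : DictResp V} (hI : d.BypassInv α C L M q)
    (hp : C.phase p = .ready c h) (hr : D.next c h = .ret r)
    (hlin : LinInv (α ++ [⟨(p, C.cnt p), .res r⟩]) L) :
    d.BypassInv (α ++ [⟨(p, C.cnt p), .res r⟩])
      { C with
        loc := Function.update C.loc p ((C.loc p).1, none)
        phase := Function.update C.phase p .idle
        cnt := Function.update C.cnt p (C.cnt p + 1) } L M q := by
  have hcur : ∀ q, q ≠ p → current (V := V) (Λ := Λ) (Ω := Ω) (n := n) { C with
        loc := Function.update C.loc p ((C.loc p).1, none)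
        phase := Function.update C.phase p .idle
        cnt := Function.update C.cnt p (C.cnt p + 1) } q = current C q := fun q hq =>
    current_congr (by simp [hq]) (by simp [hq])
  have hcurp : current (V := V) (Λ := Λ) (Ω := Ω) (n := n) { C with
        loc := Function.update C.loc p ((C.loc p).1, none)
        phase := Function.update C.phase p .idle
        cnt := Function.update C.cnt p (C.cnt p + 1) } p = none :=
    current_idle (by simp)
  refine {
    reach := hI.reach
    rep := hI.rep
    lin := hlin
    run := hI.run
    stored := hI.stored.append _
    answered := fun π r hr => ?_
    done := fun p' c' h' r hp' hr => ?_
    fresh := fun p' c' h' hp' hr b hb => ?_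
    gap := fun p' c' h' hp' hr hg => ?_
    solo := fun p' c' h' hp' hw hf => ?_
    quiet := fun hq => hI.quiet fun p' c' h' hp' hw => ?_ }
  · rcases List.mem_append.1 hr with hr | hr
    · exact hI.answered π r hr
    · simp at hr
      obtain ⟨rfl, rfl⟩ := hr
      exact ⟨_, (hI.done p c h _ (current_ready hp) ‹_›).1⟩
  all_goals by_cases hpp : p' = p
  · subst hpp; rw [hcurp] at hp'; cases hp'
  · rw [hcur p' hpp] at hp'
    simp only [Function.update_of_ne hpp]
    exact hI.done p' c' h' r hp' hr
  · subst hpp; rw [hcurp] at hp'; cases hp'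
  · rw [hcur p' hpp] at hp'
    simp only [Function.update_of_ne hpp]
    exact hI.fresh p' c' h' hp' hr b hb
  · subst hpp; rw [hcurp] at hp'; cases hp'
  · rw [hcur p' hpp] at hp'
    obtain ⟨h1, h2⟩ := hI.gap p' c' h' hp' hr hg
    simp only [Function.update_of_ne hpp]
    exact ⟨h1, h2.event _ fun _ h0 => h0⟩
  · subst hpp; rw [hcurp] at hp'; cases hp'
  · rw [hcur p' hpp] at hp'
    simp only [Function.update_of_ne hpp] at hf
    exact hI.solo p' c' h' hp' hw hf
  · subst hpp
    rw [current_ready hp] at hp'; cases hp'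
    exact absurd hr (hw.1 r)
  · have := hq p' c' h' (by rw [hcur p' hpp]; exact hp') hw
    simpa only [Function.update_of_ne hpp] using this

/-- The accesses are the steps at which operations take effect. -/
theorem BypassInv.access {α : List (Event V Λ Ω n)} {C : BConf V Λ Ω n}
    {L : LinOrder V n} {M : Mem V Λ} {q : ℕ → Option V} {p : Fin n} {c : Call V Ω}
    {h : List (Access V Λ)} {a : Req V Λ} (hα : (d.bypass n).toImpl.Exec D.toSearchData α C)
    (hI : d.BypassInv α C L M q) (hC : d.LockInv C) (hp : C.phase p = .pending c h a)
    (hl : (C.loc p).2 = none) :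
    ∃ L' M' q', d.BypassInv α
      { C with
        sh := (a.mem C.sh.1, C.sh.2)
        loc := Function.update C.loc p ((C.loc p).1, some (a.val C.sh.1)) } L' M' q' := by
  obtain ⟨hset, hn⟩ := hC.pending p c h a hp
  set C' : BConf V Λ Ω n := { C with
        sh := (a.mem C.sh.1, C.sh.2)
        loc := Function.update C.loc p ((C.loc p).1, some (a.val C.sh.1)) } with hC'
  have hcur : ∀ q, q ≠ p → current C' q = current C q := fun q hq =>
    current_congr rfl (by simp [hC', hq])
  set h₁ := h ++ [Impl.replyAccess (a.val C.sh.1) a] with hh₁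
  have hcurp : current C' p = some (c, h₁) := current_pending' (by exact hp) (by simp [hC'])
  have hcurp₀ : current C p = some (c, h) := current_pending hp hl
  have hflag : ∀ q, (C'.loc q).1 = (C.loc q).1 := by
    intro q
    by_cases hq : q = p
    · subst hq; simp [hC']
    · simp [hC', hq]
  have hcnt : C'.cnt = C.cnt := rfl
  have hsh : C'.sh.1 = a.mem C.sh.1 := rfl
  have hnr : ∀ r, D.next c h ≠ .ret r := fun r hr => by rw [hn] at hr; cases hr
  have hinv := invoked_of_current hα (.inr ⟨a, hp⟩)
  have hnE : ¬ Ended α (p, C.cnt p) := fun h0 => lt_irrefl _ ((exec_ended_iff hα _).1 h0)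
  have hfresh := hI.fresh p c h hcurp₀ hnr
  by_cases hg : d.Gapped c h
  · -- a gapped search
    obtain ⟨hfl, hgi⟩ := hI.gap p c h hcurp₀ hnr hg
    obtain ⟨hmem, hgi'⟩ := hgi.search hn
    rw [hmem] at hsh
    have hsolo : ∀ p' c' h', current C' p' = some (c', h') → d.Wants c' h' false →
        (C'.loc p').1 false = true → D.SeqRun c' M h' C'.sh.1 := by
      intro p' c' h' hp' hw hf
      by_cases hpp : p' = p
      · subst hpp
        rw [hcurp] at hp'; cases hp'
        exact absurd (hg.append _) hw.2
      · rw [hcur p' hpp] at hp'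
        rw [hflag] at hf
        rw [hsh]
        exact hI.solo p' c' h' hp' hw hf
    have hquiet : (∀ p c h, current C' p = some (c, h) → d.Wants c h false →
        (C'.loc p).1 false = false) → C'.sh.1 = M := by
      intro hq
      rw [hsh]
      refine hI.quiet fun p' c' h' hp' hw => ?_
      by_cases hpp : p' = p
      · subst hpp
        rw [hcurp₀] at hp'; cases hp'
        exact absurd hg hw.2
      · rw [← hflag]
        exact hq p' c' h' (by rw [hcur p' hpp]; exact hp') hw
    have hnogap : ∀ p' c' h', p' ≠ p → current C' p' = some (c', h') →
        (∀ r, D.next c' h' ≠ .ret r) → ¬ d.Gapped c' h' := by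
      intro p' c' h' hpp hp' hr hg'
      rw [hcur p' hpp] at hp'
      exact hpp (hC.unique (hI.gap p' c' h' hp' hr hg').1 hfl)
    by_cases hret : ∃ r, D.next c h₁ = .ret r
    · -- at its last access the search takes effect, at the split of the linearization
      obtain ⟨r, hret⟩ := hret
      obtain ⟨L₀, L₁, rfl, hover, hrun⟩ := hgi'.result hret
      have hmemL : ∀ b, b ∈ L₀ ++ L₁ → b ∈ L₀ ++ ((p, C.cnt p), c.op, r) :: L₁ := by
        intro b hb
        rcases List.mem_append.1 hb with hb | hb
        · exact List.mem_append_left _ hb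
        · exact List.mem_append_right _ (List.mem_cons_of_mem _ hb)
      refine ⟨L₀ ++ ((p, C.cnt p), c.op, r) :: L₁, M, q, {
        reach := hI.reach
        rep := hI.rep
        lin := hI.lin.insert (a := ((p, C.cnt p), c.op, r)) hfresh ⟨c.coin, hinv⟩ hnE hover
        run := hrun
        stored := hI.stored
        answered := fun π r hr => (hI.answered π r hr).imp fun o ho => hmemL _ ho
        done := fun p' c' h' r' hp' hr => ?_
        fresh := fun p' c' h' hp' hr b hb => ?_
        gap := fun p' c' h' hp' hr hg' => ?_
        solo := hsolo
        quiet := hquiet }⟩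
      · by_cases hpp : p' = p
        · subst hpp
          rw [hcurp] at hp'; cases hp'
          rw [hret] at hr; cases hr
          exact ⟨by simp [hcnt], hgi'.possible.1⟩
        · rw [hcur p' hpp] at hp'
          obtain ⟨h1, h2⟩ := hI.done p' c' h' r' hp' hr
          exact ⟨hmemL _ h1, h2⟩
      · by_cases hpp : p' = p
        · subst hpp
          rw [hcurp] at hp'; cases hp'
          exact absurd hret (hr r)
        · rw [hcur p' hpp] at hp'
          rcases List.mem_append.1 hb with hb | hb
          · exact hI.fresh p' c' h' hp' hr b (List.mem_append_left _ hb)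
          rcases List.mem_cons.1 hb with rfl | hb
          · exact fun h0 => hpp (congrArg Prod.fst h0).symm
          · exact hI.fresh p' c' h' hp' hr b (List.mem_append_right _ hb)
      · by_cases hpp : p' = p
        · subst hpp
          rw [hcurp] at hp'; cases hp'
          exact absurd hret (hr r)
        · exact absurd hg' (hnogap p' c' h' hpp hp' hr)
    · -- it goes on
      refine ⟨L, M, q, {
        reach := hI.reach
        rep := hI.rep
        lin := hI.lin
        run := hI.run
        stored := hI.stored
        answered := hI.answered
        done := fun p' c' h' r' hp' hr => ?_
        fresh := fun p' c' h' hp' hr b hb => ?_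
        gap := fun p' c' h' hp' hr hg' => ?_
        solo := hsolo
        quiet := hquiet }⟩
      · by_cases hpp : p' = p
        · subst hpp
          rw [hcurp] at hp'; cases hp'
          exact absurd ⟨r', hr⟩ hret
        · rw [hcur p' hpp] at hp'
          exact hI.done p' c' h' r' hp' hr
      · by_cases hpp : p' = p
        · subst hpp; exact hfresh b hb
        · rw [hcur p' hpp] at hp'
          exact hI.fresh p' c' h' hp' hr b hb
      · by_cases hpp : p' = p
        · subst hpp
          rw [hcurp] at hp'; cases hp'
          rw [hflag, hsh]
          exact ⟨hfl, hgi'⟩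
        · exact absurd hg' (hnogap p' c' h' hpp hp' hr)
  -- the operation that holds the lock on the root
  have hw : d.Wants c h false := ⟨hnr, hg⟩
  have hfl := (hset false).2 hw
  have hrun := hI.solo p c h hcurp₀ hw hfl
  have hrun₁ : D.SeqRun c M h₁ C'.sh.1 := seqRun_snoc hrun hn
  have hnosolo : ∀ p' c' h', p' ≠ p → (C'.loc p').1 false = true → D.SeqRun c' M h' C'.sh.1 := by
    intro p' c' h' hpp hf
    rw [hflag] at hf
    exact absurd (hC.unique hf hfl) hpp
  -- another operation can be a gapped search only during a light deletion
  have hlight : ∀ p' c' h', p' ≠ p → current C' p' = some (c', h') →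
      (∀ r, D.next c' h' ≠ .ret r) → d.Gapped c' h' →
      (C'.loc p').1 true = true ∧ d.GapInv α L q M C.sh.1 (p', C.cnt p') c' h' ∧ d.Light c h := by
    intro p' c' h' hpp hp' hr hg'
    rw [hcur p' hpp] at hp'
    obtain ⟨h1, h2⟩ := hI.gap p' c' h' hp' hr hg'
    refine ⟨by rw [hflag]; exact h1, h2, ?_⟩
    by_contra h0
    exact hpp (hC.unique h1 ((hset true).2 ⟨hnr, h0⟩))
  by_cases hret : ∃ r, D.next c h₁ = .ret r
  · -- at its last access the operation takes effect, at the end of the linearization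
    obtain ⟨r, hret⟩ := hret
    have hcomp : D.Completes c M h₁ C'.sh.1 r := ⟨hrun₁, hret⟩
    obtain ⟨q', hspec, hrep⟩ := completes_spec hI.reach hI.rep hcomp
    refine ⟨L ++ [((p, C.cnt p), c.op, r)], C'.sh.1, q', {
      reach := .step hI.reach hcomp
      rep := hrep
      lin := LinInv.insert (A := L) (B := []) (a := ((p, C.cnt p), c.op, r)) (by simpa using hI.lin)
        (by simpa using hfresh) ⟨c.coin, hinv⟩ hnE (by simp)
      run := by rw [List.map_append]; exact dictRun_snoc hI.run hspec
      stored := hI.stored.spec hspec hinv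
      answered := fun π r hr => (hI.answered π r hr).imp fun o ho => List.mem_append_left _ ho
      done := fun p' c' h' r' hp' hr => ?_
      fresh := fun p' c' h' hp' hr b hb => ?_
      gap := fun p' c' h' hp' hr hg' => ?_
      solo := fun p' c' h' hp' hw' hf => ?_
      quiet := fun _ => rfl }⟩
    · by_cases hpp : p' = p
      · subst hpp
        rw [hcurp] at hp'; cases hp'
        rw [hret] at hr; cases hr
        exact ⟨by simp [hcnt], _, _, hI.reach, hrun₁⟩
      · rw [hcur p' hpp] at hp'
        obtain ⟨h1, h2⟩ := hI.done p' c' h' r' hp' hr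
        exact ⟨List.mem_append_left _ h1, h2⟩
    · by_cases hpp : p' = p
      · subst hpp
        rw [hcurp] at hp'; cases hp'
        exact absurd hret (hr r)
      · rw [hcur p' hpp] at hp'
        rcases List.mem_append.1 hb with hb | hb
        · exact hI.fresh p' c' h' hp' hr b hb
        · rw [List.mem_singleton.1 hb]
          exact fun h0 => hpp (congrArg Prod.fst h0).symm
    · by_cases hpp : p' = p
      · subst hpp
        rw [hcurp] at hp'; cases hp'
        exact absurd hret (hr r)
      · obtain ⟨h1, h2, h3⟩ := hlight p' c' h' hpp hp' hr hg'
        refine ⟨h1, ?_⟩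
        have hprec : ¬ Precedes α (p, C.cnt p) (p', C.cnt p') := fun h0 => hnE (precedes_ended h0).1
        rcases h3 with h3 | ⟨h3, h4⟩
        · exact h2.delete_kx h3 hrun₁ hspec hprec
        · refine h2.delete_k hI.reach hI.rep hI.run h3 hcomp hspec ?_ hprec
          rcases light_writes h4 hrun hn (a.val C.sh.1) with h5 | h5
          · exact h5
          · have := (next_ret_iff.1 hret).2.2.1
            rw [h5] at this
            exact this.trans zero_le_one
    · by_cases hpp : p' = p
      · subst hpp
        rw [hcurp] at hp'; cases hp'
        exact absurd hret (hw'.1 r)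
      · rw [hflag] at hf
        exact absurd (hC.unique hf hfl) hpp
  · -- it goes on
    refine ⟨L, M, q, {
      reach := hI.reach
      rep := hI.rep
      lin := hI.lin
      run := hI.run
      stored := hI.stored
      answered := hI.answered
      done := fun p' c' h' r' hp' hr => ?_
      fresh := fun p' c' h' hp' hr b hb => ?_
      gap := fun p' c' h' hp' hr hg' => ?_
      solo := fun p' c' h' hp' hw' hf => ?_
      quiet := fun hq => ?_ }⟩
    · by_cases hpp : p' = p
      · subst hpp
        rw [hcurp] at hp'; cases hp'
        exact absurd ⟨r', hr⟩ hret
      · rw [hcur p' hpp] at hp'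
        exact hI.done p' c' h' r' hp' hr
    · by_cases hpp : p' = p
      · subst hpp; exact hfresh b hb
      · rw [hcur p' hpp] at hp'
        exact hI.fresh p' c' h' hp' hr b hb
    · by_cases hpp : p' = p
      · subst hpp
        rw [hcurp] at hp'; cases hp'
        -- by this access the search becomes gapped
        have hM : C'.sh.1 = M := (find_no_write hg'.1 hrun₁).1
        rw [hM] at hrun₁ ⊢
        rw [hflag]
        exact ⟨(hset true).2 ⟨hnr, hg'.not_light⟩,
          .begin hI.reach hI.rep hrun₁ hg' hI.run hI.stored⟩
      · obtain ⟨h1, h2, h3⟩ := hlight p' c' h' hpp hp' hr hg'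
        refine ⟨h1, h2.light_run hrun₁ ?_⟩
        rcases h3 with h3 | ⟨h3, h4⟩
        · exact .inl h3
        · -- a light deletion of `k` that goes on has not written, as its first write is its last
          right
          obtain ⟨-, h5, -, h6, -⟩ := seqRun_shape hrun₁
          by_cases h7 : numWrites h₁ = 0
          · rw [h5, h7]; rfl
          · refine absurd ⟨_, next_ret_iff.2 ⟨(h6 h7).1, (h6 h7).2, ?_, rfl⟩⟩ hret
            rcases light_writes h4 hrun hn (a.val C.sh.1) with h8 | h8
            · exact h8.trans (Nat.one_le_iff_ne_zero.2 h7)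
            · exact absurd h8 h7
    · by_cases hpp : p' = p
      · subst hpp
        rw [hcurp] at hp'; cases hp'
        exact hrun₁
      · exact hnosolo p' c' h' hpp hf
    · by_cases hg' : d.Gapped c h₁
      · exact (find_no_write hg'.1 hrun₁).1
      · have := hq p c h₁ hcurp ⟨fun r hr => hret ⟨r, hr⟩, hg'⟩
        rw [hflag, hfl] at this
        cases this

theorem BypassInv.move {α : List (Event V Λ Ω n)} {C C' : BConf V Λ Ω n} {L : LinOrder V n}
    {M : Mem V Λ} {q : ℕ → Option V} {p : Fin n} {e : Option (Event V Λ Ω n)}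
    (hα : (d.bypass n).toImpl.Exec D.toSearchData α C) (hI : d.BypassInv α C L M q)
    (hC : d.LockInv C) (hC' : d.LockInv C') (hm : d.Move C p e C')
    (hlin : ∀ e', e = some e' → e'.kind ≠ .abort → LinInv (α ++ [e']) L) :
    ∃ L' M' q', d.BypassInv (α ++ e.toList) C' L' M' q' := by
  cases hm with
  | invoke c hp => exact ⟨L, M, q, hI.invoke hα hC hp (hlin _ rfl (by simp))⟩
  | respond c h r hp _ hn => exact ⟨L, M, q, hI.respond hp hn (hlin _ rfl (by simp))⟩
  | access c h a hp hl =>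
    obtain ⟨L', M', q', hI'⟩ := hI.access hα hC hp hl
    exact ⟨L', M', q', by simpa using hI'⟩
  | lock c h i hp h1 h2 h3 h4 =>
    refine ⟨L, M, q, hI.stutter (e := none) hC hC' (by simpa using hI.lin) (by simp) rfl rfl
      (fun q => ?_) fun q c' h' j hq hw hf => ?_⟩ <;> by_cases hqp : q = p
    · subst hqp
      exact (current_ready (by exact hp)).trans (current_ready hp).symm
    · exact current_congr rfl (by simp [hqp])
    · subst hqp
      by_cases hij : j = i <;> simp [hij, hf]
    · simpa [hqp] using hf
  | unlock c h i hp h1 h2 =>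
    refine ⟨L, M, q, hI.stutter (e := none) hC hC' (by simpa using hI.lin) (by simp) rfl rfl
      (fun q => ?_) fun q c' h' j hq hw hf => ?_⟩ <;> by_cases hqp : q = p
    · subst hqp
      exact (current_ready (by exact hp)).trans (current_ready hp).symm
    · exact current_congr rfl (by simp [hqp])
    · subst hqp
      rw [current_ready (by exact hp)] at hq
      cases hq
      by_cases hij : j = i
      · subst hij; exact absurd hw h2
      · simpa [hij] using hf
    · simpa [hqp] using hf
  | request c h a hp hs hn =>
    refine ⟨L, M, q, hI.stutter (e := some _) hC hC'
      (hlin _ rfl (by cases a <;> simp [Impl.reqKind]))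
      ?_ rfl rfl (fun q => ?_) fun q c' h' j hq hw hf => ?_⟩
    · rintro e' ⟨⟩
      exact ⟨reqKind_not_inv a, reqKind_not_end a⟩
    · by_cases hqp : q = p
      · subst hqp
        rw [current_ready hp, current_pending (c := c) (h := h) (a := a) (by simp) (by simp)]
      · exact current_congr (by simp [hqp]) (by simp [hqp])
    · by_cases hqp : q = p
      · subst hqp; simpa using hf
      · simpa [hqp] using hf
  | reply c h a e hp hl =>
    refine ⟨L, M, q, hI.stutter (e := some _) hC hC'
      (hlin _ rfl (by cases a <;> simp [Impl.replyKind]))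
      ?_ rfl rfl (fun q => ?_) fun q c' h' j hq hw hf => ?_⟩
    · rintro e' ⟨⟩
      cases a <;> exact ⟨fun h => h, fun h => h⟩
    · by_cases hqp : q = p
      · subst hqp
        rw [current_pending' hp hl,
          current_ready (c := c) (h := h ++ [Impl.replyAccess e a]) (by simp)]
      · exact current_congr (by simp [hqp]) (by simp [hqp])
    · by_cases hqp : q = p
      · subst hqp; simpa using hf
      · simpa [hqp] using hf

theorem bypassInv_exec {α : List (Event V Λ Ω n)} {C : (d.bypass n).toImpl.Conf}
    (hα : (d.bypass n).toImpl.Exec D.toSearchData α C) : ∃ L M q, d.BypassInv α C L M q := by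
  induction hα with
  | nil =>
    refine ⟨[], fun _ => ∅, fun _ => none, .init, represents_empty,
      ⟨by simp, by simp, by simp, by simp⟩, rfl, fun _ _ h => (by cases h),
      fun _ _ h => (by cases h), fun _ _ _ _ h => (by cases h), fun _ _ _ h => (by cases h),
      fun _ _ _ h => (by cases h), fun _ _ _ h => (by cases h), fun _ => rfl⟩
  | @step α C C' p e hα hs ih =>
    obtain ⟨L, M, q, hI⟩ := ih
    have hα' := Impl.Exec.step hα hs
    refine hI.move hα (lockInv_exec hα) (lockInv_exec hα') (d.step_move hs) ?_
    rintro e' rfl hk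
    exact hI.lin.event hα' fun h0 => absurd h0 hk

/-- An operation that has not performed its last access runs as if alone, and has visited each
stored pair at most once. -/
theorem BypassInv.possible {α : List (Event V Λ Ω n)} {C : BConf V Λ Ω n} {L : LinOrder V n}
    {M : Mem V Λ} {q : ℕ → Option V} (hI : d.BypassInv α C L M q) (hC : d.LockInv C) {p : Fin n}
    {c : Call V Ω} {h : List (Access V Λ)} (hp : current C p = some (c, h)) :
    SeqPossible D.toSearchData c h ∧ ((∀ r, D.next c h ≠ .ret r) →
      (viewOf h).length ≤ 1 + (insertedNodes α).length) := by
  by_cases hr : ∃ r, D.next c h = .ret r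
  · obtain ⟨r, hr⟩ := hr
    exact ⟨(hI.done p c h r hp hr).2, fun h0 => absurd hr (h0 r)⟩
  have hr' : ∀ r, D.next c h ≠ .ret r := fun r h0 => hr ⟨r, h0⟩
  by_cases hg : d.Gapped c h
  · obtain ⟨h1, h2⟩ := (hI.gap p c h hp hr' hg).2.possible
    exact ⟨h1, fun _ => h2⟩
  by_cases hf : (C.loc p).1 false = true
  · have h1 := hI.solo p c h hp ⟨hr', hg⟩ hf
    exact ⟨⟨_, _, hI.reach, h1⟩, fun _ => hI.stored.view_length hI.reach hI.rep h1⟩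
  · rw [(hC.order p c h hp ⟨hr', hg⟩ (by simpa using hf)).1]
    exact ⟨⟨_, _, hI.reach, .nil⟩, fun _ => by simp [viewOf]⟩

theorem bypass_no_abort {α : List (Event V Λ Ω n)} {C : (d.bypass n).toImpl.Conf}
    (hα : (d.bypass n).toImpl.Exec D.toSearchData α C) : ∀ e ∈ α, e.kind ≠ .abort := by
  induction hα with
  | nil => simp
  | @step α C C' p e hα hs ih =>
    intro e' he'
    rcases List.mem_append.1 he' with he' | he'
    · exact ih e' he'
    have hm := d.step_move hs
    cases hm <;> simp at he' <;> subst he' <;> try simp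
    · rename_i a _ _ _; cases a <;> simp [Impl.reqKind]
    · rename_i a _ _ _; cases a <;> simp [Impl.replyKind]

theorem bypass_isLSL : (d.bypass n).toImpl.IsLSL D.toSearchData := by
  rintro H ⟨α, C, hα, rfl⟩
  constructor
  · refine locallySerializable_of_phases (fun α C hα p c h hp => ?_) hα
    obtain ⟨L, M, q, hI⟩ := bypassInv_exec hα
    have hC := lockInv_exec hα
    obtain ⟨h', hh, hcur⟩ : ∃ h', h <+: h' ∧ current (C : BConf V Λ Ω n) p = some (c, h') := by
      rcases hp with hp | ⟨a, hp⟩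
      · exact ⟨h, List.prefix_rfl, current_ready hp⟩
      · cases hl : (C.loc p).2 with
        | none => exact ⟨h, List.prefix_rfl, current_pending hp hl⟩
        | some e => exact ⟨_, List.prefix_append _ _, current_pending' hp hl⟩
    obtain ⟨m, m', hm, hr⟩ := (hI.possible hC hcur).1
    exact ⟨m, _, hm, seqRun_iff.2 ⟨runs_prefix hh (seqRun_iff.1 hr).1, rfl⟩⟩
  · obtain ⟨L, M, q, hI⟩ := bypassInv_exec hα
    exact linearizable_of_linInv hI.lin hI.answered hI.run

end Detour

end BypassLSL

/-! ### Deadlock-freedom of the lock-based implementation -/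

section Progress

variable {V Λ Ω : Type} {n : ℕ} {D : SearchStructure V Λ Ω}

/-- A measure that decreases with each action, and changes with no other step, bounds the number
of actions. -/
theorem eventually_not_of_decreasing {β : Type} {r : β → β → Prop} (hr : WellFounded r)
    {μ : ℕ → β} {A : ℕ → Prop} {T : ℕ} (hA : ∀ s, T ≤ s → A s → r (μ (s + 1)) (μ s))
    (hn : ∀ s, T ≤ s → ¬ A s → μ (s + 1) = μ s) : ∀ᶠ s in Filter.atTop, ¬ A s := by
  suffices ∀ b s, T ≤ s → μ s = b → ∀ᶠ s in Filter.atTop, ¬ A s from this _ T le_rfl rfl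
  intro b
  induction b using hr.induction with
  | _ b ih =>
    intro s hs hb
    by_cases h0 : ∃ k, A (s + k)
    · have hconst : ∀ k, k ≤ Nat.find h0 → μ (s + k) = b := by
        intro k hk
        induction k with
        | zero => exact hb
        | succ k ihk =>
          rw [← ihk (Nat.le_of_succ_le hk)]
          exact hn (s + k) (by omega) (Nat.find_min h0 hk)
      have h1 := hA (s + Nat.find h0) (by omega) (Nat.find_spec h0)
      rw [hconst _ le_rfl] at h1
      exact ih _ h1 (s + Nat.find h0 + 1) (by omega) rfl
    · push Not at h0
      filter_upwards [Filter.eventually_ge_atTop s] with s' hs'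
      obtain ⟨k, rfl⟩ := Nat.exists_eq_add_of_le hs'
      exact h0 k

/-- The events of an infinite execution before time `t`. -/
def eventsBefore (act : ℕ → Option (Fin n × Option (Event V Λ Ω n))) (t : ℕ) :
    List (Event V Λ Ω n) :=
  (List.range t).flatMap fun s => match act s with
    | none => []
    | some (_, e) => e.toList

theorem eventsBefore_succ (act : ℕ → Option (Fin n × Option (Event V Λ Ω n))) (t : ℕ) :
    eventsBefore act (t + 1) = eventsBefore act t ++ match act t with
      | none => []
      | some (_, e) => e.toList := by
  simp [eventsBefore, List.range_succ]

theorem isRun_exec {L : LockProgram V Λ Ω n} {C : ℕ → L.toImpl.Conf}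
    {act : ℕ → Option (Fin n × Option (Event V Λ Ω n))} (hr : L.IsRun D.toSearchData C act)
    (t : ℕ) : L.toImpl.Exec D.toSearchData (eventsBefore act t) (C t) := by
  induction t with
  | zero => rw [hr.1]; exact .nil
  | succ t ih =>
    rw [eventsBefore_succ]
    have := hr.2 t
    cases ha : act t with
    | none =>
      rw [ha] at this
      simp only at this
      rw [this]
      simpa using ih
    | some a =>
      rw [ha] at this
      exact .step ih this

namespace Detour

variable (d : Detour D)

/-- The steps that a process can take before its operation reads, writes or responds again. -/
noncomputable def slack (C : BConf V Λ Ω n) (p : Fin n) : ℕ :=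
  match C.phase p, (C.loc p).2 with
  | .idle, _ => 0
  | .ready c h, _ => 1 + (if (C.loc p).1 false = true ↔ d.Wants c h false then 0 else 1) +
      if (C.loc p).1 true = true ↔ d.Wants c h true then 0 else 1
  | .pending _ _ _, none => 0
  | .pending _ _ _, some _ => 4

/-- A bound, in the lexicographic order, on the steps left to the operation of a process that
visits fewer than `B` nodes: the reads, the writes, and the steps up to the next access. -/
noncomputable def stepsLeft (B : ℕ) (C : BConf V Λ Ω n) (p : Fin n) : ℕ × ℕ × ℕ :=
  match current C p with
  | none => (0, 0, 0)
  | some (c, h) => (B - (viewOf h).length, (D.update c (viewOf h)).1.length - numWrites h,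
      d.slack C p)

variable {d}

theorem stepsLeft_congr {C C' : BConf V Λ Ω n} {p : Fin n} (B : ℕ) (h : C'.phase p = C.phase p)
    (h' : C'.loc p = C.loc p) : d.stepsLeft B C' p = d.stepsLeft B C p := by
  simp only [stepsLeft, current_congr h h', slack, h, h']

theorem stepsLeft_of_current {C C' : BConf V Λ Ω n} {p : Fin n} (B : ℕ) {c : Call V Ω}
    {h : List (Access V Λ)} (hc : current C p = some (c, h)) (hc' : current C' p = some (c, h))
    (hs : d.slack C' p < d.slack C p) :
    Prod.Lex (· < ·) (Prod.Lex (· < ·) (· < ·)) (d.stepsLeft B C' p) (d.stepsLeft B C p) := by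
  simp only [stepsLeft, hc, hc']
  exact .right _ (.right _ hs)

theorem stepsLeft_move {C C' : BConf V Λ Ω n} {p : Fin n} {e : Option (Event V Λ Ω n)} {B : ℕ}
    (hC : d.LockInv C) (hm : d.Move C p e C') (he : ∀ e' ∈ e, ¬ e'.kind.IsInv ∧ ¬ e'.kind.IsEnd)
    (hB : ∀ c h, current C p = some (c, h) → (∀ r, D.next c h ≠ .ret r) →
      (viewOf h).length < B) :
    Prod.Lex (· < ·) (Prod.Lex (· < ·) (· < ·)) (d.stepsLeft B C' p) (d.stepsLeft B C p) := by
  cases hm with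
  | invoke c hp => exact absurd trivial (he _ rfl).1
  | respond c h r hp hs hn => exact absurd trivial (he _ rfl).2
  | lock c h i hp h1 h2 h3 h4 =>
    refine stepsLeft_of_current B (current_ready hp) (current_ready (by exact hp)) ?_
    cases i <;> simp [slack, hp, h1, h2]
  | unlock c h i hp h1 h2 =>
    refine stepsLeft_of_current B (current_ready hp) (current_ready (by exact hp)) ?_
    cases i <;> simp [slack, hp, h1, h2]
  | request c h a hp hs hn =>
    refine stepsLeft_of_current B (current_ready hp)
      (current_pending (c := c) (h := h) (a := a) (by simp) (by simp)) ?_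
    simp [slack, hp]
  | reply c h a e hp hl =>
    refine stepsLeft_of_current B (current_pending' hp hl)
      (current_ready (c := c) (h := h ++ [Impl.replyAccess e a]) (by simp)) ?_
    simp only [slack, hp, hl, Function.update_self]
    split_ifs <;> omega
  | access c h a hp hl =>
    have hc := current_pending hp hl
    obtain ⟨-, hn⟩ := hC.pending p c h a hp
    have hv := hB c h hc fun r hr => by rw [hn] at hr; cases hr
    simp only [stepsLeft, hc]
    rw [current_pending' (c := c) (h := h) (a := a) (e := a.val C.sh.1) (by exact hp) (by simp)]
    cases a with
    | read x =>
      refine .left _ _ ?_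
      simp [viewOf, Impl.replyAccess] at hv ⊢
      omega
    | write x e =>
      have h1 := (next_write_iff.1 hn).2.2
      have h2 := (List.getElem?_eq_some_iff.1 h1).1
      have hv1 : viewOf (h ++ [Impl.replyAccess ((Req.write x e).val C.sh.1) (.write x e)]) =
          viewOf h := by simp [viewOf, Impl.replyAccess]
      have hv2 : numWrites (h ++ [Impl.replyAccess ((Req.write x e).val C.sh.1) (.write x e)]) =
          numWrites h + 1 := by simp [numWrites, Impl.replyAccess]
      simp only [hv1, hv2]
      exact .right _ (.left _ _ (by omega))

/-- A process that cannot take a step waits for a lock that another process holds. -/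
theorem waits_of_blocked {C : (d.bypass n).toImpl.Conf} (hC : d.LockInv C) {p : Fin n}
    (hp : C.phase p ≠ .idle) (hb : ¬ ∃ e C', Impl.Step D.toSearchData C p e C') :
    ∃ c h i q, current (C : BConf V Λ Ω n) p = some (c, h) ∧ d.Wants c h i ∧
      (C.loc p).1 i = false ∧ (C.loc q).1 i = true := by
  cases hph : C.phase p with
  | idle => exact absurd hph hp
  | pending c h a =>
    obtain ⟨h1, h2⟩ := d.exists_step_of_pending hph
    cases hl : (C.loc p).2 with
    | none => exact absurd ⟨_, _, h1 hl⟩ hb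
    | some e => exact absurd ⟨_, _, h2 e hl⟩ hb
  | ready c h =>
    by_cases hs : d.Settled (C.loc p).1 c h
    · obtain ⟨h1, h2⟩ := d.exists_step_of_settled hph hs
      cases hn : D.next c h with
      | req a => exact absurd ⟨_, _, h1 a hn⟩ hb
      | ret r => exact absurd ⟨_, _, h2 r hn⟩ hb
    · obtain ⟨i, t, b, h1, h2, h3, h4⟩ := d.exists_step_of_unsettled hph hs
      cases t with
      | some t => exact absurd ⟨_, _, h4 t.1 t.2 rfl⟩ hb
      | none =>
        obtain ⟨rfl, q, -, hq⟩ := h3 rfl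
        exact ⟨c, h, i, q, current_ready hph, h1.1 rfl, by simpa using h2, hC.holds_iff.1 hq⟩

/-- If no operation returned any more, then finally no operation would be invoked and, as only
finitely many stored pairs can be visited, no process would take a step: all pending operations
would wait for locks. But as the lock on the root is acquired first, a process that holds the lock
on `(kx, vx)` waits for no lock; then nobody waits for this lock, and the process that holds the
lock on the root does not wait either. -/
theorem bypass_deadlockFree : (d.bypass n).DeadlockFree D.toSearchData := by
  intro C act hrun hfair _ t ⟨p₀, hp₀⟩
  by_contra hno
  push Not at hno
  have hexec := isRun_exec hrun
  have hinv := fun s => lockInv_exec (hexec s)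
  have hnone : ∀ s, act s = none → C (s + 1) = C s := by
    intro s hs
    have := hrun.2 s
    rw [hs] at this
    exact this
  have hstep : ∀ s p e, act s = some (p, e) → Impl.Step D.toSearchData (C s) p e (C (s + 1)) := by
    intro s p e hs
    have := hrun.2 s
    rw [hs] at this
    exact this
  have hother : ∀ s p, ¬ LockProgram.Acts act p s →
      (C (s + 1)).phase p = (C s).phase p ∧ (C (s + 1)).loc p = (C s).loc p := by
    intro s p hp
    cases ha : act s with
    | none => rw [hnone s ha]; exact ⟨rfl, rfl⟩
    | some a =>
      obtain ⟨q, e⟩ := a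
      have hqp : p ≠ q := by rintro rfl; exact hp ⟨e, ha⟩
      have := (step_local (hstep s q e ha)).1 p hqp
      exact ⟨this.1, this.2.2⟩
  have hnoabort : ∀ s p e, act s = some (p, some e) → e.kind ≠ .abort := by
    intro s p e hs
    refine bypass_no_abort (hexec (s + 1)) e ?_
    rw [eventsBefore_succ, hs]
    simp
  have hnoend : ∀ s, t ≤ s → ∀ p e, act s = some (p, some e) → ¬ e.kind.IsEnd := by
    intro s hs p e ha
    obtain ⟨π, k⟩ := e
    cases k with
    | res r => exact absurd ha (hno s hs p π r)
    | abort => exact absurd rfl (hnoabort s p _ ha)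
    | _ => exact fun h => h
  -- operations that are pending stay pending
  have hstay : ∀ p s s', t ≤ s → s ≤ s' → (C s).phase p ≠ .idle → (C s').phase p ≠ .idle := by
    intro p s s' hs hss hp
    induction s', hss using Nat.le_induction with
    | base => exact hp
    | succ s' hs' ih =>
      by_cases hact : LockProgram.Acts act p s'
      · obtain ⟨e, ha⟩ := hact
        intro hid
        have hm := d.step_move (hstep s' p e ha)
        generalize C (s' + 1) = C' at hm hid
        cases hm with
        | respond c h r hp hs hn => exact hno s' (by omega) _ _ _ ha
        | lock c h i hp | unlock c h i hp | access c h a hp => exact ih hid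
        | _ => simp at hid
      · rw [(hother s' p hact).1]; exact ih
  -- finally no process invokes an operation
  have hinvoke : ∀ᶠ s in Filter.atTop, ∀ p e, act s = some (p, some e) → ¬ e.kind.IsInv := by
    rw [Filter.eventually_all]
    intro p
    by_cases h0 : ∃ s, t ≤ s ∧ (C s).phase p ≠ .idle
    · obtain ⟨s, hs, hp⟩ := h0
      filter_upwards [Filter.eventually_ge_atTop s] with s' hs' e ha hi
      exact hstay p s s' hs hs' hp ((step_inv (hstep s' p _ ha)).1 hi)
    · push Not at h0
      filter_upwards [Filter.eventually_ge_atTop t] with s' hs' e ha hi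
      have h1 := h0 (s' + 1) (by omega)
      have hm := d.step_move (hstep s' p _ ha)
      generalize C (s' + 1) = C' at hm h1
      cases hm with
      | invoke c hp => simp at h1
      | respond c h r hp hs hn => exact hi
      | request c h a hp hs hn => simp at h1
      | reply c h a e hp hs => simp at h1
  obtain ⟨T, hT⟩ := Filter.eventually_atTop.1 (hinvoke.and (Filter.eventually_ge_atTop t))
  -- hence no new nodes are inserted
  have hnodes : ∀ s, T ≤ s → insertedNodes (eventsBefore act s) =
      insertedNodes (eventsBefore act T) := by
    intro s hs
    induction s, hs using Nat.le_induction with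
    | base => rfl
    | succ s hs ih =>
      rw [eventsBefore_succ, insertedNodes_append, ih]
      cases ha : act s with
      | none => simp [insertedNodes]
      | some a =>
        obtain ⟨q, e⟩ := a
        cases e with
        | none => simp [insertedNodes]
        | some e =>
          have := (hT s hs).1 q e ha
          obtain ⟨π, k⟩ := e
          cases k <;> simp [insertedNodes]
          exact absurd trivial this
  -- and no process takes infinitely many steps
  have hquiet : ∀ᶠ s in Filter.atTop, ∀ p, ¬ LockProgram.Acts act p s := by
    rw [Filter.eventually_all]
    intro p
    refine eventually_not_of_decreasing (T := T)
      (μ := fun s => d.stepsLeft (2 + (insertedNodes (eventsBefore act T)).length) (C s) p)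
      (wellFounded_lt.prod_lex (wellFounded_lt.prod_lex wellFounded_lt)) ?_ ?_
    · rintro s hs ⟨e, ha⟩
      refine stepsLeft_move (hinv s) (d.step_move (hstep s p e ha)) ?_ ?_
      · rintro e' ⟨⟩
        exact ⟨(hT s hs).1 p _ ha, hnoend s (hT s hs).2 p _ ha⟩
      · intro c h hc hr
        obtain ⟨L, M, q, hI⟩ := bypassInv_exec (hexec s)
        have := (hI.possible (hinv s) hc).2 hr
        rw [hnodes s hs] at this
        omega
    · intro s _ hs
      exact stepsLeft_congr _ (hother s p hs).1 (hother s p hs).2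
  obtain ⟨T', hT'⟩ := Filter.eventually_atTop.1 (hquiet.and (Filter.eventually_ge_atTop t))
  have hconst : ∀ s, T' ≤ s → C s = C T' := by
    intro s hs
    induction s, hs using Nat.le_induction with
    | base => rfl
    | succ s hs ih =>
      rw [← ih]
      refine hnone s ?_
      cases ha : act s with
      | none => rfl
      | some a => exact absurd ⟨a.2, ha⟩ ((hT' s hs).1 a.1)
  have hwait : ∀ p, (C T').phase p ≠ .idle → ∃ c h i q,
      current (C T' : BConf V Λ Ω n) p = some (c, h) ∧ d.Wants c h i ∧
      ((C T').loc p).1 i = false ∧ ((C T').loc q).1 i = true := by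
    intro p hp
    obtain ⟨s, hs, h0⟩ := hfair p T' fun s hs => by rw [hconst s hs]; exact hp
    refine waits_of_blocked (hinv T') hp ?_
    rw [← hconst s hs]
    exact h0.resolve_left ((hT' s hs).1 p)
  have hbusy : ∀ q i, ((C T').loc q).1 i = true → (C T').phase q ≠ .idle := by
    intro q i hq h0
    rw [(hinv T').idle q h0 i] at hq
    cases hq
  have hsecond : ∀ q, ((C T').loc q).1 true = true → False := by
    intro q hq
    obtain ⟨c, h, i, q', hc, hw, hf, -⟩ := hwait q (hbusy q true hq)
    cases i with
    | true => rw [hq] at hf; cases hf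
    | false =>
      rw [((hinv T').order q c h hc hw hf).2] at hq
      cases hq
  obtain ⟨c, h, i, q, -, -, -, hq⟩ := hwait p₀ (hstay p₀ t T' le_rfl (hT' T' le_rfl).2 hp₀)
  cases i with
  | true => exact hsecond q hq
  | false =>
    obtain ⟨c', h', i, q', -, -, hf, hq'⟩ := hwait q (hbusy q false hq)
    cases i with
    | true => exact hsecond q' hq'
    | false => rw [hq] at hf; cases hf

theorem bypass_mem_classP : (d.bypass n).toImpl ∈ classP D.toSearchData n :=
  ⟨bypass_isLSL, fun _ _ hα => bypass_no_abort hα, d.bypass n, rfl, bypass_deadlockFree⟩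

end Detour

end Progress

/-! ### The lock-based implementation accepts the detour -/

section BypassAccepts

variable {V Λ Ω : Type} {n : ℕ} {D : SearchStructure V Λ Ω}

/-- From the first write on, an operation visits no further nodes. -/
theorem view_of_writing {c : Call V Ω} {m : Mem V Λ} {h l : List (Access V Λ)}
    (hv : viewOf h ≠ []) (ht : D.trav c.op c.coin (viewOf h) = none)
    (hr : Runs D.toSearchData c m h l) : viewOf (h ++ l) = viewOf h := by
  induction l generalizing h m with
  | nil => simp
  | cons a l ih =>
    cases a with
    | read x e =>
      rcases next_read_iff.1 hr.1 with h0 | h0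
      · exact absurd h0.1 hv
      · rw [ht] at h0; cases h0.2
    | write x e =>
      have h1 : viewOf (h ++ [.write x e]) = viewOf h := by simp [viewOf]
      have := ih (by rw [h1]; exact hv) (by rw [h1]; exact ht) hr.2
      rw [h1, List.append_assoc] at this
      exact this

theorem accMem_of_find {c : Call V Ω} {k : ℕ} (hk : c.op = .find k) {m : Mem V Λ}
    {h l : List (Access V Λ)} (hr : Runs D.toSearchData c m h l) : accMem m l = m := by
  induction l generalizing h with
  | nil => rfl
  | cons a l ih =>
    cases a with
    | read x e => exact ih hr.2.2
    | write x e =>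
      have h1 := (next_write_iff.1 hr.1).2.2
      rw [(update_find D.toSearchData c (viewOf h) k hk).1] at h1
      cases h1

namespace Detour

variable {d : Detour D}

theorem afterEvent_loc_self {I : Impl V Λ Ω n} (C : I.Conf) (p : Fin n) (k : EvKind V Λ Ω)
    (φ : Phase V Λ Ω) : (Impl.afterEvent C p k φ).loc p = I.obs p (C.loc p) k :=
  Function.update_self ..

theorem afterEvent_phase_self {I : Impl V Λ Ω n} (C : I.Conf) (p : Fin n) (k : EvKind V Λ Ω)
    (φ : Phase V Λ Ω) : (Impl.afterEvent C p k φ).phase p = φ :=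
  Function.update_self ..

theorem afterPrim_loc_self {I : Impl V Λ Ω n} (C : I.Conf) (p : Fin n) (s : I.Sh) (l : I.Loc) :
    (Impl.afterPrim C p s l).loc p = l :=
  Function.update_self ..

/-- A process can acquire and release locks until it holds those that its operation needs, if no
other process holds one of them. -/
theorem exists_settled {α : List (Event V Λ Ω n)} {C : (d.bypass n).toImpl.Conf} {p : Fin n}
    {c : Call V Ω} {h : List (Access V Λ)} (hα : (d.bypass n).toImpl.Exec D.toSearchData α C)
    (hp : C.phase p = .ready c h)
    (hfree : ∀ i, d.Wants c h i → ∀ q, q ≠ p → (C.loc q).1 i = false) :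
    ∃ C', (d.bypass n).toImpl.Exec D.toSearchData α C' ∧ C'.sh.1 = C.sh.1 ∧
      C'.phase = C.phase ∧ (∀ q, q ≠ p → C'.loc q = C.loc q) ∧ d.Settled (C'.loc p).1 c h := by
  induction hk : d.slack C p using Nat.strong_induction_on generalizing C with
  | _ k ih =>
    by_cases hs : d.Settled (C.loc p).1 c h
    · exact ⟨C, hα, rfl, rfl, fun _ _ => rfl, hs⟩
    obtain ⟨i, t, b, h1, -, h3, h4⟩ := d.exists_step_of_unsettled hp hs
    cases t with
    | none =>
      obtain ⟨rfl, q, hq, hq'⟩ := h3 rfl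
      have := hfree i (h1.1 rfl) q hq
      rw [(lockInv_exec hα).holds_iff.1 hq'] at this
      cases this
    | some t =>
      have hstep := h4 t.1 t.2 rfl
      have hα' := Impl.Exec.step hα hstep
      rw [Option.toList_none, List.append_nil] at hα'
      have g3 := fun q hq => ((step_local hstep).1 q hq).2.2
      obtain ⟨g1, g2, g4⟩ : (Impl.afterPrim C p t.1 t.2).sh.1 = C.sh.1 ∧
          (Impl.afterPrim C p t.1 t.2).phase = C.phase ∧
          d.slack (Impl.afterPrim C p t.1 t.2) p < d.slack C p := by
        have hm := d.step_move hstep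
        clear g3
        generalize Impl.afterPrim C p t.1 t.2 = C' at hm
        cases hm with
        | lock c h i hp h1 h2 h3 h4 =>
          refine ⟨rfl, rfl, ?_⟩
          cases i <;> simp [slack, hp, h1, h2]
        | unlock c h i hp h1 h2 =>
          refine ⟨rfl, rfl, ?_⟩
          cases i <;> simp [slack, hp, h1, h2]
        | access c h a hp' hl => rw [hp] at hp'; cases hp'
      obtain ⟨C', i1, i2, i3, i4, i5⟩ := ih _ (hk ▸ g4) hα' (by rw [g2]; exact hp)
        (fun i hi q hq => by rw [g3 q hq]; exact hfree i hi q hq) rfl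
      exact ⟨C', i1, i2.trans g1, i3.trans g2, fun q hq => (i4 q hq).trans (g3 q hq), i5⟩

/-- A process can perform accesses alone, if no other process holds a lock that it needs. -/
theorem bypass_run {p : Fin n} {c : Call V Ω} (l : List (Access V Λ)) {h : List (Access V Λ)}
    {α : List (Event V Λ Ω n)} {C : (d.bypass n).toImpl.Conf} {m : Mem V Λ}
    (hα : (d.bypass n).toImpl.Exec D.toSearchData α C)
    (hp : C.phase p = .ready c h) (hm : C.sh.1 = m) (hr : Runs D.toSearchData c m h l)
    (hfree : ∀ l', l' <+: l → ∀ i, d.Wants c (h ++ l') i → ∀ q, q ≠ p → (C.loc q).1 i = false) :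
    ∃ α' C', (d.bypass n).toImpl.Exec D.toSearchData (α ++ α') C' ∧
      α'.map Event.label = (l.flatMap accShape).map (Prod.mk p) ∧ C'.sh.1 = accMem m l ∧
      C'.phase p = .ready c (h ++ l) ∧
      ∀ q, q ≠ p → C'.phase q = C.phase q ∧ C'.loc q = C.loc q := by
  induction l generalizing h α C m with
  | nil => exact ⟨[], C, by simpa using hα, rfl, hm, by simpa using hp, fun _ _ => ⟨rfl, rfl⟩⟩
  | cons b l ih =>
    obtain ⟨C₁, e1, f1, f2, f3, f4⟩ := exists_settled hα hp fun i hi =>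
      hfree [] List.nil_prefix i (by simpa using hi)
    obtain ⟨a, ha, hb, hmem, hr'⟩ : ∃ a, D.next c h = .req a ∧ Impl.replyAccess (a.val m) a = b ∧
        a.mem m = accMem m [b] ∧ Runs D.toSearchData c (accMem m [b]) (h ++ [b]) l := by
      cases b with
      | read x e => exact ⟨.read x, hr.1, by rw [hr.2.1]; rfl, rfl, hr.2.2⟩
      | write x e => exact ⟨.write x e, hr.1, rfl, rfl, hr.2⟩
    have hp₁ : C₁.phase p = .ready c h := by rw [f2]; exact hp
    have s2 := (d.exists_step_of_settled hp₁ f4).1 a ha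
    have s3 := (d.exists_step_of_pending (c := c) (h := h) (a := a) (p := p)
      (C := Impl.afterEvent C₁ p (Impl.reqKind a) (.pending c h a)) (afterEvent_phase_self ..)).1
      (by rw [afterEvent_loc_self]; rfl)
    have s4 := (d.exists_step_of_pending (c := c) (h := h) (a := a) (p := p)
      (C := Impl.afterPrim (Impl.afterEvent C₁ p (Impl.reqKind a) (.pending c h a)) p
        (a.mem C₁.sh.1, C₁.sh.2) (((Impl.afterEvent C₁ p (Impl.reqKind a)
          (.pending c h a)).loc p).1, some (a.val C₁.sh.1)))
      (afterEvent_phase_self C₁ p (Impl.reqKind a) _)).2 (a.val C₁.sh.1)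
      (congrArg Prod.snd (afterPrim_loc_self (I := (d.bypass n).toImpl) _ p _ _))
    have hoth := fun q hq => ((step_local s4).1 q hq).2.2.trans
      (((step_local s3).1 q hq).2.2.trans (((step_local s2).1 q hq).2.2.trans (f3 q hq)))
    have hoph := fun q hq => ((step_local s4).1 q hq).1.trans
      (((step_local s3).1 q hq).1.trans (((step_local s2).1 q hq).1.trans (congrFun f2 q)))
    have e4 := Impl.Exec.step (Impl.Exec.step (Impl.Exec.step e1 s2) s3) s4
    have hval : a.val C₁.sh.1 = a.val m := by rw [f1, hm]
    have hmem₁ : a.mem C₁.sh.1 = accMem m [b] := by rw [f1, hm, hmem]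
    obtain ⟨α', C', i1, i2, i3, i4, i5⟩ := ih (h := h ++ [b]) (m := accMem m [b]) e4
      (by rw [afterEvent_phase_self, ← hb, hval]) hmem₁ hr' (by
      intro l' hl' i hi q hq
      rw [hoth q hq]
      exact hfree (b :: l') (List.cons_prefix_cons.2 ⟨rfl, hl'⟩) i (by simpa using hi) q hq)
    refine ⟨_ :: _ :: α', C', by simpa using i1, ?_, ?_, by simpa using i4, ?_⟩
    · rw [← hb]
      cases a <;> simp [i2, accShape, Event.label, Impl.reqKind, Impl.replyKind, Impl.replyAccess,
        EvKind.shape, Req.val]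
    · rw [i3, ← accMem_append]; rfl
    · intro q hq
      rw [(i5 q hq).1, (i5 q hq).2]
      exact ⟨hoph q hq, hoth q hq⟩

theorem bypass_respond {p : Fin n} {c : Call V Ω} {h : List (Access V Λ)}
    {α : List (Event V Λ Ω n)} {C : (d.bypass n).toImpl.Conf} {r : DictResp V}
    (hα : (d.bypass n).toImpl.Exec D.toSearchData α C) (hp : C.phase p = .ready c h)
    (hr : D.next c h = .ret r) :
    ∃ π C', (d.bypass n).toImpl.Exec D.toSearchData (α ++ [⟨π, .res r⟩]) C' ∧ π.1 = p ∧
      C'.sh.1 = C.sh.1 ∧ C'.phase p = .idle ∧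
      ∀ q, q ≠ p → C'.phase q = C.phase q ∧ C'.loc q = C.loc q := by
  obtain ⟨C₁, e1, f1, f2, f3, f4⟩ := exists_settled hα hp fun i hi => absurd hr (hi.1 r)
  have hp₁ : C₁.phase p = .ready c h := by rw [f2]; exact hp
  have s2 := (d.exists_step_of_settled hp₁ f4).2 r hr
  exact ⟨_, _, Impl.Exec.step e1 s2, rfl, f1, Function.update_self .., fun q hq =>
    ⟨((step_local s2).1 q hq).1.trans (congrFun f2 q),
      ((step_local s2).1 q hq).2.2.trans (f3 q hq)⟩⟩

/-- A process can run a whole operation alone, if no other process holds a lock that it needs. -/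
theorem bypass_op {p : Fin n} {c : Call V Ω} {h : List (Access V Λ)} {α : List (Event V Λ Ω n)}
    {C : (d.bypass n).toImpl.Conf} {m m' : Mem V Λ} {r : DictResp V}
    (hα : (d.bypass n).toImpl.Exec D.toSearchData α C) (hp : C.phase p = .idle)
    (hm : C.sh.1 = m) (hc : D.Completes c m h m' r)
    (hfree : ∀ l, l <+: h → ∀ i, d.Wants c l i → ∀ q, q ≠ p → (C.loc q).1 i = false) :
    ∃ α' C', (d.bypass n).toImpl.Exec D.toSearchData (α ++ α') C' ∧
      α'.map Event.label = opShapes p c h ∧ C'.sh.1 = m' ∧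
      C'.phase p = .idle ∧ ∀ q, q ≠ p → C'.phase q = C.phase q ∧ C'.loc q = C.loc q := by
  have s1 : Impl.Step D.toSearchData C p _ _ := .invoke c hp
  have e1 := Impl.Exec.step hα s1
  obtain ⟨hr, rfl⟩ := seqRun_iff.1 hc.1
  obtain ⟨α₂, C₂, e2, f1, f2, f3, f4⟩ := bypass_run h e1 (afterEvent_phase_self ..) hm hr
    (fun l hl i hi q hq => by
      rw [((step_local s1).1 q hq).2.2]
      exact hfree l hl i (by simpa using hi) q hq)
  obtain ⟨π, C₃, e3, rfl, g1, g2, g3⟩ := bypass_respond e2 f3 (by simpa using hc.2)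
  refine ⟨_ :: α₂ ++ [_], C₃, by simpa using e3, ?_, g1.trans f2, g2, fun q hq => ?_⟩
  · simp [opShapes, f1, Event.label, EvKind.shape]
  · rw [(g3 q hq).1, (g3 q hq).2, (f4 q hq).1, (f4 q hq).2]
    exact ⟨((step_local s1).1 q hq).1, ((step_local s1).1 q hq).2.2⟩

theorem bypass_runsAlone : RunsAlone D.toSearchData (d.bypass n).toImpl
    fun C m => C.sh.1 = m ∧ ∀ p i, (C.loc p).1 i = false := by
  intro α C m p c h m' r hα hp hQ hc
  obtain ⟨α', C', e1, h1, h2, h3, h4⟩ := bypass_op hα hp hQ.1 hc fun _ _ i _ q _ => hQ.2 q i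
  refine ⟨α', C', e1, h1, ⟨h2, fun q i => ?_⟩, h3, h4⟩
  by_cases hq : q = p
  · subst hq; exact (lockInv_exec e1).idle q h3 i
  · rw [(h4 q hq).2]; exact hQ.2 q i

/-- The lock-based implementation has an execution with the schedule of the detour. -/
theorem bypass_runs_detour (d : Detour D) {p₁ p₂ : Fin n} (hp : p₁ ≠ p₂)
    {l : List (Call V Ω × List (Access V Λ))} {h' : List (Access V Λ)} {r' : DictResp V}
    (hl : RunList D.toSearchData (fun _ => ∅) l d.m)
    (hc' : D.Completes ⟨.find d.k, d.ω⟩ d.m₂ h' d.m₂ r') :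
    ∃ α C, (d.bypass n).toImpl.Exec D.toSearchData α C ∧ (∀ p, C.phase p = .idle) ∧
      α.map Event.label = detourSchedule d n p₁ p₂ l h' := by
  obtain ⟨α₀, C₀, e0, l0, ⟨m0, fl0⟩, j0, o0⟩ := (bypass_runsAlone (d := d) (n := n)).list .nil
    (p := p₂) rfl ⟨rfl, fun _ _ => rfl⟩ hl
  rw [List.nil_append] at e0
  have i0 : ∀ q, q ≠ p₂ → C₀.phase q = .idle := fun q hq => (o0 q hq).1
  -- the search reads the root and `(kx, vx)`, and releases the lock on the root
  set c : Call V Ω := ⟨.find d.k, d.ω⟩ with hcdef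
  have s1 : Impl.Step D.toSearchData C₀ p₁ _ _ := .invoke c (i0 p₁ hp)
  have e1 := Impl.Exec.step e0 s1
  have hsearch := (seqRun_iff.1 d.search.1).1
  obtain ⟨α₂, C₂, e2, l2, m2, h2, o2⟩ := bypass_run d.first e1 (afterEvent_phase_self ..) m0
    ⟨hsearch.1, rfl, hsearch.2.2.1, rfl, trivial⟩
    (fun _ _ i _ q hq => by rw [((step_local s1).1 q hq).2.2]; exact fl0 q i)
  have hgap : d.Gapped c d.first := ⟨rfl, d.m .root, d.m (.pair d.kx d.vx), [], rfl, d.root_leads,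
    d.node_leads⟩
  obtain ⟨C₃, e3, m3, h3, o3, hset⟩ := exists_settled e2 h2 fun i hi q hq => by
    rw [(o2 q hq).2, ((step_local s1).1 q hq).2.2]; exact fl0 q i
  have i3 : ∀ q, q ≠ p₁ → C₃.phase q = .idle ∧ ∀ i, (C₃.loc q).1 i = false := by
    intro q hq
    have hid : C₃.phase q = .idle := by
      rw [h3, (o2 q hq).1, ((step_local s1).1 q hq).1]
      by_cases hq2 : q = p₂
      · rw [hq2]; exact j0
      · exact i0 q hq2
    exact ⟨hid, (lockInv_exec e3).idle q hid⟩
  have hroot : (C₃.loc p₁).1 false = false := by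
    by_contra h0
    exact ((hset false).1 (by simpa using h0)).2 hgap
  -- a light deletion needs only the lock on the root
  have hlight : ∀ {C : (d.bypass n).toImpl.Conf} {c' : Call V Ω} {h : List (Access V Λ)},
      (∀ q, q ≠ p₁ → ∀ i, (C.loc q).1 i = false) → (C.loc p₁).1 false = false →
      (∀ l, l <+: h → d.Light c' l) → ∀ l, l <+: h → ∀ i, d.Wants c' l i →
      ∀ q, q ≠ p₂ → (C.loc q).1 i = false := by
    intro C c' h h1 h2 h3 l hl i hi q _
    by_cases hq : q = p₁
    · subst hq
      cases i with
      | false => exact h2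
      | true => exact absurd (h3 l hl) hi.2
    · exact h1 q hq i
  obtain ⟨α₄, C₄, e4, l4, m4, h4, o4⟩ := bypass_op e3 (i3 p₂ hp.symm).1 (m3.trans m2) d.delete₁
    (hlight (fun q hq => (i3 q hq).2) hroot fun _ _ => .inl rfl)
  have i4 : ∀ q, q ≠ p₁ → C₄.phase q = .idle ∧ ∀ i, (C₄.loc q).1 i = false := by
    intro q hq
    have hid : C₄.phase q = .idle := by
      by_cases hq2 : q = p₂
      · rw [hq2]; exact h4
      · rw [(o4 q hq2).1]; exact (i3 q hq).1
    exact ⟨hid, (lockInv_exec e4).idle q hid⟩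
  have hlight₂ : ∀ l, l <+: d.h₂ → d.Light ⟨.delete d.k, d.ω⟩ l := by
    rintro l ⟨l', hl'⟩
    refine .inr ⟨rfl, fun x e hw => ?_⟩
    obtain ⟨hv, ht, -⟩ := next_write_iff.1 hw
    have hr := (seqRun_iff.1 d.delete₂.1).1
    rw [← hl'] at hr
    have := view_of_writing hv ht (by simpa using (runs_append.1 hr).2)
    rw [← this, hl']
    exact d.single
  obtain ⟨α₅, C₅, e5, l5, m5, h5, o5⟩ := bypass_op e4 h4 m4 d.delete₂
    (hlight (fun q hq => (i4 q hq).2) (by rw [(o4 p₁ hp).2]; exact hroot) hlight₂)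
  have i5 : ∀ q, q ≠ p₁ → C₅.phase q = .idle ∧ ∀ i, (C₅.loc q).1 i = false := by
    intro q hq
    have hid : C₅.phase q = .idle := by
      by_cases hq2 : q = p₂
      · rw [hq2]; exact h5
      · rw [(o5 q hq2).1]; exact (i4 q hq).1
    exact ⟨hid, (lockInv_exec e5).idle q hid⟩
  -- the search goes on alone
  obtain ⟨α₆, C₆, e6, l6, m6, h6, o6⟩ := bypass_run d.rest e5
    (by rw [(o5 p₁ hp).1, (o4 p₁ hp).1, h3, h2]; rfl) m5 d.search_rest
    (fun _ _ i _ q hq => (i5 q hq).2 i)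
  obtain ⟨π, C₇, e7, rfl, m7, h7, o7⟩ := bypass_respond e6 h6 d.search.2
  rw [accMem_of_find rfl d.search_rest] at m6
  have i7 : ∀ q, C₇.phase q = .idle := by
    intro q
    by_cases hq : q = π.1
    · rw [hq]; exact h7
    · rw [(o7 q hq).1, (o6 q hq).1]; exact (i5 q hq).1
  obtain ⟨α₈, C₈, e8, l8, i8⟩ := (bypass_runsAlone (d := d) (n := n)).rounds e7 i7
    ⟨m7.trans m6, fun q => (lockInv_exec e7).idle q (i7 q)⟩ hc'
  refine ⟨_, C₈, e8, i8, ?_⟩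
  simp [detourSchedule, openShapes, closeShapes, l0, l2, l4, l5, l6, l8, Event.label, EvKind.shape,
    hcdef]

end Detour

end BypassAccepts

/-! ### Comparison of the classes -/

section Quiescent

variable {V Λ Ω : Type} {n : ℕ} {D : SearchData V Λ Ω} {I : Impl V Λ Ω n}

theorem ne_abort_of_label {α : List (Event V Λ Ω n)} (hα : ∀ e ∈ α, e.kind ≠ .abort) :
    ∀ s ∈ α.map Event.label, s.2 ≠ .abort := by
  intro s hs
  obtain ⟨e, he, rfl⟩ := List.mem_map.1 hs
  have := hα e he
  obtain ⟨o, k⟩ := e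
  cases k <;> simp_all [Event.label, EvKind.shape]

/-- The events of an execution without aborts that ends with all processes idle form an accepted
LS-linearizable schedule. -/
theorem accepts_of_quiescent {α : List (Event V Λ Ω n)} {C : I.Conf} (hα : I.Exec D α C)
    (hi : ∀ p, C.phase p = .idle) {σ : Schedule V Λ Ω n} (hσ : α.map Event.label = σ)
    (hna : ∀ e ∈ α, e.kind ≠ .abort) (hI : I.IsLSL D) :
    I.Accepts D σ ∧ σ ∈ LSLSchedules D n := by
  have h1 := scheduleOf_quiescent hα hi (ne_abort_of_label hna)
  rw [hσ] at h1
  refine ⟨⟨_, ⟨α, C, hα, rfl⟩, h1⟩, _, ?_, hI _ ⟨α, C, hα, rfl⟩, h1⟩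
  rw [history_of_no_abort hna]
  exact exec_wellFormed hα

end Quiescent

end SearchConc

theorem mainTheorem3 {V Λ Ω : Type} (D : SearchStructure V Λ Ω) (n : ℕ) (hn : 3 ≤ n) :
    ¬ acceptedBy D.toSearchData (classSM D.toSearchData n) ⊆
        acceptedBy D.toSearchData (classP D.toSearchData n) ∧
    ¬ acceptedBy D.toSearchData (classP D.toSearchData n) ⊆
        acceptedBy D.toSearchData (classSM D.toSearchData n) ∧
    ¬ LSLSchedules D.toSearchData n ⊆ acceptedBy D.toSearchData (classP D.toSearchData n) ∧
    ¬ LSLSchedules D.toSearchData n ⊆ acceptedBy D.toSearchData (classSM D.toSearchData n) ∧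
    (∀ I ∈ classP D.toSearchData n, ¬ I.ConcurrencyOptimal D.toSearchData) ∧
    (∀ I ∈ classSM D.toSearchData n, ¬ I.ConcurrencyOptimal D.toSearchData) := by
  obtain ⟨d⟩ := exists_detour D
  obtain ⟨p₁, p₂, hp⟩ : ∃ p₁ p₂ : Fin n, p₁ ≠ p₂ :=
    ⟨⟨0, by omega⟩, ⟨1, by omega⟩, by simp⟩
  -- the schedule of the stale read
  obtain ⟨σ, hσ, hσ', hσP⟩ : ∃ σ, (snapshotImpl D.toSearchData n).Accepts D.toSearchData σ ∧
      σ ∈ LSLSchedules D.toSearchData n ∧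
      ∀ I ∈ classP D.toSearchData n, ¬ I.Accepts D.toSearchData σ := by
    obtain ⟨h, m, r, hc⟩ := completes_exists (D := D) .init ⟨.insert d.k d.v, d.ω⟩
    obtain ⟨h', m', r', hc'⟩ := completes_exists (D := D) (.step .init hc) ⟨.find d.k, d.ω⟩
    obtain rfl : m' = m := (find_no_write rfl hc'.1).1
    obtain ⟨α, C, hα, hi, hlab⟩ := snapshot_runs_stale D hp hc hc'
    have hacc := accepts_of_quiescent hα hi hlab (fun e he hk => no_abort_staleSchedule
      (p₁ := p₁) (p₂ := p₂) (k := d.k) (v := d.v) (ω := d.ω) (h := h) (h' := h') e.label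
      (hlab ▸ List.mem_map_of_mem he) (by simp [Event.label, hk, EvKind.shape]))
      (snapshot_isLSL D)
    refine ⟨_, hacc.1, hacc.2, ?_⟩
    rintro I ⟨-, hI, L, rfl, -⟩
    exact lock_rejects D hp hc L hI
  -- the schedule of the detour
  obtain ⟨τ, hτ, hτ', hτS⟩ : ∃ τ, (d.bypass n).toImpl.Accepts D.toSearchData τ ∧
      τ ∈ LSLSchedules D.toSearchData n ∧
      ∀ I ∈ classSM D.toSearchData n, ¬ I.Accepts D.toSearchData τ := by
    obtain ⟨l, hl⟩ := reach_runList d.reach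
    obtain ⟨h', m', r', hc'⟩ := completes_exists (D := D)
      (.step (.step d.reach d.delete₁) d.delete₂) ⟨.find d.k, d.ω⟩
    obtain rfl : m' = d.m₂ := (find_no_write rfl hc'.1).1
    obtain ⟨α, C, hα, hi, hlab⟩ := d.bypass_runs_detour hp hl hc'
    have hacc := accepts_of_quiescent hα hi hlab (Detour.bypass_no_abort hα) Detour.bypass_isLSL
    exact ⟨_, hacc.1, hacc.2, fun I hI =>
      serializable_rejects d hp hl fun α C hα => (hI.2 α C hα).1⟩
  have h3 : ¬ LSLSchedules D.toSearchData n ⊆ acceptedBy D.toSearchData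
      (classP D.toSearchData n) := fun h => by
    obtain ⟨I, hI, hacc⟩ := h hσ'
    exact hσP I hI hacc
  have h4 : ¬ LSLSchedules D.toSearchData n ⊆ acceptedBy D.toSearchData
      (classSM D.toSearchData n) := fun h => by
    obtain ⟨I, hI, hacc⟩ := h hτ'
    exact hτS I hI hacc
  refine ⟨fun h => ?_, fun h => ?_, h3, h4, fun I hI h => h3 fun s hs => ⟨I, hI, h s hs⟩,
    fun I hI h => h4 fun s hs => ⟨I, hI, h s hs⟩⟩
  · obtain ⟨I, hI, hacc⟩ := h ⟨_, snapshotImpl_mem_classSM D, hσ⟩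
    exact hσP I hI hacc
  · obtain ⟨I, hI, hacc⟩ := h ⟨_, Detour.bypass_mem_classP, hτ⟩
    exact hτS I hI hacc
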